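/- **Theorem 2.1.** Let $G=(V,E,c)$ be a connected undirected graph on $n$ nodes with integer edge capacities in $\{1,\dots,U\}$. $\mathrm{Max\text{-}Flow}_G(s,t)$ denotes the minimum capacity of a cut of $G$ separating $s$ and $t$. A cut separating $s$ and $t$ is a $(1+\varepsilon)$-approximate minimum $st$-cut if its capacity is at most $(1+\varepsilon)\,\mathrm{Max\text{-}Flow}_G(s,t)$. A $(1+\varepsilon)$-approximate flow-equivalent tree of $G$ is a capacitated tree $T$ on $V$ with $\mathrm{Max\text{-}Flow}_G(s,t)\le \mathrm{Max\text{-}Flow}_T(s,t)\le(1+\varepsilon)\,\mathrm{Max\text{-}Flow}_G(s,t)$ for all $s\ne t$. A deterministic $(1+\varepsilon')$-approximate Min-Cut data structure for $G$ with preprocessing time $t_p$ is one that, after preprocessing in time $t_p(n)$, answers each query $(s,t)$, $s\neq t$, by a $(1+\varepsilon')$-approximate minimum $st$-cut (one side of it, as a list of $n$ bits) that depends only on the query. Algorithms are programs of a randomized word RAM with words of $O(\log(nU/\varepsilon))$ bits that may preprocess and query this data structure. Their running time includes the preprocessing time and $n+1$ units for issuing each query and receiving its answer, but not the time that the data structure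 itself spends on finding the answer. For every constant $c\ge 0$ there are constants $C,k$ (and a constant in the word length), depending only on $c$, such that the following holds for every $0<\varepsilon\le 1$. There are randomized algorithms (for each of the two tasks one program, depending on $c$ and $\varepsilon$ but not on $G$, $n$, $U$, $t_p$ or the data structure) which, given $G$ as above and a deterministic $(1+\varepsilon/3)$-approximate Min-Cut data structure for $G$ with preprocessing time $t_p$, do the following with probability at least $1-n^{-c}$, asking at most $C n(\log_2 n+1)^k$ queries and in time at most $$C\,t_p(n)+C\,n^2\left(\frac{\log_2 (nU)+1}{\varepsilon}\right)^k ,$$ that is, with $\tilde O(n)$ queries and in time $O(t_p(n))+\tilde O(n^2)$ for fixed $\varepsilon$ and $U=\mathrm{poly}(n)$ (logarithms are rounded down, with $\log_2 0 := 0$): * the first constructs a $(1+\varepsilon)$-approximate flow-equivalent tree $T$ of $G$; * the second constructs a data structure $D$ that occupies at most $C n^2(\log_2 n+1)^k$ words and stores a set $\mathcal C$ of at most $C n(\log_2 n+1)^k$ cuts, such that a fixed query program, which has access to $D$ alone, returns for every pair $s\ne t$ of nodes, within time $C(\log_2 n+1)^k$, a pointer to a cut in $\mathcal C$ that is a $(1+\varepsilon)$-approximate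 minimum $st$-cut. -/

import Mathlib

namespace MinCutOracle

/-! ### Capacitated graphs, cuts, flow-equivalent trees -/

/-- An undirected graph on the node set `Fin n` with natural-number capacities; `cap u v` is the
capacity of the edge `uv`, and it is `0` exactly when there is no such edge. -/
structure CapGraph (n : ℕ) where
  cap : Fin n → Fin n → ℕ
  symm : ∀ u v, cap u v = cap v u
  loopless : ∀ v, cap v v = 0

/-- The underlying simple graph. -/
def CapGraph.graph {n : ℕ} (G : CapGraph n) : SimpleGraph (Fin n) where
  Adj u v := G.cap u v ≠ 0
  symm := ⟨fun u v h => by rw [G.symm v u]; exact h⟩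
  loopless := ⟨fun v h => h (G.loopless v)⟩

/-- A cut `(S, V ∖ S)`, given by one side `S`, separates `s` and `t`. -/
def Separates {n : ℕ} (S : Finset (Fin n)) (s t : Fin n) : Prop :=
  ¬ (s ∈ S ↔ t ∈ S)

/-- The capacity of the cut `(S, V ∖ S)`. -/
def CapGraph.cutCap {n : ℕ} (G : CapGraph n) (S : Finset (Fin n)) : ℕ :=
  ∑ u ∈ S, ∑ v ∈ Sᶜ, G.cap u v

/-- `Max-Flow(s,t)`: the capacity of a minimum cut that separates `s` and `t` (for `s ≠ t`). -/
noncomputable def CapGraph.maxFlow {n : ℕ} (G : CapGraph n) (s t : Fin n) : ℕ :=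
  sInf {x | ∃ S : Finset (Fin n), Separates S s t ∧ G.cutCap S = x}

/-- `(S, V ∖ S)` is a `(1+ε)`-approximate minimum `st`-cut. -/
def CapGraph.IsApproxMinCut {n : ℕ} (G : CapGraph n) (ε : ℝ) (s t : Fin n)
    (S : Finset (Fin n)) : Prop :=
  Separates S s t ∧ (G.cutCap S : ℝ) ≤ (1 + ε) * (G.maxFlow s t : ℝ)

/-- `T` is a `(1+ε)`-approximate flow-equivalent tree of `G`: a capacitated tree on the same nodes
whose minimum-cut values approximate those of `G` from above. -/
def CapGraph.IsApproxFlowEquivTree {n : ℕ} (G : CapGraph n) (ε : ℝ) (T : CapGraph n) : Prop :=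
  T.graph.IsTree ∧ ∀ s t : Fin n, s ≠ t →
    G.maxFlow s t ≤ T.maxFlow s t ∧ (T.maxFlow s t : ℝ) ≤ (1 + ε) * (G.maxFlow s t : ℝ)

/-! ### A randomized word RAM with access to a Min-Cut data structure -/

/-- Binary operations on machine words. Comparisons return `1` for true and `0` for false. -/
inductive Op where
  | add | sub | mul | div | mod | lt | eq

/-- Value of an operation on words of `w` bits. -/
def Op.eval (w : ℕ) : Op → ℕ → ℕ → ℕ
  | .add, a, b => (a + b) % 2 ^ w
  | .sub, a, b => a - b
  | .mul, a, b => (a * b) % 2 ^ w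
  | .div, a, b => a / b
  | .mod, a, b => a % b
  | .lt, a, b => if a < b then 1 else 0
  | .eq, a, b => if a = b then 1 else 0

/-- Programs. Register names are literals of the program, so that a program uses finitely many
registers; the memory is addressed indirectly.
* `const r k`: `r := k` (truncated to a word);
* `op o r a b`: `r := a o b` for registers `a`, `b`;
* `load r a`: `r := mem[a]`, where `a` is a register holding the address;
* `store a b`: `mem[a] := b`;
* `rand r`: `r :=` a uniformly random word;
* `prep`: run the preprocessing of the Min-Cut data structure on the input graph;
* `query s t a`: query the Min-Cut data structure with the nodes whose names are in the registers
  `s` and `t`; the answer, a side of a cut, is written as `n` words `0`/`1` (node `v` is on the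
  side or not) to the memory cells `a, …, a + n - 1`;
* `skip`, `seq`, `ite`, `while`: the usual control structures, a register being true if it is
  nonzero. -/
inductive Com where
  | skip : Com
  | const (r k : ℕ) : Com
  | op (o : Op) (r a b : ℕ) : Com
  | load (r a : ℕ) : Com
  | store (a b : ℕ) : Com
  | rand (r : ℕ) : Com
  | prep : Com
  | query (s t a : ℕ) : Com
  | seq (p q : Com) : Com
  | ite (r : ℕ) (p q : Com) : Com
  | while (r : ℕ) (p : Com) : Com

/-- What a program runs on: the number `w` of bits of a word, the number `n` of nodes, the
preprocessing time of the Min-Cut data structure and its answers (`answer s t v` tells whether node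
`v` is on the reported side of the cut for the query `s`, `t`). -/
structure Env where
  w : ℕ
  n : ℕ
  prepTime : ℕ
  answer : ℕ → ℕ → ℕ → Bool

/-- Configurations: registers, memory, whether the data structure has been preprocessed, the time
and the number of queries so far, and the stack of the programs that are still to be executed. -/
structure Config where
  reg : ℕ → ℕ
  mem : ℕ → ℕ
  ready : Bool
  time : ℕ
  queries : ℕ
  todo : List Com

/-- The initial configuration for a program, given the contents of registers and memory. -/
def Config.init (reg mem : ℕ → ℕ) (P : Com) : Config :=
  { reg := reg, mem := mem, ready := false, time := 0, queries := 0, todo := [P] }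

/-- One step. Every instruction takes one unit of time; moreover `prep` takes the preprocessing time
of the data structure, and `query` takes `n` units of time for the transfer of the answer. A query
that is asked before the preprocessing is answered by zeros. -/
noncomputable def step (E : Env) (x : Config) : PMF Config :=
  match x.todo with
  | [] => PMF.pure x
  | c :: K =>
    let y : Config := { x with time := x.time + 1, todo := K }
    match c with
    | .skip => PMF.pure y
    | .const r k => PMF.pure { y with reg := Function.update x.reg r (k % 2 ^ E.w) }
    | .op o r a b =>
        PMF.pure { y with reg := Function.update x.reg r (o.eval E.w (x.reg a) (x.reg b)) }
    | .load r a => PMF.pure { y with reg := Function.update x.reg r (x.mem (x.reg a)) }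
    | .store a b => PMF.pure { y with mem := Function.update x.mem (x.reg a) (x.reg b) }
    | .rand r => (PMF.uniformOfFintype (Fin (2 ^ E.w))).map
        fun z => { y with reg := Function.update x.reg r z.val }
    | .prep => PMF.pure { y with ready := true, time := x.time + 1 + E.prepTime }
    | .query s t a => PMF.pure
        { y with
          time := x.time + 1 + E.n
          queries := x.queries + 1
          mem := fun i =>
            if x.reg a ≤ i ∧ i < x.reg a + E.n then
              (if x.ready && E.answer (x.reg s) (x.reg t) (i - x.reg a) then 1 else 0)
            else x.mem i }
    | .seq p q => PMF.pure { y with todo := p :: q :: K }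
    | .ite r p q => PMF.pure { y with todo := (if x.reg r ≠ 0 then p else q) :: K }
    | .while r p => PMF.pure { y with todo := if x.reg r ≠ 0 then p :: .while r p :: K else K }

/-- The distribution of the configuration after `N` steps (or at the end, if that is earlier). -/
noncomputable def runFor (E : Env) : ℕ → Config → PMF Config
  | 0, x => PMF.pure x
  | N + 1, x => (step E x).bind (runFor E N)

/-- With probability at least `p`, the machine started in `x` halts in a configuration that
satisfies `good`. (Halted configurations do not change any more, and the running time is recorded
in them; the number `N` only says how long the machine is watched.) -/
def Succeeds (E : Env) (x : Config) (p : ℝ) (good : Config → Prop) : Prop :=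
  ∃ N : ℕ, ENNReal.ofReal p ≤
    (runFor E N x).toOuterMeasure {y | y.todo = [] ∧ good y}

/-! ### Inputs and outputs -/

/-- A deterministic Min-Cut data structure for a graph on `Fin n`, as its users see it: the side of
the cut that it reports for each query. -/
abbrev CutOracle (n : ℕ) := Fin n → Fin n → Finset (Fin n)

/-- `D` is a `(1+ε)`-approximate Min-Cut data structure for `G`. -/
def CutOracle.IsApprox {n : ℕ} (D : CutOracle n) (G : CapGraph n) (ε : ℝ) : Prop :=
  ∀ s t : Fin n, s ≠ t → G.IsApproxMinCut ε s t (D s t)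

/-- The environment in which the algorithms have access to the data structure `D`. -/
def oracleEnv (w : ℕ) {n : ℕ} (D : CutOracle n) (prepTime : ℕ) : Env where
  w := w
  n := n
  prepTime := prepTime
  answer s t v :=
    if h : s < n ∧ t < n ∧ v < n then decide (⟨v, h.2.2⟩ ∈ D ⟨s, h.1⟩ ⟨t, h.2.1⟩) else false

/-- The environment without any data structure: `prep` and `query` do nothing. -/
def plainEnv (w : ℕ) : Env where
  w := w
  n := 0
  prepTime := 0
  answer _ _ _ := false

/-- The input: `n` in cell `0`, and the capacity of `uv` in cell `1 + u * n + v`. -/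
def inputMem {n : ℕ} (G : CapGraph n) : ℕ → ℕ := fun i =>
  if i = 0 then n
  else if h : (i - 1) / n < n ∧ (i - 1) % n < n then
    G.cap ⟨(i - 1) / n, h.1⟩ ⟨(i - 1) % n, h.2⟩
  else 0

/-- Start of a construction algorithm on the input `G`. -/
def inputConfig {n : ℕ} (G : CapGraph n) (P : Com) : Config :=
  Config.init (fun _ => 0) (inputMem G) P

/-- The capacitated graph `T` has been output as a list of `n - 1` edges, each given by three
successive cells (end, end, capacity), from the address in register `0` on. -/
def Config.OutputsTree {n : ℕ} (x : Config) (T : CapGraph n) : Prop :=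
  ∃ (a b : Fin (n - 1) → Fin n) (c : Fin (n - 1) → ℕ),
    (∀ i : Fin (n - 1), x.mem (x.reg 0 + 3 * i.val) = (a i).val ∧
      x.mem (x.reg 0 + 3 * i.val + 1) = (b i).val ∧
      x.mem (x.reg 0 + 3 * i.val + 2) = c i) ∧
    ∀ u v : Fin n, T.cap u v =
      ∑ i, if (a i = u ∧ b i = v) ∨ (a i = v ∧ b i = u) then c i else 0

/-- A data structure is output as a block of memory cells: register `0` holds the address and
register `1` the number of the cells. This is the block, moved to address `0`. -/
def Config.block (x : Config) : ℕ → ℕ := fun i =>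
  if i < x.reg 1 then x.mem (x.reg 0 + i) else 0

/-- The cut that is stored (as `n` words `0`/`1`) in the memory `M` from the address `a` on. -/
def storedCut (n : ℕ) (M : ℕ → ℕ) (a : ℕ) : Finset (Fin n) :=
  Finset.univ.filter fun v => M (a + v.val) = 1

/-- `M`, occupying `size` cells of words of `w` bits, is a data structure for `G` that stores at
most `numCuts` cuts and, by means of the query program `Q`, answers each query pair `s`, `t`
within time `queryTime` by (a pointer to) one of the stored cuts that is a `(1+ε)`-approximate
minimum `st`-cut. Here `A` is the set of pointers to the stored cuts. The query program sees
nothing but `M` and the two nodes, which it finds in the registers `0` and `1`; it leaves the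
answer in register `0`. -/
def IsCutDataStructure {n : ℕ} (G : CapGraph n) (ε : ℝ) (w : ℕ) (Q : Com) (M : ℕ → ℕ) (size : ℕ)
    (numCuts queryTime : ℝ) : Prop :=
  ∃ A : Finset ℕ, (A.card : ℝ) ≤ numCuts ∧
    (∀ a ∈ A, a + n ≤ size ∧ ∀ v : Fin n, M (a + v.val) = 0 ∨ M (a + v.val) = 1) ∧
    ∀ s t : Fin n, s ≠ t →
      Succeeds (plainEnv w)
        (Config.init (fun r => if r = 0 then s.val else if r = 1 then t.val else 0) M Q) 1
        fun y => (y.time : ℝ) ≤ queryTime ∧ y.reg 0 ∈ A ∧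
          G.IsApproxMinCut ε s t (storedCut n M (y.reg 0))

/-- The integer logarithm, kept away from `0`. -/
def lg (x : ℕ) : ℕ := Nat.log 2 x + 1

/-- The number of bits of a word, proportional to `log (n U / ε)`, where `n` is the number of nodes
and `U` bounds the capacities. -/
noncomputable def wordBits (κ n U : ℕ) (ε : ℝ) : ℕ := κ * lg (n * U * ⌈1 / ε⌉₊)

end MinCutOracle

open MinCutOracle

set_option linter.constructorNameAsVariable false

namespace MinCutOracle

/-! ### Deterministic steps, given a tape of random words -/

/-! Write λ(s,t) for the capacity of a minimum st-cut. Besides symmetry, one inequality carries the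
combinatorics: λ(s,t) ≥ min(λ(u,s), λ(u,t)), because a cut between s and t separates u from one of
them (`min_maxFlow_le`).

The nodes are kept in classes of nodes that are not yet separated, at first a single class. In a
round every class draws a random pivot p, and the data structure is asked for a cut between p and
each other member. The level of a member x is the least estimated capacity of a returned cut that
has x on the side away from p. Call such a cut balanced if its side away from p holds at most half
of the class; each member also records the last balanced cut of its own level that has it on that
side. Two members stay together exactly when level and record agree.

A separated pair is separated by a cheap cut. If the estimates are within a factor α of λ, then two
levels that differ are settled by the cheaper cut, at the cost of a factor α, and two records that
differ by a balanced cut, at the cost of α² (`Round.Accurate.next_spec`). Here α is (1+ε/3) times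
the error of the estimates, so that α² ≤ 1+ε (`precision_sq_le`).

Few rounds suffice. For two members of a class the same cut is returned whichever of them is the
pivot, and it is balanced in one of the two roles (`Round.balanced_or`). A member whose cut is
balanced ends in a class of at most half the size (`Round.size_le_newly`). Hence a round removes an
expected eighth of the unseparated pairs (`Round.sum_pot_next`), and O(log n) rounds finish by
Markov's inequality. This part does not use the accuracy of the estimates.

Computing one capacity exactly takes time n², which is too much for Õ(n) cuts. Instead a linear
sketch is computed once. For each repetition and each bit level, every ordered pair whose capacity
has this bit gets a random sign. Summing the signed incidences over one side of a cut leaves a sum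
of random signs over the pairs that are cut, and its squared value has their number as expectation.
The weighted sum of squares is concentrated by an exponential moment bound (`avg_blockSum_tail`). As
the answers are deterministic, the at most n² cuts that may occur are fixed before the signs are
drawn, and a union bound applies. Evaluating the sketch takes time Õ(n) for each cut.

The final table names a cheap cut for every pair; with the stored cuts it is the data structure. For
the tree, a maximum spanning tree for the estimates of these cuts is built with Prim's algorithm.
Pairs with estimate at least θ are joined by tree edges of weight at least θ, which bounds the flow
in the tree from below. The tree path between s and t crosses a minimum st-cut of G, which bounds it
from above (`IsPrim.tree_isApproxFlowEquivTree`).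

The machine enters through a small structured language with a verified translation
(`HCom.implements`), Hoare-style rules (`Tri`), and the replacement of probabilities by averages
over finite tapes of random words (`avg_le_runFor`). -/

/-- The configuration after one step in which `rand` draws the word `z`. -/
def dnext (E : Env) (x : Config) (z : ℕ) : Config :=
  match x.todo with
  | [] => x
  | c :: K =>
    let y : Config := { x with time := x.time + 1, todo := K }
    match c with
    | .skip => y
    | .const r k => { y with reg := Function.update x.reg r (k % 2 ^ E.w) }
    | .op o r a b => { y with reg := Function.update x.reg r (o.eval E.w (x.reg a) (x.reg b)) }
    | .load r a => { y with reg := Function.update x.reg r (x.mem (x.reg a)) }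
    | .store a b => { y with mem := Function.update x.mem (x.reg a) (x.reg b) }
    | .rand r => { y with reg := Function.update x.reg r z }
    | .prep => { y with ready := true, time := x.time + 1 + E.prepTime }
    | .query s t a =>
        { y with
          time := x.time + 1 + E.n
          queries := x.queries + 1
          mem := fun i =>
            if x.reg a ≤ i ∧ i < x.reg a + E.n then
              (if x.ready && E.answer (x.reg s) (x.reg t) (i - x.reg a) then 1 else 0)
            else x.mem i }
    | .seq p q => { y with todo := p :: q :: K }
    | .ite r p q => { y with todo := (if x.reg r ≠ 0 then p else q) :: K }
    | .while r p => { y with todo := if x.reg r ≠ 0 then p :: .while r p :: K else K }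

/-- Whether the next step draws a random word. -/
def draws (x : Config) : Bool :=
  match x.todo with
  | .rand _ :: _ => true
  | _ => false

/-- One step that takes its random word from the tape. -/
def dstep (E : Env) (p : Config × (ℕ → ℕ)) : Config × (ℕ → ℕ) :=
  (dnext E p.1 (p.2 0), if draws p.1 then fun i => p.2 (i + 1) else p.2)

theorem dnext_of_not_draws (E : Env) (x : Config) (h : draws x = false) (z z' : ℕ) :
    dnext E x z = dnext E x z' := by
  unfold dnext
  unfold draws at h
  split
  · rfl
  · rename_i c K hx
    rw [hx] at h
    cases c <;> simp_all

/-- With `step_of_not_draws`, this ties the probabilistic step to the function `dnext`; elsewhere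
only tapes are considered. -/
theorem step_of_draws (E : Env) (x : Config) (h : draws x = true) :
    step E x = (PMF.uniformOfFintype (Fin (2 ^ E.w))).map fun z => dnext E x z.val := by
  unfold draws at h
  unfold step dnext
  split
  · rename_i hx; simp [hx] at h
  · rename_i c K hx
    rw [hx] at h
    cases c <;> simp_all

theorem step_of_not_draws (E : Env) (x : Config) (h : draws x = false) (z : ℕ) :
    step E x = PMF.pure (dnext E x z) := by
  unfold draws at h
  unfold step dnext
  split
  · rename_i hx; simp
  · rename_i c K hx
    rw [hx] at h
    cases c <;> simp_all

theorem dstep_of_todo_nil (E : Env) (p : Config × (ℕ → ℕ)) (h : p.1.todo = []) :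
    dstep E p = p := by
  unfold dstep dnext draws
  simp [h]

/-- `b` is reached from `a` within `τ` steps, time `τ`, and with `κ` queries. -/
def Reach (E : Env) (τ κ : ℕ) (a b : Config × (ℕ → ℕ)) : Prop :=
  ∃ N ≤ τ, (dstep E)^[N] a = b ∧ b.1.time ≤ a.1.time + τ ∧ b.1.queries ≤ a.1.queries + κ

theorem Reach.trans {E : Env} {τ κ τ' κ' : ℕ} {a b c : Config × (ℕ → ℕ)}
    (h : Reach E τ κ a b) (h' : Reach E τ' κ' b c) : Reach E (τ + τ') (κ + κ') a c := by
  obtain ⟨N, hN, h1, h2, h3⟩ := h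
  obtain ⟨N', hN', h1', h2', h3'⟩ := h'
  refine ⟨N' + N, by omega, ?_, by omega, by omega⟩
  rw [Function.iterate_add_apply, h1, h1']

theorem Reach.mono {E : Env} {τ κ τ' κ' : ℕ} {a b : Config × (ℕ → ℕ)}
    (h : Reach E τ κ a b) (hτ : τ ≤ τ') (hκ : κ ≤ κ') : Reach E τ' κ' a b := by
  obtain ⟨N, hN, h1, h2, h3⟩ := h
  exact ⟨N, by omega, h1, by omega, by omega⟩

theorem Reach.one {E : Env} {x y : Config} {ω ω' : ℕ → ℕ} {τ κ : ℕ} (hτ : 1 ≤ τ)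
    (h : dstep E (x, ω) = (y, ω')) (h1 : y.time ≤ x.time + τ) (h2 : y.queries ≤ x.queries + κ) :
    Reach E τ κ (x, ω) (y, ω') :=
  ⟨1, hτ, by simpa using h, h1, h2⟩

/-! ### Expressions -/

/-- The variables of structured programs; `out` and `size` are the registers `0` and `1`. -/
inductive Var where
  | out | size | n | nn | ell | K | H | L | B | Q | T | SK | PW | INF | pred
  | k | kn | r | v | x | t | j | q | i
  | a | c | cnt | p | slot | ca | f | lo | hi | X | e | d | zp | zn | sz
  | ar | sb | z | b | bk | kx | tot | pw | x1 | x2 | s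
  deriving DecidableEq

/-- The register of a variable. -/
def Var.idx (x : Var) : ℕ := x.ctorIdx

theorem Var.idx_lt (x : Var) : x.idx < 100 := by cases x <;> decide

theorem Var.idx_injective : Function.Injective Var.idx := by
  intro x y h
  have key : ∀ z : Var, Var.ofNat z.idx = z := by intro z; cases z <;> rfl
  rw [← key x, ← key y, h]

/-- The state of a structured program. -/
structure HState where
  v : Var → ℕ
  mem : ℕ → ℕ
  ready : Bool
  tape : ℕ → ℕ

/-- Assign a value to a variable. -/
def HState.set (s : HState) (x : Var) (a : ℕ) : HState := { s with v := Function.update s.v x a }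

@[simp] theorem HState.set_v (s : HState) (x y : Var) (a : ℕ) :
    (s.set x a).v y = if y = x then a else s.v y := by simp [HState.set, Function.update_apply]
@[simp] theorem HState.set_mem (s : HState) (x : Var) (a : ℕ) : (s.set x a).mem = s.mem := rfl
@[simp] theorem HState.set_ready (s : HState) (x : Var) (a : ℕ) : (s.set x a).ready = s.ready := rfl
@[simp] theorem HState.set_tape (s : HState) (x : Var) (a : ℕ) : (s.set x a).tape = s.tape := rfl

/-- Expressions over variables and memory cells. -/
inductive Ex where
  | var (x : Var) : Ex
  | lit (k : ℕ) : Ex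
  | bin (o : Op) (a b : Ex) : Ex
  | ld (a : Ex) : Ex

instance : Coe Var Ex := ⟨Ex.var⟩
instance (k : ℕ) : OfNat Ex k := ⟨Ex.lit k⟩
instance : Add Ex := ⟨Ex.bin .add⟩
instance : Sub Ex := ⟨Ex.bin .sub⟩
instance : Mul Ex := ⟨Ex.bin .mul⟩
instance : Div Ex := ⟨Ex.bin .div⟩
instance : Mod Ex := ⟨Ex.bin .mod⟩

/-- The value of an operation without overflow. -/
def Op.val : Op → ℕ → ℕ → ℕ
  | .add, a, b => a + b
  | .sub, a, b => a - b
  | .mul, a, b => a * b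
  | .div, a, b => a / b
  | .mod, a, b => a % b
  | .lt, a, b => if a < b then 1 else 0
  | .eq, a, b => if a = b then 1 else 0

/-- The value of an expression without overflow. -/
def Ex.val (s : HState) : Ex → ℕ
  | .var x => s.v x
  | .lit k => k
  | .bin o a b => o.val (a.val s) (b.val s)
  | .ld a => s.mem (a.val s)

/-- The value of an expression on the machine. -/
def Ex.wval (w : ℕ) (s : HState) : Ex → ℕ
  | .var x => s.v x
  | .lit k => k % 2 ^ w
  | .bin o a b => o.eval w (a.wval w s) (b.wval w s)
  | .ld a => s.mem (a.wval w s)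

/-- The machine computes the value of the expression correctly: exactly if the flag is set, and
modulo the number of words otherwise. -/
def Ex.fits (w : ℕ) (s : HState) : Ex → Bool → Prop
  | .var _, _ => True
  | .lit k, f => f = true → k < 2 ^ w
  | .bin .add a b, f => a.fits w s false ∧ b.fits w s false ∧ (f = true → a.val s + b.val s < 2 ^ w)
  | .bin .mul a b, f => a.fits w s false ∧ b.fits w s false ∧ (f = true → a.val s * b.val s < 2 ^ w)
  | .bin _ a b, _ => a.fits w s true ∧ b.fits w s true
  | .ld a, _ => a.fits w s true

/-- Addition and multiplication are compatible with congruence modulo `2 ^ w`, so overflow in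
intermediate results is harmless if the true final value is a word. The other operations and loads
do not respect congruence and need exact operands. -/
theorem Ex.wval_of_fits (w : ℕ) (s : HState) (e : Ex) : ∀ f : Bool, e.fits w s f →
    (e.wval w s ≡ e.val s [MOD 2 ^ w]) ∧ (f = true → e.wval w s = e.val s) := by
  induction e with
  | var x => intro f _; exact ⟨rfl, fun _ => rfl⟩
  | lit k =>
    intro f h
    exact ⟨Nat.mod_modEq _ _, fun hf => Nat.mod_eq_of_lt (h hf)⟩
  | ld a ih =>
    intro f h
    have := (ih true h).2 rfl
    simp [Ex.wval, Ex.val, this, Nat.ModEq]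
  | bin o a b iha ihb =>
    intro f h
    cases o
    case add =>
      obtain ⟨ha, hb, hc⟩ := h
      have : Ex.wval w s (.bin .add a b) ≡ a.val s + b.val s [MOD 2 ^ w] :=
        (Nat.mod_modEq _ _).trans ((iha _ ha).1.add (ihb _ hb).1)
      refine ⟨this, fun hf => ?_⟩
      have h2 : Ex.wval w s (.bin .add a b) < 2 ^ w := Nat.mod_lt _ (by positivity)
      exact Nat.ModEq.eq_of_lt_of_lt this h2 (hc hf)
    case mul =>
      obtain ⟨ha, hb, hc⟩ := h
      have : Ex.wval w s (.bin .mul a b) ≡ a.val s * b.val s [MOD 2 ^ w] :=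
        (Nat.mod_modEq _ _).trans ((iha _ ha).1.mul (ihb _ hb).1)
      refine ⟨this, fun hf => ?_⟩
      have h2 : Ex.wval w s (.bin .mul a b) < 2 ^ w := Nat.mod_lt _ (by positivity)
      exact Nat.ModEq.eq_of_lt_of_lt this h2 (hc hf)
    all_goals
      obtain ⟨ha, hb⟩ := h
      have h1 := (iha _ ha).2 rfl
      have h2 := (ihb _ hb).2 rfl
      simp [Ex.wval, Ex.val, h1, h2, Nat.ModEq, Op.eval, Op.val]

/-- Machine code that leaves the value of the expression in register `101 + d`. -/
def Ex.comp : Ex → ℕ → Com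
  -- There is no copy instruction. Subtracting zero copies a register and, unlike addition, never
  -- truncates.
  | .var x, d => .seq (.const 100 0) (.op .sub (101 + d) x.idx 100)
  | .lit k, d => .const (101 + d) k
  | .bin o a b, d => .seq (a.comp d) (.seq (b.comp (d + 1)) (.op o (101 + d) (101 + d) (102 + d)))
  | .ld a, d => .seq (a.comp d) (.load (101 + d) (101 + d))

/-- The running time of the code for an expression. -/
def Ex.cost : Ex → ℕ
  | .var _ => 3
  | .lit _ => 1
  | .bin _ a b => a.cost + b.cost + 3
  | .ld a => a.cost + 2

/-! ### Single instructions and the code for expressions -/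

theorem reach_seq {E : Env} {x : Config} {ω : ℕ → ℕ} {p q : Com} {K : List Com}
    (h : x.todo = .seq p q :: K) :
    Reach E 1 0 (x, ω) ({ x with time := x.time + 1, todo := p :: q :: K }, ω) :=
  Reach.one le_rfl (by simp [dstep, dnext, draws, h]) le_rfl le_rfl

theorem reach_const {E : Env} {x : Config} {ω : ℕ → ℕ} {r k : ℕ} {K : List Com}
    (h : x.todo = .const r k :: K) :
    Reach E 1 0 (x, ω) ({ x with
      time := x.time + 1
      todo := K
      reg := Function.update x.reg r (k % 2 ^ E.w) }, ω) :=
  Reach.one le_rfl (by simp [dstep, dnext, draws, h]) le_rfl le_rfl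

theorem reach_op {E : Env} {x : Config} {ω : ℕ → ℕ} {o : Op} {r a b : ℕ} {K : List Com}
    (h : x.todo = .op o r a b :: K) :
    Reach E 1 0 (x, ω) ({ x with
      time := x.time + 1
      todo := K
      reg := Function.update x.reg r (o.eval E.w (x.reg a) (x.reg b)) }, ω) :=
  Reach.one le_rfl (by simp [dstep, dnext, draws, h]) le_rfl le_rfl

theorem reach_load {E : Env} {x : Config} {ω : ℕ → ℕ} {r a : ℕ} {K : List Com}
    (h : x.todo = .load r a :: K) :
    Reach E 1 0 (x, ω) ({ x with
      time := x.time + 1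
      todo := K
      reg := Function.update x.reg r (x.mem (x.reg a)) }, ω) :=
  Reach.one le_rfl (by simp [dstep, dnext, draws, h]) le_rfl le_rfl

theorem reach_store {E : Env} {x : Config} {ω : ℕ → ℕ} {a b : ℕ} {K : List Com}
    (h : x.todo = .store a b :: K) :
    Reach E 1 0 (x, ω) ({ x with
      time := x.time + 1
      todo := K
      mem := Function.update x.mem (x.reg a) (x.reg b) }, ω) :=
  Reach.one le_rfl (by simp [dstep, dnext, draws, h]) le_rfl le_rfl

theorem reach_ite {E : Env} {x : Config} {ω : ℕ → ℕ} {r : ℕ} {p q : Com} {K : List Com}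
    (h : x.todo = .ite r p q :: K) :
    Reach E 1 0 (x, ω) ({ x with
      time := x.time + 1
      todo := (if x.reg r ≠ 0 then p else q) :: K }, ω) :=
  Reach.one le_rfl (by simp [dstep, dnext, draws, h]) le_rfl le_rfl

theorem reach_while {E : Env} {x : Config} {ω : ℕ → ℕ} {r : ℕ} {p : Com} {K : List Com}
    (h : x.todo = .while r p :: K) :
    Reach E 1 0 (x, ω) ({ x with
      time := x.time + 1
      todo := if x.reg r ≠ 0 then p :: .while r p :: K else K }, ω) :=
  Reach.one le_rfl (by simp [dstep, dnext, draws, h]) le_rfl le_rfl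

/-- The registers from 101 on serve as an evaluation stack. Code for depth `d` leaves everything
below `101 + d` alone except the scratch register 100, which keeps the first operand intact while
the second one is computed. -/
theorem Ex.comp_correct (E : Env) (s : HState) (ω : ℕ → ℕ) (e : Ex) :
    ∀ (d : ℕ) (x : Config) (K : List Com), x.todo = e.comp d :: K →
      (∀ v : Var, x.reg v.idx = s.v v) → x.mem = s.mem →
      ∃ y : Config, Reach E e.cost 0 (x, ω) (y, ω) ∧ y.todo = K ∧ y.mem = x.mem ∧
        y.ready = x.ready ∧ y.reg (101 + d) = e.wval E.w s ∧
        ∀ r < 101 + d, r ≠ 100 → y.reg r = x.reg r := by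
  induction e with
  | var z =>
    intro d x K h hv hm
    have h1 := reach_seq (E := E) (ω := ω) h
    have h2 := h1.trans (reach_const rfl)
    have h3 := h2.trans (reach_op rfl)
    refine ⟨_, h3, rfl, rfl, rfl, ?_, ?_⟩
    · have : z.idx ≠ 100 := by have := z.idx_lt; omega
      simp [Op.eval, Ex.wval, this, hv]
    · intro r hr hr'
      have : r ≠ 101 + d := by omega
      simp [Function.update_apply, this, hr']
  | lit k =>
    intro d x K h hv hm
    refine ⟨_, reach_const h, rfl, rfl, rfl, ?_, ?_⟩
    · simp [Ex.wval]
    · intro r hr hr'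
      have : r ≠ 101 + d := by omega
      simp [this]
  | ld a ih =>
    intro d x K h hv hm
    obtain ⟨y, hy, hy1, hy2, hy3, hy4, hy5⟩ := ih d
      { x with
        time := x.time + 1
        todo := a.comp d :: .load (101 + d) (101 + d) :: K } _ rfl hv hm
    have h3 := ((reach_seq (E := E) (ω := ω) h).trans hy).trans (reach_load hy1)
    refine ⟨_, h3.mono (by simp [Ex.cost]; omega) le_rfl, rfl, hy2, hy3, ?_, ?_⟩
    · simp [Ex.wval, hy4, hy2, hm]
    · intro r hr hr'
      have : r ≠ 101 + d := by omega
      simp [this, hy5 r hr hr']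
  | bin o a b iha ihb =>
    intro d x K h hv hm
    obtain ⟨y, hy, hy1, hy2, hy3, hy4, hy5⟩ := iha d
      { x with
        time := x.time + 1
        todo := a.comp d :: .seq (b.comp (d + 1)) (.op o (101 + d) (101 + d) (102 + d)) :: K }
      _ rfl hv hm
    have hv' : ∀ v : Var, y.reg v.idx = s.v v := fun v => by
      have := v.idx_lt
      rw [hy5 _ (by omega) (by omega)]; exact hv v
    obtain ⟨z, hz, hz1, hz2, hz3, hz4, hz5⟩ := ihb (d + 1)
      { y with time := y.time + 1,
               todo := b.comp (d + 1) :: .op o (101 + d) (101 + d) (102 + d) :: K }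
      _ rfl hv' (hy2.trans hm)
    have h3 := (((reach_seq (E := E) (ω := ω) h).trans hy).trans ((reach_seq hy1).trans hz)).trans
      (reach_op hz1)
    refine ⟨_, h3.mono (by simp [Ex.cost]; omega) le_rfl, rfl, hz2.trans hy2, hz3.trans hy3, ?_, ?_⟩
    · have e1 : z.reg (102 + d) = b.wval E.w s := by
        rw [← hz4]; congr 1; omega
      have e2 : z.reg (101 + d) = a.wval E.w s := by
        rw [hz5 _ (by omega) (by omega)]; exact hy4
      simp [Ex.wval, e1, e2]
    · intro r hr hr'
      have : r ≠ 101 + d := by omega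
      simp only [Function.update_apply, this, if_false]
      rw [hz5 r (by omega) hr']
      exact hy5 r hr hr'

/-! ### Structured programs -/

/-- Structured programs: assignments, stores, random words, access to the Min-Cut data structure,
for-loops (`loop x y p` runs `p` for `x = 0, …, y - 1`), and integer logarithms. -/
inductive HCom where
  | skip : HCom
  | asg (x : Var) (e : Ex) : HCom
  | put (a b : Ex) : HCom
  | rnd (x : Var) : HCom
  | prep : HCom
  | ask (s t a : Ex) : HCom
  | seq (p q : HCom) : HCom
  | ite (e : Ex) (p q : HCom) : HCom
  | loop (x y : Var) (p : HCom) : HCom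
  | lgOf (x : Var) (e : Ex) : HCom

infixr:50 " ⨟ " => HCom.seq
infix:55 " ≔ " => HCom.asg

/-- The effect of a query on the memory. -/
def queryMem (E : Env) (mem : ℕ → ℕ) (ready : Bool) (s t a : ℕ) : ℕ → ℕ := fun i =>
  if a ≤ i ∧ i < a + E.n then (if ready && E.answer s t (i - a) then 1 else 0) else mem i

/-- The result of a structured program. -/
def HCom.run (E : Env) : HCom → HState → HState
  | .skip, s => s
  | .asg x e, s => s.set x (e.val s)
  | .put a b, s => { s with mem := Function.update s.mem (a.val s) (b.val s) }
  | .rnd x, s => { s.set x (s.tape 0) with tape := fun i => s.tape (i + 1) }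
  | .prep, s => { s with ready := true }
  | .ask a b c, s => { s with mem := queryMem E s.mem s.ready (a.val s) (b.val s) (c.val s) }
  | .seq p q, s => q.run E (p.run E s)
  | .ite e p q, s => if e.val s ≠ 0 then p.run E s else q.run E s
  | .loop x y p, s =>
      Nat.rec (motive := fun _ => HState) (s.set x 0) (fun i t => (p.run E t).set x (i + 1)) (s.v y)
  | .lgOf x e, s => s.set x (lg (e.val s))

/-- Whether the program may assign to the variable. -/
def HCom.writes (y : Var) : HCom → Bool
  | .asg x _ => x = y
  | .rnd x => x = y
  | .seq p q => p.writes y || q.writes y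
  | .ite _ p q => p.writes y || q.writes y
  | .loop x _ p => x = y || p.writes y
  | .lgOf x _ => x = y
  | _ => false

/-- Whether the program may change the memory. -/
def HCom.writesMem : HCom → Bool
  | .put _ _ => true
  | .ask _ _ _ => true
  | .seq p q => p.writesMem || q.writesMem
  | .ite _ p q => p.writesMem || q.writesMem
  | .loop _ _ p => p.writesMem
  | _ => false

/-- Whether the program may draw random words. -/
def HCom.draws : HCom → Bool
  | .rnd _ => true
  | .seq p q => p.draws || q.draws
  | .ite _ p q => p.draws || q.draws
  | .loop _ _ p => p.draws
  | _ => false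

/-- Whether the program may call the preprocessing. -/
def HCom.preps : HCom → Bool
  | .prep => true
  | .seq p q => p.preps || q.preps
  | .ite _ p q => p.preps || q.preps
  | .loop _ _ p => p.preps
  | _ => false

/-- What a program leaves unchanged, by its syntax. -/
structure HCom.Frame (p : HCom) (s t : HState) : Prop where
  v : ∀ z, p.writes z = false → t.v z = s.v z
  mem : p.writesMem = false → t.mem = s.mem
  tape : p.draws = false → t.tape = s.tape
  ready : p.preps = false → t.ready = s.ready

/-- The side conditions of `Frame` are decidable by computation, so facts about untouched variables
pass through whole programs by `rfl`. -/
theorem HCom.frame_run (E : Env) (p : HCom) : ∀ s, p.Frame s (p.run E s) := by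
  induction p with
  | skip => intro s; constructor <;> simp [run]
  | asg x e =>
    intro s
    constructor <;> simp [run, writes, writesMem, HCom.draws, preps]
    intro z hz h; exact absurd h.symm hz
  | lgOf x e =>
    intro s
    constructor <;> simp [run, writes, writesMem, HCom.draws, preps]
    intro z hz h; exact absurd h.symm hz
  | put a b => intro s; constructor <;> simp [run, writes, writesMem, HCom.draws, preps]
  | rnd x =>
    intro s
    constructor <;> simp [run, writes, writesMem, HCom.draws, preps]
    intro z hz h; exact absurd h.symm hz
  | prep => intro s; constructor <;> simp [run, writes, writesMem, HCom.draws, preps]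
  | ask a b c => intro s; constructor <;> simp [run, writes, writesMem, HCom.draws, preps]
  | seq p q ihp ihq =>
    intro s
    have h1 := ihp s
    have h2 := ihq (p.run E s)
    constructor
    · intro z hz; simp [writes] at hz; exact (h2.v z hz.2).trans (h1.v z hz.1)
    · intro hz; simp [writesMem] at hz; exact (h2.mem hz.2).trans (h1.mem hz.1)
    · intro hz; simp [HCom.draws] at hz; exact (h2.tape hz.2).trans (h1.tape hz.1)
    · intro hz; simp [preps] at hz; exact (h2.ready hz.2).trans (h1.ready hz.1)
  | ite e p q ihp ihq =>
    intro s
    simp only [run]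
    split
    · have h1 := ihp s
      constructor
      · intro z hz; simp [writes] at hz; exact h1.v z hz.1
      · intro hz; simp [writesMem] at hz; exact h1.mem hz.1
      · intro hz; simp [HCom.draws] at hz; exact h1.tape hz.1
      · intro hz; simp [preps] at hz; exact h1.ready hz.1
    · have h1 := ihq s
      constructor
      · intro z hz; simp [writes] at hz; exact h1.v z hz.2
      · intro hz; simp [writesMem] at hz; exact h1.mem hz.2
      · intro hz; simp [HCom.draws] at hz; exact h1.tape hz.2
      · intro hz; simp [preps] at hz; exact h1.ready hz.2
  | loop x y p ih =>
    intro s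
    simp only [run]
    generalize s.v y = N
    induction N with
    | zero =>
      constructor <;> simp [writes]
      intro z hz _ h; exact absurd h.symm hz
    | succ N ihN =>
      have h1 := ih (Nat.rec (motive := fun _ => HState) (s.set x 0)
        (fun i t => (p.run E t).set x (i + 1)) N)
      constructor
      · intro z hz
        have h2 := ihN.v z hz
        simp [writes] at hz
        have : z ≠ x := fun h => hz.1 h.symm
        simpa [this] using (h1.v z hz.2).trans h2
      · intro hz; exact (h1.mem hz).trans (ihN.mem hz)
      · intro hz; exact (h1.tape hz).trans (ihN.tape hz)
      · intro hz; exact (h1.ready hz).trans (ihN.ready hz)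

/-- No overflow occurs, loop counters are not modified by loop bodies, and the numbers of
iterations are bounded by `β`. -/
def HCom.Safe (E : Env) (β : Var → ℕ) : HCom → HState → Prop
  | .skip, _ => True
  | .asg _ e, s => e.fits E.w s true
  | .put a b, s => a.fits E.w s true ∧ b.fits E.w s true
  | .rnd _, _ => True
  | .prep, _ => True
  | .ask a b c, s => a.fits E.w s true ∧ b.fits E.w s true ∧ c.fits E.w s true
  | .seq p q, s => p.Safe E β s ∧ q.Safe E β (p.run E s)
  | .ite e p q, s => e.fits E.w s true ∧ (if e.val s ≠ 0 then p.Safe E β s else q.Safe E β s)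
  | .loop x y p, s => x ≠ y ∧ p.writes x = false ∧ p.writes y = false ∧ s.v y < 2 ^ E.w ∧
      s.v y ≤ β y ∧ ∀ i < s.v y, p.Safe E β
        (Nat.rec (motive := fun _ => HState) (s.set x 0) (fun i t => (p.run E t).set x (i + 1)) i)
  | .lgOf x e, s => e.fits E.w s true ∧ e.val s < 2 ^ E.w ∧ 2 < 2 ^ E.w ∧ lg (e.val s) ≤ β x

/-- The test of a loop. -/
def loopTest (x y : Var) : Com := .op .lt 101 x.idx y.idx

/-- The body of the `while`-loop of a loop. -/
def loopBody (x y : Var) (p : Com) : Com :=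
  .seq p (.seq (.const 101 1) (.seq (.op .add x.idx x.idx 101) (loopTest x y)))

/-- The body of the `while`-loop of a logarithm. -/
def lgBody (x : Var) : Com := .seq (.op .add x.idx x.idx 103) (.op .div 101 101 102)

/-- Machine code for a structured program. -/
def HCom.comp : HCom → Com
  | .skip => .skip
  | .asg x e => .seq (e.comp 0) (.seq (.const 100 0) (.op .sub x.idx 101 100))
  | .put a b => .seq (a.comp 0) (.seq (b.comp 1) (.store 101 102))
  | .rnd x => .rand x.idx
  | .prep => .prep
  | .ask a b c => .seq (a.comp 0) (.seq (b.comp 1) (.seq (c.comp 2) (.query 101 102 103)))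
  | .seq p q => .seq p.comp q.comp
  | .ite e p q => .seq (e.comp 0) (.ite 101 p.comp q.comp)
  | .loop x y p => .seq (.const x.idx 0) (.seq (loopTest x y) (.while 101 (loopBody x y p.comp)))
  | .lgOf x e => .seq (e.comp 0) (.seq (.const 102 2) (.seq (.const 103 1)
      (.seq (.const x.idx 1) (.seq (.op .div 101 101 102) (.while 101 (lgBody x))))))

/-- A bound for the running time of a structured program. -/
def HCom.cost (E : Env) (β : Var → ℕ) : HCom → ℕ
  | .skip => 1
  | .asg _ e => e.cost + 4
  | .put a b => a.cost + b.cost + 3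
  | .rnd _ => 1
  | .prep => 1 + E.prepTime
  | .ask a b c => a.cost + b.cost + c.cost + 4 + E.n
  | .seq p q => p.cost E β + q.cost E β + 1
  -- Adding both branches gives a bound that does not depend on the state.
  | .ite e p q => e.cost + p.cost E β + q.cost E β + 2
  | .loop _ y p => β y * (p.cost E β + 7) + 5
  | .lgOf x e => e.cost + 10 + 4 * β x

/-- A bound for the number of queries of a structured program. -/
def HCom.queries (β : Var → ℕ) : HCom → ℕ
  | .ask _ _ _ => 1
  | .seq p q => p.queries β + q.queries β
  | .ite _ p q => p.queries β + q.queries β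
  | .loop _ y p => β y * p.queries β
  | _ => 0

/-- The configuration of the machine represents the state of the structured program. -/
structure Sim (x : Config) (s : HState) : Prop where
  v : ∀ z : Var, x.reg z.idx = s.v z
  mem : x.mem = s.mem
  ready : x.ready = s.ready

theorem Sim.set {x y : Config} {s : HState} (h : Sim x s) (z : Var) (a : ℕ) (hm : y.mem = x.mem)
    (hr : y.ready = x.ready) (h1 : y.reg z.idx = a)
    (h2 : ∀ r < 100, r ≠ z.idx → y.reg r = x.reg r) : Sim y (s.set z a) := by
  refine ⟨fun z' => ?_, hm.trans h.mem, hr.trans h.ready⟩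
  by_cases hz : z' = z
  · subst hz; simp [h1]
  · simp only [HState.set_v, hz, if_false]
    rw [h2 _ z'.idx_lt (fun h => hz (Var.idx_injective h))]
    exact h.v z'

theorem Sim.of_eq {x y : Config} {s : HState} (h : Sim x s) (hm : y.mem = x.mem)
    (hr : y.ready = x.ready) (h2 : ∀ r < 100, y.reg r = x.reg r) : Sim y s :=
  ⟨fun z => (h2 _ z.idx_lt).trans (h.v z), hm.trans h.mem, hr.trans h.ready⟩

theorem Sim.eval {E : Env} {x : Config} {s : HState} (h : Sim x s) (ω : ℕ → ℕ) {e : Ex}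
    (he : e.fits E.w s true) (d : ℕ) {K : List Com} (hK : x.todo = e.comp d :: K) :
    ∃ y, Reach E e.cost 0 (x, ω) (y, ω) ∧ y.todo = K ∧ Sim y s ∧ y.reg (101 + d) = e.val s ∧
      ∀ r < 101 + d, r ≠ 100 → y.reg r = x.reg r := by
  obtain ⟨y, h1, h2, h3, h4, h5, h6⟩ := e.comp_correct E s ω d x K hK h.v h.mem
  exact ⟨y, h1, h2, h.of_eq h3 h4 fun r hr => h6 r (by omega) (by omega),
    h5.trans ((e.wval_of_fits E.w s true he).2 rfl), h6⟩

theorem lg_eq (a : ℕ) : lg a = if a / 2 = 0 then 1 else lg (a / 2) + 1 := by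
  unfold lg
  split_ifs with h
  · have : a < 2 := by omega
    rw [Nat.log_of_lt this]
  · rw [Nat.log_of_one_lt_of_le (by norm_num) (by omega)]

end MinCutOracle

namespace MinCutOracle

/-! ### Correctness of the translation into machine code -/

theorem reach_while_true {E : Env} {x : Config} {ω : ℕ → ℕ} {r : ℕ} {p : Com} {K : List Com}
    (h : x.todo = .while r p :: K) (hr : x.reg r ≠ 0) :
    Reach E 1 0 (x, ω) ({ x with
      time := x.time + 1
      todo := p :: .while r p :: K }, ω) :=
  Reach.one le_rfl (by simp [dstep, dnext, draws, h, hr]) le_rfl le_rfl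

/-- What the machine code of a program achieves from a configuration that represents `s`. -/
def HCom.Implements (E : Env) (β : Var → ℕ) (p : HCom) : Prop :=
  ∀ (s : HState) (x : Config) (K : List Com), p.Safe E β s → Sim x s → x.todo = p.comp :: K →
    ∃ y, Reach E (p.cost E β) (p.queries β) (x, s.tape) (y, (p.run E s).tape) ∧
      Sim y (p.run E s) ∧ y.todo = K

theorem implements_asg (E : Env) (β : Var → ℕ) (z : Var) (e : Ex) :
    (HCom.asg z e).Implements E β := by
  intro s x K hs hx hK
  obtain ⟨y, h1, h2, h3, h4, h5⟩ := Sim.eval (E := E) (s := s)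
    (x := { x with
      time := x.time + 1
      todo := e.comp 0 :: .seq (.const 100 0) (.op .sub z.idx 101 100) :: K })
    (hx.of_eq rfl rfl fun _ _ => rfl) s.tape hs 0 rfl
  have h6 := ((reach_seq hK).trans h1).trans (((reach_seq h2).trans (reach_const rfl)).trans
    (reach_op rfl))
  refine ⟨_, h6.mono (by simp [HCom.cost]; omega) (by simp), ?_, rfl⟩
  refine h3.set z _ rfl rfl ?_ ?_
  · simpa [Op.eval] using h4
  · intro r hr hr'
    have : r ≠ 100 := by omega
    simp [hr', this]

theorem implements_put (E : Env) (β : Var → ℕ) (a b : Ex) :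
    (HCom.put a b).Implements E β := by
  intro s x K hs hx hK
  obtain ⟨y, h1, h2, h3, h4, h5⟩ := Sim.eval (E := E) (s := s)
    (x := { x with
      time := x.time + 1
      todo := a.comp 0 :: .seq (b.comp 1) (.store 101 102) :: K })
    (hx.of_eq rfl rfl fun _ _ => rfl) s.tape hs.1 0 rfl
  obtain ⟨y', h1', h2', h3', h4', h5'⟩ := Sim.eval (E := E) (s := s)
    (x := { y with
      time := y.time + 1
      todo := b.comp 1 :: .store 101 102 :: K })
    (h3.of_eq rfl rfl fun _ _ => rfl) s.tape hs.2 1 rfl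
  have h6 := ((reach_seq hK).trans h1).trans (((reach_seq h2).trans h1').trans (reach_store h2'))
  refine ⟨_, h6.mono (by simp [HCom.cost]; omega) (by simp), ⟨h3'.v, ?_, h3'.ready⟩, rfl⟩
  have e1 : y'.reg 101 = a.val s := (h5' 101 (by omega) (by omega)).trans h4
  have e2 : y'.reg 102 = b.val s := h4'
  simp [HCom.run, e1, e2, h3'.mem]

theorem implements_ask (E : Env) (β : Var → ℕ) (a b c : Ex) :
    (HCom.ask a b c).Implements E β := by
  intro s x K hs hx hK
  obtain ⟨y, h1, h2, h3, h4, h5⟩ := Sim.eval (E := E) (s := s)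
    (x := { x with
      time := x.time + 1
      todo := a.comp 0 :: .seq (b.comp 1) (.seq (c.comp 2) (.query 101 102 103)) :: K })
    (hx.of_eq rfl rfl fun _ _ => rfl) s.tape hs.1 0 rfl
  obtain ⟨y', h1', h2', h3', h4', h5'⟩ := Sim.eval (E := E) (s := s)
    (x := { y with
      time := y.time + 1
      todo := b.comp 1 :: .seq (c.comp 2) (.query 101 102 103) :: K })
    (h3.of_eq rfl rfl fun _ _ => rfl) s.tape hs.2.1 1 rfl
  obtain ⟨z, h1'', h2'', h3'', h4'', h5''⟩ := Sim.eval (E := E) (s := s)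
    (x := { y' with
      time := y'.time + 1
      todo := c.comp 2 :: .query 101 102 103 :: K })
    (h3'.of_eq rfl rfl fun _ _ => rfl) s.tape hs.2.2 2 rfl
  have h6 := (((reach_seq hK).trans h1).trans ((reach_seq h2).trans h1')).trans
    ((reach_seq h2').trans h1'')
  have e1 : z.reg 101 = a.val s :=
    ((h5'' 101 (by omega) (by omega)).trans (h5' 101 (by omega) (by omega))).trans h4
  have e2 : z.reg 102 = b.val s := (h5'' 102 (by omega) (by omega)).trans h4'
  have e3 : z.reg 103 = c.val s := h4''
  have h7 : Reach E (1 + E.n) 1 (z, s.tape) ({ z with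
      time := z.time + 1 + E.n
      queries := z.queries + 1
      mem := queryMem E z.mem z.ready (z.reg 101) (z.reg 102) (z.reg 103)
      todo := K }, s.tape) :=
    Reach.one (by omega)
      (by simp only [dstep, dnext, draws, h2'']; rfl) (by simp; omega) le_rfl
  refine ⟨_, (h6.trans h7).mono (by simp [HCom.cost]; omega) (by simp [HCom.queries]),
    ⟨h3''.v, ?_, h3''.ready⟩, rfl⟩
  simp [HCom.run, e1, e2, e3, h3''.mem, h3''.ready]

theorem implements_lgOf (E : Env) (β : Var → ℕ) (z : Var) (e : Ex) :
    (HCom.lgOf z e).Implements E β := by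
  intro s x K hs hx hK
  obtain ⟨hs, hW, hW2, hβ⟩ := hs
  obtain ⟨y, h1, h2, h3, h4, h5⟩ := Sim.eval (E := E) (s := s)
    (x := { x with
      time := x.time + 1
      todo := e.comp 0 :: .seq (.const 102 2) (.seq (.const 103 1)
        (.seq (.const z.idx 1) (.seq (.op .div 101 101 102) (.while 101 (lgBody z))))) :: K })
    (hx.of_eq rfl rfl fun _ _ => rfl) s.tape hs 0 rfl
  have hz := z.idx_lt
  -- Invariant of the halving loop: the counter is `m` and register 101 holds `a / 2`, so that `lg a
  -- - 1` further rounds follow. The bound on `m + lg a` excludes an overflow of the counter.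
  have key : ∀ (m a : ℕ) (s' : HState) (y : Config), m + lg a < 2 ^ E.w + 1 → Sim y s' →
      s'.v z = m → y.reg 101 = a / 2 → y.reg 102 = 2 → y.reg 103 = 1 →
      y.todo = .while 101 (lgBody z) :: K →
      ∃ y', Reach E (1 + 4 * lg a) 0 (y, s.tape) (y', s.tape) ∧
        Sim y' (s'.set z (m + lg a - 1)) ∧ y'.todo = K := by
    intro m a
    induction a using Nat.strong_induction_on generalizing m with
    | _ a ih =>
      intro s' y hma hy hm hr1 hr2 hr3 htd
      have hw := reach_while (E := E) (ω := s.tape) htd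
      by_cases ha : a / 2 = 0
      · have hl : lg a = 1 := by rw [lg_eq, if_pos ha]
        refine ⟨_, hw.mono (by omega) le_rfl, ?_, by simp [hr1, ha]⟩
        refine hy.set z _ rfl rfl ?_ (fun _ _ _ => rfl)
        simp [hl, ← hm, hy.v]
      · have hl : lg a = lg (a / 2) + 1 := by rw [lg_eq, if_neg ha]
        have hl1 : 1 ≤ lg (a / 2) := by simp [lg]
        have hadd : Op.eval E.w .add (y.reg z.idx) (y.reg 103) = m + 1 := by
          rw [hy.v, hm, hr3]; exact Nat.mod_eq_of_lt (by omega)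
        obtain ⟨Y, hYr, hYt, hYm, hYd, hYg⟩ : ∃ Y, Reach E 4 0 (y, s.tape) (Y, s.tape) ∧
            Y.todo = .while 101 (lgBody z) :: K ∧ Y.mem = y.mem ∧ Y.ready = y.ready ∧
            Y.reg = Function.update (Function.update y.reg z.idx (m + 1)) 101
              (Op.eval E.w .div (Function.update y.reg z.idx (m + 1) 101)
                (Function.update y.reg z.idx (m + 1) 102)) := by
          have h := (((reach_while_true (E := E) (ω := s.tape) htd (by rw [hr1]; exact ha)).trans
            (reach_seq rfl)).trans (reach_op rfl)).trans (reach_op rfl)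
          exact ⟨_, h, rfl, rfl, rfl, by simp only [hadd]⟩
        have n1 : z.idx ≠ 101 := by omega
        have n2 : 101 ≠ z.idx := by omega
        have n3 : 102 ≠ z.idx := by omega
        have n4 : 103 ≠ z.idx := by omega
        have hS : Sim Y (s'.set z (m + 1)) := by
          refine hy.set z (m + 1) hYm hYd (by simp [n1, hYg]) fun r hr hr' => ?_
          have : r ≠ 101 := by omega
          simp [hr', this, hYg]
        obtain ⟨y', hy', hs', ht'⟩ := ih (a / 2) (by omega) (m + 1) (s'.set z (m + 1)) Y (by omega)
          hS (by simp) (by simp [n2, hr1, hr2, n3, Op.eval, hYg]) (by simp [n3, hr2, hYg])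
          (by simp [n4, hr3, hYg]) hYt
        refine ⟨y', (hYr.trans hy').mono (by omega) le_rfl, ?_, ht'⟩
        have e1 : (s'.set z (m + 1)).set z (m + 1 + lg (a / 2) - 1) =
            s'.set z (m + lg a - 1) := by
          rw [hl, show m + 1 + lg (a / 2) - 1 = m + (lg (a / 2) + 1) - 1 by omega]
          simp [HState.set]
        rw [← e1]; exact hs'
  obtain ⟨Y, hYr, hYt, hYm, hYd, hYg⟩ : ∃ Y, Reach E (e.cost + 9) 0 (x, s.tape) (Y, s.tape) ∧
      Y.todo = .while 101 (lgBody z) :: K ∧ Y.mem = y.mem ∧ Y.ready = y.ready ∧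
      ∃ g, g = Function.update (Function.update (Function.update y.reg 102 (2 % 2 ^ E.w)) 103
        (1 % 2 ^ E.w)) z.idx (1 % 2 ^ E.w) ∧
      Y.reg = Function.update g 101 (Op.eval E.w .div (g 101) (g 102)) := by
    have h6 := (((reach_seq (E := E) hK).trans h1).trans ((reach_seq h2).trans (reach_const rfl))).trans
      (((reach_seq rfl).trans (reach_const rfl)).trans
      (((reach_seq rfl).trans (reach_const rfl)).trans ((reach_seq rfl).trans (reach_op rfl))))
    exact ⟨_, h6.mono (by omega) le_rfl, rfl, rfl, rfl, _, rfl, rfl⟩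
  obtain ⟨g, hg, hYg⟩ := hYg
  have e1 : 101 ≠ z.idx := by omega
  have e2 : 102 ≠ z.idx := by omega
  have e3 : 103 ≠ z.idx := by omega
  have e4 : z.idx ≠ 101 := by omega
  have m1 : 1 % 2 ^ E.w = 1 := Nat.mod_eq_of_lt (by omega)
  have m2 : 2 % 2 ^ E.w = 2 := Nat.mod_eq_of_lt (by omega)
  have hlg : lg (e.val s) < 2 ^ E.w := by
    rw [lg_eq]
    split_ifs
    · omega
    · rename_i h0
      have := Nat.log_lt_self 2 h0
      simp only [lg]; omega
  have hS : Sim Y (s.set z 1) := by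
    refine h3.set z 1 hYm hYd (by simp [hYg, hg, e4, m1]) fun r hr hr' => ?_
    have a1 : r ≠ 101 := by omega
    have a2 : r ≠ 102 := by omega
    have a3 : r ≠ 103 := by omega
    simp [hYg, hg, hr', a1, a2, a3]
  simp only [Nat.add_zero] at h4
  obtain ⟨y', hy', hs', ht'⟩ := key 1 (e.val s) (s.set z 1) Y (by omega) hS (by simp)
    (by simp [hYg, hg, e1, e2, m2, Op.eval, h4]) (by simp [hYg, hg, e2, m2])
    (by simp [hYg, hg, e3, m1]) hYt
  refine ⟨y', (hYr.trans hy').mono ?_ (by simp), ?_, ht'⟩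
  · simp only [HCom.cost]; omega
  · have e5 : (s.set z 1).set z (1 + lg (e.val s) - 1) = s.set z (lg (e.val s)) := by
      simp [HState.set]
    rw [e5] at hs'; exact hs'

theorem implements_loop (E : Env) (β : Var → ℕ) (u z : Var) (p : HCom) (hp : p.Implements E β) :
    (HCom.loop u z p).Implements E β := by
  intro s x K hs hx hK
  obtain ⟨huz, hpu, hpz, hW, hβ, hsafe⟩ := hs
  have hu := u.idx_lt
  have hz := z.idx_lt
  have huz' : u.idx ≠ z.idx := fun h => huz (Var.idx_injective h)
  set iter : ℕ → HState := fun i =>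
    Nat.rec (motive := fun _ => HState) (s.set u 0) (fun i t => (p.run E t).set u (i + 1)) i
    with hiter
  have hv : ∀ i, (iter i).v u = i ∧ (iter i).v z = s.v z := by
    intro i
    induction i with
    | zero => simp [hiter, huz.symm]
    | succ i ih =>
      refine ⟨by simp [hiter], ?_⟩
      have := (p.frame_run E (iter i)).v z hpz
      simp only [hiter, HState.set_v, huz.symm, if_false]
      exact this.trans ih.2
  -- Induction on the number `m` of iterations that remain; register 101 holds the outcome of the
  -- loop test.
  have key : ∀ m i, i + m = s.v z → ∀ y, Sim y (iter i) →
      y.todo = .while 101 (loopBody u z p.comp) :: K →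
      y.reg 101 = (if i < s.v z then 1 else 0) →
      ∃ y', Reach E (1 + m * (p.cost E β + 7)) (m * p.queries β) (y, (iter i).tape)
        (y', (iter (s.v z)).tape) ∧ Sim y' (iter (s.v z)) ∧ y'.todo = K := by
    intro m
    induction m with
    | zero =>
      intro i hi y hy htd hr
      have hw := reach_while (E := E) (ω := (iter i).tape) htd
      have hi' : i = s.v z := by omega
      subst hi'
      exact ⟨_, hw.mono (by simp) (by simp), hy.of_eq rfl rfl (fun _ _ => rfl), by simp [hr]⟩
    | succ m ih =>
      intro i hi y hy htd hr
      have hlt : i < s.v z := by omega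
      rw [if_pos hlt] at hr
      have hw := (reach_while_true (E := E) (ω := (iter i).tape) htd (by omega)).trans
        (reach_seq rfl)
      obtain ⟨y1, h1, h2, h3⟩ := hp (iter i) { y with
            time := y.time + 1 + 1
            todo := p.comp :: .seq (.const 101 1) (.seq (.op .add u.idx u.idx 101) (loopTest u z)) ::
              .while 101 (loopBody u z p.comp) :: K } _ (hsafe i hlt)
        (hy.of_eq rfl rfl (fun _ _ => rfl)) rfl
      have m1 : 1 % 2 ^ E.w = 1 := Nat.mod_eq_of_lt (by omega)
      have e1 : y1.reg u.idx = i := by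
        rw [h2.v, (p.frame_run E (iter i)).v u hpu, (hv i).1]
      have e2 : y1.reg z.idx = s.v z := by
        rw [h2.v, (p.frame_run E (iter i)).v z hpz, (hv i).2]
      have a1 : u.idx ≠ 101 := by omega
      have a2 : z.idx ≠ 101 := by omega
      have a3 : 101 ≠ u.idx := by omega
      have hadd : (i + 1) % 2 ^ E.w = i + 1 := Nat.mod_eq_of_lt (by omega)
      obtain ⟨Y, hYr, hYt, hYm, hYd, g, hg, hYg⟩ : ∃ Y, Reach E (p.cost E β + 7) (p.queries β)
          (y, (iter i).tape) (Y, (iter (i + 1)).tape) ∧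
          Y.todo = .while 101 (loopBody u z p.comp) :: K ∧ Y.mem = y1.mem ∧ Y.ready = y1.ready ∧
          ∃ g, g = Function.update (Function.update y1.reg 101 1) u.idx (i + 1) ∧
          Y.reg = Function.update g 101 (Op.eval E.w .lt (g u.idx) (g z.idx)) := by
        have h4 := (hw.trans h1).trans (((reach_seq h3).trans (reach_const rfl)).trans
          (((reach_seq rfl).trans (reach_op rfl)).trans (reach_op rfl)))
        refine ⟨_, h4.mono (by omega) (by omega), rfl, rfl, rfl, _, rfl, ?_⟩
        simp only [Op.eval, m1, Function.update_self, Function.update_of_ne a1, e1, hadd]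
      have hS : Sim Y (iter (i + 1)) := by
        refine h2.set u (i + 1) hYm hYd ?_ ?_
        · simp [a1, hYg, hg]
        · intro r hr hr'
          have : r ≠ 101 := by omega
          simp [hr', this, hYg, hg]
      obtain ⟨y', hy', hs', ht'⟩ := ih (i + 1) (by omega) Y hS hYt (by
        simp [hYg, hg, Op.eval, Function.update_of_ne huz'.symm, a2, e2])
      refine ⟨y', (hYr.trans hy').mono ?_ ?_, hs', ht'⟩
      · have : (m + 1) * (p.cost E β + 7) = m * (p.cost E β + 7) + (p.cost E β + 7) := by ring
        omega
      · have : (m + 1) * p.queries β = m * p.queries β + p.queries β := by ring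
        omega
  have a1 : u.idx ≠ 101 := by omega
  have a2 : z.idx ≠ 101 := by omega
  obtain ⟨Y, hYr, hYt, hYm, hYd, g, hg, hYg⟩ : ∃ Y, Reach E 4 0 (x, s.tape) (Y, s.tape) ∧
      Y.todo = .while 101 (loopBody u z p.comp) :: K ∧ Y.mem = x.mem ∧ Y.ready = x.ready ∧
      ∃ g, g = Function.update x.reg u.idx 0 ∧
      Y.reg = Function.update g 101 (Op.eval E.w .lt (g u.idx) (g z.idx)) := by
    have h6 := ((reach_seq (E := E) (ω := s.tape) hK).trans (reach_const rfl)).trans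
      ((reach_seq rfl).trans (reach_op rfl))
    exact ⟨_, h6.mono (by omega) le_rfl, rfl, rfl, rfl, _, rfl, by simp⟩
  have hS : Sim Y (s.set u 0) := by
    refine hx.set u 0 hYm hYd (by simp [hYg, hg, a1]) fun r hr hr' => ?_
    have : r ≠ 101 := by omega
    simp [hr', this, hYg, hg]
  obtain ⟨y', hy', hs', ht'⟩ := key (s.v z) 0 (by omega) Y hS hYt
    (by simp [hYg, hg, huz'.symm, Op.eval, hx.v])
  refine ⟨y', (hYr.trans hy').mono ?_ ?_, hs', ht'⟩
  · have := Nat.mul_le_mul_right (p.cost E β + 7) hβ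
    simp only [HCom.cost]; omega
  · have := Nat.mul_le_mul_right (p.queries β) hβ
    simp only [HCom.queries]; omega

theorem HCom.implements (E : Env) (β : Var → ℕ) (p : HCom) : p.Implements E β := by
  induction p with
  | skip =>
    intro s x K hs hx hK
    exact ⟨{ x with
      time := x.time + 1
      todo := K }, Reach.one le_rfl (by simp [dstep, dnext, MinCutOracle.draws, hK, HCom.comp, HCom.run])
      le_rfl (by simp), hx.of_eq rfl rfl (fun _ _ => rfl), rfl⟩
  | asg z e => exact implements_asg E β z e
  | put a b => exact implements_put E β a b
  | ask a b c => exact implements_ask E β a b c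
  | lgOf z e => exact implements_lgOf E β z e
  | rnd z =>
    intro s x K hs hx hK
    refine ⟨{ x with
      time := x.time + 1
      reg := Function.update x.reg z.idx (s.tape 0)
      todo := K }, Reach.one le_rfl
        (by simp [dstep, dnext, MinCutOracle.draws, hK, HCom.comp, HCom.run]) le_rfl (by simp), ?_, rfl⟩
    have := hx.set z (s.tape 0) (y := { x with
      time := x.time + 1
      reg := Function.update x.reg z.idx (s.tape 0)
      todo := K }) rfl rfl (by simp) (fun r _ hr => by simp [hr])
    exact ⟨this.v, this.mem, this.ready⟩
  | prep =>
    intro s x K hs hx hK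
    exact ⟨{ x with
      time := x.time + 1 + E.prepTime
      ready := true
      todo := K }, Reach.one (by simp [HCom.cost])
        (by simp [dstep, dnext, MinCutOracle.draws, hK, HCom.comp, HCom.run])
        (by simp [HCom.cost]; omega) (by simp), ⟨hx.v, hx.mem, rfl⟩, rfl⟩
  | seq p q ihp ihq =>
    intro s x K hs hx hK
    obtain ⟨y, h1, h2, h3⟩ := ihp s { x with
      time := x.time + 1
      todo := p.comp :: q.comp :: K } _ hs.1 (hx.of_eq rfl rfl fun _ _ => rfl) rfl
    obtain ⟨y', h1', h2', h3'⟩ := ihq _ y _ hs.2 h2 h3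
    exact ⟨y', (((reach_seq hK).trans h1).trans h1').mono (by simp [HCom.cost]; omega)
      (by simp [HCom.queries]), h2', h3'⟩
  | ite e p q ihp ihq =>
    intro s x K hs hx hK
    obtain ⟨hs1, hs2⟩ := hs
    obtain ⟨y, h1, h2, h3, h4, h5⟩ := Sim.eval (E := E) (s := s)
      (x := { x with
        time := x.time + 1
        todo := e.comp 0 :: .ite 101 p.comp q.comp :: K })
      (hx.of_eq rfl rfl fun _ _ => rfl) s.tape hs1 0 rfl
    have h6 := ((reach_seq hK).trans h1).trans (reach_ite h2)
    by_cases he : e.val s ≠ 0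
    · rw [if_pos he] at hs2
      obtain ⟨y', h1', h2', h3'⟩ := ihp s { y with
        time := y.time + 1
        todo := (if y.reg 101 ≠ 0 then p.comp else q.comp) :: K } K hs2
        (h3.of_eq rfl rfl fun _ _ => rfl) (by
          have : y.reg 101 ≠ 0 := by rw [h4]; exact he
          simp [this])
      refine ⟨y', (?_ : Reach E _ _ _ _), ?_, h3'⟩
      · simp only [HCom.run, if_pos he]
        exact (h6.trans h1').mono (by simp only [HCom.cost]; omega) (by simp only [HCom.queries]; omega)
      · simpa only [HCom.run, if_pos he] using h2'
    · rw [if_neg he] at hs2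
      obtain ⟨y', h1', h2', h3'⟩ := ihq s { y with
        time := y.time + 1
        todo := (if y.reg 101 ≠ 0 then p.comp else q.comp) :: K } K hs2
        (h3.of_eq rfl rfl fun _ _ => rfl) (by
          have : y.reg 101 = 0 := by rw [h4]; simpa using he
          simp [this])
      refine ⟨y', (?_ : Reach E _ _ _ _), ?_, h3'⟩
      · simp only [HCom.run, if_neg he]
        exact (h6.trans h1').mono (by simp only [HCom.cost]; omega) (by simp only [HCom.queries]; omega)
      · simpa only [HCom.run, if_neg he] using h2'
  | loop u z p ih => exact implements_loop E β u z p ih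

end MinCutOracle

namespace MinCutOracle

open scoped Classical

/-! ### Averages over random tapes -/

/-- The tape with first word `r`, followed by the tape `ω`. -/
def tapeCons (r : ℕ) (ω : ℕ → ℕ) : ℕ → ℕ
  | 0 => r
  | i + 1 => ω i

/-- The first `a` words of `ω`, followed by `ω'`. -/
def tapeAppend (a : ℕ) (ω ω' : ℕ → ℕ) : ℕ → ℕ := fun i => if i < a then ω i else ω' (i - a)

/-- The average of `f` over all tapes of `m` words from `{0, …, W - 1}`. -/
noncomputable def avg (W : ℕ) : ℕ → ((ℕ → ℕ) → ℝ) → ℝ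
  | 0, f => f fun _ => 0
  | m + 1, f => (∑ r ∈ Finset.range W, avg W m fun ω => f (tapeCons r ω)) / W

theorem avg_mono {W m : ℕ} {f g : (ℕ → ℕ) → ℝ} (h : ∀ ω, f ω ≤ g ω) : avg W m f ≤ avg W m g := by
  induction m generalizing f g with
  | zero => exact h _
  | succ m ih =>
    simp only [avg]
    gcongr with r hr
    exact ih fun ω => h _

theorem avg_const {W : ℕ} (hW : 0 < W) (m : ℕ) (a : ℝ) : avg W m (fun _ => a) = a := by
  induction m with
  | zero => rfl
  | succ m ih =>
    have : (W : ℝ) ≠ 0 := by positivity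
    simp only [avg, ih, Finset.sum_const, Finset.card_range, nsmul_eq_mul]
    field_simp

theorem avg_add {W m : ℕ} (f g : (ℕ → ℕ) → ℝ) :
    avg W m (fun ω => f ω + g ω) = avg W m f + avg W m g := by
  induction m generalizing f g with
  | zero => rfl
  | succ m ih => simp only [avg, ih, Finset.sum_add_distrib, add_div]

theorem avg_mul {W m : ℕ} (a : ℝ) (f : (ℕ → ℕ) → ℝ) :
    avg W m (fun ω => a * f ω) = a * avg W m f := by
  induction m generalizing f with
  | zero => rfl
  | succ m ih => simp only [avg, ih, ← Finset.mul_sum, mul_div_assoc]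

theorem avg_sum {W m : ℕ} {ι : Type*} (s : Finset ι) (f : ι → (ℕ → ℕ) → ℝ) :
    avg W m (fun ω => ∑ i ∈ s, f i ω) = ∑ i ∈ s, avg W m (f i) := by
  induction m generalizing f with
  | zero => rfl
  | succ m ih =>
    simp only [avg, ih]
    rw [Finset.sum_comm, Finset.sum_div]

theorem avg_nonneg {W m : ℕ} {f : (ℕ → ℕ) → ℝ} (h : ∀ ω, 0 ≤ f ω) : 0 ≤ avg W m f := by
  induction m generalizing f with
  | zero => exact h _
  | succ m ih =>
    exact div_nonneg (Finset.sum_nonneg fun r _ => ih fun ω => h _) (by positivity)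

/-- This is Fubini's theorem for tapes. It separates independent stages: the blocks of the sketch
from each other, and the sketch from the rounds. -/
theorem avg_append {W : ℕ} (a b : ℕ) (f : (ℕ → ℕ) → ℝ) :
    avg W (a + b) f = avg W a fun ω => avg W b fun ω' => f (tapeAppend a ω ω') := by
  induction a generalizing f with
  | zero =>
    simp only [Nat.zero_add, avg]
    congr 1
  | succ a ih =>
    rw [show a + 1 + b = (a + b) + 1 by omega]
    simp only [avg, ih]
    congr 1
    refine Finset.sum_congr rfl fun r _ => ?_
    congr 1; funext ω; congr 1; funext ω'; congr 1
    funext i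
    cases i with
    | zero => simp [tapeCons, tapeAppend]
    | succ i => simp [tapeCons, tapeAppend]

/-- A tape of at least `N` words cannot run out in `N` steps. A drawing step splits off the first
word, which is the outer average; any other step leaves the tape unchanged. -/
theorem avg_le_runFor (E : Env) (S : Set Config) :
    ∀ (N m : ℕ) (x : Config), N ≤ m →
      ENNReal.ofReal (avg (2 ^ E.w) m fun ω => if ((dstep E)^[N] (x, ω)).1 ∈ S then 1 else 0) ≤
        (runFor E N x).toOuterMeasure S := by
  intro N
  induction N with
  | zero =>
    intro m x _
    simp only [runFor, PMF.toOuterMeasure_pure_apply]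
    have hc := avg_const (W := 2 ^ E.w) (by positivity) m (if x ∈ S then 1 else 0)
    refine (congrArg ENNReal.ofReal hc).le.trans ?_
    split_ifs <;> simp
  | succ N ih =>
    intro m x hm
    simp only [runFor, Function.iterate_succ_apply]
    by_cases hd : draws x = true
    · obtain ⟨m, rfl⟩ : ∃ m', m = m' + 1 := ⟨m - 1, by omega⟩
      rw [step_of_draws E x hd, PMF.bind_map, PMF.toOuterMeasure_bind_apply, tsum_fintype]
      simp only [avg, dstep, hd, if_true, tapeCons]
      have hpos : (0 : ℝ) < ((2 ^ E.w : ℕ) : ℝ) := by positivity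
      rw [ENNReal.ofReal_div_of_pos hpos, ENNReal.ofReal_sum_of_nonneg
        (fun r _ => avg_nonneg fun ω => by split_ifs <;> simp), ENNReal.div_eq_inv_mul,
        Finset.mul_sum, Finset.sum_range]
      refine Finset.sum_le_sum fun r _ => ?_
      rw [PMF.uniformOfFintype_apply, Fintype.card_fin]
      refine mul_le_mul' (by rw [ENNReal.ofReal_natCast]) ?_
      exact ih m _ (by omega)
    · have hd : draws x = false := by simpa using hd
      rw [step_of_not_draws E x hd 0, PMF.pure_bind]
      have : ∀ ω, dstep E (x, ω) = (dnext E x 0, ω) := fun ω => by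
        simp [dstep, hd, dnext_of_not_draws E x hd (ω 0) 0]
      simp only [this]
      exact ih m _ (by omega)

theorem iterate_dstep_of_todo_nil (E : Env) (p : Config × (ℕ → ℕ)) (h : p.1.todo = []) (m : ℕ) :
    (dstep E)^[m] p = p :=
  Function.iterate_fixed (dstep_of_todo_nil E p h) m

/-- A machine succeeds with probability at least `p` if it succeeds within `τ` steps on every tape
in a set of tapes of probability at least `p`. -/
theorem succeeds_of_avg {E : Env} {x : Config} {p : ℝ} {good : Config → Prop} (τ : ℕ)
    (A : (ℕ → ℕ) → Prop)
    (hA : ∀ ω, A ω → ∃ N ≤ τ, ((dstep E)^[N] (x, ω)).1.todo = [] ∧ good ((dstep E)^[N] (x, ω)).1)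
    (m : ℕ) (hm : τ ≤ m) (hp : p ≤ avg (2 ^ E.w) m fun ω => if A ω then 1 else 0) :
    Succeeds E x p good := by
  refine ⟨τ, le_trans (ENNReal.ofReal_le_ofReal ?_) (avg_le_runFor E _ τ m x hm)⟩
  refine hp.trans (avg_mono fun ω => ?_)
  by_cases h : A ω
  · obtain ⟨N, hN, h1, h2⟩ := hA ω h
    have : (dstep E)^[τ] (x, ω) = (dstep E)^[N] (x, ω) := by
      obtain ⟨d, rfl⟩ := Nat.exists_eq_add_of_le hN
      rw [Nat.add_comm, Function.iterate_add_apply, iterate_dstep_of_todo_nil E _ h1]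
    rw [if_pos h, this]
    simp [h1, h2]
  · rw [if_neg h]; split_ifs <;> simp

/-- A structured program that is safe and reaches a good state on sufficiently many tapes
succeeds. -/
theorem HCom.succeeds {E : Env} {β : Var → ℕ} {P : HCom} {reg mem : ℕ → ℕ} {p : ℝ}
    {good : Config → Prop} (A : (ℕ → ℕ) → Prop)
    (hA : ∀ ω, A ω → ∀ s : HState, s = ⟨fun v => reg v.idx, mem, false, ω⟩ →
      P.Safe E β s ∧ ∀ y : Config, y.time ≤ P.cost E β → y.queries ≤ P.queries β →
        Sim y (P.run E s) → good y)
    (hp : ∃ m₀, ∀ m ≥ m₀, p ≤ avg (2 ^ E.w) m fun ω => if A ω then 1 else 0) :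
    Succeeds E (Config.init reg mem P.comp) p good := by
  obtain ⟨m₀, hp⟩ := hp
  refine succeeds_of_avg (P.cost E β) A (fun ω hω => ?_) (max m₀ (P.cost E β)) (le_max_right _ _)
    (hp _ (le_max_left _ _))
  obtain ⟨hs, hg⟩ := hA ω hω _ rfl
  obtain ⟨y, ⟨N, hN, h1, h2, h3⟩, hsim, ht⟩ := P.implements E β _ (Config.init reg mem P.comp) []
    hs ⟨fun _ => rfl, rfl, rfl⟩ rfl
  refine ⟨N, hN, ?_, ?_⟩
  · rw [h1]; exact ht
  · rw [h1]
    exact hg y (by simpa [Config.init] using h2) (by simpa [Config.init] using h3) hsim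

end MinCutOracle

namespace MinCutOracle

/-! ### Sums of random signs -/

/-- The sign given by a random word. -/
def sgn (r : ℕ) : ℝ := if r % 2 = 1 then 1 else -1

/-- For an even number of words the lowest bit is unbiased. -/
theorem sum_sgn {W : ℕ} (hW : 0 < W) (h2 : 2 ∣ W) (f : ℝ → ℝ) :
    (∑ r ∈ Finset.range W, f (sgn r)) / W = (f 1 + f (-1)) / 2 := by
  obtain ⟨h, rfl⟩ := h2
  have hs : ∑ r ∈ Finset.range (2 * h), f (sgn r) = h * (f 1 + f (-1)) := by
    clear hW
    induction h with
    | zero => simp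
    | succ h ih =>
      rw [show 2 * (h + 1) = 2 * h + 1 + 1 by ring, Finset.sum_range_succ, Finset.sum_range_succ,
        ih]
      have e1 : sgn (2 * h) = -1 := by simp [sgn]
      have e2 : sgn (2 * h + 1) = 1 := by simp [sgn, Nat.add_mod]
      rw [e1, e2]; push_cast; ring
  have : (h : ℝ) ≠ 0 := by
    have : h ≠ 0 := by omega
    exact_mod_cast this
  rw [hs]; push_cast; field_simp

/-- A linear form in the signs of the first `m` words of the tape. -/
def signSum (m : ℕ) (a : ℕ → ℝ) (ω : ℕ → ℕ) : ℝ := ∑ i ∈ Finset.range m, a i * sgn (ω i)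

theorem signSum_cons (m : ℕ) (a : ℕ → ℝ) (r : ℕ) (ω : ℕ → ℕ) :
    signSum (m + 1) a (tapeCons r ω) = a 0 * sgn r + signSum m (fun i => a (i + 1)) ω := by
  simp only [signSum, Finset.sum_range_succ', tapeCons]
  ring

/-- Averaging over the first sign alone is the induction step for the moments below. -/
theorem avg_succ_signSum {W : ℕ} (hW : 0 < W) (h2 : 2 ∣ W) (m : ℕ) (a : ℕ → ℝ) (g : ℝ → ℝ) :
    avg W (m + 1) (fun ω => g (signSum (m + 1) a ω)) = avg W m fun ω =>
      (g (a 0 + signSum m (fun i => a (i + 1)) ω) +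
        g (-a 0 + signSum m (fun i => a (i + 1)) ω)) / 2 := by
  simp only [avg, signSum_cons]
  rw [← avg_sum, div_eq_inv_mul, ← avg_mul]
  congr 1; funext ω
  rw [← div_eq_inv_mul,
    sum_sgn hW h2 (fun e => g (a 0 * e + signSum m (fun i => a (i + 1)) ω))]
  simp

theorem avg_signSum_sq {W : ℕ} (hW : 0 < W) (h2 : 2 ∣ W) (m : ℕ) (a : ℕ → ℝ) :
    avg W m (fun ω => signSum m a ω ^ 2) = ∑ i ∈ Finset.range m, a i ^ 2 := by
  induction m generalizing a with
  | zero => simp [avg, signSum]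
  | succ m ih =>
    rw [avg_succ_signSum hW h2 m a (fun z => z ^ 2), Finset.sum_range_succ', ← ih]
    have : ∀ ω, ((a 0 + signSum m (fun i => a (i + 1)) ω) ^ 2 +
        (-a 0 + signSum m (fun i => a (i + 1)) ω) ^ 2) / 2 =
        signSum m (fun i => a (i + 1)) ω ^ 2 + a 0 ^ 2 := fun ω => by ring
    simp only [this, avg_add, avg_const hW]

/-- Averaging over one sign with coefficient b turns exp(t(b+z)²) into exp(tb²+tz²)·cosh(2tbz). The
bound cosh x ≤ exp(x²/2) makes this again the exponential of a multiple of z², with t raised to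
t+2t²b². The condition on t survives because b² leaves the sum of squares at the same time. -/
theorem avg_exp_signSum_sq {W : ℕ} (hW : 0 < W) (h2 : 2 ∣ W) (m : ℕ) :
    ∀ (a : ℕ → ℝ) (t : ℝ), 0 ≤ t → 4 * t * ∑ i ∈ Finset.range m, a i ^ 2 ≤ 1 →
      avg W m (fun ω => Real.exp (t * signSum m a ω ^ 2)) ≤
        Real.exp (2 * t * ∑ i ∈ Finset.range m, a i ^ 2) := by
  induction m with
  | zero => intro a t _ _; simp [avg, signSum]
  | succ m ih =>
    intro a t ht h
    rw [Finset.sum_range_succ'] at h ⊢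
    set A := ∑ i ∈ Finset.range m, a (i + 1) ^ 2 with hA
    set b := a 0 with hb
    have hA0 : 0 ≤ A := Finset.sum_nonneg fun i _ => sq_nonneg _
    have hb2 : 0 ≤ b ^ 2 := sq_nonneg b
    have htA : 4 * t * A ≤ 1 := by nlinarith [mul_nonneg ht hb2]
    -- The increase 2t²b² of t is paid for by the square b² that is removed from the sum.
    have key : 8 * t ^ 2 * b ^ 2 * A ≤ 2 * t * b ^ 2 := by
      have := mul_le_mul_of_nonneg_left htA (mul_nonneg (mul_nonneg two_pos.le ht) hb2)
      nlinarith
    rw [avg_succ_signSum hW h2 m a (fun z => Real.exp (t * z ^ 2))]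
    have h1 : ∀ ω, (Real.exp (t * (b + signSum m (fun i => a (i + 1)) ω) ^ 2) +
        Real.exp (t * (-b + signSum m (fun i => a (i + 1)) ω) ^ 2)) / 2 ≤
        Real.exp (t * b ^ 2) *
          Real.exp ((t + 2 * t ^ 2 * b ^ 2) * signSum m (fun i => a (i + 1)) ω ^ 2) := by
      intro ω
      set z := signSum m (fun i => a (i + 1)) ω
      have hc := Real.cosh_le_exp_half_sq (2 * t * b * z)
      rw [Real.cosh_eq] at hc
      have e1 : Real.exp (t * (b + z) ^ 2) =
          Real.exp (t * b ^ 2 + t * z ^ 2) * Real.exp (2 * t * b * z) := by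
        rw [← Real.exp_add]; congr 1; ring
      have e2 : Real.exp (t * (-b + z) ^ 2) =
          Real.exp (t * b ^ 2 + t * z ^ 2) * Real.exp (-(2 * t * b * z)) := by
        rw [← Real.exp_add]; congr 1; ring
      have e3 : Real.exp (t * b ^ 2) * Real.exp ((t + 2 * t ^ 2 * b ^ 2) * z ^ 2) =
          Real.exp (t * b ^ 2 + t * z ^ 2) * Real.exp ((2 * t * b * z) ^ 2 / 2) := by
        rw [← Real.exp_add, ← Real.exp_add]; congr 1; ring
      rw [e1, e2, e3, ← mul_add, mul_div_assoc]
      exact mul_le_mul_of_nonneg_left hc (Real.exp_pos _).le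
    refine (avg_mono h1).trans ?_
    rw [avg_mul]
    refine (mul_le_mul_of_nonneg_left (ih (fun i => a (i + 1)) (t + 2 * t ^ 2 * b ^ 2)
      (by positivity) ?_) (Real.exp_pos _).le).trans ?_
    · rw [← hA]; nlinarith
    · rw [← Real.exp_add, ← hA]
      refine Real.exp_le_exp.2 ?_
      nlinarith

/-- Both signs of u are needed: positive ones for the upper tail of the sketch, negative ones for
the lower tail. -/
theorem exp_le_quadratic (u : ℝ) : Real.exp u ≤ 1 + u + u ^ 2 * Real.exp |u| := by
  have h := Complex.norm_exp_sub_sum_le_norm_mul_exp (u : ℂ) 2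
  simp only [Finset.sum_range_succ, Finset.sum_range_zero] at h
  have e : Complex.exp u - (0 + (u : ℂ) ^ 0 / (Nat.factorial 0 : ℕ) +
      (u : ℂ) ^ 1 / (Nat.factorial 1 : ℕ)) = ((Real.exp u - (1 + u) : ℝ) : ℂ) := by
    push_cast; simp
  rw [e, Complex.norm_real, Complex.norm_real, Real.norm_eq_abs, Real.norm_eq_abs, sq_abs] at h
  linarith [le_abs_self (Real.exp u - (1 + u))]

/-- A two-sided moment bound with the exact first-order term sA, since the mean of the square is A.
The second-order remainder is absorbed by the cruder bound `avg_exp_signSum_sq`. -/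
theorem avg_exp_signSum_sq_le {W : ℕ} (hW : 0 < W) (h2 : 2 ∣ W) (m : ℕ) (a : ℕ → ℝ) (A s : ℝ)
    (hA : A = ∑ i ∈ Finset.range m, a i ^ 2) (hs : |s| * A ≤ 1 / 8) :
    avg W m (fun ω => Real.exp (s * signSum m a ω ^ 2)) ≤
      Real.exp (s * A + 256 * (s * A) ^ 2) := by
  have hA0 : 0 ≤ A := hA ▸ Finset.sum_nonneg fun i _ => sq_nonneg _
  rcases hA0.eq_or_lt with h0 | hpos
  · have hz : ∀ ω, signSum m a ω = 0 := by
      intro ω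
      refine Finset.sum_eq_zero fun i hi => ?_
      have := (Finset.sum_eq_zero_iff_of_nonneg (fun i _ => sq_nonneg (a i))).1
        (hA.symm.trans h0.symm) i hi
      rw [pow_eq_zero_iff (by norm_num)] at this
      simp [this]
    simp only [hz, ← h0]
    simp [avg_const hW]
  · have hpt : ∀ ω, Real.exp (s * signSum m a ω ^ 2) ≤ (1 + s * signSum m a ω ^ 2) +
        128 * (s * A) ^ 2 * Real.exp (1 / (4 * A) * signSum m a ω ^ 2) := by
      intro ω
      set z := signSum m a ω
      have hz : 0 ≤ z ^ 2 := sq_nonneg z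
      refine (exp_le_quadratic _).trans ?_
      have h1 : |s * z ^ 2| ≤ z ^ 2 / (8 * A) := by
        rw [abs_mul, abs_of_nonneg hz, le_div_iff₀ (by positivity)]
        nlinarith
      -- With this scale |sz²| ≤ y and z² = 8Ay, so the remainder is at most 64(sA)²·y²·exp(y).
      -- Bounding y² by 2·exp(y) leaves exp(2y) = exp(z²/(4A)).
      set y := z ^ 2 / (8 * A) with hy
      have hy0 : 0 ≤ y := by positivity
      have hyz : z ^ 2 = 8 * A * y := by rw [hy]; field_simp
      have h3 : y ^ 2 ≤ 2 * Real.exp y := by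
        have := Real.quadratic_le_exp_of_nonneg hy0
        nlinarith
      have h4 : (s * z ^ 2) ^ 2 * Real.exp |s * z ^ 2| ≤ (s * z ^ 2) ^ 2 * Real.exp y :=
        mul_le_mul_of_nonneg_left (Real.exp_le_exp.2 h1) (sq_nonneg _)
      have h5 : 1 / (4 * A) * z ^ 2 = y + y := by rw [hyz]; field_simp; ring
      rw [h5, Real.exp_add]
      have h6 : (s * z ^ 2) ^ 2 * Real.exp y = 64 * (s * A) ^ 2 * (y ^ 2 * Real.exp y) := by
        rw [hyz]; ring
      have h7 : y ^ 2 * Real.exp y ≤ 2 * Real.exp y * Real.exp y :=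
        mul_le_mul_of_nonneg_right h3 (Real.exp_pos _).le
      have h8 : 0 ≤ 64 * (s * A) ^ 2 := by positivity
      nlinarith [mul_le_mul_of_nonneg_left h7 h8]
    refine (avg_mono hpt).trans ?_
    rw [avg_add, avg_add, avg_const hW, avg_mul, avg_mul, avg_signSum_sq hW h2, ← hA]
    -- 1/(4A) is the largest parameter that the moment bound allows. It yields exp(1/2) ≤ 2 and
    -- thereby the constant 256.
    have hb := avg_exp_signSum_sq hW h2 m a (1 / (4 * A)) (by positivity)
      (by rw [← hA]; field_simp; exact le_rfl)
    rw [← hA, show 2 * (1 / (4 * A)) * A = 1 / 2 by field_simp; norm_num] at hb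
    have hhalf : Real.exp (1 / 2) ≤ 2 := by
      have h1 : Real.exp (1 / 2) * Real.exp (1 / 2) = Real.exp 1 := by
        rw [← Real.exp_add]; norm_num
      have h2 := Real.exp_one_lt_d9
      nlinarith [Real.exp_pos (1 / 2)]
    have h9 := mul_le_mul_of_nonneg_left (hb.trans hhalf) (by positivity : 0 ≤ 128 * (s * A) ^ 2)
    have h10 := Real.add_one_le_exp (s * A + 256 * (s * A) ^ 2)
    linarith

/-- The value of the sketch: a weighted sum of squares of linear forms in disjoint blocks of
signs. -/
def blockSum (Q m : ℕ) (c : ℕ → ℝ) (a : ℕ → ℕ → ℝ) (ω : ℕ → ℕ) : ℝ :=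
  ∑ q ∈ Finset.range Q, c q * signSum m (a q) (fun i => ω (q * m + i)) ^ 2

/-- The blocks read disjoint pieces of the tape, so the exponential moments multiply. -/
theorem avg_exp_blockSum {W : ℕ} (hW : 0 < W) (h2 : 2 ∣ W) (Q m : ℕ) (c : ℕ → ℝ)
    (a : ℕ → ℕ → ℝ) (h : ∀ q < Q, |c q| * ∑ i ∈ Finset.range m, a q i ^ 2 ≤ 1 / 8) :
    avg W (Q * m) (fun ω => Real.exp (blockSum Q m c a ω)) ≤
      Real.exp (∑ q ∈ Finset.range Q, (c q * ∑ i ∈ Finset.range m, a q i ^ 2 +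
        256 * (c q * ∑ i ∈ Finset.range m, a q i ^ 2) ^ 2)) := by
  induction Q with
  | zero => simp [avg, blockSum]
  | succ Q ih =>
    rw [Nat.succ_mul, avg_append, Finset.sum_range_succ, Real.exp_add]
    have h1 : ∀ ω ω', blockSum (Q + 1) m c a (tapeAppend (Q * m) ω ω') =
        blockSum Q m c a ω + c Q * signSum m (a Q) ω' ^ 2 := by
      intro ω ω'
      simp only [blockSum, Finset.sum_range_succ]
      congr 1
      · refine Finset.sum_congr rfl fun q hq => ?_
        congr 2
        refine Finset.sum_congr rfl fun i hi => ?_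
        have : q * m + i < Q * m := by
          have h1 : (q + 1) * m ≤ Q * m := Nat.mul_le_mul_right m (Finset.mem_range.1 hq)
          have h2 := Finset.mem_range.1 hi
          rw [Nat.succ_mul] at h1; omega
        simp [tapeAppend, this]
      · congr 2
        refine Finset.sum_congr rfl fun i _ => ?_
        simp [tapeAppend]
    simp only [h1, Real.exp_add, avg_mul]
    have h3 := avg_exp_signSum_sq_le hW h2 m (a Q) _ (c Q) rfl (h Q (by omega))
    set b := avg W m fun ω' => Real.exp (c Q * signSum m (a Q) ω' ^ 2)
    have hb : 0 ≤ b := avg_nonneg fun ω => (Real.exp_pos _).le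
    have : avg W (Q * m) (fun ω => Real.exp (blockSum Q m c a ω) * b) =
        avg W (Q * m) (fun ω => Real.exp (blockSum Q m c a ω)) * b := by
      rw [mul_comm (avg W (Q * m) _), ← avg_mul]
      exact congrArg _ (funext fun ω => mul_comm _ _)
    rw [this, ← Real.exp_add (c Q * _)]
    exact mul_le_mul (ih fun q hq => h q (by omega)) h3 hb (Real.exp_pos _).le

open scoped Classical in
/-- Concentration of the sketch. -/
theorem avg_blockSum_tail {W : ℕ} (hW : 0 < W) (h2 : 2 ∣ W) (Q m : ℕ) (c : ℕ → ℝ)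
    (a : ℕ → ℕ → ℝ) (B D δ : ℝ) (hD : 0 < D) (hδ0 : 0 < δ) (hδ1 : δ ≤ 1)
    (hc : ∀ q, 0 ≤ c q)
    (hq : ∀ q < Q, c q * ∑ i ∈ Finset.range m, a q i ^ 2 ≤ D)
    (hB : ∑ q ∈ Finset.range Q, c q * ∑ i ∈ Finset.range m, a q i ^ 2 = B * D) :
    avg W (Q * m) (fun ω => if (1 - δ) * (B * D) ≤ blockSum Q m c a ω ∧
      blockSum Q m c a ω ≤ (1 + δ) * (B * D) then 0 else 1) ≤
        2 * Real.exp (-(B * δ ^ 2 / 1024)) := by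
  set S : ℕ → ℝ := fun q => ∑ i ∈ Finset.range m, a q i ^ 2 with hS
  have hS0 : ∀ q, 0 ≤ S q := fun q => Finset.sum_nonneg fun i _ => sq_nonneg _
  -- After division by `D` every block has mean at most 1, and the means add up to `B`; `D` sets the
  -- scale of the moment parameter.
  have main : ∀ θ : ℝ, |θ| ≤ 1 / 8 →
      avg W (Q * m) (fun ω => Real.exp (θ / D * blockSum Q m c a ω)) ≤
        Real.exp (θ * B + 256 * θ ^ 2 * B) := by
    intro θ hθ
    have h1 := avg_exp_blockSum hW h2 Q m (fun q => θ / D * c q) a (by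
      intro q hq'
      have := hq q hq'
      rw [abs_mul, abs_div, abs_of_pos hD, abs_of_nonneg (hc q), mul_assoc]
      calc |θ| / D * (c q * ∑ i ∈ Finset.range m, a q i ^ 2) ≤ |θ| / D * D :=
            mul_le_mul_of_nonneg_left this (by positivity)
        _ = |θ| := by field_simp
        _ ≤ 1 / 8 := hθ)
    have e1 : ∀ ω, blockSum Q m (fun q => θ / D * c q) a ω = θ / D * blockSum Q m c a ω := by
      intro ω; simp only [blockSum, Finset.mul_sum, mul_assoc]
    simp only [e1] at h1
    refine h1.trans (Real.exp_le_exp.2 ?_)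
    have e2 : B = ∑ q ∈ Finset.range Q, c q * S q / D := by
      rw [← Finset.sum_div, hB]; field_simp
    rw [e2, Finset.mul_sum, Finset.mul_sum, ← Finset.sum_add_distrib]
    refine Finset.sum_le_sum fun q hq' => ?_
    have h3 := hq q (Finset.mem_range.1 hq')
    set y := c q * S q / D with hy
    have hy0 : 0 ≤ y := div_nonneg (mul_nonneg (hc q) (hS0 q)) hD.le
    have hy1 : y ≤ 1 := by rw [hy, div_le_one hD]; exact h3
    have e3 : θ / D * c q * ∑ i ∈ Finset.range m, a q i ^ 2 = θ * y := by
      rw [hy]; simp only [hS]; field_simp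
    rw [e3]
    -- Since 0 ≤ y ≤ 1, the squared means add up to at most `B` as well.
    have : (θ * y) ^ 2 ≤ θ ^ 2 * y := by
      have : y ^ 2 ≤ y := by nlinarith
      rw [mul_pow]; exact mul_le_mul_of_nonneg_left this (sq_nonneg _)
    linarith
  -- θ = ±δ/512 minimizes -θδ + 256θ² up to sign, with value -δ²/1024.
  have hup := main (δ / 512) (by rw [abs_of_pos (by positivity)]; linarith)
  have hlo := main (-(δ / 512)) (by rw [abs_neg, abs_of_pos (by positivity)]; linarith)
  have hpt : ∀ ω, (if (1 - δ) * (B * D) ≤ blockSum Q m c a ω ∧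
      blockSum Q m c a ω ≤ (1 + δ) * (B * D) then (0 : ℝ) else 1) ≤
      Real.exp (-(δ / 512 * (1 + δ) * B)) * Real.exp (δ / 512 / D * blockSum Q m c a ω) +
      Real.exp (δ / 512 * (1 - δ) * B) * Real.exp (-(δ / 512) / D * blockSum Q m c a ω) := by
    intro ω
    set X := blockSum Q m c a ω
    rw [← Real.exp_add, ← Real.exp_add]
    split_ifs with hX
    · positivity
    · have hX' : X < (1 - δ) * (B * D) ∨ (1 + δ) * (B * D) < X := by
        by_contra hcon
        exact hX ⟨not_lt.1 fun h => hcon (Or.inl h), not_lt.1 fun h => hcon (Or.inr h)⟩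
      rcases hX' with hX' | hX'
      · have : 0 ≤ δ / 512 * (1 - δ) * B + -(δ / 512) / D * X := by
          have e : δ / 512 * (1 - δ) * B + -(δ / 512) / D * X =
              δ / 512 / D * ((1 - δ) * (B * D) - X) := by field_simp; ring
          rw [e]; exact mul_nonneg (by positivity) (by linarith)
        have h3 := Real.one_le_exp this
        have h4 := Real.exp_pos (-(δ / 512 * (1 + δ) * B) + δ / 512 / D * X)
        linarith
      · have : 0 ≤ -(δ / 512 * (1 + δ) * B) + δ / 512 / D * X := by
          have e : -(δ / 512 * (1 + δ) * B) + δ / 512 / D * X =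
              δ / 512 / D * (X - (1 + δ) * (B * D)) := by field_simp; ring
          rw [e]; exact mul_nonneg (by positivity) (by linarith)
        have h3 := Real.one_le_exp this
        have h4 := Real.exp_pos (δ / 512 * (1 - δ) * B + -(δ / 512) / D * X)
        linarith
  refine (avg_mono hpt).trans ?_
  rw [avg_add, avg_mul, avg_mul]
  have h5 := mul_le_mul_of_nonneg_left hup (Real.exp_pos (-(δ / 512 * (1 + δ) * B))).le
  have h6 := mul_le_mul_of_nonneg_left hlo (Real.exp_pos (δ / 512 * (1 - δ) * B)).le
  rw [← Real.exp_add] at h5 h6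
  have e5 : -(δ / 512 * (1 + δ) * B) + (δ / 512 * B + 256 * (δ / 512) ^ 2 * B) =
    -(B * δ ^ 2 / 1024) := by ring
  have e6 : δ / 512 * (1 - δ) * B + (-(δ / 512) * B + 256 * (-(δ / 512)) ^ 2 * B) =
    -(B * δ ^ 2 / 1024) := by ring
  rw [e5] at h5
  rw [e6] at h6
  linarith

end MinCutOracle

namespace MinCutOracle

/-! ### One round of refinement -/

/-- The value of `f` at the last `x < m` that satisfies `p`, and `0` if there is none. -/
def lastOr (f : ℕ → ℕ) (p : ℕ → Prop) [DecidablePred p] : ℕ → ℕ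
  | 0 => 0
  | m + 1 => if p m then f m else lastOr f p m

theorem lastOr_spec (f : ℕ → ℕ) (p : ℕ → Prop) [DecidablePred p] (m : ℕ) :
    (∃ x < m, p x ∧ lastOr f p m = f x ∧ ∀ y < m, p y → y ≤ x) ∨
      ((∀ x < m, ¬ p x) ∧ lastOr f p m = 0) := by
  induction m with
  | zero => right; simp [lastOr]
  | succ m ih =>
    by_cases h : p m
    · left; exact ⟨m, by omega, h, by simp [lastOr, h], fun y hy _ => by omega⟩
    · rcases ih with ⟨x, hx, h1, h2, h3⟩ | ⟨h1, h2⟩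
      · left
        refine ⟨x, by omega, h1, by simp [lastOr, h, h2], fun y hy hp => ?_⟩
        refine h3 y ?_ hp
        rcases Nat.lt_succ_iff_lt_or_eq.1 hy with h4 | h4
        · exact h4
        · subst h4; exact absurd hp h
      · right
        refine ⟨fun x hx hp => ?_, by simp [lastOr, h, h2]⟩
        rcases Nat.lt_succ_iff_lt_or_eq.1 hx with h4 | h4
        · exact h1 x h4 hp
        · subst h4; exact h hp

theorem exists_count_eq (p : ℕ → Prop) [DecidablePred p] {m i : ℕ} (h : i < Nat.count p m) :
    ∃ x < m, p x ∧ Nat.count p x = i := by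
  induction m with
  | zero => simp at h
  | succ m ih =>
    rw [Nat.count_succ] at h
    by_cases h' : i < Nat.count p m
    · obtain ⟨x, hx, h1⟩ := ih h'
      exact ⟨x, by omega, h1⟩
    · by_cases hp : p m
      · rw [if_pos hp] at h
        exact ⟨m, by omega, hp, by omega⟩
      · rw [if_neg hp] at h; omega

/-- The data of one round: the number of nodes, the answers of the Min-Cut data structure, the
estimates of their capacities, a value larger than all estimates, a matrix whose zeros are the
pairs of nodes that are not yet separated, and a random word. -/
structure Round where
  n : ℕ
  ans : ℕ → ℕ → ℕ → Bool
  est : ℕ → ℕ → ℕ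
  inf : ℕ
  tb : ℕ → ℕ → ℕ
  r : ℕ

namespace Round

variable (P : Round)

/-- The size of the class of `v`. -/
def size (v : ℕ) : ℕ := Nat.count (fun x => P.tb v x = 0) P.n

/-- The number of members of the class of `v` below `x`. -/
def rank (v x : ℕ) : ℕ := Nat.count (fun y => P.tb v y = 0) x

/-- The pivot of the class of `v`. -/
def piv (v : ℕ) : ℕ := lastOr id (fun x => P.tb v x = 0 ∧ P.rank v x = P.r % P.size v) P.n

/-- The answer for the pair of `v` and its pivot. -/
def bit (v x : ℕ) : Bool :=
  if P.piv v = v then false else P.ans (min (P.piv v) v) (max (P.piv v) v) x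

/-- The side of the cut between `v` and its pivot that does not contain the pivot. -/
def side (v x : ℕ) : Prop := P.bit v x ≠ P.bit v (P.piv v)

instance (v x : ℕ) : Decidable (P.side v x) := inferInstanceAs (Decidable (_ ≠ _))

/-- The estimated capacity of the cut between `v` and its pivot. -/
def e (v : ℕ) : ℕ := if P.piv v = v then P.inf else P.est (min (P.piv v) v) (max (P.piv v) v)

/-- The number of nodes of the class that are on the side of `v`. -/
def sideSize (v : ℕ) : ℕ := Nat.count (fun x => P.tb v x = 0 ∧ P.side v x) P.n

/-- The cheapest cut, among those of the nodes below the last argument, that separates `x` from the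
pivot. -/
def argAux (x : ℕ) : ℕ → ℕ
  | 0 => x
  | v + 1 => if P.tb v x = 0 ∧ P.side v x ∧ P.e v < P.e (argAux x v) then v else argAux x v

/-- The cheapest cut that separates `x` from the pivot. -/
def arg (x : ℕ) : ℕ := P.argAux x P.n

/-- The estimated capacity of the cheapest cut that separates `x` from the pivot. -/
def best (x : ℕ) : ℕ := P.e (P.arg x)

/-- The successor of the last node `z` whose cut separates `x` from the pivot, is balanced, and
is on the same level as `x`. -/
def sub (x : ℕ) : ℕ :=
  lastOr Nat.succ (fun z => P.tb z x = 0 ∧ P.side z x ∧ 2 * P.sideSize z ≤ P.size z ∧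
    P.best z = P.best x) P.n

/-- The matrix after the round; the entry for a pair that is separated now is the successor of
the number of the separating cut. -/
def next (kn s t : ℕ) : ℕ :=
  if P.tb s t ≠ 0 then P.tb s t
  else if P.best s < P.best t then kn + P.arg s + 1
  else if P.best t < P.best s then kn + P.arg t + 1
  else if P.sub s < P.sub t then kn + P.sub t
  else if P.sub t < P.sub s then kn + P.sub s
  else 0

/-- Every new entry is positive: the first two cases add one, and in the last two the chosen `sub`
value is the larger one, hence nonzero. Thus a zero can serve as the mark of an unseparated pair. -/
theorem next_eq_zero {kn s t : ℕ} :
    P.next kn s t = 0 ↔ P.tb s t = 0 ∧ P.best s = P.best t ∧ P.sub s = P.sub t := by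
  unfold next
  split_ifs <;> grind

end Round

/-- The zeros of the matrix form an equivalence relation on the nodes. -/
structure IsClassMatrix (n : ℕ) (tb : ℕ → ℕ → ℕ) : Prop where
  refl : ∀ s < n, tb s s = 0
  symm : ∀ s < n, ∀ t < n, tb s t = tb t s
  trans : ∀ s < n, ∀ t < n, ∀ u < n, tb s t = 0 → tb t u = 0 → tb s u = 0

namespace Round

variable {P : Round}

/-- The new relation refines the old one by equality of two functions of a node, `best` and `sub`.
-/
theorem isClassMatrix_next (h : IsClassMatrix P.n P.tb) (kn : ℕ) :
    IsClassMatrix P.n (P.next kn) := by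
  refine ⟨fun s hs => (P.next_eq_zero).2 ⟨h.refl s hs, rfl, rfl⟩, fun s hs t ht => ?_,
    fun s hs t ht u hu h1 h2 => ?_⟩
  · have := h.symm s hs t ht
    unfold next
    split_ifs <;> omega
  · rw [next_eq_zero] at *
    exact ⟨h.trans s hs t ht u hu h1.1 h2.1, h1.2.1.trans h2.2.1, h1.2.2.trans h2.2.2⟩

theorem tb_iff (h : IsClassMatrix P.n P.tb) {v x y : ℕ} (hv : v < P.n) (hx : x < P.n)
    (hy : y < P.n) (hvx : P.tb v x = 0) : P.tb v y = 0 ↔ P.tb x y = 0 := by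
  have hxv : P.tb x v = 0 := by rw [h.symm x hx v hv]; exact hvx
  exact ⟨fun h1 => h.trans x hx v hv y hy hxv h1, fun h1 => h.trans v hv x hx y hy hvx h1⟩

theorem count_congr_of_lt {p q : ℕ → Prop} [DecidablePred p] [DecidablePred q] {m : ℕ}
    (h : ∀ x < m, p x ↔ q x) : Nat.count p m = Nat.count q m := by
  rw [Nat.count_eq_card_filter_range, Nat.count_eq_card_filter_range]
  congr 1
  exact Finset.filter_congr fun x hx => h x (Finset.mem_range.1 hx)

theorem size_congr (h : IsClassMatrix P.n P.tb) {v x : ℕ} (hv : v < P.n) (hx : x < P.n)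
    (hvx : P.tb v x = 0) : P.size v = P.size x :=
  count_congr_of_lt fun _ hy => tb_iff h hv hx hy hvx

theorem size_pos (h : IsClassMatrix P.n P.tb) {v : ℕ} (hv : v < P.n) : 0 < P.size v := by
  unfold size
  rw [Nat.count_eq_card_filter_range, Finset.card_pos]
  exact ⟨v, by simp [hv, h.refl v hv]⟩

theorem piv_spec (h : IsClassMatrix P.n P.tb) {v : ℕ} (hv : v < P.n) :
    P.piv v < P.n ∧ P.tb v (P.piv v) = 0 ∧ P.rank v (P.piv v) = P.r % P.size v := by
  rcases lastOr_spec id (fun x => P.tb v x = 0 ∧ P.rank v x = P.r % P.size v) P.n with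
    ⟨x, hx, h1, h2, _⟩ | ⟨h1, _⟩
  · have : P.piv v = x := h2
    rw [this]; exact ⟨hx, h1⟩
  · obtain ⟨x, hx, h3, h4⟩ := exists_count_eq (fun x => P.tb v x = 0)
      (Nat.mod_lt P.r (size_pos h hv))
    exact absurd ⟨h3, h4⟩ (h1 x hx)

theorem piv_eq_iff (h : IsClassMatrix P.n P.tb) {v x : ℕ} (hv : v < P.n)
    (hvx : P.tb v x = 0) : P.piv v = x ↔ P.rank v x = P.r % P.size v := by
  obtain ⟨h1, h2, h3⟩ := piv_spec h hv
  refine ⟨fun he => he ▸ h3, fun he => ?_⟩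
  exact Nat.count_injective (p := fun y => P.tb v y = 0) h2 hvx (h3.trans he.symm)

/-- Each node computes its pivot on its own from one common random word. Ranks and sizes depend only
on the class, so all members find the same pivot. -/
theorem piv_congr (h : IsClassMatrix P.n P.tb) {v x : ℕ} (hv : v < P.n) (hx : x < P.n)
    (hvx : P.tb v x = 0) : P.piv v = P.piv x := by
  obtain ⟨h1, h2, h3⟩ := piv_spec h hx
  have h4 := (tb_iff h hv hx h1 hvx).2 h2
  rw [piv_eq_iff h hv h4, size_congr h hv hx hvx, ← h3]
  exact count_congr_of_lt fun y hy => tb_iff h hv hx (hy.trans h1) hvx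

theorem bit_of_eq {v x : ℕ} (hv : P.piv v = v) : P.bit v x = false := by simp [bit, hv]

theorem ne_of_side {v x : ℕ} (h : P.side v x) : P.piv v ≠ v := fun hv =>
  h (by rw [bit_of_eq hv, bit_of_eq hv])

theorem not_side_piv (h : IsClassMatrix P.n P.tb) {v x : ℕ} (hv : v < P.n) (hx : x < P.n)
    (hvx : P.tb v x = 0) (hp : P.piv x = x) : ¬ P.side v x := by
  have : P.piv v = x := (piv_congr h hv hx hvx).trans hp
  simp [side, this]

/-- The answers separate the nodes of the query. -/
def Sep (P : Round) : Prop :=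
  ∀ s t, s < t → t < P.n → P.ans s t s ≠ P.ans s t t

theorem ans_minmax (hs : P.Sep) {s t : ℕ} (h1 : s < P.n) (h2 : t < P.n) (hst : s ≠ t) :
    P.ans (min s t) (max s t) s ≠ P.ans (min s t) (max s t) t := by
  rcases lt_or_gt_of_ne hst with h | h
  · rw [min_eq_left h.le, max_eq_right h.le]; exact hs s t h h2
  · rw [min_eq_right h.le, max_eq_left h.le]; exact (hs t s h h1).symm

theorem side_self (h : IsClassMatrix P.n P.tb) (hs : P.Sep) {v : ℕ} (hv : v < P.n)
    (hp : P.piv v ≠ v) : P.side v v := by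
  have := ans_minmax hs (piv_spec h hv).1 hv hp
  simp only [side, bit, if_neg hp]
  exact this.symm

/-- The search starts with the cut of `x` itself, which separates `x` from the pivot unless `x` is
the pivot; hence the disjunction. -/
theorem argAux_spec (h : IsClassMatrix P.n P.tb) {x : ℕ} (hx : x < P.n) (m : ℕ) (hm : m ≤ P.n) :
    (P.argAux x m < P.n ∧ P.tb (P.argAux x m) x = 0 ∧
      (P.side (P.argAux x m) x ∨ P.argAux x m = x)) ∧ P.e (P.argAux x m) ≤ P.e x ∧
      ∀ v < m, P.tb v x = 0 → P.side v x → P.e (P.argAux x m) ≤ P.e v := by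
  induction m with
  | zero => simp [argAux, hx, h.refl]
  | succ m ih =>
    obtain ⟨⟨h1, h2, h3⟩, h4, h5⟩ := ih (by omega)
    simp only [argAux]
    split_ifs with hc
    · refine ⟨⟨by omega, hc.1, Or.inl hc.2.1⟩, by omega, fun v hv hv1 hv2 => ?_⟩
      rcases Nat.lt_succ_iff_lt_or_eq.1 hv with h6 | h6
      · have := h5 v h6 hv1 hv2; omega
      · rw [h6]
    · refine ⟨⟨h1, h2, h3⟩, h4, fun v hv hv1 hv2 => ?_⟩
      rcases Nat.lt_succ_iff_lt_or_eq.1 hv with h6 | h6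
      · exact h5 v h6 hv1 hv2
      · subst h6
        by_contra hcon
        exact hc ⟨hv1, hv2, by omega⟩

/-- What is known about the estimates: they are bounded by multiples of the connectivities `lam`,
and every cut has at least the capacity of a minimum cut. -/
structure Accurate (P : Round) (lam : ℕ → ℕ → ℝ) (α : ℝ) : Prop where
  one_le : 1 ≤ α
  sep : P.Sep
  nonneg : ∀ s t, 0 ≤ lam s t
  symm : ∀ s t, lam s t = lam t s
  ultra : ∀ s < P.n, ∀ t < P.n, ∀ u < P.n, s ≠ t → min (lam u s) (lam u t) ≤ lam s t
  est_le : ∀ s t, s < t → t < P.n → (P.est s t : ℝ) ≤ α * lam s t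
  le_est : ∀ s t x y, s < t → t < P.n → x < P.n → y < P.n →
    P.ans s t x ≠ P.ans s t y → lam x y ≤ P.est s t
  lt_inf : ∀ s t, s < t → t < P.n → P.est s t < P.inf

/-! ### Separated pairs are separated by cheap cuts -/

section Accurate

variable {lam : ℕ → ℕ → ℝ} {α : ℝ}

theorem Accurate.e_le (ha : P.Accurate lam α) (h : IsClassMatrix P.n P.tb) {v : ℕ} (hv : v < P.n)
    (hp : P.piv v ≠ v) : (P.e v : ℝ) ≤ α * lam (P.piv v) v := by
  have h1 := (piv_spec h hv).1
  simp only [e, if_neg hp]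
  rcases lt_or_gt_of_ne hp with h2 | h2
  · rw [min_eq_left h2.le, max_eq_right h2.le]; exact ha.est_le _ _ h2 hv
  · rw [min_eq_right h2.le, max_eq_left h2.le, ha.symm]; exact ha.est_le _ _ h2 h1

theorem Accurate.le_e (ha : P.Accurate lam α) (h : IsClassMatrix P.n P.tb) {v x y : ℕ}
    (hv : v < P.n) (hx : x < P.n) (hy : y < P.n) (hb : P.bit v x ≠ P.bit v y) :
    lam x y ≤ P.e v := by
  have hp : P.piv v ≠ v := fun hp => hb (by rw [bit_of_eq hp, bit_of_eq hp])
  have h1 := (piv_spec h hv).1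
  simp only [e, bit, if_neg hp] at hb ⊢
  exact ha.le_est _ _ _ _ (by omega) (by omega) hx hy hb

theorem Accurate.e_lt_inf (ha : P.Accurate lam α) (h : IsClassMatrix P.n P.tb) {v : ℕ}
    (hv : v < P.n) (hp : P.piv v ≠ v) : P.e v < P.inf := by
  have h1 := (piv_spec h hv).1
  simp only [e, if_neg hp]
  exact ha.lt_inf _ _ (by omega) (by omega)

/-- No cut of the round has the pivot on the side away from itself, so its level is the artificial
maximum. With accurate estimates it is separated from all other members. -/
theorem best_of_piv (h : IsClassMatrix P.n P.tb) {x : ℕ} (hx : x < P.n) (hp : P.piv x = x) :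
    P.best x = P.inf := by
  obtain ⟨⟨h1, h2, h3⟩, -⟩ := argAux_spec h hx P.n le_rfl
  rcases h3 with h3 | h3
  · exact absurd h3 (not_side_piv h h1 hx h2 hp)
  · have : P.arg x = x := h3
    simp [best, this, e, hp]

theorem best_le (h : IsClassMatrix P.n P.tb) {x : ℕ} (hx : x < P.n) : P.best x ≤ P.e x :=
  (argAux_spec h hx P.n le_rfl).2.1

theorem best_le_of_side (h : IsClassMatrix P.n P.tb) {x v : ℕ} (hx : x < P.n) (hv : v < P.n)
    (h1 : P.tb v x = 0) (h2 : P.side v x) : P.best x ≤ P.e v :=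
  (argAux_spec h hx P.n le_rfl).2.2 v hv h1 h2

theorem arg_spec (h : IsClassMatrix P.n P.tb) (hs : P.Sep) {x : ℕ} (hx : x < P.n)
    (hp : P.piv x ≠ x) : P.arg x < P.n ∧ P.tb (P.arg x) x = 0 ∧ P.side (P.arg x) x := by
  obtain ⟨⟨h1, h2, h3⟩, -⟩ := argAux_spec h hx P.n le_rfl
  refine ⟨h1, h2, ?_⟩
  rcases h3 with h3 | h3
  · exact h3
  · have : P.arg x = x := h3
    rw [this]; exact side_self h hs hx hp

theorem bit_ne_of_side {v s t : ℕ} (h1 : P.side v s) (h2 : ¬ P.side v t) :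
    P.bit v s ≠ P.bit v t := by
  unfold side at h1 h2
  rw [not_not] at h2
  rw [h2]; exact h1

/-- The cheapest cut around `s` cannot have `t` on the same side, or the level of `t` would be no
larger. Its estimate is the level of `s`, hence at most α·λ(p,s). It also lies below the level of
`t`, hence is at most α·λ(p,t), unless `t` is the pivot. The ultrametric inequality bounds the
smaller of the two by α·λ(s,t). -/
theorem Accurate.of_best_lt (ha : P.Accurate lam α) (h : IsClassMatrix P.n P.tb) {s t : ℕ}
    (hs : s < P.n) (ht : t < P.n) (hst : s ≠ t) (htb : P.tb s t = 0) (hb : P.best s < P.best t) :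
    P.arg s < P.n ∧ P.bit (P.arg s) s ≠ P.bit (P.arg s) t ∧
      (P.e (P.arg s) : ℝ) ≤ α ^ 2 * lam s t := by
  have hpst := piv_congr h hs ht htb
  have ht_le : P.best t ≤ P.inf := by
    by_cases hp : P.piv t = t
    · exact (best_of_piv h ht hp).le
    · exact (best_le h ht).trans (ha.e_lt_inf h ht hp).le
  have hps : P.piv s ≠ s := fun hp => by rw [best_of_piv h hs hp] at hb; omega
  obtain ⟨h1, h2, h3⟩ := arg_spec h ha.sep hs hps
  have hnt : ¬ P.side (P.arg s) t := fun hside => by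
    have := best_le_of_side h ht h1 (h.trans _ h1 _ hs _ ht h2 htb) hside
    have e : P.best s = P.e (P.arg s) := rfl
    omega
  refine ⟨h1, bit_ne_of_side h3 hnt, ?_⟩
  have hα := ha.one_le
  have h4 : (P.e (P.arg s) : ℝ) ≤ α * lam (P.piv s) s :=
    le_trans (by exact_mod_cast best_le h hs) (ha.e_le h hs hps)
  have h5 : (P.e (P.arg s) : ℝ) ≤ α * lam s t := by
    by_cases hpt : P.piv t = t
    · rw [hpst, hpt, ha.symm] at h4; exact h4
    · have h6 : (P.e (P.arg s) : ℝ) ≤ α * lam (P.piv s) t := by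
        rw [hpst]
        exact le_trans (by exact_mod_cast hb.le.trans (best_le h ht)) (ha.e_le h ht hpt)
      refine le_trans ?_ (mul_le_mul_of_nonneg_left
        (ha.ultra s hs t ht (P.piv s) (piv_spec h hs).1 hst) (by linarith))
      rw [mul_min_of_nonneg _ _ (by linarith : 0 ≤ α)]
      exact le_min h4 h6
  have := ha.nonneg s t
  nlinarith [mul_nonneg (by linarith : 0 ≤ α) this]

/-- The balanced cut of `z` need not be the cheapest around `t`. But its estimate is at most
α·λ(p,z), λ(p,z) is at most the level of `z`, and this level is shared by `s` and `t`, hence at most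
α·λ(s,t). This is where the second factor α and the condition of equal levels come from. -/
theorem Accurate.of_sub_lt (ha : P.Accurate lam α) (h : IsClassMatrix P.n P.tb) {s t : ℕ}
    (hs : s < P.n) (ht : t < P.n) (hst : s ≠ t) (htb : P.tb s t = 0) (hb : P.best s = P.best t)
    (hsub : P.sub s < P.sub t) : ∃ z < P.n, P.sub t = z + 1 ∧ P.bit z s ≠ P.bit z t ∧
      (P.e z : ℝ) ≤ α ^ 2 * lam s t := by
  have hpst := piv_congr h hs ht htb
  rcases lastOr_spec Nat.succ (fun z => P.tb z t = 0 ∧ P.side z t ∧ 2 * P.sideSize z ≤ P.size z ∧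
    P.best z = P.best t) P.n with ⟨z, hz, ⟨hz1, hz2, hz3, hz4⟩, hz5, -⟩ | ⟨-, h2⟩
  swap
  · have : P.sub t = 0 := h2
    omega
  have hz5 : P.sub t = z + 1 := hz5
  have hzs : P.tb z s = 0 := (tb_iff h hz ht hs hz1).2 (by rw [h.symm t ht s hs]; exact htb)
  -- If `s` were on this side too, `z` would be a candidate for `s`, and the last candidate of `s`
  -- could not come before it.
  have hns : ¬ P.side z s := fun hside => by
    rcases lastOr_spec Nat.succ (fun z => P.tb z s = 0 ∧ P.side z s ∧
      2 * P.sideSize z ≤ P.size z ∧ P.best z = P.best s) P.n with ⟨y, hy, -, hy5, hy6⟩ | ⟨h2, -⟩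
    · have h7 := hy6 z hz ⟨hzs, hside, hz3, hz4.trans hb.symm⟩
      have hy5 : P.sub s = y + 1 := hy5
      omega
    · exact h2 z hz ⟨hzs, hside, hz3, hz4.trans hb.symm⟩
  refine ⟨z, hz, hz5, (bit_ne_of_side hz2 hns).symm, ?_⟩
  have hpz := ne_of_side hz2
  have hpzs := piv_congr h hz hs hzs
  have hnotpiv : ∀ x < P.n, P.best x = P.best z → P.piv x ≠ x := fun x hx hxz hp => by
    have h1 := best_of_piv h hx hp
    have h2 := best_le h hz
    have h3 := ha.e_lt_inf h hz hpz
    omega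
  have hps := hnotpiv s hs (by omega)
  have hpt := hnotpiv t ht (by omega)
  obtain ⟨h1, h2, h3⟩ := arg_spec h ha.sep hz hpz
  have hpa := piv_congr h h1 hz h2
  have hα := ha.one_le
  have e1 : (P.e z : ℝ) ≤ α * lam (P.piv z) z := ha.e_le h hz hpz
  -- The cut that realizes the level of `z` separates `z` from the pivot, and its estimate is at
  -- least the minimum capacity of such a cut.
  have e2 : lam (P.piv z) z ≤ P.best z := by
    rw [ha.symm]
    refine ha.le_e h h1 hz (piv_spec h hz).1 ?_
    rw [← hpa]; exact h3
  have e3 : (P.best z : ℝ) ≤ α * lam (P.piv z) s := by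
    rw [hpzs, hz4, ← hb]
    exact le_trans (by exact_mod_cast best_le h hs) (ha.e_le h hs hps)
  have e4 : (P.best z : ℝ) ≤ α * lam (P.piv z) t := by
    rw [hpzs, hpst, hz4]
    exact le_trans (by exact_mod_cast best_le h ht) (ha.e_le h ht hpt)
  have e5 : (P.best z : ℝ) ≤ α * lam s t := by
    refine le_trans ?_ (mul_le_mul_of_nonneg_left
      (ha.ultra s hs t ht (P.piv z) (piv_spec h hz).1 hst) (by linarith))
    rw [mul_min_of_nonneg _ _ (by linarith : 0 ≤ α)]
    exact le_min e3 e4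
  calc (P.e z : ℝ) ≤ α * lam (P.piv z) z := e1
    _ ≤ α * (α * lam s t) := mul_le_mul_of_nonneg_left (e2.trans e5) (by linarith)
    _ = α ^ 2 * lam s t := by ring

/-- Every pair that is separated in the round is separated by a cheap cut. -/
theorem Accurate.next_spec (ha : P.Accurate lam α) (h : IsClassMatrix P.n P.tb) {s t : ℕ}
    (kn : ℕ) (hs : s < P.n) (ht : t < P.n) (htb : P.tb s t = 0) (hn : P.next kn s t ≠ 0) :
    ∃ v < P.n, P.next kn s t = kn + v + 1 ∧ P.bit v s ≠ P.bit v t ∧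
      lam s t ≤ P.e v ∧ (P.e v : ℝ) ≤ α ^ 2 * lam s t := by
  have hst : s ≠ t := by
    rintro rfl
    exact hn ((P.next_eq_zero).2 ⟨htb, rfl, rfl⟩)
  have hts : P.tb t s = 0 := by rw [h.symm t ht s hs]; exact htb
  rcases lt_trichotomy (P.best s) (P.best t) with hb | hb | hb
  · obtain ⟨h1, h2, h3⟩ := ha.of_best_lt h hs ht hst htb hb
    exact ⟨_, h1, by simp [next, htb, hb], h2, ha.le_e h h1 hs ht h2, h3⟩
  · rcases lt_trichotomy (P.sub s) (P.sub t) with hc | hc | hc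
    · obtain ⟨z, h1, h2, h3, h4⟩ := ha.of_sub_lt h hs ht hst htb hb hc
      exact ⟨_, h1, by unfold next; split_ifs <;> omega, h3, ha.le_e h h1 hs ht h3, h4⟩
    · exact absurd ((P.next_eq_zero).2 ⟨htb, hb, hc⟩) hn
    · obtain ⟨z, h1, h2, h3, h4⟩ := ha.of_sub_lt h ht hs hst.symm hts hb.symm hc
      rw [ha.symm t s] at h4
      exact ⟨_, h1, by simp [next, htb, hb, hc, hc.not_gt]; omega, h3.symm,
        ha.le_e h h1 hs ht h3.symm, h4⟩
  · obtain ⟨h1, h2, h3⟩ := ha.of_best_lt h ht hs hst.symm hts hb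
    rw [ha.symm t s] at h3
    exact ⟨_, h1, by simp [next, htb, hb, hb.not_gt], h2.symm, ha.le_e h h1 hs ht h2.symm, h3⟩

end Accurate

end Round

end MinCutOracle

namespace MinCutOracle

open Finset

/-! ### The number of pairs that are not yet separated -/

/-- The number of ordered pairs of distinct nodes that are not yet separated. -/
def pot (n : ℕ) (tb : ℕ → ℕ → ℕ) : ℕ :=
  ∑ s ∈ range n, #{t ∈ range n | t ≠ s ∧ tb s t = 0}

/-- Reducing a uniform word modulo `a` is not uniform, but every residue occurs at least ⌊W/a⌋ ≥
W/(2a) times. -/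
theorem card_mod_eq {W a i : ℕ} (hi : i < a) (ha : a ≤ W) :
    W ≤ 2 * a * #{r ∈ range W | r % a = i} := by
  have h1 : W / a ≤ #{r ∈ range W | r % a = i} := by
    have : #(range (W / a)) ≤ #{r ∈ range W | r % a = i} := by
      refine card_le_card_of_injOn (fun j => j * a + i) (fun j hj => ?_) (fun j _ j' _ h => ?_)
      · simp only [coe_range, Set.mem_Iio] at hj
        have : (j + 1) * a ≤ W / a * a := Nat.mul_le_mul_right a hj
        have h2 := Nat.div_mul_le_self W a
        simp only [coe_filter, mem_range, Set.mem_ofPred_eq]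
        refine ⟨by rw [Nat.add_mul] at this; omega, ?_⟩
        rw [Nat.add_comm, Nat.add_mul_mod_self_right, Nat.mod_eq_of_lt hi]
      · have h3 : j * a = j' * a := by simpa using h
        exact Nat.eq_of_mul_eq_mul_right (by omega) h3
    simpa using this
  have h2 : W < a * (W / a) + a := by
    have := Nat.div_add_mod W a
    have := Nat.mod_lt W (by omega : 0 < a)
    omega
  have h3 : a * 1 ≤ a * (W / a) := Nat.mul_le_mul_left a (Nat.div_pos ha (by omega))
  have h4 := Nat.mul_le_mul_left (2 * a) h1
  have h5 : 2 * a * (W / a) = a * (W / a) + a * (W / a) := by ring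
  omega

namespace Round

variable {P : Round}

/-- The cut between `x` and the pivot `p` is balanced. -/
def Balanced (P : Round) (p x : ℕ) : Prop :=
  2 * Nat.count (fun y => P.tb x y = 0 ∧
    P.ans (min p x) (max p x) y ≠ P.ans (min p x) (max p x) p) P.n ≤ P.size x

instance (p x : ℕ) : Decidable (P.Balanced p x) := inferInstanceAs (Decidable (_ ≤ _))

/-- Queries are asked with the smaller node first, so the two roles of `p` and `x` yield the same
cut. Its two sides split the class, and one of them has at most half of it. -/
theorem balanced_or (h : IsClassMatrix P.n P.tb) (hs : P.Sep) {p x : ℕ} (hp : p < P.n)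
    (hx : x < P.n) (hpx : P.tb p x = 0) (hne : p ≠ x) : P.Balanced p x ∨ P.Balanced x p := by
  have h1 := ans_minmax hs hp hx hne
  unfold Balanced
  rw [min_comm x p, max_comm x p, size_congr h hp hx hpx]
  set g := P.ans (min p x) (max p x)
  have h2 : Nat.count (fun y => P.tb p y = 0 ∧ g y ≠ g x) P.n =
      Nat.count (fun y => P.tb x y = 0 ∧ ¬ g y ≠ g p) P.n := by
    refine count_congr_of_lt fun y hy => ?_
    rw [tb_iff h hp hx hy hpx]
    refine and_congr_right fun _ => ?_
    cases e1 : g y <;> cases e2 : g x <;> cases e3 : g p <;> simp_all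
  have h3 : Nat.count (fun y => P.tb x y = 0 ∧ g y ≠ g p) P.n +
      Nat.count (fun y => P.tb x y = 0 ∧ ¬ g y ≠ g p) P.n = P.size x := by
    simp only [size, Nat.count_eq_card_filter_range, ← filter_filter]
    exact card_filter_add_card_filter_not _
  rw [h2]
  omega

/-- The number of nodes that are separated from `s` in this round. -/
def newly (P : Round) (kn s : ℕ) : ℕ := #{t ∈ range P.n | P.tb s t = 0 ∧ P.next kn s t ≠ 0}

theorem pot_next_add (h : IsClassMatrix P.n P.tb) (kn : ℕ) :
    pot P.n (P.next kn) + ∑ s ∈ range P.n, P.newly kn s = pot P.n P.tb := by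
  unfold pot newly
  rw [← sum_add_distrib]
  refine sum_congr rfl fun s hs => ?_
  rw [← card_union_of_disjoint]
  · congr 1
    ext t
    simp only [mem_union, mem_filter, mem_range]
    have hs' := mem_range.1 hs
    constructor
    · rintro (⟨h1, h2, h3⟩ | ⟨h1, h2, h3⟩)
      · exact ⟨h1, h2, (P.next_eq_zero.1 h3).1⟩
      · refine ⟨h1, ?_, h2⟩
        rintro rfl
        exact h3 ((isClassMatrix_next h kn).refl _ h1)
    · rintro ⟨h1, h2, h3⟩
      by_cases h4 : P.next kn s t = 0
      · exact Or.inl ⟨h1, h2, h4⟩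
      · exact Or.inr ⟨h1, h3, h4⟩
  · rw [disjoint_left]
    intro t h1 h2
    simp only [mem_filter] at h1 h2
    exact h2.2.2 h1.2.2

/-- The cut of `x` is itself a candidate for `sub x`, so some balanced cut `z` is recorded.
Everything that stays with `x` records the same `z` and lies on its small side. -/
theorem size_le_newly (h : IsClassMatrix P.n P.tb) (hs : P.Sep) (kn : ℕ) {x : ℕ} (hx : x < P.n)
    (hp : P.piv x ≠ x) (hb : P.Balanced (P.piv x) x) : P.size x ≤ 2 * P.newly kn x := by
  have hside : ∀ y, P.bit x y = P.ans (min (P.piv x) x) (max (P.piv x) x) y := fun y => by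
    simp [bit, hp]
  have hgood : 2 * P.sideSize x ≤ P.size x := by
    have : P.sideSize x = Nat.count (fun y => P.tb x y = 0 ∧
        P.ans (min (P.piv x) x) (max (P.piv x) x) y ≠
          P.ans (min (P.piv x) x) (max (P.piv x) x) (P.piv x)) P.n := by
      unfold sideSize
      refine count_congr_of_lt fun y _ => ?_
      simp only [side, hside]
    rw [this]; exact hb
  rcases lastOr_spec Nat.succ (fun z => P.tb z x = 0 ∧ P.side z x ∧ 2 * P.sideSize z ≤ P.size z ∧
    P.best z = P.best x) P.n with ⟨z, hz, ⟨hz1, hz2, hz3, hz4⟩, hz5, -⟩ | ⟨h1, -⟩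
  swap
  · exact absurd ⟨h.refl x hx, side_self h hs hx hp, hgood, rfl⟩ (h1 x hx)
  have hz5 : P.sub x = z + 1 := hz5
  have hsub : #{t ∈ range P.n | P.tb x t = 0} ≤ P.newly kn x + P.sideSize z := by
    unfold newly sideSize
    rw [Nat.count_eq_card_filter_range]
    refine le_trans (card_le_card fun y hy => ?_) (card_union_le _ _)
    simp only [mem_filter, mem_range, mem_union] at hy ⊢
    by_cases hn : P.next kn x y = 0
    · right
      obtain ⟨h1, h2, h3⟩ := P.next_eq_zero.1 hn
      rcases lastOr_spec Nat.succ (fun z => P.tb z y = 0 ∧ P.side z y ∧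
        2 * P.sideSize z ≤ P.size z ∧ P.best z = P.best y) P.n with ⟨w, hw, hw1, hw5, -⟩ | ⟨-, h4⟩
      · have hw5 : P.sub y = w + 1 := hw5
        have : w = z := by omega
        subst this
        exact ⟨hy.1, hw1.1, hw1.2.1⟩
      · have h4 : P.sub y = 0 := h4
        omega
    · exact Or.inl ⟨hy.1, hy.2, hn⟩
  rw [← Nat.count_eq_card_filter_range] at hsub
  have hsub : P.size x ≤ P.newly kn x + P.sideSize z := hsub
  rw [size_congr h hz hx hz1] at hz3
  omega

/-- Each pivot that is favourable for `s` is drawn with probability at least 1/(2·size), and then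
`s` loses at least size/2 companions. The class sizes cancel. -/
theorem sum_newly (h : IsClassMatrix P.n P.tb) (hs : P.Sep) (kn : ℕ) {W s : ℕ} (hW : P.n ≤ W)
    (hsn : s < P.n) :
    W * #{p ∈ range P.n | p ≠ s ∧ P.tb s p = 0 ∧ P.Balanced p s} ≤
      4 * ∑ r ∈ range W, ({ P with r := r } : Round).newly kn s := by
  set G := {p ∈ range P.n | p ≠ s ∧ P.tb s p = 0 ∧ P.Balanced p s} with hG
  have h0 : P.size s ≤ W := by
    refine le_trans ?_ hW
    exact Nat.count_le _
  have h1 : ∀ p ∈ G, W ≤ 2 * P.size s * #{r ∈ range W | ({ P with r := r } : Round).piv s = p} := by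
    intro p hp
    simp only [hG, mem_filter, mem_range] at hp
    have hrank : P.rank s p < P.size s :=
      Nat.count_strict_mono (p := fun y => P.tb s y = 0) hp.2.2.1 hp.1
    refine (card_mod_eq hrank h0).trans (Nat.mul_le_mul_left _ (card_le_card ?_))
    intro r hr
    simp only [mem_filter] at hr ⊢
    refine ⟨hr.1, ?_⟩
    exact (piv_eq_iff (P := { P with r := r }) h hsn hp.2.2.1).2 hr.2.symm
  have h2 : ∀ r, P.size s * #{p ∈ G | ({ P with r := r } : Round).piv s = p} ≤
      2 * ({ P with r := r } : Round).newly kn s := by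
    intro r
    have hle : #{p ∈ G | ({ P with r := r } : Round).piv s = p} ≤ 1 := by
      rw [card_le_one]
      intro a ha b hb
      simp only [mem_filter] at ha hb
      exact ha.2.symm.trans hb.2
    rcases Nat.eq_zero_or_pos (#{p ∈ G | ({ P with r := r } : Round).piv s = p}) with h3 | h3
    · rw [h3]; simp
    · obtain ⟨p, hp⟩ := card_pos.1 h3
      simp only [hG, mem_filter, mem_range] at hp
      have h4 := size_le_newly (P := { P with r := r }) h hs kn hsn (by rw [hp.2]; exact hp.1.2.1)
        (by rw [hp.2]; exact hp.1.2.2.2)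
      calc P.size s * #{p ∈ G | ({ P with r := r } : Round).piv s = p} ≤ P.size s * 1 :=
            Nat.mul_le_mul_left _ hle
        _ = P.size s := Nat.mul_one _
        _ ≤ _ := h4
  calc W * #G = ∑ p ∈ G, W := by rw [sum_const, smul_eq_mul, mul_comm]
    _ ≤ ∑ p ∈ G, 2 * P.size s * #{r ∈ range W | ({ P with r := r } : Round).piv s = p} :=
        sum_le_sum h1
    _ = 2 * (P.size s * ∑ p ∈ G, #{r ∈ range W | ({ P with r := r } : Round).piv s = p}) := by
        rw [← mul_sum, mul_assoc]
    _ = 2 * (P.size s * ∑ r ∈ range W, #{p ∈ G | ({ P with r := r } : Round).piv s = p}) := by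
        congr 2
        simp only [card_filter]
        exact sum_comm
    _ = 2 * ∑ r ∈ range W, P.size s * #{p ∈ G | ({ P with r := r } : Round).piv s = p} := by
        rw [mul_sum]
    _ ≤ 2 * ∑ r ∈ range W, 2 * ({ P with r := r } : Round).newly kn s :=
        Nat.mul_le_mul_left _ (sum_le_sum fun r _ => h2 r)
    _ = 4 * ∑ r ∈ range W, ({ P with r := r } : Round).newly kn s := by
        rw [← mul_sum]; ring

/-- A round separates a constant fraction of the pairs on average. -/
theorem sum_pot_next (h : IsClassMatrix P.n P.tb) (hs : P.Sep) (kn : ℕ) {W : ℕ} (hW : P.n ≤ W) :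
    8 * ∑ r ∈ range W, pot P.n (({ P with r := r } : Round).next kn) ≤ 7 * W * pot P.n P.tb := by
  have h1 : ∀ r, pot P.n (({ P with r := r } : Round).next kn) +
      ∑ s ∈ range P.n, ({ P with r := r } : Round).newly kn s = pot P.n P.tb :=
    fun r => pot_next_add (P := { P with r := r }) h kn
  have h2 : ∑ r ∈ range W, pot P.n (({ P with r := r } : Round).next kn) +
      ∑ r ∈ range W, ∑ s ∈ range P.n, ({ P with r := r } : Round).newly kn s =
      W * pot P.n P.tb := by
    rw [← sum_add_distrib, sum_congr rfl fun r _ => h1 r, sum_const, card_range, smul_eq_mul]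
  have h3 : W * pot P.n P.tb ≤
      8 * ∑ r ∈ range W, ∑ s ∈ range P.n, ({ P with r := r } : Round).newly kn s := by
    rw [sum_comm]
    have h4 : ∑ s ∈ range P.n, W * #{p ∈ range P.n | p ≠ s ∧ P.tb s p = 0 ∧ P.Balanced p s} ≤
        4 * ∑ s ∈ range P.n, ∑ r ∈ range W, ({ P with r := r } : Round).newly kn s := by
      rw [mul_sum]
      exact sum_le_sum fun s hs' => sum_newly h hs kn hW (mem_range.1 hs')
    -- Each unseparated ordered pair is balanced in one of its two orientations, so balanced pairs
    -- make up at least half.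
    have h5 : pot P.n P.tb ≤
        2 * ∑ s ∈ range P.n, #{p ∈ range P.n | p ≠ s ∧ P.tb s p = 0 ∧ P.Balanced p s} := by
      have h6 : ∑ s ∈ range P.n, #{p ∈ range P.n | p ≠ s ∧ P.tb s p = 0 ∧ P.Balanced p s} =
          ∑ s ∈ range P.n, #{p ∈ range P.n | p ≠ s ∧ P.tb s p = 0 ∧ P.Balanced s p} := by
        simp only [card_filter]
        rw [sum_comm]
        refine sum_congr rfl fun s hs' => sum_congr rfl fun p hp => ?_
        rw [h.symm s (mem_range.1 hs') p (mem_range.1 hp)]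
        simp only [ne_comm (a := p) (b := s)]
      rw [two_mul]
      nth_rewrite 2 [h6]
      unfold pot
      rw [← sum_add_distrib]
      refine sum_le_sum fun s hs' => ?_
      refine le_trans (card_le_card fun p hp => ?_) (card_union_le _ _)
      simp only [mem_filter, mem_range, mem_union] at hp ⊢
      rcases balanced_or h hs (mem_range.1 hs') hp.1 hp.2.2 hp.2.1.symm with h7 | h7
      · exact Or.inr ⟨hp.1, hp.2.1, hp.2.2, h7⟩
      · exact Or.inl ⟨hp.1, hp.2.1, hp.2.2, h7⟩
    rw [← mul_sum] at h4
    have h8 := Nat.mul_le_mul_left W h5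
    have h9 : W * (2 * ∑ s ∈ range P.n, #{p ∈ range P.n | p ≠ s ∧ P.tb s p = 0 ∧ P.Balanced p s}) =
      2 * (W * ∑ s ∈ range P.n, #{p ∈ range P.n | p ≠ s ∧ P.tb s p = 0 ∧ P.Balanced p s}) := by ring
    omega
  have h10 : 7 * W * pot P.n P.tb = 7 * (W * pot P.n P.tb) := by ring
  omega

end Round

/-- The matrix after `K` rounds, with the random words from the tape `ω`, where the first round has
the number `k`. -/
def rounds (n : ℕ) (ans : ℕ → ℕ → ℕ → Bool) (est : ℕ → ℕ → ℕ) (inf : ℕ) :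
    ℕ → ℕ → (ℕ → ℕ → ℕ) → (ℕ → ℕ) → ℕ → ℕ → ℕ
  | 0, _, tb, _ => tb
  | K + 1, k, tb, ω => rounds n ans est inf K (k + 1)
      ((⟨n, ans, est, inf, tb, ω 0⟩ : Round).next (k * n)) fun i => ω (i + 1)

/-- The expected decrease of a round holds from every class matrix, so the factors multiply. The
additional `m` words are not read. -/
theorem avg_pot_rounds {n : ℕ} {ans : ℕ → ℕ → ℕ → Bool} (est : ℕ → ℕ → ℕ) (inf : ℕ) {W : ℕ}
    (hW : n ≤ W) (hW0 : 0 < W) (hs : ∀ s t, s < t → t < n → ans s t s ≠ ans s t t) (m K : ℕ) :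
    ∀ (k : ℕ) (tb : ℕ → ℕ → ℕ), IsClassMatrix n tb →
      avg W (K + m) (fun ω => (pot n (rounds n ans est inf K k tb ω) : ℝ)) ≤
        (7 / 8) ^ K * pot n tb := by
  induction K with
  | zero => intro k tb _; simp [rounds, avg_const hW0]
  | succ K ih =>
    intro k tb h
    rw [show K + 1 + m = (K + m) + 1 by ring]
    simp only [avg, rounds, tapeCons]
    have h1 : ∀ r, avg W (K + m) (fun ω => (pot n (rounds n ans est inf K (k + 1)
        ((⟨n, ans, est, inf, tb, r⟩ : Round).next (k * n)) ω) : ℝ)) ≤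
        (7 / 8) ^ K * pot n ((⟨n, ans, est, inf, tb, r⟩ : Round).next (k * n)) := fun r =>
      ih (k + 1) _ (Round.isClassMatrix_next (P := ⟨n, ans, est, inf, tb, r⟩) h _)
    have hW1 : (0 : ℝ) < W := by exact_mod_cast hW0
    rw [div_le_iff₀ hW1]
    refine (Finset.sum_le_sum fun r _ => h1 r).trans ?_
    rw [← Finset.mul_sum]
    have h2 := Round.sum_pot_next (P := ⟨n, ans, est, inf, tb, 0⟩) h hs (k * n) hW
    have h3 : (8 : ℝ) * ∑ r ∈ range W, (pot n ((⟨n, ans, est, inf, tb, r⟩ : Round).next (k * n)) : ℝ)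
        ≤ 7 * W * pot n tb := by exact_mod_cast h2
    have h4 : (0 : ℝ) ≤ (7 / 8) ^ K := by positivity
    rw [pow_succ]
    nlinarith [mul_le_mul_of_nonneg_left h3 h4]

end MinCutOracle

namespace MinCutOracle

/-! ### Minimum cuts -/

section MaxFlow

variable {n : ℕ} (G : CapGraph n)

theorem maxFlow_le {s t : Fin n} {S : Finset (Fin n)} (h : Separates S s t) :
    G.maxFlow s t ≤ G.cutCap S := Nat.sInf_le ⟨S, h, rfl⟩

theorem exists_cut_eq_maxFlow {s t : Fin n} (h : s ≠ t) :
    ∃ S, Separates S s t ∧ G.cutCap S = G.maxFlow s t := by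
  have : {x | ∃ S : Finset (Fin n), Separates S s t ∧ G.cutCap S = x}.Nonempty :=
    ⟨_, {s}, by simp [Separates, h.symm], rfl⟩
  exact Nat.sInf_mem this

theorem Separates.symm {S : Finset (Fin n)} {s t : Fin n} (h : Separates S s t) :
    Separates S t s := fun h' => h h'.symm

theorem maxFlow_comm (s t : Fin n) : G.maxFlow s t = G.maxFlow t s := by
  unfold CapGraph.maxFlow
  congr 1
  ext x
  exact ⟨fun ⟨S, h, h'⟩ => ⟨S, h.symm, h'⟩, fun ⟨S, h, h'⟩ => ⟨S, h.symm, h'⟩⟩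

/-- Wherever `u` lies, a minimum cut between `s` and `t` separates it from one of them. -/
theorem min_maxFlow_le {s t : Fin n} (u : Fin n) (h : s ≠ t) :
    min (G.maxFlow u s) (G.maxFlow u t) ≤ G.maxFlow s t := by
  obtain ⟨S, hS, hc⟩ := exists_cut_eq_maxFlow G h
  rw [← hc]
  by_cases h1 : Separates S u s
  · exact (min_le_left _ _).trans (maxFlow_le G h1)
  · refine (min_le_right _ _).trans (maxFlow_le G ?_)
    unfold Separates at *
    tauto

theorem exists_cross_of_walk {V : Type*} {H : SimpleGraph V} {s t : V} (p : H.Walk s t) (S : Set V)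
    (h : ¬ (s ∈ S ↔ t ∈ S)) : ∃ d ∈ p.darts, ¬ (d.fst ∈ S ↔ d.snd ∈ S) := by
  by_cases hs : s ∈ S
  · have ht : t ∉ S := fun ht => h (by simp [hs, ht])
    obtain ⟨d, h1, h2, h3⟩ := p.exists_boundary_dart S hs ht
    exact ⟨d, h1, by simp [h2, h3]⟩
  · have ht : t ∈ S := by by_contra ht; exact h (by simp [hs, ht])
    obtain ⟨d, h1, h2, h3⟩ := p.exists_boundary_dart Sᶜ hs (by simpa using ht)
    exact ⟨d, h1, by simp at h2 h3; simp [h2, h3]⟩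

theorem cap_le_cutCap {S : Finset (Fin n)} {u v : Fin n} (h : Separates S u v) :
    G.cap u v ≤ G.cutCap S := by
  have key : ∀ u v, u ∈ S → v ∉ S → G.cap u v ≤ G.cutCap S := fun u v hu hv => by
    unfold CapGraph.cutCap
    refine le_trans ?_ (Finset.single_le_sum (f := fun u => ∑ v ∈ Sᶜ, G.cap u v)
      (fun _ _ => Nat.zero_le _) hu)
    exact Finset.single_le_sum (f := fun v => G.cap u v) (fun _ _ => Nat.zero_le _)
      (Finset.mem_compl.2 hv)
  by_cases hu : u ∈ S
  · exact key u v hu fun hv => h (by simp [hu, hv])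
  · rw [G.symm]
    exact key v u (by by_contra hv; exact h (by simp [hu, hv])) hu

theorem maxFlow_pos (hG : G.graph.Connected) {s t : Fin n} (h : s ≠ t) : 0 < G.maxFlow s t := by
  obtain ⟨S, hS, hc⟩ := exists_cut_eq_maxFlow G h
  obtain ⟨p⟩ := hG.preconnected s t
  obtain ⟨d, -, h2⟩ := exists_cross_of_walk p (S : Set (Fin n)) (by simpa [Separates] using hS)
  have h3 := cap_le_cutCap G (S := S) (u := d.fst) (v := d.snd) (by simpa [Separates] using h2)
  have h4 : G.cap d.fst d.snd ≠ 0 := d.adj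
  omega

/-! ### Trees -/

theorem le_maxFlow_of_reachable (T : CapGraph n) {s t : Fin n} (h : s ≠ t) (θ : ℕ)
    (H : SimpleGraph (Fin n)) (hH : ∀ u v, H.Adj u v → θ ≤ T.cap u v) (hr : H.Reachable s t) :
    θ ≤ T.maxFlow s t := by
  obtain ⟨S, hS, hc⟩ := exists_cut_eq_maxFlow T h
  obtain ⟨p⟩ := hr
  obtain ⟨d, -, h2⟩ := exists_cross_of_walk p (S : Set (Fin n)) (by simpa [Separates] using hS)
  rw [← hc]
  exact (hH _ _ d.adj).trans (cap_le_cutCap T (by simpa [Separates] using h2))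

/-- Take an edge at which the tree path crosses a minimum cut of `G`. That cut also separates the
ends of the edge, and removing the edge from the tree gives a cut of `T` between `s` and `t` that
only this edge crosses. -/
theorem exists_edge_ge_maxFlow (T : CapGraph n) (hT : T.graph.IsTree) {s t : Fin n} (h : s ≠ t) :
    ∃ u v, T.graph.Adj u v ∧ G.maxFlow u v ≤ G.maxFlow s t ∧ T.maxFlow s t ≤ T.cap u v := by
  classical
  obtain ⟨C, hC, hc⟩ := exists_cut_eq_maxFlow G h
  obtain ⟨p, hp⟩ := (hT.existsUnique_path s t).exists
  obtain ⟨d, hd, h2⟩ := exists_cross_of_walk p (C : Set (Fin n)) (by simpa [Separates] using hC)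
  refine ⟨d.fst, d.snd, d.adj, ?_, ?_⟩
  · rw [← hc]; exact maxFlow_le G (by simpa [Separates] using h2)
  set T' := T.graph.deleteEdges {s(d.fst, d.snd)} with hT'
  have hns : ¬ T'.Reachable s t := by
    intro hr
    obtain ⟨q, hq⟩ := hr.exists_isPath
    have hle : T' ≤ T.graph := SimpleGraph.deleteEdges_le _
    have h3 : (⟨p, hp⟩ : T.graph.Path s t) = ⟨q.mapLe hle, hq.mapLe hle⟩ :=
      (hT.isAcyclic.subsingleton_path _ _).elim _ _
    have h4 : p = q.mapLe hle := congrArg Subtype.val h3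
    have h5 : s(d.fst, d.snd) ∈ p.edges := by
      have := List.mem_map_of_mem (f := SimpleGraph.Dart.edge) hd
      exact this
    rw [h4, SimpleGraph.Walk.edges_mapLe_eq_edges] at h5
    have h6 := q.edges_subset_edgeSet h5
    simp [hT'] at h6
  set S : Finset (Fin n) := Finset.univ.filter fun x => T'.Reachable s x with hS
  have hsep : Separates S s t := by
    simp [Separates, hS, hns]
  refine (maxFlow_le T hsep).trans ?_
  have hcross : ∀ x ∈ S, ∀ y ∈ Sᶜ, T.cap x y ≠ 0 → s(x, y) = s(d.fst, d.snd) := by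
    intro x hx y hy hxy
    by_contra hne
    simp only [hS, Finset.mem_compl, Finset.mem_filter, Finset.mem_univ, true_and] at hx hy
    refine hy (hx.trans (SimpleGraph.Adj.reachable ?_))
    rw [hT', SimpleGraph.deleteEdges_adj]
    exact ⟨hxy, by simpa using hne⟩
  have key : ∀ a b, s(a, b) = s(d.fst, d.snd) → a ∈ S → b ∉ S → T.cutCap S ≤ T.cap a b := by
    intro a b hab ha hb
    have : ∀ x ∈ S, ∀ y ∈ Sᶜ, T.cap x y ≤ if y = b then (if x = a then T.cap a b else 0) else 0 := by
      intro x hx y hy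
      by_cases h0 : T.cap x y = 0
      · simp [h0]
      · have h1 := hcross x hx y hy h0
        rw [← hab, Sym2.eq_iff] at h1
        rcases h1 with ⟨rfl, rfl⟩ | ⟨rfl, rfl⟩
        · simp
        · exact absurd hx hb
    refine (Finset.sum_le_sum fun x hx => Finset.sum_le_sum fun y hy => this x hx y hy).trans ?_
    simp [ha, hb]
  by_cases hf : d.fst ∈ S
  · by_cases hg : d.snd ∈ S
    -- Only the removed edge can leave the component `S`, so with both ends inside nothing does.
    · have : T.cutCap S = 0 := by
        refine Finset.sum_eq_zero fun x hx => Finset.sum_eq_zero fun y hy => ?_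
        by_contra h0
        have h1 := hcross x hx y hy h0
        rw [Sym2.eq_iff] at h1
        rcases h1 with ⟨h1, h2⟩ | ⟨h1, h2⟩
        · rw [← h2] at hg; exact (Finset.mem_compl.1 hy) hg
        · rw [← h2] at hf; exact (Finset.mem_compl.1 hy) hf
      omega
    · exact key _ _ rfl hf hg
  · by_cases hg : d.snd ∈ S
    · rw [T.symm]; exact key _ _ Sym2.eq_swap hg hf
    · have : T.cutCap S = 0 := by
        refine Finset.sum_eq_zero fun x hx => Finset.sum_eq_zero fun y hy => ?_
        by_contra h0
        have h1 := hcross x hx y hy h0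
        rw [Sym2.eq_iff] at h1
        rcases h1 with ⟨h1, h2⟩ | ⟨h1, h2⟩
        · rw [h1] at hx; exact hf hx
        · rw [h1] at hx; exact hg hx
      omega

end MaxFlow

/-! ### Maximum spanning trees by Prim's algorithm -/

/-- The nodes that have been reached after `i` steps of Prim's algorithm, in which `b j` is the
node that is reached in step `j`. -/
def Reached (b : ℕ → ℕ) (i x : ℕ) : Prop := x = 0 ∨ ∃ j < i, b j = x

/-- `b`, `y`, `c` describe a run of Prim's algorithm for a tree of maximum weight on `n` nodes with
weights `val`: in step `i` the node `b i` is linked to `y i`, and the edge has weight `c i`. -/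
structure IsPrim (n : ℕ) (val : ℕ → ℕ → ℕ) (b y c : ℕ → ℕ) : Prop where
  b_lt : ∀ i, i + 1 < n → b i < n
  y_lt : ∀ i, i + 1 < n → y i < n
  b_new : ∀ i, i + 1 < n → ¬ Reached b i (b i)
  y_old : ∀ i, i + 1 < n → Reached b i (y i)
  c_eq : ∀ i, i + 1 < n → c i = val (y i) (b i)
  c_max : ∀ i, i + 1 < n → ∀ u < n, ∀ x < n, Reached b i u → ¬ Reached b i x → val u x ≤ c i

namespace IsPrim

variable {n : ℕ} {val : ℕ → ℕ → ℕ} {b y c : ℕ → ℕ}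

theorem reached_succ {i x : ℕ} : Reached b (i + 1) x ↔ Reached b i x ∨ b i = x := by
  unfold Reached
  constructor
  · rintro (h | ⟨j, hj, h⟩)
    · exact Or.inl (Or.inl h)
    · rcases Nat.lt_succ_iff_lt_or_eq.1 hj with h1 | h1
      · exact Or.inl (Or.inr ⟨j, h1, h⟩)
      · subst h1; exact Or.inr h
  · rintro ((h | ⟨j, hj, h⟩) | h)
    · exact Or.inl h
    · exact Or.inr ⟨j, by omega, h⟩
    · exact Or.inr ⟨i, by omega, h⟩

theorem reached_mono {i j x : ℕ} (hij : i ≤ j) (h : Reached b i x) : Reached b j x := by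
  rcases h with h | ⟨k, hk, h⟩
  · exact Or.inl h
  · exact Or.inr ⟨k, by omega, h⟩

/-- The start node followed by the new nodes of the steps gives an injective, hence surjective, map
of `Fin n` to itself. -/
theorem reached_all (h : IsPrim n val b y c) {x : ℕ} (hx : x < n) : Reached b (n - 1) x := by
  have hn : 0 < n := by omega
  let f : Fin n → Fin n := fun i => if hi : i.val = 0 then ⟨0, hn⟩ else
    ⟨b (i.val - 1), h.b_lt _ (by omega)⟩
  have hf : Function.Injective f := by
    intro i j hij
    have key : ∀ i j : Fin n, i.val < j.val → f i = f j → False := by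
      intro i j hlt hij
      have hj : j.val ≠ 0 := by omega
      have h1 := h.b_new (j.val - 1) (by omega)
      simp only [f, dif_neg hj] at hij
      by_cases hi : i.val = 0
      · simp only [dif_pos hi, Fin.mk.injEq] at hij
        exact h1 (Or.inl hij.symm)
      · simp only [dif_neg hi, Fin.mk.injEq] at hij
        exact h1 (Or.inr ⟨i.val - 1, by omega, hij⟩)
    rcases lt_trichotomy i.val j.val with h1 | h1 | h1
    · exact (key i j h1 hij).elim
    · exact Fin.ext h1
    · exact (key j i h1 hij.symm).elim
  obtain ⟨i, hi⟩ := (Finite.injective_iff_surjective.1 hf) ⟨x, hx⟩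
  by_cases h0 : i.val = 0
  · simp only [f, dif_pos h0, Fin.mk.injEq] at hi
    exact Or.inl hi.symm
  · simp only [f, dif_neg h0, Fin.mk.injEq] at hi
    exact Or.inr ⟨i.val - 1, by omega, hi⟩

/-- No edge is chosen twice, so the sum that defines a capacity of the tree has at most one nonzero
term. -/
theorem pair_injective (h : IsPrim n val b y c) {i j : ℕ} (hi : i + 1 < n) (hj : j + 1 < n)
    (hij : (b i = b j ∧ y i = y j) ∨ (b i = y j ∧ y i = b j)) : i = j := by
  have key : ∀ i j, i < j → j + 1 < n →
      ¬ ((b i = b j ∧ y i = y j) ∨ (b i = y j ∧ y i = b j)) := by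
    intro i j hlt hj hij
    have h1 := h.b_new j hj
    rcases hij with ⟨h2, -⟩ | ⟨-, h2⟩
    · exact h1 (Or.inr ⟨i, hlt, h2⟩)
    · refine h1 (h2 ▸ reached_mono hlt.le (h.y_old i (by omega)))
  rcases lt_trichotomy i j with h1 | h1 | h1
  · exact (key i j h1 hj hij).elim
  · exact h1
  · refine (key j i h1 hi ?_).elim
    rcases hij with ⟨h2, h3⟩ | ⟨h2, h3⟩
    · exact Or.inl ⟨h2.symm, h3.symm⟩
    · exact Or.inr ⟨h3.symm, h2.symm⟩

theorem b_ne_y (h : IsPrim n val b y c) {i : ℕ} (hi : i + 1 < n) : b i ≠ y i := fun he =>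
  h.b_new i hi (by rw [he]; exact h.y_old i hi)

/-- The nodes that are reached are connected by heavy edges whenever possible. -/
theorem heavy (h : IsPrim n val b y c) (hsym : ∀ u < n, ∀ v < n, val u v = val v u) (θ : ℕ)
    (R : ℕ → ℕ → Prop) (hR : Equivalence R)
    (hE : ∀ i, i + 1 < n → θ ≤ c i → R (b i) (y i)) (i : ℕ) (hi : i + 1 ≤ n) :
    (∀ u < n, ∀ x < n, Reached b i u → Reached b i x → u ≠ x → θ ≤ val u x → R u x) ∧
    ∀ u < n, ∀ u' < n, Reached b i u → Reached b i u' →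
      (∃ x < n, ¬ Reached b i x ∧ θ ≤ val u x) → (∃ x < n, ¬ Reached b i x ∧ θ ≤ val u' x) →
      R u u' := by
  induction i with
  | zero =>
    constructor
    · rintro u - x - (rfl | ⟨j, hj, -⟩) (rfl | ⟨j', hj', -⟩)
      · intro h; exact absurd rfl h
      all_goals omega
    · rintro u - x - (rfl | ⟨j, hj, -⟩) (rfl | ⟨j', hj', -⟩) _ _
      · exact hR.refl _
      all_goals omega
  | succ i ih =>
    obtain ⟨ih1, ih2⟩ := ih (by omega)
    have hb := h.b_lt i (by omega)
    have hbn := h.b_new i (by omega)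
    -- If a heavy edge leaves the reached set, the edge chosen next is heavy too. Its old end is
    -- then joined to `u` by the second part of the induction hypothesis, and its new end follows.
    have hlink : ∀ u < n, Reached b i u → (∃ x < n, ¬ Reached b i x ∧ θ ≤ val u x) →
        R u (b i) := by
      rintro u hu hru ⟨x, hx, hrx, hux⟩
      have hc : θ ≤ c i := hux.trans (h.c_max i (by omega) u hu x hx hru hrx)
      have h1 := hE i (by omega) hc
      have h2 : θ ≤ val (y i) (b i) := by rw [← h.c_eq i (by omega)]; exact hc
      exact hR.trans (ih2 u hu (y i) (h.y_lt i (by omega)) hru (h.y_old i (by omega))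
        ⟨x, hx, hrx, hux⟩ ⟨b i, hb, hbn, h2⟩) (hR.symm h1)
    have hout : ∀ u, (∃ x < n, ¬ Reached b (i + 1) x ∧ θ ≤ val u x) →
        ∃ x < n, ¬ Reached b i x ∧ θ ≤ val u x := by
      rintro u ⟨x, hx, hrx, hux⟩
      exact ⟨x, hx, fun h' => hrx (reached_mono (by omega) h'), hux⟩
    constructor
    · intro u hu x hx hru hrx hne hux
      rw [reached_succ] at hru hrx
      rcases hru with hru | rfl <;> rcases hrx with hrx | rfl
      · exact ih1 u hu x hx hru hrx hne hux
      · exact hlink u hu hru ⟨b i, hb, hbn, hux⟩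
      · exact hR.symm (hlink x hx hrx ⟨b i, hb, hbn, by rw [hsym x hx _ hb]; exact hux⟩)
      · exact absurd rfl hne
    · intro u hu u' hu' hru hru' ho ho'
      rw [reached_succ] at hru hru'
      rcases hru with hru | rfl <;> rcases hru' with hru' | rfl
      · exact ih2 u hu u' hu' hru hru' (hout u ho) (hout u' ho')
      · exact hlink u hu hru (hout u ho)
      · exact hR.symm (hlink u' hu' hru' (hout u' ho'))
      · exact hR.refl _

/-- The end that is new in step `i`, as a node. -/
def endB (h : IsPrim n val b y c) (i : Fin (n - 1)) : Fin n := ⟨b i, h.b_lt _ (by omega)⟩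

/-- The end that is old in step `i`, as a node. -/
def endY (h : IsPrim n val b y c) (i : Fin (n - 1)) : Fin n := ⟨y i, h.y_lt _ (by omega)⟩

/-- The tree that Prim's algorithm constructs. -/
def tree (h : IsPrim n val b y c) : CapGraph n where
  cap u v := ∑ i : Fin (n - 1), if (h.endB i = u ∧ h.endY i = v) ∨ (h.endB i = v ∧ h.endY i = u)
    then c i else 0
  symm u v := Finset.sum_congr rfl fun i _ => by simp only [or_comm]
  loopless v := Finset.sum_eq_zero fun i _ => by
    rw [if_neg]
    rintro (⟨h1, h2⟩ | ⟨h1, h2⟩) <;>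
    · have := h1.trans h2.symm
      simp only [endB, endY, Fin.mk.injEq] at this
      exact h.b_ne_y (by omega) this

theorem tree_cap (h : IsPrim n val b y c) (i : Fin (n - 1)) :
    h.tree.cap (h.endB i) (h.endY i) = c i := by
  simp only [tree]
  rw [Finset.sum_eq_single i]
  · simp
  · intro j _ hj
    rw [if_neg]
    intro hc
    refine hj (Fin.ext (h.pair_injective (by omega) (by omega) ?_))
    simpa [endB, endY, Fin.ext_iff, and_comm] using hc
  · simp

theorem exists_of_tree_adj (h : IsPrim n val b y c) {u v : Fin n} (hv : h.tree.graph.Adj u v) :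
    ∃ i, (h.endB i = u ∧ h.endY i = v) ∨ (h.endB i = v ∧ h.endY i = u) := by
  by_contra hcon
  push Not at hcon
  refine hv ?_
  simp only [tree]
  refine Finset.sum_eq_zero fun i _ => ?_
  rw [if_neg]
  have := hcon i
  tauto

/-- The graph is connected and has at most `n - 1` edges; positive weights ensure that every chosen
edge is really present. -/
theorem tree_isTree (h : IsPrim n val b y c) (hn : 0 < n) (hc : ∀ i, i + 1 < n → 0 < c i) :
    h.tree.graph.IsTree := by
  have hadj : ∀ i : Fin (n - 1), h.tree.graph.Adj (h.endB i) (h.endY i) := fun i => by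
    change h.tree.cap _ _ ≠ 0
    rw [h.tree_cap]
    exact (hc i (by omega)).ne'
  have hreach : ∀ i, i + 1 ≤ n → ∀ x : Fin n, Reached b i x.val →
      h.tree.graph.Reachable ⟨0, hn⟩ x := by
    intro i
    induction i with
    | zero =>
      rintro - x (hx | ⟨j, hj, -⟩)
      · have : x = ⟨0, hn⟩ := Fin.ext hx
        rw [this]
      · omega
    | succ i ih =>
      intro hi x hx
      rcases reached_succ.1 hx with hx | hx
      · exact ih (by omega) x hx
      · have h1 : x = h.endB ⟨i, by omega⟩ := Fin.ext hx.symm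
        rw [h1]
        exact (ih (by omega) (h.endY ⟨i, by omega⟩) (h.y_old i (by omega))).trans
          (hadj ⟨i, by omega⟩).reachable.symm
  have hconn : h.tree.graph.Connected := by
    have : Nonempty (Fin n) := ⟨⟨0, hn⟩⟩
    refine ⟨fun u v => ?_⟩
    have h1 := hreach (n - 1) (by omega) u (h.reached_all u.isLt)
    have h2 := hreach (n - 1) (by omega) v (h.reached_all v.isLt)
    exact h1.symm.trans h2
  rw [SimpleGraph.isTree_iff_connected_and_card]
  refine ⟨hconn, le_antisymm ?_ ?_⟩
  · have hle : Nat.card h.tree.graph.edgeSet ≤ Nat.card (Fin (n - 1)) := by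
      refine Nat.card_le_card_of_surjective (fun i => ⟨s(h.endB i, h.endY i), hadj i⟩) ?_
      rintro ⟨e, he⟩
      induction e with | _ u v =>
      obtain ⟨i, hi⟩ := h.exists_of_tree_adj he
      refine ⟨i, Subtype.ext ?_⟩
      change s(h.endB i, h.endY i) = s(u, v)
      rcases hi with ⟨h1, h2⟩ | ⟨h1, h2⟩
      · rw [h1, h2]
      · rw [h1, h2]; exact Sym2.eq_swap
    simp only [Nat.card_eq_fintype_card, Fintype.card_fin] at hle ⊢
    omega
  · exact hconn.card_vert_le_card_edgeSet_add_one

/-- Prim's algorithm turns approximate values of all minimum cuts into an approximate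
flow-equivalent tree. -/
theorem tree_isApproxFlowEquivTree (h : IsPrim n val b y c) (hn : 0 < n) (G : CapGraph n)
    (hG : G.graph.Connected) (ε : ℝ)
    (hsym : ∀ u < n, ∀ v < n, val u v = val v u)
    (hval : ∀ s t : Fin n, s ≠ t →
      G.maxFlow s t ≤ val s t ∧ (val s t : ℝ) ≤ (1 + ε) * G.maxFlow s t) :
    G.IsApproxFlowEquivTree ε h.tree := by
  have hpos : ∀ i, i + 1 < n → 0 < c i := by
    intro i hi
    have hne : h.endY ⟨i, by omega⟩ ≠ h.endB ⟨i, by omega⟩ := fun he =>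
      h.b_ne_y hi (Fin.mk.inj_iff.1 he).symm
    rw [h.c_eq i hi]
    exact (maxFlow_pos G hG hne).trans_le (hval _ _ hne).1
  have htree := h.tree_isTree hn hpos
  refine ⟨htree, fun s t hst => ⟨?_, ?_⟩⟩
  · refine (hval s t hst).1.trans ?_
    set θ := val s t
    let H : SimpleGraph (Fin n) :=
      { Adj := fun u v => u ≠ v ∧ θ ≤ h.tree.cap u v
        symm := ⟨fun u v huv => ⟨huv.1.symm, by rw [h.tree.symm]; exact huv.2⟩⟩
        loopless := ⟨fun v hv => hv.1 rfl⟩ }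
    refine le_maxFlow_of_reachable h.tree hst θ H (fun u v huv => huv.2) ?_
    -- Reachability by edges of capacity at least θ, made reflexive outside the range of the nodes
    -- by the first disjunct.
    let R : ℕ → ℕ → Prop := fun u v => u = v ∨ ∃ (hu : u < n) (hv : v < n), H.Reachable ⟨u, hu⟩ ⟨v, hv⟩
    have hR : Equivalence R := by
      refine ⟨fun u => Or.inl rfl, ?_, ?_⟩
      · rintro u v (h1 | ⟨hu, hv, h1⟩)
        · exact Or.inl h1.symm
        · exact Or.inr ⟨hv, hu, h1.symm⟩
      · rintro u v w (rfl | ⟨hu, hv, h1⟩) (rfl | ⟨hv', hw, h2⟩)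
        · exact Or.inl rfl
        · exact Or.inr ⟨hv', hw, h2⟩
        · exact Or.inr ⟨hu, hv, h1⟩
        · exact Or.inr ⟨hu, hw, h1.trans h2⟩
    have h1 := (h.heavy hsym θ R hR (fun i hi hc => by
      refine Or.inr ⟨h.b_lt i hi, h.y_lt i hi, SimpleGraph.Adj.reachable ?_⟩
      refine ⟨fun he => h.b_ne_y hi (Fin.mk.inj_iff.1 he), ?_⟩
      have := h.tree_cap ⟨i, by omega⟩
      exact hc.trans this.ge) (n - 1) (by omega)).1 s s.isLt t t.isLt (h.reached_all s.isLt)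
      (h.reached_all t.isLt) (fun he => hst (Fin.ext he)) le_rfl
    rcases h1 with h1 | ⟨_, _, h1⟩
    · exact absurd (Fin.ext h1) hst
    · exact h1
  · obtain ⟨u, v, h1, h2, h3⟩ := exists_edge_ge_maxFlow G h.tree htree hst
    have hne : u ≠ v := h1.ne
    have hcap : h.tree.cap u v = val u v := by
      obtain ⟨i, ⟨rfl, rfl⟩ | ⟨rfl, rfl⟩⟩ := h.exists_of_tree_adj h1
      · rw [h.tree_cap, h.c_eq i (by omega)]
        exact hsym _ (h.y_lt _ (by omega)) _ (h.b_lt _ (by omega))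
      · rw [h.tree.symm, h.tree_cap, h.c_eq i (by omega)]; rfl
    have h4 := (hval u v hne).2
    by_cases hε : 0 ≤ 1 + ε
    · calc (h.tree.maxFlow s t : ℝ) ≤ val u v := by rw [← hcap]; exact_mod_cast h3
        _ ≤ (1 + ε) * G.maxFlow u v := h4
        _ ≤ (1 + ε) * G.maxFlow s t := mul_le_mul_of_nonneg_left (by exact_mod_cast h2) hε
    -- A negative factor would contradict the positive flows of a connected graph.
    · exfalso
      have h5 : (0 : ℝ) < G.maxFlow u v := by exact_mod_cast maxFlow_pos G hG hne
      have h6 : (0 : ℝ) ≤ val u v := by positivity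
      nlinarith

end IsPrim

end MinCutOracle

namespace MinCutOracle

/-! ### Total correctness of structured programs -/

infix:60 " ≺ " => Ex.bin Op.lt
infix:60 " ≐ " => Ex.bin Op.eq

/-! ### Rules for expressions and programs -/

section Ex

variable (w : ℕ) (s : HState) (x : Var) (a b : Ex) (k : ℕ) (f : Bool)

@[simp] theorem Ex.val_var : (Ex.var x).val s = s.v x := rfl
@[simp] theorem Ex.val_lit : (Ex.lit k).val s = k := rfl
@[simp] theorem Ex.val_ofNat [k.AtLeastTwo] : (ofNat(k) : Ex).val s = k := rfl
@[simp] theorem Ex.val_zero : (0 : Ex).val s = 0 := rfl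
@[simp] theorem Ex.val_one : (1 : Ex).val s = 1 := rfl
@[simp] theorem Ex.val_add : (a + b).val s = a.val s + b.val s := rfl
@[simp] theorem Ex.val_sub : (a - b).val s = a.val s - b.val s := rfl
@[simp] theorem Ex.val_mul : (a * b).val s = a.val s * b.val s := rfl
@[simp] theorem Ex.val_div : (a / b).val s = a.val s / b.val s := rfl
@[simp] theorem Ex.val_mod : (a % b).val s = a.val s % b.val s := rfl
@[simp] theorem Ex.val_lt : (a ≺ b).val s = if a.val s < b.val s then 1 else 0 := rfl
@[simp] theorem Ex.val_eq : (a ≐ b).val s = if a.val s = b.val s then 1 else 0 := rfl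
@[simp] theorem Ex.val_ld : (Ex.ld a).val s = s.mem (a.val s) := rfl

@[simp] theorem Ex.fits_var : (Ex.var x).fits w s f ↔ True := Iff.rfl
@[simp] theorem Ex.fits_lit : (Ex.lit k).fits w s f ↔ (f = true → k < 2 ^ w) := Iff.rfl
@[simp] theorem Ex.fits_ofNat [k.AtLeastTwo] :
    (ofNat(k) : Ex).fits w s f ↔ (f = true → k < 2 ^ w) := Iff.rfl
@[simp] theorem Ex.fits_zero : (0 : Ex).fits w s f ↔ True := by
  change (f = true → 0 < 2 ^ w) ↔ True
  simp
@[simp] theorem Ex.fits_one : (1 : Ex).fits w s f ↔ (f = true → 1 < 2 ^ w) := Iff.rfl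
@[simp] theorem Ex.fits_add : (a + b).fits w s f ↔
    a.fits w s false ∧ b.fits w s false ∧ (f = true → a.val s + b.val s < 2 ^ w) := Iff.rfl
@[simp] theorem Ex.fits_mul : (a * b).fits w s f ↔
    a.fits w s false ∧ b.fits w s false ∧ (f = true → a.val s * b.val s < 2 ^ w) := Iff.rfl
@[simp] theorem Ex.fits_sub : (a - b).fits w s f ↔ a.fits w s true ∧ b.fits w s true := Iff.rfl
@[simp] theorem Ex.fits_div : (a / b).fits w s f ↔ a.fits w s true ∧ b.fits w s true := Iff.rfl
@[simp] theorem Ex.fits_mod : (a % b).fits w s f ↔ a.fits w s true ∧ b.fits w s true := Iff.rfl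
@[simp] theorem Ex.fits_lt : (a ≺ b).fits w s f ↔ a.fits w s true ∧ b.fits w s true := Iff.rfl
@[simp] theorem Ex.fits_eq : (a ≐ b).fits w s f ↔ a.fits w s true ∧ b.fits w s true := Iff.rfl
@[simp] theorem Ex.fits_ld : (Ex.ld a).fits w s f ↔ a.fits w s true := Iff.rfl

end Ex

/-- The program does not overflow and ends in a state that satisfies `Q`. -/
def Tri (E : Env) (β : Var → ℕ) (p : HCom) (s : HState) (Q : HState → Prop) : Prop :=
  p.Safe E β s ∧ Q (p.run E s)

section Tri

variable {E : Env} {β : Var → ℕ} {s : HState} {Q : HState → Prop}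

theorem Tri.mono {p : HCom} {R : HState → Prop} (h : Tri E β p s R)
    (h' : ∀ t, R t → p.Frame s t → Q t) : Tri E β p s Q :=
  ⟨h.1, h' _ h.2 (p.frame_run E s)⟩

@[simp] theorem tri_skip : Tri E β .skip s Q ↔ Q s := by simp [Tri, HCom.Safe, HCom.run]
@[simp] theorem tri_asg {x : Var} {e : Ex} :
    Tri E β (x ≔ e) s Q ↔ e.fits E.w s true ∧ Q (s.set x (e.val s)) := Iff.rfl
@[simp] theorem tri_put {a b : Ex} : Tri E β (.put a b) s Q ↔
    (a.fits E.w s true ∧ b.fits E.w s true) ∧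
      Q { s with mem := Function.update s.mem (a.val s) (b.val s) } := Iff.rfl
@[simp] theorem tri_rnd {x : Var} : Tri E β (.rnd x) s Q ↔
    Q { s.set x (s.tape 0) with tape := fun i => s.tape (i + 1) } := by
  simp [Tri, HCom.Safe, HCom.run]
@[simp] theorem tri_prep : Tri E β .prep s Q ↔ Q { s with ready := true } := by
  simp [Tri, HCom.Safe, HCom.run]
@[simp] theorem tri_ask {a b c : Ex} : Tri E β (.ask a b c) s Q ↔
    (a.fits E.w s true ∧ b.fits E.w s true ∧ c.fits E.w s true) ∧
      Q { s with mem := queryMem E s.mem s.ready (a.val s) (b.val s) (c.val s) } := Iff.rfl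
@[simp] theorem tri_seq {p q : HCom} :
    Tri E β (p ⨟ q) s Q ↔ Tri E β p s fun t => Tri E β q t Q := by
  simp [Tri, HCom.Safe, HCom.run, and_assoc]
@[simp] theorem tri_ite {e : Ex} {p q : HCom} : Tri E β (.ite e p q) s Q ↔
    e.fits E.w s true ∧ (e.val s ≠ 0 → Tri E β p s Q) ∧ (e.val s = 0 → Tri E β q s Q) := by
  by_cases h : e.val s = 0 <;> simp [Tri, HCom.Safe, HCom.run, h, and_assoc]
@[simp] theorem tri_lgOf {x : Var} {e : Ex} : Tri E β (.lgOf x e) s Q ↔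
    (e.fits E.w s true ∧ e.val s < 2 ^ E.w ∧ 2 < 2 ^ E.w ∧ lg (e.val s) ≤ β x) ∧
      Q (s.set x (lg (e.val s))) := Iff.rfl

/-- Each iteration also receives the frame of the whole loop from its start, so invariants need only
speak of what the body changes. -/
theorem tri_loop {x y : Var} {p : HCom} (Inv : ℕ → HState → Prop) (hxy : x ≠ y)
    (hx : p.writes x = false) (hy : p.writes y = false) (hw : s.v y < 2 ^ E.w) (hβ : s.v y ≤ β y)
    (h0 : Inv 0 (s.set x 0))
    (hstep : ∀ i t, i < s.v y → t.v x = i → (HCom.loop x y p).Frame s t → Inv i t →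
      Tri E β p t fun u => Inv (i + 1) (u.set x (i + 1)))
    (hQ : ∀ t, t.v x = s.v y → (HCom.loop x y p).Frame s t → Inv (s.v y) t → Q t) :
    Tri E β (.loop x y p) s Q := by
  set f : ℕ → HState := fun i => Nat.rec (motive := fun _ => HState) (s.set x 0)
    (fun i t => (p.run E t).set x (i + 1)) i with hf
  have hfr : ∀ i, (HCom.loop x y p).Frame s (f i) := by
    intro i
    induction i with
    | zero =>
      constructor <;> simp [f, HCom.writes]
      intro z hz _ h; exact absurd h.symm hz
    | succ i ih =>
      have h1 := HCom.frame_run E p (f i)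
      constructor
      · intro z hz
        have h2 := ih.v z hz
        simp only [HCom.writes, Bool.or_eq_false_iff, decide_eq_false_iff_not] at hz
        have : z ≠ x := fun h => hz.1 h.symm
        simpa [f, this] using (h1.v z hz.2).trans h2
      · intro hz; exact (h1.mem hz).trans (ih.mem hz)
      · intro hz; exact (h1.tape hz).trans (ih.tape hz)
      · intro hz; exact (h1.ready hz).trans (ih.ready hz)
  have hfx : ∀ i, (f i).v x = i := by
    intro i; cases i <;> simp [f]
  have hinv : ∀ i ≤ s.v y, Inv i (f i) := by
    intro i
    induction i with
    | zero => intro _; exact h0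
    | succ i ih => intro hi; exact (hstep i (f i) hi (hfx i) (hfr i) (ih (by omega))).2
  refine ⟨⟨hxy, hx, hy, hw, hβ, fun i hi => ?_⟩, ?_⟩
  · exact (hstep i (f i) hi (hfx i) (hfr i) (hinv i hi.le)).1
  · exact hQ (f (s.v y)) (hfx _) (hfr _) (hinv _ le_rfl)

end Tri

/-- The variables that are not modified any more once they have been set up. -/
def Var.isGlobal : Var → Bool
  | .n | .nn | .ell | .K | .H | .L | .B | .Q | .T | .SK | .PW | .INF | .pred => true
  | _ => false

/-- The global variables have the values `g`. -/
def Glob (g : Var → ℕ) (s : HState) : Prop := ∀ z, z.isGlobal = true → s.v z = g z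

/-- The program does not assign to global variables. -/
def HCom.local : HCom → Bool
  | .asg x _ => !x.isGlobal
  | .rnd x => !x.isGlobal
  | .seq p q => p.local && q.local
  | .ite _ p q => p.local && q.local
  | .loop x _ p => !x.isGlobal && p.local
  | .lgOf x _ => !x.isGlobal
  | _ => true

theorem HCom.writes_of_local {p : HCom} (h : p.local = true) {z : Var} (hz : z.isGlobal = true) :
    p.writes z = false := by
  induction p <;> simp_all [HCom.local, HCom.writes] <;> (rintro rfl; simp_all)

theorem Glob.of_frame {g : Var → ℕ} {p : HCom} {s t : HState} (h : Glob g s) (hf : p.Frame s t)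
    (hp : p.local = true) : Glob g t :=
  fun z hz => (hf.v z (p.writes_of_local hp hz)).trans (h z hz)

end MinCutOracle

namespace MinCutOracle

/-! ### The programs -/

namespace Prog

open Var HCom

/-- The entry of the table for the pair `a`, `b`. -/
def tbAt (a b : Ex) : Ex := .ld (H + a * n + b)

/-- The bit of the node `b` in the cut of the node `a` in the current round. -/
def cutAt (a b : Ex) : Ex := .ld (2 * H + (kn + a) * n + b)

/-- The estimate for the cut of the node `a` in the current round. -/
def estAt (a : Ex) : Ex := .ld (3 * H + 1 + kn + a)

/-- Computes the parameters. -/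
def setup (c₀ M : ℕ) : HCom :=
  -- Six rounds at least halve the expected number of unseparated pairs, as (7/8)⁶ ≤ 1/2; `K` rounds
  -- bring it down by the factor n^(c₀+3). The segment length `H` has room for all `K * n` cuts.
  n ≔ .ld 0 ⨟ nn ≔ n * n ⨟ lgOf ell n ⨟ K ≔ .lit (6 * (c₀ + 3)) * ell ⨟ H ≔ nn * (K + 2) ⨟
  -- The memory is organized by multiples of `H`. The table starts at `H`, the cuts at `2 * H`,
  -- their estimates at `3 * H`. The pivot bits, balance flags, cheapest cuts, `sub` values and
  -- levels of a round start at `4 * H`, …, `8 * H`. Marks, keys and parents of Prim's algorithm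
  -- start at `9 * H`, `10 * H`, `11 * H`, the output tree at `12 * H`, the sketch at `16 * H`. The
  -- query program sees only the memory, so `H` is stored in a cell.
  .put (nn + 1) H ⨟
  tot ≔ 0 ⨟ loop i nn (tot ≔ tot + .ld (i + 1)) ⨟
  lgOf L tot ⨟
  -- With precision δ = 1/(60M) the tail exponent Bδ²/1024 becomes exactly (c₀+4)·lg n. The bit
  -- length `L` is taken from the total capacity, as the program does not know `U`.
  B ≔ .lit (1024 * 3600 * M * M * (c₀ + 4)) * ell ⨟ Q ≔ B * L ⨟ T ≔ Q * nn ⨟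
  SK ≔ 16 * H ⨟ PW ≔ SK + 2 * (Q * n) ⨟
  pw ≔ 1 ⨟ loop j L (.put (PW + j) pw ⨟ pw ≔ 2 * pw) ⨟
  -- Each of the `Q` blocks contributes at most 2^L times the square of `n * nn`, so no estimate
  -- reaches this value.
  INF ≔ Q * pw * (n * nn) * (n * nn) + 1 ⨟ pred ≔ n - 1

/-- Computes the sketch. -/
def sketch : HCom :=
  -- A word is drawn in every step, used or not, so the sketch consumes exactly `T` words and step
  -- `t` reads word `t`.
  loop t T (rnd r ⨟ q ≔ t / nn ⨟ i ≔ t % nn ⨟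
    -- Block `q` looks at the bit `q % L` of each capacity. A sign orients the pair, and heads and
    -- tails are counted separately because words are nonnegative.
    .ite (.ld (i + 1) / .ld (PW + q % L) % 2)
      (.ite (r % 2) (x1 ≔ i / n ⨟ x2 ≔ i % n) (x1 ≔ i % n ⨟ x2 ≔ i / n) ⨟
        a ≔ SK + 2 * (q * n + x1) ⨟ .put a (.ld a + 1) ⨟
        a ≔ SK + 2 * (q * n + x2) + 1 ⨟ .put a (.ld a + 1))
      .skip)

/-- The size of the class of `v`. -/
def classSize : HCom := sz ≔ 0 ⨟ loop x n (sz ≔ sz + (tbAt v x ≐ 0))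

/-- The pivot of the class of `v`. -/
def pivot : HCom :=
  ar ≔ r % sz ⨟ cnt ≔ 0 ⨟ p ≔ 0 ⨟
  loop x n (.ite (tbAt v x) .skip (.ite (cnt ≐ ar) (p ≔ x) .skip ⨟ cnt ≔ cnt + 1))

/-- Queries the Min-Cut data structure for `v` and its pivot. -/
def query : HCom :=
  slot ≔ kn + v ⨟ ca ≔ 2 * H + slot * n ⨟
  -- For the pivot itself the name `n`, which is not a node, is queried. The answer is then zero
  -- everywhere and separates nothing.
  .ite (p ≺ v) (lo ≔ p ⨟ hi ≔ v) (lo ≔ v ⨟ hi ≔ p) ⨟ .ite (p ≐ v) (lo ≔ n) .skip ⨟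
  .ask lo hi ca ⨟ f ≔ .ld (ca + p) ⨟ .put (4 * H + v) f

/-- The number of nodes of the class that are on the side of `v`. -/
def sideSize : HCom :=
  sb ≔ 0 ⨟
  loop x n (.ite (tbAt v x) .skip (.ite (.ld (ca + x) ≐ f) .skip (sb ≔ sb + 1))) ⨟
  .put (5 * H + v) (2 * sb ≺ sz + 1)

/-- One block of the sketch of the cut. -/
def sketchBlock : HCom :=
  zp ≔ 0 ⨟ zn ≔ 0 ⨟
  loop x n (.ite (.ld (ca + x)) (zp ≔ zp + .ld (SK + 2 * (q * n + x)) ⨟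
    zn ≔ zn + .ld (SK + 2 * (q * n + x) + 1)) .skip)

/-- The estimate of the capacity of the cut. -/
def estimate (M : ℕ) : HCom :=
  X ≔ 0 ⨟
  loop q Q (sketchBlock ⨟ d ≔ (zp - zn) + (zn - zp) ⨟ X ≔ X + .ld (PW + q % L) * d * d) ⨟
  -- `X` is near 2B times the capacity, as each edge occurs in both orders. Dividing also by 1-δ
  -- with δ = 1/(60M) keeps the estimate from falling below the capacity.
  .ite (p ≐ v) (e ≔ INF) (e ≔ X * .lit (60 * M) / (B * .lit (2 * (60 * M - 1)))) ⨟
  .put (3 * H + 1 + kn + v) e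

/-- The queries of a round. -/
def queries (M : ℕ) : HCom :=
  loop v n (classSize ⨟ pivot ⨟ query ⨟ sideSize ⨟ estimate M)

/-- The cheapest cuts of a round. -/
def argmins : HCom :=
  loop x n (z ≔ x ⨟
    loop v n (.ite (tbAt v x) .skip (.ite (cutAt v x ≐ .ld (4 * H + v)) .skip
      (.ite (estAt v ≺ estAt z) (z ≔ v) .skip))) ⨟
    .put (6 * H + x) z ⨟ .put (8 * H + x) (estAt z))

/-- The last balanced cuts of a round. -/
def subs : HCom :=
  loop x n (s ≔ 0 ⨟
    loop z n (.ite (tbAt z x) .skip (.ite (cutAt z x ≐ .ld (4 * H + z)) .skip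
      (.ite (.ld (5 * H + z)) (.ite (.ld (8 * H + z) ≐ .ld (8 * H + x)) (s ≔ z + 1) .skip)
        .skip))) ⨟
    .put (7 * H + x) s)

/-- The new table. -/
def refine : HCom :=
  loop i nn (.ite (.ld (H + i)) .skip (a ≔ i / n ⨟ b ≔ i % n ⨟
    .ite (.ld (8 * H + a) ≺ .ld (8 * H + b)) (.put (H + i) (kn + .ld (6 * H + a) + 1))
    (.ite (.ld (8 * H + b) ≺ .ld (8 * H + a)) (.put (H + i) (kn + .ld (6 * H + b) + 1))
    (.ite (.ld (7 * H + a) ≺ .ld (7 * H + b)) (.put (H + i) (kn + .ld (7 * H + b)))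
    (.ite (.ld (7 * H + b) ≺ .ld (7 * H + a)) (.put (H + i) (kn + .ld (7 * H + a))) .skip)))))

/-- One round. -/
def round (M : ℕ) : HCom :=
  rnd r ⨟ kn ≔ k * n ⨟ queries M ⨟ argmins ⨟ subs ⨟ refine

/-- All queries and the table of the cheap cuts. -/
def cuts (c₀ M : ℕ) : HCom := setup c₀ M ⨟ sketch ⨟ prep ⨟ loop k K (round M)

/-- The estimate for a pair of nodes. -/
def valAt (a b : Ex) : Ex := .ld (3 * H + tbAt a b)

/-- Prim's algorithm for the estimates. -/
def prim : HCom :=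
  .put (9 * H) 1 ⨟
  loop x n (.put (10 * H + x) (valAt 0 x) ⨟ .put (11 * H + x) 0) ⨟
  loop i pred (
    -- `bk` holds the best key plus one, so that zero means that no candidate has been seen.
    b ≔ 0 ⨟ bk ≔ 0 ⨟
    loop x n (.ite (.ld (9 * H + x)) .skip (.ite (bk ≺ .ld (10 * H + x) + 1)
      (b ≔ x ⨟ bk ≔ .ld (10 * H + x) + 1) .skip)) ⨟
    .put (12 * H + 3 * i) b ⨟ .put (12 * H + 3 * i + 1) (.ld (11 * H + b)) ⨟
    .put (12 * H + 3 * i + 2) (.ld (10 * H + b)) ⨟ .put (9 * H + b) 1 ⨟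
    loop x n (kx ≔ valAt b x ⨟
      .ite (.ld (10 * H + x) ≺ kx) (.put (10 * H + x) kx ⨟ .put (11 * H + x) b) .skip))

/-- The construction of a flow-equivalent tree. -/
def treeProg (c₀ M : ℕ) : HCom := cuts c₀ M ⨟ prim ⨟ out ≔ 12 * H

/-- The construction of the data structure. -/
def dsProg (c₀ M : ℕ) : HCom := cuts c₀ M ⨟ out ≔ 0 ⨟ size ≔ 3 * H

/-- The query program. -/
def queryProg : HCom :=
  -- The variables `out` and `size` are the registers 0 and 1, in which the two query nodes arrive.
  -- Table entries are cut numbers plus one.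
  n ≔ .ld 0 ⨟ H ≔ .ld (n * n + 1) ⨟ out ≔ 2 * H + (.ld (H + out * n + size) - 1) * n

end Prog

/-! ### Verification of one round -/

/-- The relations between the parameters, and their bounds. -/
structure Params (E : Env) (β : Var → ℕ) (M : ℕ) (g : Var → ℕ) : Prop where
  M_pos : 0 < M
  n_eq : E.n = g .n
  answer : ∀ t x, E.answer (g .n) t x = false
  n_pos : 0 < g .n
  nn : g .nn = g .n * g .n
  K_pos : 0 < g .K
  H : g .H = g .nn * (g .K + 2)
  B_pos : 0 < g .B
  L_pos : 0 < g .L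
  Q : g .Q = g .B * g .L
  T : g .T = g .Q * g .nn
  SK : g .SK = 16 * g .H
  PW : g .PW = g .SK + 2 * (g .Q * g .n)
  pred : g .pred = g .n - 1
  lt : ∀ z, z.isGlobal = true → g z < 2 ^ E.w
  le : ∀ z, z.isGlobal = true → g z ≤ β z
  addr : g .PW + g .L + 2 < 2 ^ E.w
  INF : g .INF = g .Q * 2 ^ g .L * (g .n * g .nn) * (g .n * g .nn) + 1
  INF_lt : g .INF * (60 * M) < 2 ^ E.w
  den_lt : g .B * (2 * (60 * M - 1)) < 2 ^ E.w

namespace Params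

variable {E : Env} {β : Var → ℕ} {M : ℕ} {g : Var → ℕ}

theorem n_le_nn (h : Params E β M g) : g .n ≤ g .nn := by
  rw [h.nn]; exact Nat.le_mul_of_pos_left _ h.n_pos

theorem nn_le_H (h : Params E β M g) : 3 * g .nn ≤ g .H := by
  rw [h.H, mul_comm]
  exact Nat.mul_le_mul_left _ (by have := h.K_pos; omega)

theorem kn_le (h : Params E β M g) {k : ℕ} (hk : k < g .K) :
    k * g .n + g .n + 2 * g .nn ≤ g .H := by
  have h1 : (k + 1) * g .n ≤ g .K * g .nn := Nat.mul_le_mul hk h.n_le_nn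
  rw [Nat.succ_mul] at h1
  rw [h.H, Nat.mul_add, Nat.mul_comm (g .nn)]
  omega

theorem slot_le (h : Params E β M g) {k v : ℕ} (hk : k < g .K) (hv : v < g .n) :
    (k * g .n + v) * g .n + g .n + 2 * g .nn ≤ g .H := by
  have h1 : (k + 1) * g .n ≤ g .K * g .n := Nat.mul_le_mul_right _ hk
  rw [Nat.succ_mul] at h1
  have h2 : (k * g .n + v + 1) * g .n ≤ g .K * g .n * g .n := Nat.mul_le_mul_right _ (by omega)
  rw [Nat.succ_mul, Nat.mul_assoc (g .K), ← h.nn] at h2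
  rw [h.H, Nat.mul_add, Nat.mul_comm (g .nn)]
  omega

theorem row_le (h : Params E β M g) {v : ℕ} (hv : v < g .n) : v * g .n + g .n ≤ g .nn := by
  rw [h.nn]
  have := Nat.mul_le_mul_right (g .n) (show v + 1 ≤ g .n from hv)
  linarith

theorem n_mul_nn_lt (h : Params E β M g) : g .n * g .nn < 2 ^ E.w := by
  have h1 : 0 < g .Q := by rw [h.Q]; exact Nat.mul_pos h.B_pos h.L_pos
  have h2 : 0 < g .n * g .nn := Nat.mul_pos h.n_pos (h.n_pos.trans_le h.n_le_nn)
  have h3 : g .n * g .nn ≤ g .Q * 2 ^ g .L * (g .n * g .nn) * (g .n * g .nn) :=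
    Nat.le_mul_of_pos_left _ (Nat.mul_pos (Nat.mul_pos h1 (by positivity)) h2)
  have h4 := h.lt .INF rfl
  rw [h.INF] at h4
  omega

theorem H_le (h : Params E β M g) : 16 * g .H + 2 < 2 ^ E.w := by
  have := h.addr; have := h.PW; have := h.SK; omega

end Params

/-- The distance of two numbers. -/
def absDiff (a b : ℕ) : ℕ := (a - b) + (b - a)

theorem absDiff_lt {a b c : ℕ} (ha : a < c) (hb : b < c) : (a - b) + (b - a) < c := by omega

/-- The sum of `f` over a set of nodes. -/
def sideSum (n : ℕ) (f : ℕ → ℕ) (S : ℕ → Bool) : ℕ := ∑ x ∈ Finset.range n, if S x then f x else 0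

theorem sideSum_le {n m : ℕ} {f : ℕ → ℕ} (h : ∀ x < n, f x ≤ m) (S : ℕ → Bool) :
    sideSum n f S ≤ n * m := by
  unfold sideSum
  refine (Finset.sum_le_card_nsmul _ _ m fun x hx => ?_).trans (by simp)
  split_ifs
  · exact h x (Finset.mem_range.1 hx)
  · exact Nat.zero_le _

/-- The value of the sketch given by the first `m` blocks. -/
def sketchSum (n L : ℕ) (Pf Nf : ℕ → ℕ → ℕ) (S : ℕ → Bool) (m : ℕ) : ℕ :=
  ∑ q ∈ Finset.range m, 2 ^ (q % L) * absDiff (sideSum n (Pf q) S) (sideSum n (Nf q) S) *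
    absDiff (sideSum n (Pf q) S) (sideSum n (Nf q) S)

/-- The estimate that is given by the sketch. -/
def sketchEst (M : ℕ) (g : Var → ℕ) (Pf Nf : ℕ → ℕ → ℕ) (S : ℕ → Bool) : ℕ :=
  sketchSum (g .n) (g .L) Pf Nf S (g .Q) * (60 * M) / (g .B * (2 * (60 * M - 1)))

/-- The memory contains the sketch. -/
structure AtSketch (g : Var → ℕ) (Pf Nf : ℕ → ℕ → ℕ) (mem : ℕ → ℕ) : Prop where
  pos : ∀ q < g .Q, ∀ x < g .n, mem (g .SK + 2 * (q * g .n + x)) = Pf q x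
  neg : ∀ q < g .Q, ∀ x < g .n, mem (g .SK + 2 * (q * g .n + x) + 1) = Nf q x
  pow : ∀ j < g .L, mem (g .PW + j) = 2 ^ j
  pos_le : ∀ q < g .Q, ∀ x < g .n, Pf q x ≤ g .nn
  neg_le : ∀ q < g .Q, ∀ x < g .n, Nf q x ≤ g .nn

/-- The state represents the table of the round `P`. -/
structure AtRound (E : Env) (M : ℕ) (g : Var → ℕ) (Pf Nf : ℕ → ℕ → ℕ) (P : Round) (k : ℕ)
    (s : HState) : Prop where
  glob : Glob g s
  n_eq : P.n = g .n
  ans_eq : P.ans = E.answer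
  est_eq : P.est = fun s t => sketchEst M g Pf Nf (E.answer s t)
  inf_eq : P.inf = g .INF
  cls : IsClassMatrix P.n P.tb
  k_lt : k < g .K
  kn_eq : s.v .kn = k * g .n
  r_eq : s.v .r = P.r
  ready : s.ready = true
  tb : ∀ x < g .n, ∀ y < g .n, s.mem (g .H + x * g .n + y) = P.tb x y
  sk : AtSketch g Pf Nf s.mem

section Round

variable {E : Env} {β : Var → ℕ} {M : ℕ} {g : Var → ℕ} {Pf Nf : ℕ → ℕ → ℕ}

theorem AtRound.of_frame {P : Round} {k : ℕ} {p : HCom} {s t : HState} (h : Params E β M g)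
    (hs : AtRound E M g Pf Nf P k s) (hf : p.Frame s t) (hp : p.local = true)
    (hkn : p.writes .kn = false) (hr : p.writes .r = false) (hprep : p.preps = false)
    (hm : ∀ a, (g .H ≤ a ∧ a < 2 * g .H) ∨ 16 * g .H ≤ a → t.mem a = s.mem a) :
    AtRound E M g Pf Nf P k t := by
  have hSK := h.SK
  have hPW := h.PW
  refine ⟨hs.glob.of_frame hf hp, hs.n_eq, hs.ans_eq, hs.est_eq, hs.inf_eq, hs.cls, hs.k_lt,
    (hf.v _ hkn).trans hs.kn_eq, (hf.v _ hr).trans hs.r_eq, (hf.ready hprep).trans hs.ready,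
    fun x hx y hy => ?_, fun q hq x hx => ?_, fun q hq x hx => ?_, fun j hj => ?_,
    hs.sk.pos_le, hs.sk.neg_le⟩
  · rw [hm]
    · exact hs.tb x hx y hy
    · have := h.row_le hx
      have := h.nn_le_H
      have := h.n_pos
      have := h.n_le_nn
      omega
  · rw [hm _ (by omega)]; exact hs.sk.pos q hq x hx
  · rw [hm _ (by omega)]; exact hs.sk.neg q hq x hx
  · rw [hm _ (by omega)]; exact hs.sk.pow j hj

theorem tri_classSize (h : Params E β M g) {P : Round} {k v : ℕ} {s : HState}
    (hs : AtRound E M g Pf Nf P k s) (hv : s.v .v = v) (hvn : v < g .n) :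
    Tri E β Prog.classSize s fun t => t.v .sz = P.size v := by
  have hn := hs.glob .n rfl
  have hH := hs.glob .H rfl
  have h1 := h.row_le hvn
  have h2 := h.nn_le_H
  have h3 := h.H_le
  simp only [Prog.classSize, tri_seq, tri_asg, Ex.fits_zero, true_and]
  refine tri_loop (fun i u => u.v .sz = Nat.count (fun x => P.tb v x = 0) i) (by decide) rfl rfl
    (by simp [hn]; exact h.lt _ rfl) (by simp [hn]; exact h.le _ rfl) (by simp) ?_ ?_
  · intro i t hi hx hf ht
    have e1 := hf.v .n rfl
    have e2 := hf.v .H rfl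
    have e3 := hf.v .v rfl
    have e4 := hf.mem rfl
    simp [hn, hH, hv] at e1 e2 e3 e4 hi
    have h4 : Nat.count (fun x => P.tb v x = 0) i ≤ i := Nat.count_le _
    have e5 := hs.tb v hvn i hi
    simp [Prog.tbAt, e1, e2, e3, e4, hx, ht, e5, Nat.count_succ]
    refine ⟨by omega, ?_⟩
    split_ifs <;> omega
  · intro t _ _ ht
    simp [hn] at ht
    rw [ht, Round.size, hs.n_eq]

theorem tri_pivot (h : Params E β M g) {P : Round} {k v : ℕ} {s : HState}
    (hs : AtRound E M g Pf Nf P k s) (hv : s.v .v = v) (hvn : v < g .n) (hsz : s.v .sz = P.size v) :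
    Tri E β Prog.pivot s fun t => t.v .p = P.piv v := by
  have hn := hs.glob .n rfl
  have hH := hs.glob .H rfl
  have h1 := h.row_le hvn
  have h2 := h.nn_le_H
  have h3 := h.H_le
  simp [Prog.pivot]
  refine tri_loop (fun i u => u.v .cnt = P.rank v i ∧
      u.v .p = lastOr id (fun x => P.tb v x = 0 ∧ P.rank v x = P.r % P.size v) i)
    (by decide) rfl rfl
    (by simp [hn]; exact h.lt _ rfl) (by simp [hn]; exact h.le _ rfl)
    (by simp [Round.rank, lastOr]) ?_ ?_
  · intro i t hi hx hf ht
    have e1 := hf.v .n rfl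
    have e2 := hf.v .H rfl
    have e3 := hf.v .v rfl
    have e4 := hf.mem rfl
    have e6 := hf.v .ar rfl
    simp [hn, hH, hv, hs.r_eq, hsz] at e1 e2 e3 e4 e6 hi
    have h4 : P.rank v i ≤ i := Nat.count_le _
    have e5 := hs.tb v hvn i hi
    simp [Prog.tbAt, e1, e2, e3, e4, hx, ht.1, ht.2, e5, e6]
    refine ⟨by omega, ?_, ?_⟩
    · intro h5
      simp [Round.rank, Nat.count_succ, h5, lastOr]
    · intro h5
      refine ⟨fun h6 => ⟨by omega, ?_⟩, fun h6 => ⟨by omega, ?_⟩⟩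
      · simp [Round.rank, Nat.count_succ, h5, lastOr] at h6 ⊢
        simp [h6]
      · simp [Round.rank, Nat.count_succ, h5, lastOr] at h6 ⊢
        simp [h6]
  · intro t _ _ ht
    simp [hn] at ht
    rw [ht.2, Round.piv, hs.n_eq]

theorem tri_query (h : Params E β M g) {P : Round} {k v : ℕ} {s : HState}
    (hs : AtRound E M g Pf Nf P k s) (hv : s.v .v = v) (hvn : v < g .n) (hp : s.v .p = P.piv v) :
    Tri E β Prog.query s fun t => t.v .slot = k * g .n + v ∧
      t.v .ca = 2 * g .H + (k * g .n + v) * g .n ∧ t.v .f = (P.bit v (P.piv v)).toNat ∧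
      (∀ x < g .n, t.mem (2 * g .H + (k * g .n + v) * g .n + x) = (P.bit v x).toNat) ∧
      t.mem (4 * g .H + v) = (P.bit v (P.piv v)).toNat ∧
      ∀ a, ¬ (2 * g .H + (k * g .n + v) * g .n ≤ a ∧
          a < 2 * g .H + (k * g .n + v) * g .n + g .n) → a ≠ 4 * g .H + v →
        t.mem a = s.mem a := by
  have hn := hs.glob .n rfl
  have hH := hs.glob .H rfl
  have h2 := h.nn_le_H
  have h3 := h.H_le
  have h4 := h.slot_le hs.k_lt hvn
  have h5 := h.kn_le hs.k_lt
  have h6 := h.n_le_nn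
  have h7 := Round.piv_spec hs.cls (hs.n_eq ▸ hvn : v < P.n)
  have h8 := hs.n_eq
  -- The cases p < v, p = v and p > v differ only in the names that are queried; in each the answer
  -- is the row of bits of `v`.
  have key : ∀ (m : ℕ → ℕ) (lo hi : ℕ), (∀ x < g .n, E.answer lo hi x = P.bit v x) →
      ∀ m', m' = queryMem E m true lo hi (2 * g .H + (k * g .n + v) * g .n) →
      m' (2 * g .H + (k * g .n + v) * g .n + P.piv v) = (P.bit v (P.piv v)).toNat ∧
      (∀ x < g .n, Function.update m' (4 * g .H + v) (P.bit v (P.piv v)).toNat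
        (2 * g .H + (k * g .n + v) * g .n + x) = (P.bit v x).toNat) ∧
      ∀ a, ¬ (2 * g .H + (k * g .n + v) * g .n ≤ a ∧
          a < 2 * g .H + (k * g .n + v) * g .n + g .n) → a ≠ 4 * g .H + v →
        Function.update m' (4 * g .H + v) (P.bit v (P.piv v)).toNat a = m a := by
    rintro m lo hi hb _ rfl
    have hval : ∀ x < g .n, queryMem E m true lo hi (2 * g .H + (k * g .n + v) * g .n)
        (2 * g .H + (k * g .n + v) * g .n + x) = (P.bit v x).toNat := fun x hx => by
      simp only [queryMem, h.n_eq]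
      rw [if_pos (by omega), Nat.add_sub_cancel_left, hb x hx]
      cases P.bit v x <;> rfl
    refine ⟨hval _ (by omega), fun x hx => ?_, fun a ha ha' => ?_⟩
    · rw [Function.update_of_ne (by omega)]; exact hval x hx
    · rw [Function.update_of_ne ha']
      simp only [queryMem, h.n_eq]
      rw [if_neg ha]
  simp [Prog.query, hs.kn_eq, hv, hH, hn, hp, hs.ready]
  refine ⟨by omega, by omega, fun h9 => ⟨fun h10 => absurd h10 (by omega), fun _ => ?_⟩,
    fun h9 => ⟨fun h10 => ?_, fun h10 => ?_⟩⟩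
  · obtain ⟨k1, k2, k3⟩ := key s.mem (P.piv v) v (fun x hx => by
      simp [Round.bit, h9.ne, min_eq_left h9.le, max_eq_right h9.le, hs.ans_eq]) _ rfl
    rw [k1]
    exact ⟨by omega, by omega, rfl, k2, rfl, fun a ha ha' => k3 a (by omega) ha'⟩
  · obtain ⟨k1, k2, k3⟩ := key s.mem (g .n) (P.piv v) (fun x hx => by
      rw [h.answer, Round.bit_of_eq h10]) _ rfl
    rw [k1]
    exact ⟨by omega, by omega, rfl, k2, rfl, fun a ha ha' => k3 a (by omega) ha'⟩
  · obtain ⟨k1, k2, k3⟩ := key s.mem v (P.piv v) (fun x hx => by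
      simp [Round.bit, h10, min_eq_right h9, max_eq_left h9, hs.ans_eq]) _ rfl
    rw [k1]
    exact ⟨by omega, by omega, rfl, k2, rfl, fun a ha ha' => k3 a (by omega) ha'⟩

theorem tri_sideSize (h : Params E β M g) {P : Round} {k v : ℕ} {s : HState}
    (hs : AtRound E M g Pf Nf P k s) (hv : s.v .v = v) (hvn : v < g .n) (hsz : s.v .sz = P.size v)
    (hca : s.v .ca = 2 * g .H + (k * g .n + v) * g .n) (hf : s.v .f = (P.bit v (P.piv v)).toNat)
    (hb : ∀ x < g .n, s.mem (2 * g .H + (k * g .n + v) * g .n + x) = (P.bit v x).toNat) :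
    Tri E β Prog.sideSize s fun t => t.mem = Function.update s.mem (5 * g .H + v)
      (if 2 * P.sideSize v ≤ P.size v then 1 else 0) := by
  have hn := hs.glob .n rfl
  have hH := hs.glob .H rfl
  have h1 := h.row_le hvn
  have h2 := h.nn_le_H
  have h3 := h.H_le
  have h4 := h.slot_le hs.k_lt hvn
  have h6 := h.n_le_nn
  simp [Prog.sideSize]
  refine tri_loop (fun i u => u.v .sb = Nat.count (fun x => P.tb v x = 0 ∧ P.side v x) i)
    (by decide) rfl rfl
    (by simp [hn]; exact h.lt _ rfl) (by simp [hn]; exact h.le _ rfl) (by simp) ?_ ?_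
  · intro i t hi hx hfr ht
    have e1 := hfr.v .n rfl
    have e2 := hfr.v .H rfl
    have e3 := hfr.v .v rfl
    have e4 := hfr.mem rfl
    have e5 := hfr.v .ca rfl
    have e6 := hfr.v .f rfl
    simp [hn, hH, hv, hca, hf] at e1 e2 e3 e4 e5 e6 hi
    have h8 : Nat.count (fun x => P.tb v x = 0 ∧ P.side v x) i ≤ i := Nat.count_le _
    have e7 := hs.tb v hvn i hi
    simp [Prog.tbAt, e1, e2, e3, e4, hx, ht, e5, e6, e7, hb i hi]
    have hside : ((P.bit v i).toNat = (P.bit v (P.piv v)).toNat) ↔ ¬ P.side v i := by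
      simp only [Round.side, not_not]
      cases P.bit v i <;> cases P.bit v (P.piv v) <;> simp
    rw [hside]
    refine ⟨by omega, ?_, ?_⟩
    · intro h5
      simp [Nat.count_succ, h5]
    · intro h5
      refine ⟨by omega, fun h6 => ?_, fun h6 => ⟨by omega, ?_⟩⟩
      · simp [Nat.count_succ, h6]
      · simp [Nat.count_succ, h5, h6]
  · intro t _ hfr ht
    have e2 := hfr.v .H rfl
    have e3 := hfr.v .v rfl
    have e4 := hfr.mem rfl
    have e5 := hfr.v .sz rfl
    have e6 : P.sideSize v = Nat.count (fun x => P.tb v x = 0 ∧ P.side v x) (g .n) := by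
      rw [← hs.n_eq]; rfl
    have h7 : P.sideSize v ≤ g .n := by rw [e6]; exact Nat.count_le _
    have h8 : P.size v ≤ g .n := by rw [← hs.n_eq]; exact Nat.count_le _
    simp [hH, hv, hn, hsz, ← e6] at e2 e3 e4 e5 ht
    simp [e2, e3, e4, e5, ht]
    omega

theorem tri_sketchBlock (h : Params E β M g) {S : ℕ → Bool} {c q : ℕ} {s : HState}
    (hg : Glob g s) (hs : AtSketch g Pf Nf s.mem) (hc : s.v .ca = c) (hcw : c + g .n < 2 ^ E.w)
    (hb : ∀ x < g .n, s.mem (c + x) = (S x).toNat) (hq : s.v .q = q) (hqQ : q < g .Q) :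
    Tri E β Prog.sketchBlock s fun t => t.v .zp = sideSum (g .n) (Pf q) S ∧
      t.v .zn = sideSum (g .n) (Nf q) S := by
  have hn := hg .n rfl
  have hSK := hg .SK rfl
  have h1 : q * g .n + g .n ≤ g .Q * g .n := by
    have := Nat.mul_le_mul_right (g .n) (show q + 1 ≤ g .Q from hqQ)
    linarith
  have h2 := h.PW
  have h3 := h.addr
  have h4 := h.n_mul_nn_lt
  simp [Prog.sketchBlock]
  refine tri_loop (fun i u => u.v .zp = sideSum i (Pf q) S ∧ u.v .zn = sideSum i (Nf q) S)
    (by decide) rfl rfl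
    (by simp [hn]; exact h.lt _ rfl) (by simp [hn]; exact h.le _ rfl) (by simp [sideSum]) ?_ ?_
  · intro i t hi hx hfr ht
    have e1 := hfr.v .n rfl
    have e2 := hfr.v .SK rfl
    have e3 := hfr.v .ca rfl
    have e4 := hfr.mem rfl
    have e5 := hfr.v .q rfl
    simp [hn, hSK, hc, hq] at e1 e2 e3 e4 e5 hi
    have h5 : ∀ f : ℕ → ℕ, (∀ x < g .n, f x ≤ g .nn) → sideSum (i + 1) f S < 2 ^ E.w := by
      intro f hf
      have h6 := sideSum_le (n := i + 1) (m := g .nn) (fun x hx => hf x (by omega)) S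
      have h7 := Nat.mul_le_mul_right (g .nn) (show i + 1 ≤ g .n from hi)
      omega
    have h6 : ∀ f, sideSum (i + 1) f S = sideSum i f S + if S i then f i else 0 := fun f =>
      Finset.sum_range_succ _ _
    have h7 := h5 _ (hs.pos_le q hqQ)
    have h8 := h5 _ (hs.neg_le q hqQ)
    rw [h6] at h7 h8
    simp [e1, e2, e3, e4, hx, ht.1, ht.2, e5, hb i hi, hs.pos q hqQ i hi, hs.neg q hqQ i hi, h6]
    refine ⟨by omega, ?_, ?_⟩
    · intro h9
      simp [h9] at h7 h8 ⊢
      exact ⟨⟨by omega, h7⟩, by omega, h8⟩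
    · intro h9
      simp [h9]
  · intro t _ _ ht
    simpa [hn] using ht

theorem sketchSum_le (h : Params E β M g) (hP : ∀ q < g .Q, ∀ x < g .n, Pf q x ≤ g .nn)
    (hN : ∀ q < g .Q, ∀ x < g .n, Nf q x ≤ g .nn) (S : ℕ → Bool) (m : ℕ) (hm : m ≤ g .Q) :
    sketchSum (g .n) (g .L) Pf Nf S m < g .INF := by
  have h1 : sketchSum (g .n) (g .L) Pf Nf S m ≤
      m * (2 ^ g .L * (g .n * g .nn) * (g .n * g .nn)) := by
    unfold sketchSum
    refine (Finset.sum_le_card_nsmul _ _ (2 ^ g .L * (g .n * g .nn) * (g .n * g .nn))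
      fun q hq => ?_).trans (by simp)
    have hq : q < g .Q := by have := Finset.mem_range.1 hq; omega
    have h3 := sideSum_le (hP q hq) S
    have h4 := sideSum_le (hN q hq) S
    have h5 : absDiff (sideSum (g .n) (Pf q) S) (sideSum (g .n) (Nf q) S) ≤ g .n * g .nn := by
      unfold absDiff; omega
    have h6 : 2 ^ (q % g .L) ≤ 2 ^ g .L :=
      Nat.pow_le_pow_right (by norm_num) (Nat.mod_lt _ h.L_pos).le
    gcongr
  have h2 := Nat.mul_le_mul_right (2 ^ g .L * (g .n * g .nn) * (g .n * g .nn)) hm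
  rw [h.INF, Nat.lt_succ_iff]
  refine h1.trans (h2.trans_eq ?_)
  ring

theorem tri_estimate (h : Params E β M g) {P : Round} {k v : ℕ} {s : HState}
    (hs : AtRound E M g Pf Nf P k s) (hv : s.v .v = v) (hvn : v < g .n) (hp : s.v .p = P.piv v)
    (hca : s.v .ca = 2 * g .H + (k * g .n + v) * g .n)
    (hb : ∀ x < g .n, s.mem (2 * g .H + (k * g .n + v) * g .n + x) = (P.bit v x).toNat) :
    Tri E β (Prog.estimate M) s fun t => t.mem = Function.update s.mem
      (3 * g .H + 1 + k * g .n + v) (P.e v) := by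
  have hn := hs.glob .n rfl
  have h2 := h.nn_le_H
  have h3 := h.H_le
  have h4 := h.slot_le hs.k_lt hvn
  have h5 := h.kn_le hs.k_lt
  have h6 := h.n_le_nn
  have hM := h.M_pos
  simp [Prog.estimate]
  refine tri_loop (fun i u => u.v .X = sketchSum (g .n) (g .L) Pf Nf (P.bit v) i)
    (by decide) rfl rfl
    (by simp [hs.glob .Q rfl]; exact h.lt _ rfl) (by simp [hs.glob .Q rfl]; exact h.le _ rfl)
    (by simp [sketchSum]) ?_ ?_
  · intro i t hi hx hfr ht
    have hg : Glob g t := Glob.of_frame (s := s.set .X 0)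
      (fun z hz => by rw [HState.set_v, if_neg (by rintro rfl; simp [Var.isGlobal] at hz)]
                      exact hs.glob z hz) hfr rfl
    have e3 := hfr.v .ca rfl
    have e4 := hfr.mem rfl
    simp [hca, hs.glob .Q rfl] at e3 e4 hi
    rw [tri_seq]
    refine (tri_sketchBlock h hg (Pf := Pf) (Nf := Nf) (S := P.bit v) (by rw [e4]; exact hs.sk) e3
      (by omega) (by rw [e4]; exact hb) hx hi).mono fun u hu hfu => ?_
    have d1 := (hfu.v .PW rfl).trans (hg .PW rfl)
    have d2 := (hfu.v .L rfl).trans (hg .L rfl)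
    have d3 := (hfu.v .X rfl).trans ht
    have d4 := (hfu.v .q rfl).trans hx
    have d5 := (hfu.mem rfl).trans e4
    have h7 := Nat.mod_lt i h.L_pos
    have h8 := h.addr
    have h9 := sketchSum_le h hs.sk.pos_le hs.sk.neg_le (P.bit v) (i + 1) hi
    have h10 := h.lt .INF rfl
    rw [sketchSum, Finset.sum_range_succ, ← sketchSum, absDiff] at h9
    have h11 := sideSum_le (hs.sk.pos_le i hi) (P.bit v)
    have h12 := sideSum_le (hs.sk.neg_le i hi) (P.bit v)
    have h13 := h.INF
    have h14 := h.n_mul_nn_lt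
    simp only [tri_asg, tri_seq, Ex.fits_add, Ex.fits_mul, Ex.fits_sub, Ex.fits_mod, Ex.fits_ld,
      Ex.fits_var, Ex.val_add, Ex.val_mul, Ex.val_sub, Ex.val_mod, Ex.val_ld, Ex.val_var,
      HState.set_v, HState.set_mem, reduceCtorEq, if_false, if_true, true_and, and_true,
      d1, d2, d3, d4, d5, hu.1, hu.2, hs.sk.pow _ h7, forall_const, Bool.false_eq_true, false_imp_iff]
    refine ⟨absDiff_lt (h11.trans_lt h14) (h12.trans_lt h14), ⟨?_, h9.trans h10⟩, ?_⟩
    · clear h9 h13 h11 h12 h14; omega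
    · rw [sketchSum, sketchSum, Finset.sum_range_succ, absDiff]
  · intro t _ hfr ht
    have hg : Glob g t := Glob.of_frame (s := s.set .X 0)
      (fun z hz => by rw [HState.set_v, if_neg (by rintro rfl; simp [Var.isGlobal] at hz)]
                      exact hs.glob z hz) hfr rfl
    have d1 := hg .H rfl
    have d2 := hg .INF rfl
    have d3 := hg .B rfl
    have d4 := hfr.v .v rfl
    have d5 := hfr.mem rfl
    have d6 := hfr.v .p rfl
    have d7 := hfr.v .kn rfl
    simp [hv, hp, hs.kn_eq, hs.glob .Q rfl] at d4 d5 d6 d7 ht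
    have h7 := sketchSum_le h hs.sk.pos_le hs.sk.neg_le (P.bit v) _ le_rfl
    have h8 := h.INF_lt
    have h9 := h.den_lt
    have h10 := Nat.mul_le_mul_right (60 * M) h7.le
    simp [d1, d2, d3, d4, d5, d6, d7, ht]
    refine ⟨fun h15 => ⟨by omega, ?_⟩, fun h15 => ⟨⟨h10.trans_lt h8, h9⟩, by omega, ?_⟩⟩
    · rw [Round.e, if_pos h15, hs.inf_eq]
    · rw [Round.e, if_neg h15]
      have : E.answer (min (P.piv v) v) (max (P.piv v) v) = P.bit v := by
        funext x; simp [Round.bit, h15, hs.ans_eq]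
      simp only [hs.est_eq, sketchEst, this]

end Round

end MinCutOracle

namespace MinCutOracle

/-! ### The phases of a round: queries, levels, records, new table -/

section Round

variable {E : Env} {β : Var → ℕ} {M : ℕ} {g : Var → ℕ} {Pf Nf : ℕ → ℕ → ℕ}

theorem AtRound.of_frame' {P : Round} {k : ℕ} {p : HCom} {s t : HState} (h : Params E β M g)
    (hs : AtRound E M g Pf Nf P k s) (hf : p.Frame s t) (hp : p.local = true)
    (hkn : p.writes .kn = false) (hr : p.writes .r = false) (hprep : p.preps = false)
    (hm : p.writesMem = false) : AtRound E M g Pf Nf P k t :=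
  hs.of_frame h hf hp hkn hr hprep fun a _ => by rw [hf.mem hm]

/-- The memory contains the results of the query for `v` in the round `k`. -/
structure SlotAt (g : Var → ℕ) (P : Round) (k v : ℕ) (mem : ℕ → ℕ) : Prop where
  cut : ∀ x < g .n, mem (2 * g .H + (k * g .n + v) * g .n + x) = (P.bit v x).toNat
  est : mem (3 * g .H + 1 + k * g .n + v) = P.e v
  piv : mem (4 * g .H + v) = (P.bit v (P.piv v)).toNat
  good : mem (5 * g .H + v) = if 2 * P.sideSize v ≤ P.size v then 1 else 0

theorem SlotAt.congr {P : Round} {k v : ℕ} {m m' : ℕ → ℕ} (h : SlotAt g P k v m)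
    (h1 : ∀ x < g .n, m' (2 * g .H + (k * g .n + v) * g .n + x) =
      m (2 * g .H + (k * g .n + v) * g .n + x))
    (h2 : m' (3 * g .H + 1 + k * g .n + v) = m (3 * g .H + 1 + k * g .n + v))
    (h3 : m' (4 * g .H + v) = m (4 * g .H + v)) (h4 : m' (5 * g .H + v) = m (5 * g .H + v)) :
    SlotAt g P k v m' :=
  ⟨fun x hx => (h1 x hx).trans (h.cut x hx), h2.trans h.est, h3.trans h.piv, h4.trans h.good⟩

/-- The cells that the queries of round `k` do not change. -/
def Untouched (g : Var → ℕ) (k a : ℕ) : Prop :=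
  a < 2 * g .H + k * g .n * g .n ∨
  (2 * g .H + (k + 1) * g .n * g .n ≤ a ∧ a < 3 * g .H + 1 + k * g .n) ∨
  (3 * g .H + 1 + (k + 1) * g .n ≤ a ∧ a < 4 * g .H) ∨ 6 * g .H ≤ a

theorem tri_queryBody (h : Params E β M g) {P : Round} {k v : ℕ} {s : HState}
    (hs : AtRound E M g Pf Nf P k s) (hv : s.v .v = v) (hvn : v < g .n) :
    Tri E β (Prog.classSize ⨟ Prog.pivot ⨟ Prog.query ⨟ Prog.sideSize ⨟ Prog.estimate M) s
      fun t => SlotAt g P k v t.mem ∧ ∀ a, ¬ (2 * g .H + (k * g .n + v) * g .n ≤ a ∧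
          a < 2 * g .H + (k * g .n + v) * g .n + g .n) → a ≠ 3 * g .H + 1 + k * g .n + v →
          a ≠ 4 * g .H + v → a ≠ 5 * g .H + v → t.mem a = s.mem a := by
  have h2 := h.nn_le_H
  have h3 := h.H_le
  have h4 := h.slot_le hs.k_lt hvn
  have h5 := h.kn_le hs.k_lt
  have h6 := h.n_le_nn
  rw [tri_seq]
  refine (tri_classSize h hs hv hvn).mono fun t1 r1 f1 => ?_
  have s1 := hs.of_frame' h f1 rfl rfl rfl rfl rfl
  have v1 := (f1.v .v rfl).trans hv
  rw [tri_seq]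
  refine (tri_pivot h s1 v1 hvn r1).mono fun t2 r2 f2 => ?_
  have s2 := s1.of_frame' h f2 rfl rfl rfl rfl rfl
  have v2 := (f2.v .v rfl).trans v1
  have z2 := (f2.v .sz rfl).trans r1
  have m2 : t2.mem = s.mem := (f2.mem rfl).trans (f1.mem rfl)
  rw [tri_seq]
  refine (tri_query h s2 v2 hvn r2).mono fun t3 r3 f3 => ?_
  obtain ⟨-, r3b, r3c, r3d, r3e, r3f⟩ := r3
  have s3 := s2.of_frame h f3 rfl rfl rfl rfl fun a ha => r3f a (by omega) (by omega)
  have v3 := (f3.v .v rfl).trans v2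
  rw [tri_seq]
  refine (tri_sideSize h s3 v3 hvn ((f3.v .sz rfl).trans z2) r3b r3c r3d).mono fun t4 r4 f4 => ?_
  have s4 := s3.of_frame h f4 rfl rfl rfl rfl fun a ha => by
    rw [r4, Function.update_of_ne (by omega)]
  have v4 := (f4.v .v rfl).trans v3
  have c4 : ∀ x < g .n, t4.mem (2 * g .H + (k * g .n + v) * g .n + x) = (P.bit v x).toNat :=
    fun x hx => by rw [r4, Function.update_of_ne (by omega)]; exact r3d x hx
  refine (tri_estimate h s4 v4 hvn ((f4.v .p rfl).trans ((f3.v .p rfl).trans r2))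
    ((f4.v .ca rfl).trans r3b) c4).mono fun t5 r5 f5 => ?_
  refine ⟨⟨fun x hx => ?_, ?_, ?_, ?_⟩, fun a h7 h8 h9 h10 => ?_⟩
  · rw [r5, Function.update_of_ne (by omega)]; exact c4 x hx
  · rw [r5, Function.update_self]
  · rw [r5, Function.update_of_ne (by omega), r4, Function.update_of_ne (by omega)]; exact r3e
  · rw [r5, Function.update_of_ne (by omega), r4, Function.update_self]
  · rw [r5, Function.update_of_ne h8, r4, Function.update_of_ne h10, r3f a h7 h9, m2]

/-- The cells written for different nodes are disjoint, so results already stored survive; the rows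
of earlier rounds are untouched. -/
theorem tri_queries (h : Params E β M g) {P : Round} {k : ℕ} {s : HState}
    (hs : AtRound E M g Pf Nf P k s) :
    Tri E β (Prog.queries M) s fun t => (∀ v < g .n, SlotAt g P k v t.mem) ∧
      ∀ a, Untouched g k a → t.mem a = s.mem a := by
  have hn := hs.glob .n rfl
  have h2 := h.nn_le_H
  have h5 := h.kn_le hs.k_lt
  have h6 := h.n_le_nn
  have h7 : (k + 1) * g .n * g .n = k * g .n * g .n + g .nn := by rw [h.nn]; ring
  have h8 : (k + 1) * g .n = k * g .n + g .n := Nat.succ_mul _ _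
  refine tri_loop (fun i u => (∀ v < i, SlotAt g P k v u.mem) ∧
      ∀ a, Untouched g k a → u.mem a = s.mem a) (by decide) rfl rfl
    (by simp [hn]; exact h.lt _ rfl) (by simp [hn]; exact h.le _ rfl) (by simp) ?_ ?_
  · rintro i t hi hx hfr ⟨ht1, ht2⟩
    rw [hn] at hi
    have h9 := h.slot_le hs.k_lt hi
    have st := hs.of_frame h hfr rfl rfl rfl rfl fun a ha => ht2 a (by unfold Untouched; omega)
    have h10 := h.row_le hi
    have e1 : (k * g .n + i) * g .n = k * g .n * g .n + i * g .n := Nat.add_mul _ _ _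
    refine (tri_queryBody h st hx hi).mono fun u hu _ => ⟨fun v hv => ?_, fun a ha => ?_⟩
    · rcases Nat.lt_succ_iff_lt_or_eq.1 hv with h11 | h11
      · have e2 : (k * g .n + v) * g .n = k * g .n * g .n + v * g .n := Nat.add_mul _ _ _
        have h12 : v * g .n + g .n ≤ i * g .n := by
          have := Nat.mul_le_mul_right (g .n) (show v + 1 ≤ i from h11)
          rwa [Nat.succ_mul] at this
        refine (ht1 v h11).congr (fun x hx => ?_) ?_ ?_ ?_ <;>
          exact hu.2 _ (by omega) (by omega) (by omega) (by omega)
      · subst h11; exact hu.1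
    · have h11 := ht2 a ha
      unfold Untouched at ha
      simp only [HState.set_mem]
      rw [hu.2 a (by omega) (by omega) (by omega) (by omega), h11]
  · rintro t _ _ ⟨ht1, ht2⟩
    exact ⟨by rwa [hn] at ht1, ht2⟩

theorem tri_argmins (h : Params E β M g) {P : Round} {k : ℕ} {s : HState}
    (hs : AtRound E M g Pf Nf P k s) (hsl : ∀ v < g .n, SlotAt g P k v s.mem) :
    Tri E β Prog.argmins s fun t => (∀ x < g .n, t.mem (6 * g .H + x) = P.arg x ∧
        t.mem (8 * g .H + x) = P.best x) ∧
      ∀ a, (a < 6 * g .H ∨ (7 * g .H ≤ a ∧ a < 8 * g .H) ∨ 9 * g .H ≤ a) →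
        t.mem a = s.mem a := by
  have hn := hs.glob .n rfl
  have hH := hs.glob .H rfl
  have hkn := hs.kn_eq
  have h2 := h.nn_le_H
  have h3 := h.H_le
  have h5 := h.kn_le hs.k_lt
  have h6 := h.n_le_nn
  refine tri_loop (fun i u => (∀ x < i, u.mem (6 * g .H + x) = P.arg x ∧
        u.mem (8 * g .H + x) = P.best x) ∧
      ∀ a, (a < 6 * g .H ∨ (7 * g .H ≤ a ∧ a < 8 * g .H) ∨ 9 * g .H ≤ a) →
        u.mem a = s.mem a) (by decide) rfl rfl
    (by simp [hn]; exact h.lt _ rfl) (by simp [hn]; exact h.le _ rfl) (by simp) ?_ ?_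
  · rintro i t hi hx hfr ⟨ht1, ht2⟩
    have c1 := (hfr.v .n rfl).trans hn
    have c2 := (hfr.v .H rfl).trans hH
    have c3 := (hfr.v .kn rfl).trans hkn
    rw [hn] at hi
    rw [tri_seq, tri_asg, tri_seq]
    refine ⟨trivial, ?_⟩
    refine tri_loop (fun j u => u.v .z = P.argAux i j) (by decide) rfl rfl
      (by simp [c1]; exact h.lt _ rfl) (by simp [c1]; exact h.le _ rfl)
      (by simp [hx, Round.argAux]) ?_ ?_
    · intro j u hj hv hfu hz
      have e1 := hfu.v .n rfl
      have e2 := hfu.v .H rfl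
      have e3 := hfu.v .kn rfl
      have e4 := hfu.mem rfl
      have e5 := hfu.v .x rfl
      simp [c1, c2, c3, hx] at e1 e2 e3 e4 e5 hj
      have h9 := h.slot_le hs.k_lt hj
      have h10 := h.row_le hj
      have hslj := hsl j hj
      have hz1 := (Round.argAux_spec hs.cls (hs.n_eq.symm ▸ hi) j (by rw [hs.n_eq]; omega)).1.1
      rw [hs.n_eq] at hz1
      have m1 := (ht2 _ (by omega)).trans (hs.tb j hj i hi)
      have m2 := (ht2 _ (by omega)).trans (hslj.cut i hi)
      have m3 := (ht2 _ (by omega)).trans hslj.piv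
      have m4 := (ht2 _ (by omega)).trans hslj.est
      have m5 := (ht2 _ (by omega)).trans (hsl _ hz1).est
      have hside : ((P.bit j i).toNat = (P.bit j (P.piv j)).toNat) ↔ ¬ P.side j i := by
        simp only [Round.side, not_not]
        cases P.bit j i <;> cases P.bit j (P.piv j) <;> simp
      simp [Prog.tbAt, Prog.cutAt, Prog.estAt, e1, e2, e3, e4, e5, hv, hz, m1, m2, m3, m4, m5,
        hside, Round.argAux]
      refine ⟨by omega, fun h11 => by simp [h11], fun h11 => ⟨⟨by omega, by omega⟩,
        fun h12 => by simp [h12], fun h12 => ⟨⟨by omega, by omega⟩, fun h13 => ?_, fun h13 => ?_⟩⟩⟩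
      · simp [h11, h12, h13]
      · simp [h13.not_gt]
    · intro u _ hfu hz
      have e1 := hfu.v .n rfl
      have e2 := hfu.v .H rfl
      have e3 := hfu.v .kn rfl
      have e4 := hfu.mem rfl
      have e5 := hfu.v .x rfl
      simp [c1, c2, c3, hx] at e1 e2 e3 e4 e5 hz
      have hz' : u.v .z = P.arg i := by rw [hz, Round.arg, hs.n_eq]
      have hz1 := (Round.argAux_spec hs.cls (hs.n_eq.symm ▸ hi) P.n le_rfl).1.1
      rw [← Round.arg, hs.n_eq] at hz1
      have m5 := (ht2 _ (by omega)).trans (hsl _ hz1).est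
      simp [Prog.estAt, e2, e3, e4, e5, hz']
      rw [Function.update_of_ne (by omega), m5]
      refine ⟨by omega, ⟨by omega, by omega⟩, fun x hxi => ?_, fun a ha => ?_⟩
      · rcases Nat.lt_or_eq_of_le hxi with h11 | h11
        · rw [Function.update_of_ne (by omega), Function.update_of_ne (by omega),
            Function.update_of_ne (by omega), Function.update_of_ne (by omega)]
          exact ht1 x h11
        · subst h11
          rw [Function.update_of_ne (by omega), Function.update_self, Function.update_self]
          exact ⟨rfl, rfl⟩
      · rw [Function.update_of_ne (by omega), Function.update_of_ne (by omega)]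
        exact ht2 a ha
  · rintro t _ _ ⟨ht1, ht2⟩
    exact ⟨by rwa [hn] at ht1, ht2⟩

theorem tri_subs (h : Params E β M g) {P : Round} {k : ℕ} {s : HState}
    (hs : AtRound E M g Pf Nf P k s) (hsl : ∀ v < g .n, SlotAt g P k v s.mem)
    (hbest : ∀ x < g .n, s.mem (8 * g .H + x) = P.best x) :
    Tri E β Prog.subs s fun t => (∀ x < g .n, t.mem (7 * g .H + x) = P.sub x) ∧
      ∀ a, (a < 7 * g .H ∨ 8 * g .H ≤ a) → t.mem a = s.mem a := by
  have hn := hs.glob .n rfl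
  have hH := hs.glob .H rfl
  have hkn := hs.kn_eq
  have h2 := h.nn_le_H
  have h3 := h.H_le
  have h5 := h.kn_le hs.k_lt
  have h6 := h.n_le_nn
  refine tri_loop (fun i u => (∀ x < i, u.mem (7 * g .H + x) = P.sub x) ∧
      ∀ a, (a < 7 * g .H ∨ 8 * g .H ≤ a) → u.mem a = s.mem a) (by decide) rfl rfl
    (by simp [hn]; exact h.lt _ rfl) (by simp [hn]; exact h.le _ rfl) (by simp) ?_ ?_
  · rintro i t hi hx hfr ⟨ht1, ht2⟩
    have c1 := (hfr.v .n rfl).trans hn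
    have c2 := (hfr.v .H rfl).trans hH
    have c3 := (hfr.v .kn rfl).trans hkn
    rw [hn] at hi
    have m6 := (ht2 _ (by omega)).trans (hbest i hi)
    simp only [tri_seq, tri_asg, Ex.fits_zero, true_and]
    refine tri_loop (fun j u => u.v .s = lastOr Nat.succ (fun z => P.tb z i = 0 ∧ P.side z i ∧
      2 * P.sideSize z ≤ P.size z ∧ P.best z = P.best i) j) (by decide) rfl rfl
      (by simp [c1]; exact h.lt _ rfl) (by simp [c1]; exact h.le _ rfl)
      (by simp [lastOr]) ?_ ?_
    · intro j u hj hv hfu hz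
      have e1 := hfu.v .n rfl
      have e2 := hfu.v .H rfl
      have e3 := hfu.v .kn rfl
      have e4 := hfu.mem rfl
      have e5 := hfu.v .x rfl
      simp [c1, c2, c3, hx] at e1 e2 e3 e4 e5 hj
      have h9 := h.slot_le hs.k_lt hj
      have h10 := h.row_le hj
      have hslj := hsl j hj
      have m1 := (ht2 _ (by omega)).trans (hs.tb j hj i hi)
      have m2 := (ht2 _ (by omega)).trans (hslj.cut i hi)
      have m3 := (ht2 _ (by omega)).trans hslj.piv
      have m4 := (ht2 _ (by omega)).trans hslj.good
      have m5 := (ht2 _ (by omega)).trans (hbest j hj)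
      have hside : ((P.bit j i).toNat = (P.bit j (P.piv j)).toNat) ↔ ¬ P.side j i := by
        simp only [Round.side, not_not]
        cases P.bit j i <;> cases P.bit j (P.piv j) <;> simp
      simp [Prog.tbAt, Prog.cutAt, e1, e2, e3, e4, e5, hv, hz, m1, m2, m3, m4, m5, m6,
        hside, lastOr]
      refine ⟨by omega, fun h11 => by simp [h11], fun h11 => ⟨⟨by omega, by omega⟩,
        fun h12 => by simp [h12], fun h12 => ⟨by omega, fun h13 => ⟨⟨by omega, by omega⟩,
        fun h14 => ⟨by omega, ?_⟩, fun h14 => ?_⟩, fun h13 => ?_⟩⟩⟩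
      · simp [h11, h12, h13, h14]
      · simp [h14]
      · simp [h13.not_ge]
    · intro u _ hfu hz
      have e2 := hfu.v .H rfl
      have e4 := hfu.mem rfl
      have e5 := hfu.v .x rfl
      simp [c1, c2, hx] at e2 e4 e5 hz
      have hz' : u.v .s = P.sub i := by rw [hz, Round.sub, hs.n_eq]
      simp [e2, e4, e5, hz']
      refine ⟨by omega, fun x hxi => ?_, fun a ha => ?_⟩
      · rcases Nat.lt_or_eq_of_le hxi with h11 | h11
        · rw [Function.update_of_ne (by omega)]
          exact ht1 x h11
        · subst h11
          rw [Function.update_self]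
      · rw [Function.update_of_ne (by omega)]
        exact ht2 a ha
  · rintro t _ _ ⟨ht1, ht2⟩
    exact ⟨by rwa [hn] at ht1, ht2⟩

theorem Round.sub_le {P : Round} (x : ℕ) : P.sub x ≤ P.n := by
  rcases lastOr_spec Nat.succ (fun z => P.tb z x = 0 ∧ P.side z x ∧
    2 * P.sideSize z ≤ P.size z ∧ P.best z = P.best x) P.n with ⟨y, hy, -, hy5, -⟩ | ⟨-, h2⟩
  · have : P.sub x = y + 1 := hy5
    omega
  · have : P.sub x = 0 := h2
    omega

/-- The table can be rewritten in place: a new entry depends on the old table only through the same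
entry, and everything else was stored in other segments by the previous phases. -/
theorem tri_refine (h : Params E β M g) {P : Round} {k : ℕ} {s : HState}
    (hs : AtRound E M g Pf Nf P k s)
    (harg : ∀ x < g .n, s.mem (6 * g .H + x) = P.arg x)
    (hbest : ∀ x < g .n, s.mem (8 * g .H + x) = P.best x)
    (hsub : ∀ x < g .n, s.mem (7 * g .H + x) = P.sub x) :
    Tri E β Prog.refine s fun t =>
      (∀ x < g .n, ∀ y < g .n, t.mem (g .H + x * g .n + y) = P.next (k * g .n) x y) ∧
      ∀ a, (a < g .H ∨ 2 * g .H ≤ a) → t.mem a = s.mem a := by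
  have hn := hs.glob .n rfl
  have hH := hs.glob .H rfl
  have hnn := hs.glob .nn rfl
  have hkn := hs.kn_eq
  have h2 := h.nn_le_H
  have h3 := h.H_le
  have h5 := h.kn_le hs.k_lt
  have h6 := h.n_le_nn
  have hnp := h.n_pos
  refine tri_loop (fun i u => (∀ j < i, u.mem (g .H + j) =
        P.next (k * g .n) (j / g .n) (j % g .n)) ∧
      ∀ a, (a < g .H ∨ g .H + i ≤ a) →
        u.mem a = s.mem a) (by decide) rfl rfl
    (by simp [hnn]; exact h.lt _ rfl) (by simp [hnn]; exact h.le _ rfl) (by simp) ?_ ?_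
  · rintro i t hi hx hfr ⟨ht1, ht2⟩
    rw [hnn] at hi
    have e1 := (hfr.v .n rfl).trans hn
    have e2 := (hfr.v .H rfl).trans hH
    have e3 := (hfr.v .kn rfl).trans hkn
    have hx1 : i / g .n < g .n := Nat.div_lt_of_lt_mul (by rwa [← h.nn])
    have hy1 : i % g .n < g .n := Nat.mod_lt _ hnp
    have hxy : i / g .n * g .n + i % g .n = i := Nat.div_add_mod' i (g .n)
    generalize hX : i / g .n = X at hx1 hxy
    generalize hY : i % g .n = Y at hy1 hxy
    have m0 : t.mem (g .H + i) = P.tb X Y := by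
      rw [ht2 _ (by omega), ← hs.tb X hx1 Y hy1, Nat.add_assoc, hxy]
    have m1 := (ht2 _ (by omega)).trans (hbest X hx1)
    have m2 := (ht2 _ (by omega)).trans (hbest Y hy1)
    have m3 := (ht2 _ (by omega)).trans (hsub X hx1)
    have m4 := (ht2 _ (by omega)).trans (hsub Y hy1)
    have m5 := (ht2 _ (by omega)).trans (harg X hx1)
    have m6 := (ht2 _ (by omega)).trans (harg Y hy1)
    have b3 := P.sub_le X
    have b4 := P.sub_le Y
    have b5 := (Round.argAux_spec hs.cls (hs.n_eq.symm ▸ hx1) P.n le_rfl).1.1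
    have b6 := (Round.argAux_spec hs.cls (hs.n_eq.symm ▸ hy1) P.n le_rfl).1.1
    rw [← Round.arg] at b5 b6
    have hPn := hs.n_eq
    have fin : ∀ z, z = P.next (k * g .n) X Y →
        (∀ j ≤ i, Function.update t.mem (g .H + i) z (g .H + j) =
          P.next (k * g .n) (j / g .n) (j % g .n)) ∧
        ∀ a, (a < g .H ∨ g .H + (i + 1) ≤ a) →
          Function.update t.mem (g .H + i) z a = s.mem a := by
      rintro _ rfl
      refine ⟨fun j hj => ?_, fun a ha => ?_⟩
      · rcases Nat.lt_or_eq_of_le hj with h11 | rfl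
        · rw [Function.update_of_ne (by omega)]
          exact ht1 j h11
        · rw [Function.update_self, hX, hY]
      · rw [Function.update_of_ne (by omega)]
        exact ht2 a (by omega)
    have fin' : t.mem (g .H + i) = P.next (k * g .n) X Y →
        (∀ j ≤ i, t.mem (g .H + j) = P.next (k * g .n) (j / g .n) (j % g .n)) ∧
        ∀ a, (a < g .H ∨ g .H + (i + 1) ≤ a) → t.mem a = s.mem a := fun h' => by
      have := fin _ h'
      rwa [Function.update_eq_self] at this
    simp [e1, e2, e3, hx, hX, hY, m0, m1, m2, m3, m4, m5, m6]
    refine ⟨by omega, fun h7 => fin' (by rw [m0]; simp [Round.next, h7]), fun h7 =>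
      ⟨by omega, fun h8 => ⟨by omega, fin _ ?_⟩, fun h8 => ⟨by omega,
        fun h9 => ⟨by omega, fin _ ?_⟩, fun h9 => ⟨by omega, fun h10 => ⟨by omega, fin _ ?_⟩,
        fun h10 => ⟨by omega, fun h11 => ⟨by omega, fin _ ?_⟩, fun h11 => fin' ?_⟩⟩⟩⟩⟩
    · simp [Round.next, h7, h8]
    · simp [Round.next, h7, h9, h9.not_gt]
    · simp [Round.next, h7, h8.not_gt, h9.not_gt, h10]
    · simp [Round.next, h7, h8.not_gt, h9.not_gt, h10.not_gt, h11]
    · rw [m0]; simp [Round.next, h7, h8.not_gt, h9.not_gt, h10.not_gt, h11.not_gt]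
  · rintro t _ _ ⟨ht1, ht2⟩
    rw [hnn] at ht1 ht2
    refine ⟨fun x hx y hy => ?_, fun a ha => ?_⟩
    · have := h.row_le hx
      rw [Nat.add_assoc, ht1 _ (by omega), Nat.add_comm, Nat.add_mul_div_right _ _ hnp,
        Nat.div_eq_of_lt hy, Nat.add_mul_mod_self_right, Nat.mod_eq_of_lt hy, Nat.zero_add]
    · exact ht2 a (by omega)

end Round

end MinCutOracle

namespace MinCutOracle

theorem Glob.set {g : Var → ℕ} {s : HState} (h : Glob g s) {z : Var} (hz : z.isGlobal = false)
    (a : ℕ) : Glob g (s.set z a) := fun y hy => by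
  rw [HState.set_v, if_neg (by rintro rfl; simp [hz] at hy)]
  exact h y hy

/-! ### The loop over the rounds -/

section Round

variable {E : Env} {β : Var → ℕ} {M : ℕ} {g : Var → ℕ} {Pf Nf : ℕ → ℕ → ℕ}

/-- The round that the program executes. -/
def mkRound (E : Env) (M : ℕ) (g : Var → ℕ) (Pf Nf : ℕ → ℕ → ℕ) (tb : ℕ → ℕ → ℕ) (r : ℕ) : Round :=
  ⟨g .n, E.answer, fun s t => sketchEst M g Pf Nf (E.answer s t), g .INF, tb, r⟩

/-- The cut with the positive number `m` is a stored answer of the Min-Cut data structure that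
separates `x` and `y` and is cheap. -/
def GoodCut (E : Env) (M : ℕ) (g : Var → ℕ) (Pf Nf : ℕ → ℕ → ℕ) (lam : ℕ → ℕ → ℝ) (α : ℝ)
    (mem : ℕ → ℕ) (m x y : ℕ) : Prop :=
  ∃ a b, a < b ∧ b < g .n ∧
    (∀ z < g .n, mem (2 * g .H + (m - 1) * g .n + z) = (E.answer a b z).toNat) ∧
    mem (3 * g .H + m) = sketchEst M g Pf Nf (E.answer a b) ∧
    E.answer a b x ≠ E.answer a b y ∧
    lam x y ≤ sketchEst M g Pf Nf (E.answer a b) ∧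
    (sketchEst M g Pf Nf (E.answer a b) : ℝ) ≤ α ^ 2 * lam x y

/-- The state before the round `k`. -/
structure CutsInv (E : Env) (M : ℕ) (g : Var → ℕ) (Pf Nf : ℕ → ℕ → ℕ) (lam : ℕ → ℕ → ℝ) (α : ℝ)
    (ω : ℕ → ℕ) (m₀ : ℕ → ℕ) (k : ℕ) (tb : ℕ → ℕ → ℕ) (s : HState) : Prop where
  glob : Glob g s
  ready : s.ready = true
  sk : AtSketch g Pf Nf s.mem
  cls : IsClassMatrix (g .n) tb
  mem_tb : ∀ x < g .n, ∀ y < g .n, s.mem (g .H + x * g .n + y) = tb x y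
  rounds_eq : rounds (g .n) E.answer (fun s t => sketchEst M g Pf Nf (E.answer s t)) (g .INF)
    (g .K - k) k tb s.tape =
    rounds (g .n) E.answer (fun s t => sketchEst M g Pf Nf (E.answer s t)) (g .INF)
    (g .K) 0 (fun _ _ => 0) ω
  tb_le : ∀ x < g .n, ∀ y < g .n, tb x y ≤ k * g .n
  tb_good : ∀ x < g .n, ∀ y < g .n, tb x y ≠ 0 →
    GoodCut E M g Pf Nf lam α s.mem (tb x y) x y
  bits : ∀ i < k * g .n * g .n, s.mem (2 * g .H + i) = 0 ∨ s.mem (2 * g .H + i) = 1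
  frame : ∀ a, a < g .H ∨ a = 3 * g .H ∨ 9 * g .H ≤ a → s.mem a = m₀ a

variable {lam : ℕ → ℕ → ℝ} {α : ℝ} {ω : ℕ → ℕ} {m₀ : ℕ → ℕ}

theorem CutsInv.set {k : ℕ} {tb : ℕ → ℕ → ℕ} {s : HState}
    (h : CutsInv E M g Pf Nf lam α ω m₀ k tb s) {z : Var} (hz : z.isGlobal = false) (a : ℕ) :
    CutsInv E M g Pf Nf lam α ω m₀ k tb (s.set z a) :=
  ⟨h.glob.set hz a, h.ready, h.sk, h.cls, h.mem_tb, h.rounds_eq, h.tb_le, h.tb_good, h.bits,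
    h.frame⟩

/-- Old entries keep their cuts because every round writes to fresh rows; new entries receive theirs
from `Round.Accurate.next_spec`. -/
theorem tri_round (h : Params E β M g)
    (hacc : ∀ tb r, (mkRound E M g Pf Nf tb r).Accurate lam α) {k : ℕ} {tb : ℕ → ℕ → ℕ}
    {s : HState} (hs : CutsInv E M g Pf Nf lam α ω m₀ k tb s) (hk : s.v .k = k) (hkK : k < g .K) :
    Tri E β (Prog.round M) s fun t => ∃ tb', CutsInv E M g Pf Nf lam α ω m₀ (k + 1) tb' t := by
  have hn := hs.glob .n rfl
  have h2 := h.nn_le_H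
  have h3 := h.H_le
  have h5 := h.kn_le hkK
  have h6 := h.n_le_nn
  have h7 : (k + 1) * g .n * g .n = k * g .n * g .n + g .nn := by rw [h.nn]; ring
  have h8 : (k + 1) * g .n = k * g .n + g .n := Nat.succ_mul _ _
  have h9 : k * g .n * g .n + g .nn + 2 * g .nn ≤ g .H := by
    have h10 : (k + 1) * g .nn ≤ g .K * g .nn := Nat.mul_le_mul_right _ hkK
    rw [h.H, Nat.mul_add, Nat.mul_comm (g .nn), Nat.mul_assoc k, ← h.nn]
    rw [Nat.succ_mul] at h10
    omega
  set P := mkRound E M g Pf Nf tb (s.tape 0) with hP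
  simp only [Prog.round, tri_seq, tri_rnd, tri_asg]
  refine ⟨?_, ?_⟩
  · simp [hk, hn]; omega
  set s0 : HState := HState.set { s.set .r (s.tape 0) with tape := fun i => s.tape (i + 1) } .kn
    (k * g .n) with hs0
  have e0 : (Ex.var .k * Ex.var .n).val
      { s.set .r (s.tape 0) with tape := fun i => s.tape (i + 1) } = k * g .n := by
    simp [hk, hn]
  rw [e0]
  have a0 : AtRound E M g Pf Nf P k s0 := by
    refine ⟨fun z hz => ?_, rfl, rfl, rfl, rfl, hs.cls, hkK, by simp [s0], by simp [s0, hP, mkRound],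
      hs.ready, hs.mem_tb, hs.sk⟩
    rw [← (hs.glob.set (z := .r) rfl (s.tape 0)).set (z := .kn) rfl (k * g .n) z hz]
    simp [s0]
  refine (tri_queries h a0).mono fun t1 r1 f1 => ?_
  obtain ⟨r1a, r1b⟩ := r1
  have a1 := a0.of_frame h f1 rfl rfl rfl rfl fun a ha => r1b a (by unfold Untouched; omega)
  refine (tri_argmins h a1 r1a).mono fun t2 r2 f2 => ?_
  obtain ⟨r2a, r2b⟩ := r2
  have a2 := a1.of_frame h f2 rfl rfl rfl rfl fun a ha => r2b a (by omega)
  have r2c : ∀ v < g .n, SlotAt g P k v t2.mem := fun v hv => by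
    have := h.slot_le hkK hv
    refine (r1a v hv).congr (fun x hx => ?_) ?_ ?_ ?_ <;> exact r2b _ (by omega)
  refine (tri_subs h a2 r2c fun x hx => (r2a x hx).2).mono fun t3 r3 f3 => ?_
  obtain ⟨r3a, r3b⟩ := r3
  have a3 := a2.of_frame h f3 rfl rfl rfl rfl fun a ha => r3b a (by omega)
  refine (tri_refine h a3 (fun x hx => (r3b _ (by omega)).trans (r2a x hx).1)
    (fun x hx => (r3b _ (by omega)).trans (r2a x hx).2) r3a).mono fun t4 r4 f4 => ?_
  obtain ⟨r4a, r4b⟩ := r4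
  have hacc' := hacc tb (s.tape 0)
  have hcls : IsClassMatrix P.n P.tb := hs.cls
  have m4 : ∀ a, 2 * g .H ≤ a → a < 6 * g .H → t4.mem a = t1.mem a := fun a h1 h2 => by
    rw [r4b a (by omega), r3b a (by omega), r2b a (by omega)]
  have m4' : ∀ a, 2 * g .H ≤ a → a < 6 * g .H → Untouched g k a → t4.mem a = s.mem a :=
    fun a h1 h2 h3 => (m4 a h1 h2).trans (r1b a h3)
  have m9 : ∀ a, a < g .H ∨ a = 3 * g .H ∨ 9 * g .H ≤ a → t4.mem a = s.mem a := fun a ha => by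
    rw [r4b a (by omega), r3b a (by omega), r2b a (by omega), r1b a (by unfold Untouched; omega)]
    rfl
  have hSK := h.SK
  have hPW := h.PW
  refine ⟨P.next (k * g .n), a3.glob.of_frame f4 rfl, (f4.ready rfl).trans a3.ready,
    ⟨fun q hq x hx => ?_, fun q hq x hx => ?_, fun j hj => ?_, hs.sk.pos_le, hs.sk.neg_le⟩,
    Round.isClassMatrix_next hcls _, r4a, ?_, fun x hx y hy => ?_, fun x hx y hy hne => ?_,
    fun i hi => ?_, fun a ha => (m9 a ha).trans (hs.frame a ha)⟩
  · rw [m9 _ (by omega)]; exact hs.sk.pos q hq x hx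
  · rw [m9 _ (by omega)]; exact hs.sk.neg q hq x hx
  · rw [m9 _ (by omega)]; exact hs.sk.pow j hj
  -- The round consumes exactly one word, so the remaining rounds on the remaining tape give the
  -- same final table.
  · rw [← hs.rounds_eq, show g .K - k = (g .K - (k + 1)) + 1 by omega, rounds]
    have : t4.tape = fun i => s.tape (i + 1) := by
      rw [f4.tape rfl, f3.tape rfl, f2.tape rfl, f1.tape rfl]; rfl
    rw [this]; rfl
  · by_cases h0 : P.tb x y = 0
    · by_cases h1 : P.next (k * g .n) x y = 0
      · omega
      · obtain ⟨v, hv, h11, -⟩ := hacc'.next_spec hcls (k * g .n) hx hy h0 h1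
        have hv : v < g .n := hv
        have h11 : P.next (k * g .n) x y = k * g .n + v + 1 := h11
        omega
    · have h1 : P.next (k * g .n) x y = P.tb x y := by simp [Round.next, h0]
      have h11 : P.tb x y ≤ k * g .n := hs.tb_le x hx y hy
      omega
  · by_cases h0 : P.tb x y = 0
    · obtain ⟨v, hv, h11, h12, h13, h14⟩ := hacc'.next_spec hcls (k * g .n) hx hy h0 hne
      have hv : v < g .n := hv
      change P.next (k * g .n) x y = _ at h11
      change P.bit v x ≠ P.bit v y at h12
      change lam x y ≤ P.e v at h13
      change (P.e v : ℝ) ≤ _ at h14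
      have hp : P.piv v ≠ v := fun hp => h12 (by rw [Round.bit_of_eq hp, Round.bit_of_eq hp])
      have hp1 : P.piv v < g .n := (Round.piv_spec hcls hv).1
      have hsl := h.slot_le hkK hv
      have hb : P.bit v = E.answer (min (P.piv v) v) (max (P.piv v) v) := by
        funext z; simp only [Round.bit, if_neg hp]; rfl
      have he : P.e v = sketchEst M g Pf Nf (E.answer (min (P.piv v) v) (max (P.piv v) v)) := by
        simp only [Round.e, if_neg hp]; rfl
      rw [h11]
      refine ⟨min (P.piv v) v, max (P.piv v) v, by omega, by omega, fun z hz => ?_, ?_, ?_, ?_, ?_⟩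
      · rw [Nat.add_sub_cancel, m4 _ (by omega) (by omega), (r1a v hv).cut z hz, hb]
      · rw [← he, ← (r1a v hv).est, m4 _ (by omega) (by omega)]
        congr 1; ring
      · rw [← hb]; exact h12
      · rw [← he]; exact h13
      · rw [← he]; exact h14
    · have h1 : P.next (k * g .n) x y = tb x y := if_pos h0
      rw [h1]
      obtain ⟨a, b, hab, hb, h11, h12, h13⟩ := hs.tb_good x hx y hy h0
      have h14 := hs.tb_le x hx y hy
      have h15 : (tb x y - 1 + 1) * g .n ≤ k * g .n * g .n := Nat.mul_le_mul_right _ (by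
        have : tb x y ≠ 0 := h0
        omega)
      rw [Nat.succ_mul] at h15
      refine ⟨a, b, hab, hb, fun z hz => ?_, ?_, h13⟩
      · rw [m4' _ (by omega) (by omega) (by unfold Untouched; omega)]; exact h11 z hz
      · rw [m4' _ (by omega) (by omega) (by unfold Untouched; omega)]; exact h12
  · by_cases hi' : i < k * g .n * g .n
    · rw [m4' _ (by omega) (by omega) (by unfold Untouched; omega)]; exact hs.bits i hi'
    · obtain ⟨j, rfl⟩ := Nat.exists_eq_add_of_le (not_lt.1 hi')
      have hj : j < g .nn := by omega
      have hv : j / g .n < g .n := Nat.div_lt_of_lt_mul (by rwa [← h.nn])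
      have hz : j % g .n < g .n := Nat.mod_lt _ h.n_pos
      have h11 := (r1a _ hv).cut _ hz
      have h12 : 2 * g .H + (k * g .n + j / g .n) * g .n + j % g .n =
          2 * g .H + (k * g .n * g .n + j) := by
        have := Nat.div_add_mod' j (g .n)
        rw [Nat.add_mul]; omega
      rw [h12] at h11
      rw [m4 _ (by omega) (by omega), h11]
      cases P.bit (j / g .n) (j % g .n) <;> simp

/-- The invariant only asserts that a table exists. After the last round no rounds remain, and its
equation identifies that table with the result of `rounds` on the original tape. -/
theorem tri_rounds (h : Params E β M g)
    (hacc : ∀ tb r, (mkRound E M g Pf Nf tb r).Accurate lam α) {s : HState} (hg : Glob g s)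
    (hready : s.ready = true) (hsk : AtSketch g Pf Nf s.mem)
    (hzero : ∀ i < g .nn, s.mem (g .H + i) = 0) :
    Tri E β (.loop .k .K (Prog.round M)) s fun t => Glob g t ∧
      CutsInv E M g Pf Nf lam α s.tape s.mem (g .K)
        (rounds (g .n) E.answer (fun s t => sketchEst M g Pf Nf (E.answer s t)) (g .INF)
          (g .K) 0 (fun _ _ => 0) s.tape) t := by
  have hK := hg .K rfl
  refine tri_loop (fun k u => ∃ tb, CutsInv E M g Pf Nf lam α s.tape s.mem k tb u) (by decide)
    rfl rfl (by simp [hK]; exact h.lt _ rfl) (by simp [hK]; exact h.le _ rfl) ?_ ?_ ?_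
  · refine ⟨fun _ _ => 0, CutsInv.set ⟨hg, hready, hsk, ?_, fun x hx y hy => ?_, rfl, by simp,
      by simp, by simp, by simp⟩ rfl 0⟩
    · exact ⟨by simp, by simp, by simp⟩
    · have := h.row_le hx
      rw [Nat.add_assoc]; exact hzero _ (by omega)
  · rintro k t hk hv hf ⟨tb, ht⟩
    exact (tri_round h hacc ht hv (by omega)).mono fun u ⟨tb', hu⟩ _ => ⟨tb', hu.set rfl _⟩
  · rintro t - - ⟨tb, ht⟩
    rw [hK] at ht
    have h1 := ht.rounds_eq
    rw [Nat.sub_self, rounds] at h1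
    rw [h1] at ht
    exact ⟨ht.glob, ht⟩

end Round

end MinCutOracle

namespace MinCutOracle

/-! ### Verification of the setup and of the sketch -/

/-- The constant in the number of repetitions of the sketch. -/
def repConst (c₀ M : ℕ) : ℕ := 1024 * 3600 * M * M * (c₀ + 4)

/-- The values of the parameters. -/
def parms (c₀ M n tot : ℕ) : Var → ℕ
  | .n => n
  | .nn => n * n
  | .ell => lg n
  | .K => 6 * (c₀ + 3) * lg n
  | .H => n * n * (6 * (c₀ + 3) * lg n + 2)
  | .L => lg tot
  | .B => repConst c₀ M * lg n
  | .Q => repConst c₀ M * lg n * lg tot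
  | .T => repConst c₀ M * lg n * lg tot * (n * n)
  | .SK => 16 * (n * n * (6 * (c₀ + 3) * lg n + 2))
  | .PW => 16 * (n * n * (6 * (c₀ + 3) * lg n + 2)) + 2 * (repConst c₀ M * lg n * lg tot * n)
  | .INF => repConst c₀ M * lg n * lg tot * 2 ^ lg tot * (n * (n * n)) * (n * (n * n)) + 1
  | .pred => n - 1
  | _ => 0

theorem lg_pos (x : ℕ) : 0 < lg x := Nat.succ_pos _

theorem repConst_pos {c₀ M : ℕ} (hM : 0 < M) : 0 < repConst c₀ M := by
  unfold repConst; positivity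

theorem lg_le {x : ℕ} (hx : 0 < x) : lg x ≤ x := by
  unfold lg
  exact Nat.log_lt_self 2 hx.ne'

theorem lt_two_pow_lg (x : ℕ) : x < 2 ^ lg x := Nat.lt_pow_succ_log_self (by norm_num) x

theorem params_parms {E : Env} {β : Var → ℕ} {c₀ M n tot : ℕ} (hM : 0 < M) (hn : 0 < n)
    (hE : E.n = n) (hans : ∀ t x, E.answer n t x = false)
    (hle : ∀ z, z.isGlobal = true → parms c₀ M n tot z ≤ β z)
    (addr : parms c₀ M n tot .PW + parms c₀ M n tot .L + 2 < 2 ^ E.w)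
    (INF_lt : parms c₀ M n tot .INF * (60 * M) < 2 ^ E.w)
    (den_lt : parms c₀ M n tot .B * (2 * (60 * M - 1)) < 2 ^ E.w) :
    Params E β M (parms c₀ M n tot) := by
  have hell := lg_pos n
  have hL := lg_pos tot
  have hR := repConst_pos (c₀ := c₀) hM
  have hQ : 0 < repConst c₀ M * lg n * lg tot := by positivity
  have hnn : n ≤ n * n := Nat.le_mul_of_pos_left _ hn
  have hH : n * n ≤ n * n * (6 * (c₀ + 3) * lg n + 2) := Nat.le_mul_of_pos_right _ (by omega)
  have hK : 6 * (c₀ + 3) * lg n ≤ n * n * (6 * (c₀ + 3) * lg n + 2) :=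
    (Nat.le_add_right _ 2).trans (Nat.le_mul_of_pos_left _ (by positivity))
  have hlg := lg_le hn
  have hINF : parms c₀ M n tot .INF ≤ parms c₀ M n tot .INF * (60 * M) :=
    Nat.le_mul_of_pos_right _ (by omega)
  have hB : parms c₀ M n tot .B ≤ parms c₀ M n tot .B * (2 * (60 * M - 1)) :=
    Nat.le_mul_of_pos_right _ (by omega)
  have hQ1 : repConst c₀ M * lg n * lg tot * (n * n) ≤ parms c₀ M n tot .INF := by
    simp only [parms]
    refine Nat.le_succ_of_le ?_
    rw [Nat.mul_assoc (repConst c₀ M * lg n * lg tot), Nat.mul_assoc (repConst c₀ M * lg n * lg tot)]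
    refine Nat.mul_le_mul_left _ ?_
    refine le_trans ?_ (Nat.le_mul_of_pos_right _ (by positivity))
    exact (Nat.le_mul_of_pos_left _ hn).trans (Nat.le_mul_of_pos_left _ (by positivity))
  have hQ2 : repConst c₀ M * lg n * lg tot ≤ repConst c₀ M * lg n * lg tot * (n * n) :=
    Nat.le_mul_of_pos_right _ (by positivity)
  refine ⟨hM, hE, hans, hn, rfl, by simp only [parms]; positivity, rfl,
    by simp only [parms]; positivity, hL, rfl, rfl, rfl, rfl, rfl, fun z hz => ?_, hle, addr, rfl,
    INF_lt, den_lt⟩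
  simp only [parms] at addr hINF INF_lt hB den_lt hQ1 ⊢
  cases z <;> simp [Var.isGlobal] at hz <;> simp only <;> omega

theorem tri_setup {E : Env} {β : Var → ℕ} {c₀ M n tot : ℕ} {s : HState}
    (h : Params E β M (parms c₀ M n tot)) (hn : s.mem 0 = n)
    (htot : ∑ i ∈ Finset.range (n * n), s.mem (i + 1) = tot) :
    Tri E β (Prog.setup c₀ M) s fun t => Glob (parms c₀ M n tot) t ∧
      t.mem (n * n + 1) = parms c₀ M n tot .H ∧
      (∀ j < lg tot, t.mem (parms c₀ M n tot .PW + j) = 2 ^ j) ∧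
      ∀ a, a ≠ n * n + 1 → a < parms c₀ M n tot .PW → t.mem a = s.mem a := by
  have l1 := h.lt .n rfl
  have l2 := h.lt .nn rfl
  have l3 := h.lt .ell rfl
  have l4 := h.lt .K rfl
  have l5 := h.lt .H rfl
  have l6 := h.lt .L rfl
  have l7 := h.lt .B rfl
  have l8 := h.lt .Q rfl
  have l9 := h.lt .T rfl
  have l10 := h.lt .SK rfl
  have l11 := h.lt .PW rfl
  have l12 := h.lt .INF rfl
  have b2 := h.le .nn rfl
  have b3 := h.le .ell rfl
  have b6 := h.le .L rfl
  have hH1 := h.nn_le_H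
  have hH2 := h.H_le
  have hnp := h.n_pos
  have haddr := h.addr
  have h4 : 2 < 2 ^ E.w := by omega
  have hpw : 2 ^ lg tot < 2 ^ E.w := by
    refine lt_of_le_of_lt ?_ l12
    have hQ : 0 < repConst c₀ M * lg n * lg tot :=
      Nat.mul_pos (Nat.mul_pos (repConst_pos h.M_pos) (lg_pos n)) (lg_pos tot)
    have hnp : 0 < n := hnp
    simp only [parms]
    refine Nat.le_succ_of_le ?_
    refine le_trans ?_ (Nat.le_mul_of_pos_right _ (by positivity))
    refine le_trans ?_ (Nat.le_mul_of_pos_right _ (by positivity))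
    exact Nat.le_mul_of_pos_left _ hQ
  have htw : tot < 2 ^ E.w := (lt_two_pow_lg tot).trans hpw
  simp only [parms] at l1 l2 l3 l4 l5 l6 l7 l8 l9 l10 l11 l12 b2 b3 b6 hH1 hH2 hnp haddr
  have hnH : n * n + 1 < n * n * (6 * (c₀ + 3) * lg n + 2) := by
    have : n * n * 2 ≤ n * n * (6 * (c₀ + 3) * lg n) :=
      Nat.mul_le_mul_left _ (by have := lg_pos n; nlinarith)
    have : 0 < n * n := by positivity
    omega
  simp [Prog.setup, hn]
  refine ⟨l2, ⟨l1, h4, b3⟩, l4, l5, by omega, ?_⟩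
  refine tri_loop (fun i u => u.v .tot = ∑ j ∈ Finset.range i, s.mem (j + 1)) (by decide) rfl rfl
    (by simpa using l2) (by simpa using b2) (by simp) ?_ ?_
  · intro i t hi hx hf ht
    have e1 := hf.mem rfl
    simp at hi e1
    simp [hx, ht, e1]
    rw [Function.update_of_ne (by omega), ← Finset.sum_range_succ]
    refine ⟨⟨by omega, ?_⟩, rfl⟩
    refine lt_of_le_of_lt (Finset.sum_le_sum_of_subset (Finset.range_mono hi)) (htot ▸ htw)
  · intro t _ hf ht
    have e1 := hf.mem rfl
    have e2 := hf.v .n rfl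
    have e3 := hf.v .nn rfl
    have e4 := hf.v .ell rfl
    have e5 := hf.v .K rfl
    have e6 := hf.v .H rfl
    simp [htot] at e1 e2 e3 e4 e5 e6 ht
    have hw1 : E.w ≠ 0 := by rintro h0; rw [h0] at h4; omega
    have h5 : 1024 * 3600 * M * M * (c₀ + 4) = repConst c₀ M := rfl
    simp [-Nat.reduceMul, ht, e2, e3, e4, e6, h5]
    refine ⟨⟨htw, h4, b6⟩, l7, l8, l9, l10, l11, hw1, ?_⟩
    refine tri_loop (fun i u => u.v .pw = 2 ^ i ∧
      (∀ j < i, u.mem (parms c₀ M n tot .PW + j) = 2 ^ j) ∧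
      ∀ a, a < parms c₀ M n tot .PW → u.mem a = t.mem a) (by decide) rfl rfl
      (by simpa using l6) (by simpa using b6) (by simp) ?_ ?_
    · rintro i u hi hx hfu ⟨hu1, hu2, hu3⟩
      have d1 := hfu.v .PW rfl
      simp at hi d1
      have h6 : 2 ^ (i + 1) ≤ 2 ^ lg tot := Nat.pow_le_pow_right (by norm_num) hi
      simp only [parms] at hu2 hu3
      simp [hx, hu1, d1, parms]
      refine ⟨by omega, by rw [Nat.pow_succ] at h6; omega, by rw [Nat.pow_succ]; ring, ?_, ?_⟩
      · intro j hj
        rcases Nat.lt_or_eq_of_le hj with h7 | rfl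
        · rw [Function.update_of_ne (by omega)]; exact hu2 j h7
        · rw [Function.update_self]
      · intro a ha
        rw [Function.update_of_ne (by omega)]; exact hu3 a ha
    · rintro u - hfu ⟨hu1, hu2, hu3⟩
      have d1 := hfu.v .n rfl
      have d2 := hfu.v .nn rfl
      have d3 := hfu.v .ell rfl
      have d4 := hfu.v .K rfl
      have d5 := hfu.v .H rfl
      have d6 := hfu.v .L rfl
      have d7 := hfu.v .B rfl
      have d8 := hfu.v .Q rfl
      have d9 := hfu.v .T rfl
      have d10 := hfu.v .SK rfl
      have d11 := hfu.v .PW rfl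
      simp [e2, e3, e4, e5, e6] at d1 d2 d3 d4 d5 d6 d7 d8 d9 d10 d11 hu1 hu2
      simp only [parms] at hu2 hu3
      simp [d1, d2, d8, hu1]
      refine ⟨l12, hw1, fun z hz => ?_, ?_, hu2, fun a ha hb => ?_⟩
      · cases z <;> simp [Var.isGlobal] at hz <;>
          simp [parms, d1, d2, d3, d4, d5, d6, d7, d8, d9, d10, d11]
      · rw [hu3 _ (by omega), e1, Function.update_self]; rfl
      · rw [hu3 a hb, e1, Function.update_of_ne ha]

/-- The node that is increased in the positive part of the sketch for a pair of nodes. -/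
def headOf (n r i : ℕ) : ℕ := if r % 2 = 1 then i / n else i % n

/-- The node that is increased in the negative part of the sketch for a pair of nodes. -/
def tailOf (n r i : ℕ) : ℕ := if r % 2 = 1 then i % n else i / n

/-- The bit of the capacity that is considered in the step `t` of the sketch. -/
def Live (nn L : ℕ) (cap : ℕ → ℕ) (t : ℕ) : Prop := cap (t % nn) / 2 ^ (t / nn % L) % 2 ≠ 0

instance (nn L : ℕ) (cap : ℕ → ℕ) (t : ℕ) : Decidable (Live nn L cap t) :=
  inferInstanceAs (Decidable (_ ≠ _))

/-- An entry of a part of the sketch after `m` steps. -/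
def sketchCount (end' : ℕ → ℕ → ℕ → ℕ) (n nn L : ℕ) (cap ω : ℕ → ℕ) (q x m : ℕ) : ℕ :=
  Nat.count (fun t => t / nn = q ∧ Live nn L cap t ∧ end' n (ω t) (t % nn) = x) m

/-- The steps that touch block `q` are `m` consecutive ones, so an entry of the sketch is a count
over the pairs alone. -/
theorem count_block {m : ℕ} (hm : 0 < m) (p : ℕ → Prop) [DecidablePred p] {Q q : ℕ} (hq : q < Q) :
    Nat.count (fun t => t / m = q ∧ p t) (Q * m) = Nat.count (fun i => p (q * m + i)) m := by
  induction Q with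
  | zero => omega
  | succ Q ih =>
    rw [Nat.succ_mul, Nat.count_add]
    have h1 : ∀ i < m, (Q * m + i) / m = Q := fun i hi => by
      rw [Nat.add_comm, Nat.add_mul_div_right _ _ hm, Nat.div_eq_of_lt hi, Nat.zero_add]
    rcases Nat.lt_or_eq_of_le (Nat.lt_succ_iff.1 hq) with h | rfl
    · rw [ih h, Nat.add_eq_left, Nat.count_iff_forall_not]
      intro i hi h2
      rw [h1 i hi] at h2
      omega
    · have h2 : Nat.count (fun t => t / m = q ∧ p t) (q * m) = 0 := by
        rw [Nat.count_iff_forall_not]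
        intro i hi h2
        have := Nat.div_lt_of_lt_mul (show i < m * q by rwa [Nat.mul_comm])
        omega
      rw [h2, Nat.zero_add]
      exact Round.count_congr_of_lt fun i hi => by simp [h1 i hi]

theorem sketchCount_le {end' : ℕ → ℕ → ℕ → ℕ} {n nn L : ℕ} {cap ω : ℕ → ℕ} {q x Q : ℕ}
    (hnn : 0 < nn) (hq : q < Q) : sketchCount end' n nn L cap ω q x (Q * nn) ≤ nn := by
  rw [sketchCount, count_block hnn _ hq]
  exact Nat.count_le _

theorem mul_add_inj {n q x q' x' : ℕ} (hx : x < n) (hx' : x' < n)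
    (h : q * n + x = q' * n + x') : q = q' ∧ x = x' := by
  have h1 : ∀ a b, b < n → (a * n + b) / n = a ∧ (a * n + b) % n = b := fun a b hb => by
    rw [Nat.add_comm, Nat.add_mul_div_right _ _ (by omega), Nat.div_eq_of_lt hb,
      Nat.add_mul_mod_self_right, Nat.mod_eq_of_lt hb]
    simp
  have h2 := h1 q x hx
  have h3 := h1 q' x' hx'
  rw [h] at h2
  exact ⟨h2.1.symm.trans h3.1, h2.2.symm.trans h3.2⟩

theorem tri_sketch {E : Env} {β : Var → ℕ} {M : ℕ} {g : Var → ℕ} (h : Params E β M g)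
    {s : HState} {cap : ℕ → ℕ} (hg : Glob g s) (hcap : ∀ i < g .nn, s.mem (i + 1) = cap i)
    (hpow : ∀ j < g .L, s.mem (g .PW + j) = 2 ^ j)
    (hzero : ∀ a, g .SK ≤ a → a < g .PW → s.mem a = 0) :
    Tri E β Prog.sketch s fun t =>
      AtSketch g (fun q x => sketchCount headOf (g .n) (g .nn) (g .L) cap s.tape q x (g .T))
        (fun q x => sketchCount tailOf (g .n) (g .nn) (g .L) cap s.tape q x (g .T)) t.mem ∧
      (∀ a < g .SK, t.mem a = s.mem a) ∧ t.tape = fun i => s.tape (g .T + i) := by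
  have hn := hg .n rfl
  have hnn := hg .nn rfl
  have hT := hg .T rfl
  have hL := hg .L rfl
  have hSK := hg .SK rfl
  have hPW := hg .PW rfl
  have lT := h.lt .T rfl
  have hnp := h.n_pos
  have hLp := h.L_pos
  have hn1 := h.n_le_nn
  have hH := h.nn_le_H
  have e2 := h.SK
  have e3 := h.PW
  have ha := h.addr
  have eT := h.T
  have row : ∀ q < g .Q, q * g .n + g .n ≤ g .Q * g .n := fun q hq => by
    have := Nat.mul_le_mul_right (g .n) (show q + 1 ≤ g .Q from hq)
    rwa [Nat.succ_mul] at this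
  refine tri_loop (fun i u =>
      (∀ q < g .Q, ∀ x < g .n, u.mem (g .SK + 2 * (q * g .n + x)) =
        sketchCount headOf (g .n) (g .nn) (g .L) cap s.tape q x i) ∧
      (∀ q < g .Q, ∀ x < g .n, u.mem (g .SK + 2 * (q * g .n + x) + 1) =
        sketchCount tailOf (g .n) (g .nn) (g .L) cap s.tape q x i) ∧
      (∀ a, a < g .SK ∨ g .PW ≤ a → u.mem a = s.mem a) ∧
      u.tape = fun j => s.tape (i + j)) (by decide) rfl rfl
    (by simpa [hT] using h.lt .T rfl) (by simpa [hT] using h.le .T rfl) ?_ ?_ ?_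
  · refine ⟨fun q hq x hx => ?_, fun q hq x hx => ?_, fun _ _ => rfl, by simp⟩
    · have := row q hq
      simp only [HState.set_mem, sketchCount, Nat.count_zero]
      exact hzero _ (by omega) (by omega)
    · have := row q hq
      simp only [HState.set_mem, sketchCount, Nat.count_zero]
      exact hzero _ (by omega) (by omega)
  · rintro i t hi hx hf ⟨t1, t2, t3, t4⟩
    rw [hT] at hi
    have c1 := (hf.v .n rfl).trans hn
    have c2 := (hf.v .nn rfl).trans hnn
    have c3 := (hf.v .L rfl).trans hL
    have c4 := (hf.v .SK rfl).trans hSK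
    have c5 := (hf.v .PW rfl).trans hPW
    have hq : i / g .nn < g .Q := Nat.div_lt_of_lt_mul (by rw [Nat.mul_comm]; omega)
    have hm : i % g .nn < g .nn := Nat.mod_lt _ (by omega)
    have hj : i / g .nn % g .L < g .L := Nat.mod_lt _ hLp
    have m1 := (t3 (i % g .nn + 1) (by omega)).trans (hcap _ hm)
    have m2 := (t3 _ (by omega)).trans (hpow _ hj)
    have hd1 : i % g .nn / g .n < g .n := Nat.div_lt_of_lt_mul (by rwa [← h.nn])
    have hd2 : i % g .nn % g .n < g .n := Nat.mod_lt _ hnp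
    have succ : ∀ (end' : ℕ → ℕ → ℕ → ℕ) q x,
        sketchCount end' (g .n) (g .nn) (g .L) cap s.tape q x (i + 1) =
        sketchCount end' (g .n) (g .nn) (g .L) cap s.tape q x i +
          if i / g .nn = q ∧ Live (g .nn) (g .L) cap i ∧
            end' (g .n) (s.tape i) (i % g .nn) = x then 1 else 0 := fun end' q x =>
      Nat.count_succ _ _
    have bd : ∀ (end' : ℕ → ℕ → ℕ → ℕ) q x,
        sketchCount end' (g .n) (g .nn) (g .L) cap s.tape q x i ≤ i := fun end' q x =>
      Nat.count_le _
    have hr := row _ hq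
    -- Both outcomes of the coin lead here, with the roles of the two ends exchanged. Head counters
    -- have even offsets and tail counters odd ones, so the two writes do not interfere.
    have fin : ∀ y1 y2, y1 = headOf (g .n) (s.tape i) (i % g .nn) →
        y2 = tailOf (g .n) (s.tape i) (i % g .nn) → y1 < g .n → y2 < g .n →
        Live (g .nn) (g .L) cap i → ∀ m1 m2 m3, m1 = Function.update t.mem
          (g .SK + 2 * (i / g .nn * g .n + y1)) (t.mem
            (g .SK + 2 * (i / g .nn * g .n + y1)) + 1) →
        m2 = m1 (g .SK + 2 * (i / g .nn * g .n + y2) + 1) + 1 →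
        m3 = Function.update m1 (g .SK + 2 * (i / g .nn * g .n + y2) + 1) m2 →
        (t.mem (g .SK + 2 * (i / g .nn * g .n + y1)) + 1 < 2 ^ E.w ∧ m2 < 2 ^ E.w) ∧
        (∀ q < g .Q, ∀ x < g .n, m3 (g .SK + 2 * (q * g .n + x)) =
          sketchCount headOf (g .n) (g .nn) (g .L) cap s.tape q x (i + 1)) ∧
        (∀ q < g .Q, ∀ x < g .n, m3 (g .SK + 2 * (q * g .n + x) + 1) =
          sketchCount tailOf (g .n) (g .nn) (g .L) cap s.tape q x (i + 1)) ∧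
        (∀ a, a < g .SK ∨ g .PW ≤ a → m3 a = s.mem a) := by
      rintro y1 y2 h1 h2 h3 h4 h5 m1 m2 m3 rfl rfl rfl
      have hu : Function.update t.mem (g .SK + 2 * (i / g .nn * g .n + y1))
          (t.mem (g .SK + 2 * (i / g .nn * g .n + y1)) + 1)
          (g .SK + 2 * (i / g .nn * g .n + y2) + 1) =
          t.mem (g .SK + 2 * (i / g .nn * g .n + y2) + 1) := Function.update_of_ne (by omega) _ _
      rw [hu, t1 _ hq y1 h3, t2 _ hq y2 h4]
      have b1 := bd headOf (i / g .nn) y1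
      have b2 := bd tailOf (i / g .nn) y2
      refine ⟨⟨by omega, by omega⟩, fun q hqq x hxx => ?_, fun q hqq x hxx => ?_, fun a ha => ?_⟩
      · rw [Function.update_of_ne (by omega), succ, ← h1]
        by_cases he : i / g .nn = q ∧ y1 = x
        · obtain ⟨rfl, rfl⟩ := he
          rw [Function.update_self, if_pos ⟨rfl, h5, rfl⟩]
        · rw [Function.update_of_ne, if_neg (fun h6 => he ⟨h6.1, h6.2.2⟩), t1 q hqq x hxx]
          · rfl
          · intro h6
            exact he (mul_add_inj h3 hxx (by omega))
      · rw [succ, ← h2]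
        by_cases he : i / g .nn = q ∧ y2 = x
        · obtain ⟨rfl, rfl⟩ := he
          rw [Function.update_self, if_pos ⟨rfl, h5, rfl⟩]
        · rw [Function.update_of_ne, if_neg (fun h6 => he ⟨h6.1, h6.2.2⟩),
            Function.update_of_ne (by omega), t2 q hqq x hxx]
          · rfl
          · intro h6
            exact he (mul_add_inj h4 hxx (by omega))
      · rw [Function.update_of_ne (by omega), Function.update_of_ne (by omega)]
        exact t3 a ha
    have tape : (fun j => t.tape (j + 1)) = fun j => s.tape (i + 1 + j) := by
      rw [t4]; funext j; change s.tape (i + (j + 1)) = _; congr 1; omega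
    have r0 : t.tape 0 = s.tape i := by rw [t4]; rfl
    simp only [tri_seq, tri_rnd, tri_asg]
    simp [hx, c1, c2, c3, c4, c5, m1, m2, r0]
    have w2 : 2 < 2 ^ E.w := by omega
    refine ⟨⟨⟨by omega, by omega⟩, w2⟩, fun h5 => ⟨w2, fun h6 => ?_, fun h6 => ?_⟩, fun h5 => ?_⟩
    · have h5' : Live (g .nn) (g .L) cap i := by unfold Live; omega
      obtain ⟨⟨k1, k2⟩, k3, k4, k5⟩ := fin _ _ (by simp [headOf, h6]) (by simp [tailOf, h6]) hd1 hd2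
        h5' _ _ _ rfl rfl rfl
      exact ⟨by omega, k1, by omega, k2, k3, k4, k5, tape⟩
    · have h5' : Live (g .nn) (g .L) cap i := by unfold Live; omega
      obtain ⟨⟨k1, k2⟩, k3, k4, k5⟩ := fin _ _ (by simp [headOf, h6]) (by simp [tailOf, h6]) hd2 hd1
        h5' _ _ _ rfl rfl rfl
      exact ⟨by omega, k1, by omega, k2, k3, k4, k5, tape⟩
    · have h5' : ¬ Live (g .nn) (g .L) cap i := by unfold Live; omega
      refine ⟨fun q hqq x hxx => ?_, fun q hqq x hxx => ?_, t3, tape⟩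
      · rw [succ, if_neg (fun h7 => h5' h7.2.1)]; exact t1 q hqq x hxx
      · rw [succ, if_neg (fun h7 => h5' h7.2.1)]; exact t2 q hqq x hxx
  · rintro t - - ⟨t1, t2, t3, t4⟩
    rw [hT, eT] at t1 t2 t4
    rw [eT]
    refine ⟨⟨t1, t2, fun j hj => (t3 _ (by omega)).trans (hpow j hj), fun q hq x hx => ?_,
      fun q hq x hx => ?_⟩, fun a ha => t3 a (by omega), t4⟩
    · exact sketchCount_le (by omega) hq
    · exact sketchCount_le (by omega) hq

end MinCutOracle

namespace MinCutOracle

/-! ### Verification of Prim's algorithm -/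

theorem reached_congr {b b' : ℕ → ℕ} {i x : ℕ} (h : ∀ j < i, b j = b' j) :
    Reached b i x ↔ Reached b' i x := by
  unfold Reached
  exact or_congr_right ⟨fun ⟨j, hj, h1⟩ => ⟨j, hj, (h j hj) ▸ h1⟩,
    fun ⟨j, hj, h1⟩ => ⟨j, hj, (h j hj).symm ▸ h1⟩⟩

/-- After `i` steps at most `i + 1` nodes have been reached. This guarantees that the search for the
next node finds one. -/
theorem exists_not_reached (b : ℕ → ℕ) {i n : ℕ} (h : i + 1 < n) : ∃ x < n, ¬ Reached b i x := by
  by_contra hcon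
  push Not at hcon
  have h1 : Finset.range n ⊆ insert 0 ((Finset.range i).image b) := by
    intro x hx
    rcases hcon x (Finset.mem_range.1 hx) with rfl | ⟨j, hj, rfl⟩
    · simp
    · simp only [Finset.mem_insert, Finset.mem_image, Finset.mem_range]
      exact Or.inr ⟨j, hj, rfl⟩
  have h2 := (Finset.card_le_card h1).trans (Finset.card_insert_le _ _)
  have h3 := Finset.card_image_le (s := Finset.range i) (f := b)
  simp at h2 h3
  omega

/-- The memory during Prim's algorithm, after `i` steps. -/
structure PrimInv (H n : ℕ) (val : ℕ → ℕ → ℕ) (m₀ : ℕ → ℕ) (b y c : ℕ → ℕ) (i : ℕ)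
    (mem : ℕ → ℕ) : Prop where
  out : ∀ j < i, mem (12 * H + 3 * j) = b j ∧ mem (12 * H + 3 * j + 1) = y j ∧
    mem (12 * H + 3 * j + 2) = c j
  mark : ∀ x < n, mem (9 * H + x) = 0 ↔ ¬ Reached b i x
  par_lt : ∀ x < n, ¬ Reached b i x → mem (11 * H + x) < n
  par : ∀ x < n, ¬ Reached b i x → Reached b i (mem (11 * H + x))
  key : ∀ x < n, ¬ Reached b i x → mem (10 * H + x) = val (mem (11 * H + x)) x
  le_key : ∀ x < n, ¬ Reached b i x → ∀ u < n, Reached b i u → val u x ≤ mem (10 * H + x)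
  b_lt : ∀ j < i, b j < n
  y_lt : ∀ j < i, y j < n
  b_new : ∀ j < i, ¬ Reached b j (b j)
  y_old : ∀ j < i, Reached b j (y j)
  c_eq : ∀ j < i, c j = val (y j) (b j)
  c_max : ∀ j < i, ∀ u < n, ∀ x < n, Reached b j u → ¬ Reached b j x → val u x ≤ c j
  frame : ∀ a < 9 * H, mem a = m₀ a

theorem tri_prim {E : Env} {β : Var → ℕ} {M : ℕ} {g : Var → ℕ} (h : Params E β M g)
    {s : HState} {tb val : ℕ → ℕ → ℕ} (hg : Glob g s)
    (htb : ∀ x < g .n, ∀ y < g .n, s.mem (g .H + x * g .n + y) = tb x y)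
    (htb_lt : ∀ x < g .n, ∀ y < g .n, tb x y < g .H)
    (hval : ∀ x < g .n, ∀ y < g .n, s.mem (3 * g .H + tb x y) = val x y)
    (hval_lt : ∀ x < g .n, ∀ y < g .n, val x y + 1 < 2 ^ E.w)
    (hzero : ∀ x < g .n, s.mem (9 * g .H + x) = 0) :
    Tri E β Prog.prim s fun t => ∃ b y c, IsPrim (g .n) val b y c ∧
      ∀ i, i + 1 < g .n → t.mem (12 * g .H + 3 * i) = b i ∧
        t.mem (12 * g .H + 3 * i + 1) = y i ∧ t.mem (12 * g .H + 3 * i + 2) = c i := by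
  have hn := hg .n rfl
  have hH := hg .H rfl
  have hpred := hg .pred rfl
  have h2 := h.nn_le_H
  have h3 := h.H_le
  have h6 := h.n_le_nn
  have hnp := h.n_pos
  have row : ∀ x < g .n, x * g .n + g .n ≤ g .nn := fun x hx => h.row_le hx
  simp only [Prog.prim, tri_seq, tri_put]
  refine ⟨?_, ?_⟩
  · simp [hH]; constructor <;> first | omega | (rintro h0; rw [h0] at h3; omega)
  refine tri_loop (fun i u => (∀ x < i, u.mem (10 * g .H + x) = val 0 x ∧
      u.mem (11 * g .H + x) = 0) ∧
      ∀ a, a < 10 * g .H ∨ 12 * g .H ≤ a → u.mem a = Function.update s.mem (9 * g .H) 1 a)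
    (by decide) rfl rfl (by simpa [hn] using h.lt .n rfl) (by simpa [hn] using h.le .n rfl)
    (by simp [hH]) ?_ ?_
  · rintro i t hi hx hf ⟨t1, t2⟩
    have e1 := hf.v .n rfl
    have e2 := hf.v .H rfl
    simp [hn, hH] at e1 e2 hi
    have hr := row 0 hnp
    have m1 : t.mem (g .H + i) = tb 0 i := by
      rw [t2 _ (by omega), Function.update_of_ne (by omega), ← htb 0 hnp i hi]; simp
    have m2 : t.mem (3 * g .H + tb 0 i) = val 0 i := by
      have := htb_lt 0 hnp i hi
      rw [t2 _ (by omega), Function.update_of_ne (by omega), hval 0 hnp i hi]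
    simp [Prog.valAt, Prog.tbAt, hx, e1, e2, m1, m2]
    refine ⟨?_, by omega, fun x hx => ?_, fun a ha => ?_⟩
    · have := htb_lt 0 hnp i hi
      omega
    · rcases Nat.lt_or_eq_of_le hx with h7 | rfl
      · rw [Function.update_of_ne (by omega), Function.update_of_ne (by omega),
          Function.update_of_ne (by omega), Function.update_of_ne (by omega)]
        exact t1 x h7
      · rw [Function.update_of_ne (by omega), Function.update_self, Function.update_self]
        exact ⟨rfl, rfl⟩
    · rw [Function.update_of_ne (by omega), Function.update_of_ne (by omega)]
      exact t2 a ha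
  rintro t - hft ⟨t1, t2⟩
  have hgt : Glob g t := Glob.of_frame (p := .loop .x .n _) (s := { s with
    mem := Function.update s.mem (Ex.val s (9 * Ex.var .H)) (Ex.val s 1) }) hg hft rfl
  have htn := hgt .n rfl
  have htH := hgt .H rfl
  have htp := hgt .pred rfl
  simp only [hn] at t1
  replace t1 : ∀ x < g .n, t.mem (10 * g .H + x) = val 0 x ∧ t.mem (11 * g .H + x) = 0 := t1
  refine tri_loop (fun i u => ∃ b y c, PrimInv (g .H) (g .n) val s.mem b y c i u.mem)
    (by decide) rfl rfl (by simpa [htp] using h.lt .pred rfl)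
    (by simpa [htp] using h.le .pred rfl) ?_ ?_ ?_
  · have hreach : ∀ x, Reached (fun _ => 0) 0 x ↔ x = 0 := fun x => by simp [Reached]
    refine ⟨fun _ => 0, fun _ => 0, fun _ => 0, ⟨by simp, fun x hx => ?_, fun x hx _ => ?_,
      fun x hx _ => ?_, fun x hx _ => ?_, fun x hx _ u hu hru => ?_, by simp, by simp, by simp,
      by simp, by simp, by simp, fun a ha => ?_⟩⟩
    · rw [HState.set_mem, t2 _ (by omega), hreach]
      by_cases h0 : x = 0
      · subst h0; simp
      · rw [Function.update_of_ne (by omega), hzero x hx]; simp [h0]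
    · rw [HState.set_mem, (t1 x hx).2]; exact hnp
    · rw [HState.set_mem, (t1 x hx).2, hreach]
    · rw [HState.set_mem, (t1 x hx).2, (t1 x hx).1]
    · rw [hreach] at hru
      rw [HState.set_mem, (t1 x hx).1, hru]
    · rw [HState.set_mem, t2 _ (by omega), Function.update_of_ne (by omega)]
  · rintro i u hi hui hfu ⟨b, y, c, hu⟩
    have hgu := hgt.of_frame hfu rfl
    have hun := hgu .n rfl
    have huH := hgu .H rfl
    have hpr := h.pred
    rw [htp] at hi
    have hi' : i + 1 < g .n := by omega
    simp only [tri_seq, tri_asg, Ex.fits_zero, true_and, Ex.val_zero]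
    -- Either all nodes inspected so far are already in the tree, or `b` is an outside node with the
    -- largest key among them.
    refine tri_loop (fun j w => (w.v .bk = 0 ∧ ∀ x < j, Reached b i x) ∨
      (w.v .b < g .n ∧ ¬ Reached b i (w.v .b) ∧ w.v .bk = u.mem (10 * g .H + w.v .b) + 1 ∧
        ∀ x < j, ¬ Reached b i x → u.mem (10 * g .H + x) ≤ u.mem (10 * g .H + w.v .b)))
      (by decide) rfl rfl (by simpa [hun] using h.lt .n rfl) (by simpa [hun] using h.le .n rfl)
      (by simp) ?_ ?_
    · intro j w hj hwj hfw hw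
      have e1 := hfw.v .H rfl
      have e2 := hfw.mem rfl
      simp [huH, hun] at e1 e2 hj
      have hkey : ¬ Reached b i j → u.mem (10 * g .H + j) + 1 < 2 ^ E.w := fun hr => by
        rw [hu.key j hj hr]
        exact hval_lt _ (hu.par_lt j hj hr) _ hj
      simp [e1, e2, hwj]
      refine ⟨by omega, fun h7 => ?_, fun h7 => ?_⟩
      · rw [← ne_eq, ne_eq, hu.mark j hj, not_not] at h7
        rcases hw with ⟨hw1, hw2⟩ | ⟨hw1, hw2, hw3, hw4⟩
        · left
          refine ⟨hw1, fun x hx => ?_⟩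
          rcases Nat.lt_or_eq_of_le hx with h8 | rfl
          · exact hw2 x h8
          · exact h7
        · right
          refine ⟨hw1, hw2, hw3, fun x hx hr => ?_⟩
          rcases Nat.lt_or_eq_of_le hx with h8 | rfl
          · exact hw4 x h8 hr
          · exact absurd h7 hr
      · rw [hu.mark j hj] at h7
        refine ⟨⟨by omega, hkey h7⟩, fun h8 => ⟨⟨by omega, hkey h7⟩, hj, h7, fun x hx hr => ?_⟩,
          fun h8 => ?_⟩
        · rcases Nat.lt_or_eq_of_le hx with h9 | rfl
          · rcases hw with ⟨hw1, hw2⟩ | ⟨hw1, hw2, hw3, hw4⟩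
            · exact absurd (hw2 x h9) hr
            · have := hw4 x h9 hr
              omega
          · exact le_rfl
        · rcases hw with ⟨hw1, hw2⟩ | ⟨hw1, hw2, hw3, hw4⟩
          · omega
          · right
            refine ⟨hw1, hw2, hw3, fun x hx hr => ?_⟩
            rcases Nat.lt_or_eq_of_le hx with h9 | rfl
            · exact hw4 x h9 hr
            · omega
    · rintro w - hfw hw
      rw [HState.set_v, if_neg (by decide), HState.set_v, if_neg (by decide), hun] at hw
      obtain ⟨hw1, hw2, hw4⟩ : w.v .b < g .n ∧ ¬ Reached b i (w.v .b) ∧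
          ∀ x < g .n, ¬ Reached b i x → u.mem (10 * g .H + x) ≤ u.mem (10 * g .H + w.v .b) := by
        rcases hw with ⟨-, hw2⟩ | ⟨hw1, hw2, -, hw4⟩
        · obtain ⟨x, hx, hr⟩ := exists_not_reached b hi'
          exact absurd (hw2 x hx) hr
        · exact ⟨hw1, hw2, hw4⟩
      have e1 := hfw.v .H rfl
      have e2 := hfw.mem rfl
      have e3 := hfw.v .i rfl
      have e4 := hfw.v .n rfl
      simp [huH, hui, hun] at e1 e2 e3 e4
      generalize hB : w.v .b = v at hw1 hw2 hw4
      have hw0 : E.w ≠ 0 := by rintro h0; rw [h0] at h3; omega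
      set m1 : ℕ → ℕ := Function.update (Function.update (Function.update (Function.update u.mem
        (12 * g .H + 3 * i) v) (12 * g .H + 3 * i + 1) (u.mem (11 * g .H + v)))
        (12 * g .H + 3 * i + 2) (u.mem (10 * g .H + v))) (9 * g .H + v) 1 with hm1
      have hm1a : ∀ a, a < 9 * g .H ∨ (10 * g .H ≤ a ∧ a < 12 * g .H + 3 * i) → m1 a = u.mem a :=
        fun a ha => by
          rw [hm1, Function.update_of_ne (by omega), Function.update_of_ne (by omega),
            Function.update_of_ne (by omega), Function.update_of_ne (by omega)]
      have goal1 : Tri E β (.loop .x .n (.kx ≔ Prog.valAt (Ex.var .b) (Ex.var .x) ⨟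
          .ite (.ld (10 * Ex.var .H + Ex.var .x) ≺ Ex.var .kx)
            (.put (10 * Ex.var .H + Ex.var .x) (Ex.var .kx) ⨟
              .put (11 * Ex.var .H + Ex.var .x) (Ex.var .b)) .skip))
          { w with mem := m1 } fun z => ∃ b y c, PrimInv (g .H) (g .n) val s.mem b y c (i + 1)
            z.mem := by
        -- Keys and parents are updated for tree nodes as well, which is harmless because only those
        -- of outside nodes are consulted.
        refine tri_loop (fun j z => (∀ x < g .n,
          z.mem (10 * g .H + x) = (if x < j ∧ u.mem (10 * g .H + x) < val v x then val v x
            else u.mem (10 * g .H + x)) ∧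
          z.mem (11 * g .H + x) = (if x < j ∧ u.mem (10 * g .H + x) < val v x then v
            else u.mem (11 * g .H + x))) ∧
          ∀ a, a < 10 * g .H ∨ 12 * g .H ≤ a → z.mem a = m1 a) (by decide) rfl rfl
          (by simpa [e4] using h.lt .n rfl) (by simpa [e4] using h.le .n rfl) ?_ ?_ ?_
        · refine ⟨fun x hx => ?_, fun a ha => rfl⟩
          simp only [HState.set_mem, Nat.not_lt_zero, false_and, if_false]
          exact ⟨hm1a _ (by omega), hm1a _ (by omega)⟩
        · rintro j z hj hzj hfz ⟨z1, z2⟩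
          have f1 := hfz.v .H rfl
          have f2 := hfz.v .b rfl
          have f3 := hfz.v .n rfl
          simp [e1, e4, hB] at f1 f2 f3 hj
          have hrv := row v hw1
          have htl := htb_lt v hw1 j hj
          have q1 : z.mem (g .H + v * g .n + j) = tb v j := by
            rw [z2 _ (by omega), hm1a _ (by omega), hu.frame _ (by omega), htb v hw1 j hj]
          have q2 : z.mem (3 * g .H + tb v j) = val v j := by
            rw [z2 _ (by omega), hm1a _ (by omega), hu.frame _ (by omega), hval v hw1 j hj]
          have q3 : z.mem (10 * g .H + j) = u.mem (10 * g .H + j) := by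
            rw [(z1 j hj).1, if_neg (by omega)]
          have q4 : z.mem (11 * g .H + j) = u.mem (11 * g .H + j) := by
            rw [(z1 j hj).2, if_neg (by omega)]
          simp [Prog.valAt, Prog.tbAt, f1, f2, f3, hzj, q1, q2, q3]
          refine ⟨by omega, by omega, fun h7 => ⟨by omega, by omega, fun x hx => ?_,
            fun a ha => ?_⟩, fun h7 => ⟨fun x hx => ?_, z2⟩⟩
          · by_cases hxj : x = j
            · subst hxj
              rw [Function.update_of_ne (by omega), Function.update_self, Function.update_self,
                if_pos ⟨by omega, h7⟩, if_pos ⟨by omega, h7⟩]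
              exact ⟨rfl, rfl⟩
            · have h8 : x ≤ j ↔ x < j := by omega
              rw [Function.update_of_ne (by omega), Function.update_of_ne (by omega),
                Function.update_of_ne (by omega), Function.update_of_ne (by omega)]
              simp only [h8]
              exact z1 x hx
          · rw [Function.update_of_ne (by omega), Function.update_of_ne (by omega)]
            exact z2 a ha
          · by_cases hxj : x = j
            · subst hxj
              rw [q3, q4, if_neg (by omega), if_neg (by omega)]
              exact ⟨rfl, rfl⟩
            · have h8 : x ≤ j ↔ x < j := by omega
              simp only [h8]
              exact z1 x hx
        · rintro z - - ⟨z1, z2⟩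
          have hwn : ({ w with mem := m1 } : HState).v .n = g .n := e4
          rw [hwn] at z1
          have hag : ∀ j < i, b j = Function.update b i v j := fun j hj => by
            rw [Function.update_of_ne (by omega)]
          have hR : ∀ j ≤ i, ∀ x, Reached (Function.update b i v) j x ↔ Reached b j x :=
            fun j hj x => (reached_congr fun k hk => hag k (by omega)).symm
          have hRs : ∀ x, Reached (Function.update b i v) (i + 1) x ↔ Reached b i x ∨ v = x :=
            fun x => by rw [IsPrim.reached_succ, hR i le_rfl, Function.update_self]
          have z3 : ∀ x < g .n, ¬ (Reached b i x ∨ v = x) →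
              z.mem (11 * g .H + x) < g .n ∧
              (Reached b i (z.mem (11 * g .H + x)) ∨ v = z.mem (11 * g .H + x)) ∧
              z.mem (10 * g .H + x) = val (z.mem (11 * g .H + x)) x ∧
              ∀ k < g .n, (Reached b i k ∨ v = k) → val k x ≤ z.mem (10 * g .H + x) := by
            intro x hx hr
            rw [not_or] at hr
            obtain ⟨y1, y2⟩ := z1 x hx
            rw [y1, y2]
            by_cases h8 : u.mem (10 * g .H + x) < val v x
            · rw [if_pos ⟨hx, h8⟩, if_pos ⟨hx, h8⟩]
              refine ⟨hw1, Or.inr rfl, rfl, ?_⟩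
              rintro k hk (h9 | rfl)
              · exact (hu.le_key x hx hr.1 k hk h9).trans h8.le
              · exact le_rfl
            · rw [if_neg (fun h9 => h8 h9.2), if_neg (fun h9 => h8 h9.2)]
              refine ⟨hu.par_lt x hx hr.1, Or.inl (hu.par x hx hr.1), hu.key x hx hr.1, ?_⟩
              rintro k hk (h9 | rfl)
              · exact hu.le_key x hx hr.1 k hk h9
              · omega
          have split : ∀ {j}, j < i + 1 → j < i ∨ j = i := fun hj => by omega
          refine ⟨Function.update b i v, Function.update y i (u.mem (11 * g .H + v)),
            Function.update c i (u.mem (10 * g .H + v)), ⟨fun j hj => ?_, fun x hx => ?_,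
            fun x hx hr => ?_, fun x hx hr => ?_, fun x hx hr => ?_, fun x hx hr k hk hrk => ?_,
            fun j hj => ?_, fun j hj => ?_, fun j hj => ?_, fun j hj => ?_, fun j hj => ?_,
            fun j hj k hk x hx => ?_, fun a ha => ?_⟩⟩
          · rw [z2 _ (by omega), z2 _ (by omega), z2 _ (by omega)]
            rcases split hj with h8 | rfl
            · rw [hm1a _ (by omega), hm1a _ (by omega), hm1a _ (by omega),
                Function.update_of_ne h8.ne, Function.update_of_ne h8.ne,
                Function.update_of_ne h8.ne]
              exact hu.out j h8
            · rw [hm1, Function.update_self, Function.update_self, Function.update_self]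
              refine ⟨?_, ?_, ?_⟩
              · rw [Function.update_of_ne (by omega), Function.update_of_ne (by omega),
                  Function.update_of_ne (by omega), Function.update_self]
              · rw [Function.update_of_ne (by omega), Function.update_of_ne (by omega),
                  Function.update_self]
              · rw [Function.update_of_ne (by omega), Function.update_self]
          · rw [z2 _ (by omega), hRs]
            by_cases h8 : v = x
            · subst h8
              rw [hm1, Function.update_self]; simp
            · rw [hm1, Function.update_of_ne (by omega), Function.update_of_ne (by omega),
                Function.update_of_ne (by omega), Function.update_of_ne (by omega), hu.mark x hx]
              simp [h8]
          · rw [hRs] at hr; exact (z3 x hx hr).1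
          · rw [hRs] at hr ⊢; exact (z3 x hx hr).2.1
          · rw [hRs] at hr; exact (z3 x hx hr).2.2.1
          · rw [hRs] at hr hrk; exact (z3 x hx hr).2.2.2 k hk hrk
          · rcases split hj with h8 | rfl
            · rw [Function.update_of_ne h8.ne]; exact hu.b_lt j h8
            · rw [Function.update_self]; exact hw1
          · rcases split hj with h8 | rfl
            · rw [Function.update_of_ne h8.ne]; exact hu.y_lt j h8
            · rw [Function.update_self]; exact hu.par_lt v hw1 hw2
          · rw [hR j (by omega)]
            rcases split hj with h8 | rfl
            · rw [Function.update_of_ne h8.ne]; exact hu.b_new j h8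
            · rw [Function.update_self]; exact hw2
          · rw [hR j (by omega)]
            rcases split hj with h8 | rfl
            · rw [Function.update_of_ne h8.ne]; exact hu.y_old j h8
            · rw [Function.update_self]; exact hu.par v hw1 hw2
          · rcases split hj with h8 | rfl
            · rw [Function.update_of_ne h8.ne, Function.update_of_ne h8.ne,
                Function.update_of_ne h8.ne]
              exact hu.c_eq j h8
            · rw [Function.update_self, Function.update_self, Function.update_self]
              exact hu.key v hw1 hw2
          · rw [hR j (by omega), hR j (by omega)]
            rcases split hj with h8 | rfl
            · rw [Function.update_of_ne h8.ne]; exact hu.c_max j h8 k hk x hx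
            · rw [Function.update_self]
              exact fun h9 h10 => (hu.le_key x hx h10 k hk h9).trans (hw4 x hx h10)
          · rw [z2 _ (by omega), hm1a _ (by omega)]; exact hu.frame a ha
      simp [e1, e2, e3, hB, hw0]
      refine ⟨by omega, ⟨by omega, by omega⟩, ⟨by omega, by omega⟩, by omega, ?_⟩
      have k1 : Function.update u.mem (12 * g .H + 3 * i) v (11 * g .H + v) =
          u.mem (11 * g .H + v) := Function.update_of_ne (by omega) _ _
      have k2 : ∀ z, Function.update (Function.update u.mem (12 * g .H + 3 * i) v)
          (12 * g .H + 3 * i + 1) z (10 * g .H + v) = u.mem (10 * g .H + v) := fun z => by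
        rw [Function.update_of_ne (by omega), Function.update_of_ne (by omega)]
      rw [k1, k2]
      exact goal1
  · rintro u - - ⟨b, y, c, hu⟩
    have hpr := h.pred
    rw [htp] at hu
    refine ⟨b, y, c, ⟨fun i hi => hu.b_lt i (by omega), fun i hi => hu.y_lt i (by omega),
      fun i hi => hu.b_new i (by omega), fun i hi => hu.y_old i (by omega),
      fun i hi => hu.c_eq i (by omega), fun i hi => hu.c_max i (by omega)⟩,
      fun i hi => hu.out i (by omega)⟩

end MinCutOracle

namespace MinCutOracle

/-! ### Verification of the common part and of the query program -/

/-- The numbers of heads of the pairs in the sketch, for a stream of random words. -/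
def headSketch (g : Var → ℕ) (cap ω : ℕ → ℕ) (q x : ℕ) : ℕ :=
  sketchCount headOf (g .n) (g .nn) (g .L) cap ω q x (g .T)

/-- The numbers of tails of the pairs in the sketch, for a stream of random words. -/
def tailSketch (g : Var → ℕ) (cap ω : ℕ → ℕ) (q x : ℕ) : ℕ :=
  sketchCount tailOf (g .n) (g .nn) (g .L) cap ω q x (g .T)

/-- The estimates of the capacities of the answers, for a stream of random words. -/
def tapeEst (E : Env) (M : ℕ) (g : Var → ℕ) (cap ω : ℕ → ℕ) (s t : ℕ) : ℕ :=
  sketchEst M g (headSketch g cap ω) (tailSketch g cap ω) (E.answer s t)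

/-- The final table, for a stream of random words. -/
def finalTable (E : Env) (M : ℕ) (g : Var → ℕ) (cap ω : ℕ → ℕ) : ℕ → ℕ → ℕ :=
  rounds (g .n) E.answer (tapeEst E M g cap ω) (g .INF) (g .K) 0 (fun _ _ => 0)
    fun i => ω (g .T + i)

theorem tri_cuts {E : Env} {β : Var → ℕ} {c₀ M n tot : ℕ} {s : HState} {cap : ℕ → ℕ}
    {lam : ℕ → ℕ → ℝ} {α : ℝ}
    (h : Params E β M (parms c₀ M n tot)) (hn : s.mem 0 = n)
    (hcap : ∀ i < n * n, s.mem (i + 1) = cap i)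
    (htot : ∑ i ∈ Finset.range (n * n), cap i = tot) (hzero : ∀ a, n * n < a → s.mem a = 0)
    (hacc : ∀ tb r, (mkRound E M (parms c₀ M n tot) (headSketch (parms c₀ M n tot) cap s.tape)
      (tailSketch (parms c₀ M n tot) cap s.tape) tb r).Accurate lam α) :
    Tri E β (Prog.cuts c₀ M) s fun t => ∃ ω m₀,
      CutsInv E M (parms c₀ M n tot) (headSketch (parms c₀ M n tot) cap s.tape)
        (tailSketch (parms c₀ M n tot) cap s.tape) lam α ω m₀ (parms c₀ M n tot .K)
        (finalTable E M (parms c₀ M n tot) cap s.tape) t ∧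
      m₀ 0 = n ∧ m₀ (n * n + 1) = parms c₀ M n tot .H ∧
      m₀ (3 * parms c₀ M n tot .H) = 0 ∧
      ∀ a, 9 * parms c₀ M n tot .H ≤ a → a < 16 * parms c₀ M n tot .H → m₀ a = 0 := by
  have h1 := h.nn_le_H
  have h2 := h.SK
  have h3 := h.PW
  have h4 := h.n_pos
  have h5 := h.n_le_nn
  have e1 : parms c₀ M n tot .n = n := rfl
  have e2 : parms c₀ M n tot .nn = n * n := rfl
  simp only [Prog.cuts, tri_seq]
  rw [e2] at h1 h5
  rw [e1] at h4 h5
  have htot' : ∑ i ∈ Finset.range (n * n), s.mem (i + 1) = tot := by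
    rw [← htot]
    exact Finset.sum_congr rfl fun i hi => hcap i (Finset.mem_range.1 hi)
  refine (tri_setup h hn htot').mono fun t1 ⟨a1, a2, a3, a4⟩ f1 => ?_
  have k1 := f1.tape rfl
  refine (tri_sketch h (cap := cap) a1 (fun i hi => ?_) a3 fun a ha hb => ?_).mono
    fun t2 ⟨b1, b2, b3⟩ f2 => ?_
  · rw [e2] at hi
    rw [a4 _ (by omega) (by omega), hcap i hi]
  · rw [a4 a (by omega) hb, hzero a (by omega)]
  have a1' := a1.of_frame f2 rfl
  rw [tri_prep]
  rw [k1] at b1 b3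
  have hz : ∀ a, n * n + 1 < a → a < 16 * parms c₀ M n tot .H → t2.mem a = 0 := fun a ha hb => by
    rw [b2 a (by omega), a4 a (by omega) (by omega), hzero a (by omega)]
  refine (tri_rounds (s := { t2 with ready := true }) h hacc a1' rfl b1 fun i hi =>
    hz _ (by omega) ?_).mono fun t3 ⟨c1, c2⟩ _ => ⟨t2.tape, t2.mem, ?_, ?_, ?_, hz _ ?_ ?_,
      fun a ha hb => hz a ?_ hb⟩
  · rw [e2] at hi; omega
  · rw [finalTable, ← b3]; exact c2
  · rw [b2 _ (by omega), a4 _ (by omega) (by omega), hn]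
  · rw [b2 _ (by omega), a2]
  all_goals omega

theorem tri_queryProg {E : Env} {β : Var → ℕ} {n H m : ℕ} {s : HState} (h0 : s.mem 0 = n)
    (h1 : s.mem (n * n + 1) = H) (h2 : s.mem (H + s.v .out * n + s.v .size) = m)
    (hn : n * n + 1 < 2 ^ E.w) (hH : H + s.v .out * n + s.v .size < 2 ^ E.w)
    (ho : 2 * H + (m - 1) * n < 2 ^ E.w) (hw : 2 < 2 ^ E.w) :
    Tri E β Prog.queryProg s fun t => t.v .out = 2 * H + (m - 1) * n := by
  simp [Prog.queryProg, h0, h1, h2]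
  refine ⟨hn, ⟨hH, ?_⟩, ho⟩
  rintro h3
  rw [h3] at hw
  omega

end MinCutOracle

namespace MinCutOracle

/-! ### The sketch as a quadratic form in random signs -/

theorem sum_range_mul_mod {R : Type*} [Semiring R] (B L : ℕ) (f : ℕ → R) :
    ∑ q ∈ Finset.range (B * L), f (q % L) = B * ∑ j ∈ Finset.range L, f j := by
  induction B with
  | zero => simp
  | succ B ih =>
    rw [Nat.succ_mul, Finset.sum_range_add, ih, Nat.cast_succ, add_mul, one_mul]
    congr 1
    refine Finset.sum_congr rfl fun j hj => ?_
    rw [Nat.add_comm, Nat.add_mul_mod_self_right, Nat.mod_eq_of_lt (Finset.mem_range.1 hj)]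

theorem sum_range_mul_div_mod {R : Type*} [Semiring R] (m n : ℕ) (f : ℕ → ℕ → R) :
    ∑ i ∈ Finset.range (m * n), f (i / n) (i % n) =
      ∑ u ∈ Finset.range m, ∑ v ∈ Finset.range n, f u v := by
  induction m with
  | zero => simp
  | succ m ih =>
    rw [Nat.succ_mul, Finset.sum_range_add, ih, Finset.sum_range_succ]
    congr 1
    refine Finset.sum_congr rfl fun j hj => ?_
    have hj := Finset.mem_range.1 hj
    rw [Nat.add_comm, Nat.add_mul_div_right _ _ (by omega), Nat.div_eq_of_lt hj,
      Nat.add_mul_mod_self_right, Nat.mod_eq_of_lt hj, Nat.zero_add]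

theorem sum_bits (a L : ℕ) : ∑ j ∈ Finset.range L, 2 ^ j * (a / 2 ^ j % 2) = a % 2 ^ L := by
  induction L with
  | zero => simp [Nat.mod_one]
  | succ L ih => rw [Finset.sum_range_succ, ih, Nat.mod_pow_succ]

theorem bit_le (a j : ℕ) : 2 ^ j * (a / 2 ^ j % 2) ≤ a :=
  (Nat.mul_le_mul_left _ (Nat.mod_le _ _)).trans (Nat.mul_div_le _ _)

theorem cast_count (p : ℕ → Prop) [DecidablePred p] (m : ℕ) :
    (Nat.count p m : ℝ) = ∑ i ∈ Finset.range m, if p i then 1 else 0 := by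
  rw [Nat.count_eq_card_filter_range, Finset.sum_boole]

/-- The indicator function of a set of nodes. -/
def ind (S : ℕ → Bool) (x : ℕ) : ℝ := if S x then 1 else 0

/-- The coefficient of the sign of the pair `i` in the block `q` of the sketch of `S`. -/
def sketchCoef (n L : ℕ) (cap : ℕ → ℕ) (S : ℕ → Bool) (q i : ℕ) : ℝ :=
  (cap i / 2 ^ (q % L) % 2 : ℕ) * (ind S (i / n) - ind S (i % n))

/-- Exchange the sums over nodes and over pairs: each live pair counts once, at the node that its
coin selects. -/
theorem sideSum_sketchCount {end' : ℕ → ℕ → ℕ → ℕ} {n nn L Q q : ℕ} {cap ω : ℕ → ℕ}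
    (hnn : 0 < nn) (hq : q < Q) (hend : ∀ r i, i < nn → end' n r i < n) (S : ℕ → Bool) :
    (sideSum n (fun x => sketchCount end' n nn L cap ω q x (Q * nn)) S : ℝ) =
      ∑ i ∈ Finset.range nn, (cap i / 2 ^ (q % L) % 2 : ℕ) *
        ind S (end' n (ω (q * nn + i)) i) := by
  have h1 : ∀ i < nn, (q * nn + i) / nn = q ∧ (q * nn + i) % nn = i := fun i hi => by
    rw [Nat.add_comm, Nat.add_mul_div_right _ _ hnn, Nat.div_eq_of_lt hi,
      Nat.add_mul_mod_self_right, Nat.mod_eq_of_lt hi, Nat.zero_add]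
    exact ⟨rfl, rfl⟩
  simp only [sideSum, sketchCount, count_block hnn _ hq]
  push_cast
  have h2 : ∀ x, (if S x then (Nat.count (fun i => Live nn L cap (q * nn + i) ∧
      end' n (ω (q * nn + i)) ((q * nn + i) % nn) = x) nn : ℝ) else 0) =
      ∑ i ∈ Finset.range nn, (cap i / 2 ^ (q % L) % 2 : ℕ) *
        (if end' n (ω (q * nn + i)) i = x then ind S x else 0) := fun x => by
    unfold ind
    by_cases hS : S x
    · simp only [hS, if_true]
      rw [cast_count]
      refine Finset.sum_congr rfl fun i hi => ?_
      obtain ⟨h3, h4⟩ := h1 i (Finset.mem_range.1 hi)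
      have h5 := Nat.mod_lt (cap i / 2 ^ (q % L)) (y := 2) (by norm_num)
      simp only [Live, h3, h4]
      interval_cases h6 : cap i / 2 ^ (q % L) % 2 <;> simp
    · simp [hS]
  rw [Finset.sum_congr rfl fun x _ => h2 x, Finset.sum_comm]
  refine Finset.sum_congr rfl fun i hi => ?_
  rw [← Finset.mul_sum, Finset.sum_ite_eq, if_pos]
  exact Finset.mem_range.2 (hend _ _ (Finset.mem_range.1 hi))

section Sketch

variable {E : Env} {β : Var → ℕ} {M : ℕ} {g : Var → ℕ} {cap : ℕ → ℕ}

theorem div_mod_lt {n i : ℕ} (h : i < n * n) : i / n < n ∧ i % n < n :=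
  ⟨Nat.div_lt_of_lt_mul h, Nat.mod_lt _ (by rcases n with _ | n <;> omega)⟩

/-- Heads minus tails inside `S` is a linear form in the signs. Its coefficient vanishes for pairs
within one side and is ±1 for live pairs that are cut. -/
theorem sketchSum_eq_blockSum (h : Params E β M g) (cap ω : ℕ → ℕ) (S : ℕ → Bool) :
    (sketchSum (g .n) (g .L) (headSketch g cap ω) (tailSketch g cap ω) S (g .Q) : ℝ) =
      blockSum (g .Q) (g .nn) (fun q => 2 ^ (q % g .L)) (sketchCoef (g .n) (g .L) cap S) ω := by
  have hnn : 0 < g .nn := h.n_pos.trans_le h.n_le_nn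
  have habs : ∀ a b : ℕ, (absDiff a b : ℝ) * absDiff a b = ((a : ℝ) - b) ^ 2 := fun a b => by
    unfold absDiff
    rcases le_total a b with hab | hab
    · rw [Nat.sub_eq_zero_of_le hab, Nat.zero_add, Nat.cast_sub hab]; ring
    · rw [Nat.sub_eq_zero_of_le hab, Nat.add_zero, Nat.cast_sub hab]; ring
  unfold sketchSum blockSum
  push_cast
  refine Finset.sum_congr rfl fun q hq => ?_
  have hq := Finset.mem_range.1 hq
  rw [mul_assoc, habs]
  congr 2
  have e1 : headSketch g cap ω q =
    fun x => sketchCount headOf (g .n) (g .nn) (g .L) cap ω q x (g .Q * g .nn) := by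
    funext x; rw [headSketch, h.T]
  have e2 : tailSketch g cap ω q =
    fun x => sketchCount tailOf (g .n) (g .nn) (g .L) cap ω q x (g .Q * g .nn) := by
    funext x; rw [tailSketch, h.T]
  rw [e1, e2, sideSum_sketchCount hnn hq _ S, sideSum_sketchCount hnn hq _ S,
    ← Finset.sum_sub_distrib, signSum]
  · refine Finset.sum_congr rfl fun i _ => ?_
    unfold sketchCoef headOf tailOf sgn
    split_ifs <;> ring
  all_goals
    intro r i hi
    rw [h.nn] at hi
    have := div_mod_lt hi
    first | unfold headOf | unfold tailOf
    split_ifs <;> omega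

theorem sketchCoef_sq (n L : ℕ) (cap : ℕ → ℕ) (S : ℕ → Bool) (q i : ℕ) :
    sketchCoef n L cap S q i ^ 2 =
      (cap i / 2 ^ (q % L) % 2 : ℕ) * if S (i / n) = S (i % n) then 0 else 1 := by
  have h5 := Nat.mod_lt (cap i / 2 ^ (q % L)) (y := 2) (by norm_num)
  unfold sketchCoef ind
  interval_cases h6 : cap i / 2 ^ (q % L) % 2 <;>
    cases S (i / n) <;> cases S (i % n) <;> simp

/-- The sum of the capacities of the pairs that are cut. -/
def pairCap (n : ℕ) (cap : ℕ → ℕ) (S : ℕ → Bool) : ℕ :=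
  ∑ i ∈ Finset.range (n * n), cap i * if S (i / n) = S (i % n) then 0 else 1

/-- One bit level never accounts for more than the whole capacity. This is the bound `D` on a block
in `avg_blockSum_tail`. -/
theorem mul_sum_sketchCoef_le (n L : ℕ) (cap : ℕ → ℕ) (S : ℕ → Bool) (q : ℕ) :
    (2 : ℝ) ^ (q % L) * ∑ i ∈ Finset.range (n * n), sketchCoef n L cap S q i ^ 2 ≤
      pairCap n cap S := by
  rw [Finset.mul_sum, pairCap]
  push_cast
  refine Finset.sum_le_sum fun i _ => ?_
  rw [sketchCoef_sq, ← mul_assoc]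
  refine mul_le_mul_of_nonneg_right ?_ (by split_ifs <;> norm_num)
  exact_mod_cast bit_le (cap i) (q % L)

/-- The blocks run through all bit levels `B` times, and the weighted bits of a capacity add up to
the capacity. -/
theorem sum_mul_sum_sketchCoef (n L B : ℕ) (cap : ℕ → ℕ) (S : ℕ → Bool)
    (hcap : ∀ i < n * n, cap i < 2 ^ L) :
    ∑ q ∈ Finset.range (B * L), (2 : ℝ) ^ (q % L) *
      ∑ i ∈ Finset.range (n * n), sketchCoef n L cap S q i ^ 2 = B * pairCap n cap S := by
  simp only [sketchCoef_sq]
  rw [sum_range_mul_mod B L fun j => (2 : ℝ) ^ j * ∑ i ∈ Finset.range (n * n),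
    (cap i / 2 ^ j % 2 : ℕ) * if S (i / n) = S (i % n) then (0 : ℝ) else 1]
  congr 1
  simp only [Finset.mul_sum]
  rw [Finset.sum_comm, pairCap]
  push_cast
  refine Finset.sum_congr rfl fun i hi => ?_
  have h1 := sum_bits (cap i) L
  rw [Nat.mod_eq_of_lt (hcap i (Finset.mem_range.1 hi))] at h1
  conv_rhs => rw [← h1]
  push_cast
  rw [Finset.sum_mul]
  exact Finset.sum_congr rfl fun j _ => by ring

/-- The random words make all sketches of answers accurate. -/
def GoodTape (E : Env) (M : ℕ) (g : Var → ℕ) (cap ω : ℕ → ℕ) (s t : ℕ) : Prop :=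
  (1 - 1 / (60 * M : ℝ)) * (g .B * pairCap (g .n) cap (E.answer s t)) ≤
    blockSum (g .Q) (g .nn) (fun q => 2 ^ (q % g .L)) (sketchCoef (g .n) (g .L) cap (E.answer s t)) ω ∧
  blockSum (g .Q) (g .nn) (fun q => 2 ^ (q % g .L)) (sketchCoef (g .n) (g .L) cap (E.answer s t)) ω ≤
    (1 + 1 / (60 * M : ℝ)) * (g .B * pairCap (g .n) cap (E.answer s t))

/-- Division by 1-δ turns the two-sided error into a one-sided one with factor (1+δ)/(1-δ), where δ
= 1/(60M). Rounding down does no harm, as `c` is an integer. -/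
theorem tapeEst_bounds (h : Params E β M g) {ω : ℕ → ℕ} {s t c : ℕ}
    (hω : GoodTape E M g cap ω s t) (hc : pairCap (g .n) cap (E.answer s t) = 2 * c) :
    c ≤ tapeEst E M g cap ω s t ∧
      (tapeEst E M g cap ω s t : ℝ) ≤ (60 * M + 1) / (60 * M - 1) * c := by
  obtain ⟨h1, h2⟩ := hω
  rw [← sketchSum_eq_blockSum h, hc] at h1 h2
  have hM : (1 : ℝ) ≤ M := by exact_mod_cast h.M_pos
  have hMn := h.M_pos
  have hB : (1 : ℝ) ≤ g .B := by exact_mod_cast h.B_pos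
  have hBn := h.B_pos
  set X := sketchSum (g .n) (g .L) (headSketch g cap ω) (tailSketch g cap ω) (E.answer s t) (g .Q)
    with hX
  have hden : 0 < g .B * (2 * (60 * M - 1)) := Nat.mul_pos h.B_pos (by omega)
  have hcast : ((g .B * (2 * (60 * M - 1)) : ℕ) : ℝ) = g .B * (2 * (60 * M - 1)) := by
    push_cast [Nat.cast_sub (show 1 ≤ 60 * M by omega)]
    ring
  have hdenR : (0 : ℝ) < g .B * (2 * (60 * M - 1)) := by rw [← hcast]; exact_mod_cast hden
  push_cast at h1 h2
  have e1 : (1 - 1 / (60 * M : ℝ)) * (g .B * (2 * c)) = c * (g .B * (2 * (60 * M - 1))) / (60 * M) := by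
    field_simp
  have e2 : (1 + 1 / (60 * M : ℝ)) * (g .B * (2 * c)) = c * (g .B * (2 * (60 * M + 1))) / (60 * M) := by
    field_simp
  rw [e1, div_le_iff₀ (by positivity)] at h1
  rw [e2, le_div_iff₀ (by positivity)] at h2
  unfold tapeEst sketchEst
  rw [← hX]
  constructor
  · rw [Nat.le_div_iff_mul_le hden]
    have : ((c * (g .B * (2 * (60 * M - 1))) : ℕ) : ℝ) ≤ ((X * (60 * M) : ℕ) : ℝ) := by
      rw [Nat.cast_mul, hcast]
      push_cast
      linarith
    exact_mod_cast this
  · refine Nat.cast_div_le.trans ?_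
    rw [hcast, div_le_iff₀ hdenR]
    push_cast
    have e3 : (60 * (M : ℝ) + 1) / (60 * M - 1) * c * (g .B * (2 * (60 * M - 1))) =
        c * (g .B * (2 * (60 * M + 1))) := by
      have : (60 * (M : ℝ) - 1) ≠ 0 := by linarith
      field_simp
    rw [e3]
    exact h2

theorem tapeEst_lt (h : Params E β M g) (cap ω : ℕ → ℕ) (s t : ℕ) :
    tapeEst E M g cap ω s t < g .INF := by
  have hnn : 0 < g .nn := h.n_pos.trans_le h.n_le_nn
  have hM := h.M_pos
  have hB := h.B_pos
  have h1 : 60 * M ≤ g .B * (2 * (60 * M - 1)) :=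
    le_trans (by omega) (Nat.le_mul_of_pos_left _ hB)
  refine lt_of_le_of_lt (Nat.div_le_of_le_mul ?_) (sketchSum_le h (Pf := headSketch g cap ω)
    (Nf := tailSketch g cap ω) (fun q hq x _ => ?_) (fun q hq x _ => ?_) (E.answer s t) (g .Q) le_rfl)
  · rw [Nat.mul_comm]
    exact Nat.mul_le_mul_right _ h1
  · rw [headSketch, h.T]; exact sketchCount_le hnn hq
  · rw [tailSketch, h.T]; exact sketchCount_le hnn hq

open scoped Classical in
theorem avg_goodTape (h : Params E β M g) (hW : 0 < E.w)
    (hcap : ∀ i < g .n * g .n, cap i < 2 ^ g .L) {s t : ℕ}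
    (hpos : 0 < pairCap (g .n) cap (E.answer s t)) :
    avg (2 ^ E.w) (g .T) (fun ω => if GoodTape E M g cap ω s t then 0 else 1) ≤
      2 * Real.exp (-(g .B * (1 / (60 * M : ℝ)) ^ 2 / 1024)) := by
  have hM : (1 : ℝ) ≤ M := by exact_mod_cast h.M_pos
  rw [h.T]
  have h1 := avg_blockSum_tail (W := 2 ^ E.w) (by positivity) (dvd_pow_self 2 hW.ne') (g .Q) (g .nn)
    (fun q => 2 ^ (q % g .L)) (sketchCoef (g .n) (g .L) cap (E.answer s t)) (g .B)
    (pairCap (g .n) cap (E.answer s t)) (1 / (60 * M)) (by exact_mod_cast hpos) (by positivity)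
    (by rw [div_le_one (by positivity)]; linarith) (fun q => by positivity)
    (fun q _ => by rw [h.nn]; exact mul_sum_sketchCoef_le _ _ _ _ _)
    (by rw [h.nn, h.Q]; exact sum_mul_sum_sketchCoef _ _ _ _ _ hcap)
  refine le_trans (avg_mono fun ω => le_of_eq ?_) h1
  by_cases hg : GoodTape E M g cap ω s t
  · rw [if_pos hg]; exact (if_pos hg).symm
  · rw [if_neg hg]; exact (if_neg hg).symm

end Sketch

/-! ### Cut capacities and pairs -/

section Cut

variable {n : ℕ} (G : CapGraph n)

/-- The capacities in the order of the input. -/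
def inputCap (i : ℕ) : ℕ := inputMem G (i + 1)

theorem inputCap_eq (u v : Fin n) : inputCap G (u * n + v) = G.cap u v := by
  have hn : 0 < n := u.pos
  have h1 : (u.val * n + v.val) / n = u ∧ (u.val * n + v.val) % n = v := by
    rw [Nat.add_comm, Nat.add_mul_div_right _ _ hn, Nat.div_eq_of_lt v.isLt,
      Nat.add_mul_mod_self_right, Nat.mod_eq_of_lt v.isLt, Nat.zero_add]
    exact ⟨rfl, rfl⟩
  have h2 : (u.val * n + v.val + 1 - 1) / n < n ∧ (u.val * n + v.val + 1 - 1) % n < n := by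
    rw [Nat.add_sub_cancel, h1.1, h1.2]; exact ⟨u.isLt, v.isLt⟩
  rw [inputCap, inputMem, if_neg (by omega), dif_pos h2]
  congr 1 <;> ext <;> simp [h1.1, h1.2]

theorem inputMem_eq_zero {a : ℕ} (h : n * n < a) : inputMem G a = 0 := by
  rw [inputMem, if_neg (by omega), dif_neg]
  rintro ⟨h1, -⟩
  rw [Nat.div_lt_iff_lt_mul (Nat.pos_of_ne_zero (by rintro rfl; simp at h1))] at h1
  omega

theorem sum_range_inputCap {R : Type*} [Semiring R] (f : ℕ → ℕ → ℕ → R) :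
    ∑ i ∈ Finset.range (n * n), f (inputCap G i) (i / n) (i % n) =
      ∑ u : Fin n, ∑ v : Fin n, f (G.cap u v) u v := by
  have h1 : ∀ i ∈ Finset.range (n * n), f (inputCap G i) (i / n) (i % n) =
      f (inputCap G (i / n * n + i % n)) (i / n) (i % n) := fun i _ => by
    rw [Nat.div_add_mod']
  rw [Finset.sum_congr rfl h1, sum_range_mul_div_mod n n fun u v => f (inputCap G (u * n + v)) u v,
    Finset.sum_range]
  refine Finset.sum_congr rfl fun u _ => ?_
  rw [Finset.sum_range]
  exact Finset.sum_congr rfl fun v _ => by rw [inputCap_eq]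

/-- The input matrix lists every edge in both orders. -/
theorem pairCap_inputCap {S : ℕ → Bool} {A : Finset (Fin n)} (hS : ∀ v : Fin n, S v = decide (v ∈ A)) :
    pairCap n (inputCap G) S = 2 * G.cutCap A := by
  have h1 := sum_range_inputCap G (fun c u v => c * if S u = S v then 0 else 1)
  rw [pairCap, h1, two_mul]
  have h2 : G.cutCap A = ∑ u : Fin n, ∑ v : Fin n, if u ∈ A ∧ v ∉ A then G.cap u v else 0 := by
    rw [CapGraph.cutCap, ← Finset.sum_filter_add_sum_filter_not Finset.univ (fun u => u ∈ A)
      (fun u => ∑ v : Fin n, if u ∈ A ∧ v ∉ A then G.cap u v else 0)]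
    rw [Finset.sum_eq_zero (s := {u | u ∉ A}), add_zero]
    · refine Finset.sum_congr (by ext; simp) fun u hu => ?_
      rw [← Finset.sum_filter]
      refine Finset.sum_congr ?_ fun _ _ => rfl
      ext v; simp_all
    · intro u hu
      simp_all
  have h3 : G.cutCap A = ∑ u : Fin n, ∑ v : Fin n, if v ∈ A ∧ u ∉ A then G.cap u v else 0 := by
    rw [h2, Finset.sum_comm]
    refine Finset.sum_congr rfl fun u _ => Finset.sum_congr rfl fun v _ => ?_
    rw [G.symm]
  nth_rewrite 1 [h2]
  rw [h3, ← Finset.sum_add_distrib]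
  refine Finset.sum_congr rfl fun u _ => ?_
  rw [← Finset.sum_add_distrib]
  refine Finset.sum_congr rfl fun v _ => ?_
  rw [hS, hS]
  by_cases hu : u ∈ A <;> by_cases hv : v ∈ A <;> simp [hu, hv]

end Cut

end MinCutOracle

namespace MinCutOracle

/-! ### Accuracy -/

/-- The minimum capacity of a cut between two nodes, extended by `0` to all numbers. -/
noncomputable def CapGraph.flow {n : ℕ} (G : CapGraph n) (s t : ℕ) : ℝ :=
  if h : s < n ∧ t < n then G.maxFlow ⟨s, h.1⟩ ⟨t, h.2⟩ else 0

theorem CapGraph.flow_eq {n : ℕ} (G : CapGraph n) {s t : ℕ} (hs : s < n) (ht : t < n) :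
    G.flow s t = G.maxFlow ⟨s, hs⟩ ⟨t, ht⟩ := dif_pos ⟨hs, ht⟩

theorem oracle_answer {w n tp : ℕ} (D : CutOracle n) {a b : ℕ} (ha : a < n) (hb : b < n) (v : Fin n) :
    (oracleEnv w D tp).answer a b v = decide (v ∈ D ⟨a, ha⟩ ⟨b, hb⟩) := by
  simp [oracleEnv, ha, hb]

/-- The precision that is obtained with sketches of the precision `1 / (60 * M)`. -/
noncomputable def precision (ε : ℝ) (M : ℕ) : ℝ := (60 * M + 1) / (60 * M - 1) * (1 + ε / 3)

theorem one_le_precision {ε : ℝ} (hε : 0 < ε) {M : ℕ} (hM : 0 < M) : 1 ≤ precision ε M := by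
  have hM' : (1 : ℝ) ≤ M := by exact_mod_cast hM
  unfold precision
  refine one_le_mul_of_one_le_of_one_le ?_ (by linarith)
  rw [le_div_iff₀ (by linarith)]
  linarith

/-- The choice 60 leaves room: (60M+1)/(60M-1) ≤ 1+2ε/59, its product with 1+ε/3 is at most 1+2ε/5,
and (1+2ε/5)² ≤ 1+ε for ε ≤ 1. -/
theorem precision_sq_le {ε : ℝ} (hε : 0 < ε) (hε1 : ε ≤ 1) {M : ℕ} (hM : 1 / ε ≤ M) :
    precision ε M ^ 2 ≤ 1 + ε := by
  have h1 : 1 ≤ M * ε := by rwa [div_le_iff₀ hε] at hM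
  have hM' : (1 : ℝ) ≤ M := le_trans (by rw [le_div_iff₀ hε]; linarith) hM
  have h2 : (60 * M + 1) / (60 * M - 1) ≤ 1 + 2 * ε / 59 := by
    rw [div_le_iff₀ (by linarith)]
    nlinarith
  have h3 : (0 : ℝ) ≤ (60 * M + 1) / (60 * M - 1) := div_nonneg (by linarith) (by linarith)
  have h4 : precision ε M ≤ (1 + 2 * ε / 59) * (1 + ε / 3) :=
    mul_le_mul_of_nonneg_right h2 (by linarith)
  have h5 : (1 + 2 * ε / 59) * (1 + ε / 3) ≤ 1 + 2 * ε / 5 := by nlinarith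
  have h6 : 0 ≤ precision ε M := mul_nonneg h3 (by linarith)
  calc precision ε M ^ 2 ≤ (1 + 2 * ε / 5) ^ 2 := by gcongr; exact h4.trans h5
    _ ≤ 1 + ε := by nlinarith

section Accuracy

variable {n w tp c₀ M : ℕ} {G : CapGraph n} {D : CutOracle n} {β : Var → ℕ} {ε : ℝ} {ω : ℕ → ℕ}

/-- The sum of all entries of the capacity matrix. -/
def CapGraph.total (G : CapGraph n) : ℕ := ∑ i ∈ Finset.range (n * n), inputCap G i

theorem inputCap_lt {i : ℕ} (hi : i < n * n) : inputCap G i < 2 ^ lg G.total :=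
  (Finset.single_le_sum (f := inputCap G) (fun _ _ => Nat.zero_le _)
    (Finset.mem_range.2 hi)).trans_lt (lt_two_pow_lg _)

theorem pairCap_answer {a b : ℕ} (ha : a < n) (hb : b < n) :
    pairCap n (inputCap G) ((oracleEnv w D tp).answer a b) = 2 * G.cutCap (D ⟨a, ha⟩ ⟨b, hb⟩) :=
  pairCap_inputCap G fun v => oracle_answer D ha hb v

theorem answer_ne (hD : D.IsApprox G (ε / 3)) {s t : ℕ} (hst : s < t) (ht : t < n) :
    (oracleEnv w D tp).answer s t s ≠ (oracleEnv w D tp).answer s t t := by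
  have hs : s < n := hst.trans ht
  have h1 := oracle_answer (w := w) (tp := tp) D hs ht ⟨s, hs⟩
  have h2 := oracle_answer (w := w) (tp := tp) D hs ht ⟨t, ht⟩
  have h3 := (hD ⟨s, hs⟩ ⟨t, ht⟩ (by simp only [ne_eq, Fin.mk.injEq]; omega)).1
  simp only at h1 h2
  rw [h1, h2]
  unfold Separates at h3
  simpa [decide_eq_decide] using h3

/-- All sketches of answers are accurate. -/
def AllGood (n w tp c₀ M : ℕ) (G : CapGraph n) (D : CutOracle n) (ω : ℕ → ℕ) : Prop :=
  ∀ s t, s < t → t < n →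
    GoodTape (oracleEnv w D tp) M (parms c₀ M n G.total) (inputCap G) ω s t

/-- The estimates lose the sketch factor, and the answers the factor 1+ε/3 over a minimum cut;
`precision` is the product. Since estimates never fall below capacities, they bound from above the
connectivity of all pairs that the cut separates. -/
theorem accurate_of_allGood (hε : 0 < ε) (hD : D.IsApprox G (ε / 3))
    (h : Params (oracleEnv w D tp) β M (parms c₀ M n G.total)) (hω : AllGood n w tp c₀ M G D ω)
    (tb : ℕ → ℕ → ℕ) (r : ℕ) :
    (mkRound (oracleEnv w D tp) M (parms c₀ M n G.total)
      (headSketch (parms c₀ M n G.total) (inputCap G) ω)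
      (tailSketch (parms c₀ M n G.total) (inputCap G) ω) tb r).Accurate G.flow (precision ε M) := by
  have hM' : (1 : ℝ) ≤ M := by exact_mod_cast h.M_pos
  have key : ∀ s t (hst : s < t) (ht : t < n), _ := fun s t hst ht =>
    tapeEst_bounds h (hω s t hst ht) (pairCap_answer (hst.trans ht) ht)
  refine ⟨one_le_precision hε h.M_pos, fun s t hst ht => answer_ne (w := w) (tp := tp) hD hst ht,
    fun s t => ?_,
    fun s t => ?_, fun s hs t ht u hu hst => ?_, fun s t hst ht => ?_,
    fun s t x y hst ht hx hy hxy => ?_, fun s t _ _ => tapeEst_lt h (inputCap G) ω s t⟩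
  · unfold CapGraph.flow; split_ifs <;> positivity
  · by_cases h1 : s < n ∧ t < n
    · rw [G.flow_eq h1.1 h1.2, G.flow_eq h1.2 h1.1, maxFlow_comm]
    · rw [CapGraph.flow, CapGraph.flow, dif_neg h1, dif_neg (fun h2 => h1 h2.symm)]
  · have hs : s < n := hs
    have ht : t < n := ht
    have hu : u < n := hu
    rw [G.flow_eq hu hs, G.flow_eq hu ht, G.flow_eq hs ht]
    have := min_maxFlow_le G (s := ⟨s, hs⟩) (t := ⟨t, ht⟩) ⟨u, hu⟩ (by simpa using hst)
    exact_mod_cast this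
  · have ht : t < n := ht
    have hs := hst.trans ht
    refine (key s t hst ht).2.trans ?_
    rw [G.flow_eq hs ht, precision, mul_assoc]
    refine mul_le_mul_of_nonneg_left ?_ (div_nonneg (by linarith) (by linarith))
    exact (hD ⟨s, hs⟩ ⟨t, ht⟩ (by simp only [ne_eq, Fin.mk.injEq]; omega)).2
  · have ht : t < n := ht
    have hx : x < n := hx
    have hy : y < n := hy
    have hs := hst.trans ht
    rw [G.flow_eq hx hy]
    refine le_trans ?_ (Nat.cast_le.2 (key s t hst ht).1)
    refine Nat.cast_le.2 (maxFlow_le G ?_)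
    have h1 := oracle_answer (w := w) (tp := tp) D hs ht ⟨x, hx⟩
    have h2 := oracle_answer (w := w) (tp := tp) D hs ht ⟨y, hy⟩
    simp only at h1 h2
    have hxy : (oracleEnv w D tp).answer s t x ≠ (oracleEnv w D tp).answer s t y := hxy
    rw [h1, h2] at hxy
    unfold Separates
    simpa [decide_eq_decide] using hxy

/-! ### The probability of success -/

/-- The random words lead to a correct result. -/
def Lucky (n w tp c₀ M : ℕ) (G : CapGraph n) (D : CutOracle n) (ω : ℕ → ℕ) : Prop :=
  AllGood n w tp c₀ M G D ω ∧
    pot n (finalTable (oracleEnv w D tp) M (parms c₀ M n G.total) (inputCap G) ω) = 0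

theorem Lucky.table_ne_zero (hω : Lucky n w tp c₀ M G D ω) {x y : ℕ} (hx : x < n) (hy : y < n)
    (hxy : x ≠ y) :
    finalTable (oracleEnv w D tp) M (parms c₀ M n G.total) (inputCap G) ω x y ≠ 0 := by
  have h1 := hω.2
  rw [pot, Finset.sum_eq_zero_iff] at h1
  have h2 := h1 x (Finset.mem_range.2 hx)
  rw [Finset.card_eq_zero, Finset.filter_eq_empty_iff] at h2
  have h3 := h2 (Finset.mem_range.2 hy)
  tauto

theorem sketchCount_congr {end' : ℕ → ℕ → ℕ → ℕ} {nn L q x m : ℕ} {cap ω ω' : ℕ → ℕ}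
    (h : ∀ i < m, ω i = ω' i) :
    sketchCount end' n nn L cap ω q x m = sketchCount end' n nn L cap ω' q x m :=
  Round.count_congr_of_lt fun i hi => by rw [h i hi]

theorem blockSum_congr {Q m : ℕ} {c : ℕ → ℝ} {a : ℕ → ℕ → ℝ} {ω ω' : ℕ → ℕ}
    (h : ∀ i < Q * m, ω i = ω' i) : blockSum Q m c a ω = blockSum Q m c a ω' := by
  unfold blockSum signSum
  refine Finset.sum_congr rfl fun q hq => ?_
  congr 2
  refine Finset.sum_congr rfl fun i hi => ?_
  have hq := Finset.mem_range.1 hq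
  have hi := Finset.mem_range.1 hi
  change a q i * sgn (ω (q * m + i)) = a q i * sgn (ω' (q * m + i))
  rw [h]
  calc q * m + i < (q + 1) * m := by rw [Nat.succ_mul]; omega
    _ ≤ Q * m := Nat.mul_le_mul_right _ hq

theorem two_pow_lg_le {x : ℕ} (hx : 0 < x) (e : ℕ) :
    ((1 : ℝ) / 2) ^ (e * lg x) ≤ (1 / (x : ℝ)) ^ e := by
  rw [mul_comm, pow_mul]
  gcongr
  rw [one_div_pow]
  gcongr
  exact_mod_cast (lt_two_pow_lg x).le

/-- The factor 2/n²+1/n is at most 1, with equality at n = 2. -/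
theorem sum_failure_le {n : ℕ} (hn : 2 ≤ n) (c : ℕ) :
    (n : ℝ) * n * (2 * (1 / (n : ℝ)) ^ (c + 4)) + (1 / (n : ℝ)) ^ (c + 3) * (n * n) ≤
      1 / (n : ℝ) ^ c := by
  have h1 : (2 : ℝ) ≤ n := by exact_mod_cast hn
  have h2 : (0 : ℝ) < n := by linarith
  have e : (n : ℝ) * n * (2 * (1 / (n : ℝ)) ^ (c + 4)) + (1 / (n : ℝ)) ^ (c + 3) * (n * n) =
      (2 / (n : ℝ) ^ 2 + 1 / n) * (1 / (n : ℝ) ^ c) := by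
    rw [one_div_pow, one_div_pow, pow_add, pow_add]
    field_simp
  rw [e]
  refine mul_le_of_le_one_left (by positivity) ?_
  rw [div_add_div _ _ (by positivity) (by positivity), div_le_one (by positivity)]
  nlinarith

open scoped Classical in
-- The first `T` words decide the sketch, and the following ones the pivots. For a fixed sketch the
-- expected number of unseparated pairs is small whether or not the estimates are accurate, so the
-- two kinds of failure are bounded separately and added.
theorem avg_lucky (hG : G.graph.Connected) (hD : D.IsApprox G (ε / 3)) (hn : 2 ≤ n)
    (h : Params (oracleEnv w D tp) β M (parms c₀ M n G.total)) {m : ℕ}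
    (hm : parms c₀ M n G.total .T + parms c₀ M n G.total .K ≤ m) :
    1 - 1 / (n : ℝ) ^ c₀ ≤
      avg (2 ^ (oracleEnv w D tp).w) m fun ω => if Lucky n w tp c₀ M G D ω then 1 else 0 := by
  set E := oracleEnv w D tp with hE
  set g := parms c₀ M n G.total with hg
  have hM : (1 : ℝ) ≤ M := by exact_mod_cast h.M_pos
  have hnw : n < 2 ^ E.w := h.lt .n rfl
  have hw : 0 < E.w := by
    rcases Nat.eq_zero_or_pos E.w with h0 | h0
    · rw [h0] at hnw; omega
    · exact h0
  obtain ⟨d, rfl⟩ := Nat.exists_eq_add_of_le hm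
  rw [Nat.add_assoc]
  rw [avg_append]
  have hgood : ∀ ω ω' s t, GoodTape E M g (inputCap G) (tapeAppend (g .T) ω ω') s t ↔
      GoodTape E M g (inputCap G) ω s t := fun ω ω' s t => by
    unfold GoodTape
    rw [blockSum_congr (ω := tapeAppend (g .T) ω ω') (ω' := ω)]
    intro i hi
    rw [← h.T] at hi
    simp [tapeAppend, hi]
  have hest : ∀ ω ω', tapeEst E M g (inputCap G) (tapeAppend (g .T) ω ω') =
      tapeEst E M g (inputCap G) ω := fun ω ω' => by
    have e1 : ∀ i < g .T, tapeAppend (g .T) ω ω' i = ω i := fun i hi => by simp [tapeAppend, hi]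
    have e2 : headSketch g (inputCap G) (tapeAppend (g .T) ω ω') = headSketch g (inputCap G) ω := by
      funext q x; exact sketchCount_congr e1
    have e3 : tailSketch g (inputCap G) (tapeAppend (g .T) ω ω') = tailSketch g (inputCap G) ω := by
      funext q x; exact sketchCount_congr e1
    funext s t
    rw [tapeEst, tapeEst, e2, e3]
  have htab : ∀ ω ω', finalTable E M g (inputCap G) (tapeAppend (g .T) ω ω') =
      rounds n E.answer (tapeEst E M g (inputCap G) ω) (g .INF) (g .K) 0 (fun _ _ => 0) ω' :=
    fun ω ω' => by
      rw [finalTable, hest]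
      congr 1
      funext i
      simp [tapeAppend]
  set bad : (ℕ → ℕ) → ℝ := fun ω => ∑ s ∈ Finset.range n, ∑ t ∈ Finset.range n,
    if s < t then (if GoodTape E M g (inputCap G) ω s t then 0 else 1) else 0 with hbad
  set rest : (ℕ → ℕ) → (ℕ → ℕ) → ℝ := fun ω ω' => (pot n (rounds n E.answer
    (tapeEst E M g (inputCap G) ω) (g .INF) (g .K) 0 (fun _ _ => 0) ω') : ℝ) with hrest
  have hbad0 : ∀ ω s t, (0 : ℝ) ≤
      if s < t then (if GoodTape E M g (inputCap G) ω s t then 0 else 1) else 0 := fun ω s t => by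
    split_ifs <;> norm_num
  -- Union bound and Markov's inequality in one: every failure makes the number of inaccurate
  -- sketches or the number of unseparated pairs at least 1.
  have hpoint : ∀ ω ω', (1 : ℝ) ≤
      (if Lucky n w tp c₀ M G D (tapeAppend (g .T) ω ω') then 1 else 0) + (bad ω + rest ω ω') := by
    intro ω ω'
    have hb0 : 0 ≤ bad ω := Finset.sum_nonneg fun s _ => Finset.sum_nonneg fun t _ => hbad0 ω s t
    have hr0 : 0 ≤ rest ω ω' := Nat.cast_nonneg _
    by_cases hL : Lucky n w tp c₀ M G D (tapeAppend (g .T) ω ω')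
    · rw [if_pos hL]; linarith
    rw [if_neg hL, zero_add]
    by_cases hA : AllGood n w tp c₀ M G D (tapeAppend (g .T) ω ω')
    · have h1 : pot n (finalTable E M g (inputCap G) (tapeAppend (g .T) ω ω')) ≠ 0 :=
        fun h0 => hL ⟨hA, h0⟩
      rw [htab] at h1
      have : (1 : ℝ) ≤ rest ω ω' := by
        simp only [hrest]; exact_mod_cast Nat.one_le_iff_ne_zero.2 h1
      linarith
    · simp only [AllGood, not_forall] at hA
      obtain ⟨s, t, hst, ht, hA⟩ := hA
      rw [← hE, ← hg, hgood] at hA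
      have : (1 : ℝ) ≤ bad ω := by
        refine le_trans ?_ (Finset.single_le_sum (fun s _ => Finset.sum_nonneg fun t _ => hbad0 ω s t)
          (Finset.mem_range.2 (hst.trans ht)))
        refine le_trans ?_ (Finset.single_le_sum (fun t _ => hbad0 ω s t) (Finset.mem_range.2 ht))
        rw [if_pos hst, if_neg hA]
      linarith
  have hW : 0 < 2 ^ E.w := by positivity
  have hmain : 1 ≤ avg (2 ^ E.w) (g .T) (fun ω => avg (2 ^ E.w) (g .K + d) fun ω' =>
      if Lucky n w tp c₀ M G D (tapeAppend (g .T) ω ω') then 1 else 0) +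
      (avg (2 ^ E.w) (g .T) bad +
        avg (2 ^ E.w) (g .T) fun ω => avg (2 ^ E.w) (g .K + d) (rest ω)) := by
    rw [← avg_add, ← avg_add]
    refine (avg_const hW (g .T) 1).symm.le.trans (avg_mono fun ω => ?_)
    rw [← avg_const hW (g .K + d) (bad ω), ← avg_add, ← avg_add]
    exact (avg_const hW (g .K + d) 1).symm.le.trans (avg_mono fun ω' => hpoint ω ω')
  have hhalf : Real.exp (-1) ≤ 1 / 2 := by
    have := Real.add_one_le_exp 1
    rw [Real.exp_neg, ← one_div]
    exact one_div_le_one_div_of_le (by norm_num) (by linarith)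
  -- The constants in `B` cancel and leave the exponent (c₀+4)·lg n; then use exp(-1) ≤ 1/2 and n ≤
  -- 2^(lg n).
  have hexp : Real.exp (-(g .B * (1 / (60 * M : ℝ)) ^ 2 / 1024)) ≤ (1 / (n : ℝ)) ^ (c₀ + 4) := by
    have e1 : (g .B * (1 / (60 * M : ℝ)) ^ 2 / 1024) = ((c₀ + 4) * lg n : ℕ) := by
      have : (g .B : ℝ) = ((1024 * 3600 * M * M * (c₀ + 4) * lg n : ℕ) : ℝ) := rfl
      rw [this]
      push_cast
      field_simp
      norm_num
      ring
    rw [e1, ← mul_neg_one, Real.exp_nat_mul]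
    exact (pow_le_pow_left₀ (Real.exp_pos _).le hhalf _).trans (two_pow_lg_le (by omega) _)
  have hb : avg (2 ^ E.w) (g .T) bad ≤ n * n * (2 * (1 / (n : ℝ)) ^ (c₀ + 4)) := by
    rw [hbad, avg_sum]
    simp only [avg_sum]
    refine (Finset.sum_le_sum fun s hs => Finset.sum_le_sum (g := fun _ => 2 * (1 / (n : ℝ)) ^ (c₀ + 4))
      fun t ht => ?_).trans (by simp [mul_assoc])
    have ht := Finset.mem_range.1 ht
    by_cases hst : s < t
    · simp only [hst, if_true]
      have h1 : pairCap (g .n) (inputCap G) (E.answer s t) =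
        2 * G.cutCap (D ⟨s, hst.trans ht⟩ ⟨t, ht⟩) := pairCap_answer (hst.trans ht) ht
      have hne : (⟨s, hst.trans ht⟩ : Fin n) ≠ ⟨t, ht⟩ := by
        simp only [ne_eq, Fin.mk.injEq]; omega
      have h2 := maxFlow_pos G hG hne
      have h3 := maxFlow_le G (hD _ _ hne).1
      refine (avg_goodTape h hw (fun i hi => inputCap_lt hi) (by rw [h1]; omega)).trans ?_
      linarith
    · simp only [hst, if_false]
      rw [avg_const hW]
      positivity
  have hr : (avg (2 ^ E.w) (g .T) fun ω => avg (2 ^ E.w) (g .K + d) (rest ω)) ≤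
      (1 / (n : ℝ)) ^ (c₀ + 3) * (n * n) := by
    rw [← avg_const hW (g .T) ((1 / (n : ℝ)) ^ (c₀ + 3) * (n * n))]
    refine avg_mono fun ω => ?_
    refine (avg_pot_rounds (tapeEst E M g (inputCap G) ω) (g .INF) hnw.le hW
      (fun s t hst ht => answer_ne hD hst ht) d (g .K) 0 (fun _ _ => 0)
      ⟨by simp, by simp, by simp⟩).trans ?_
    refine mul_le_mul ?_ ?_ (by positivity) (by positivity)
    · have : g .K = 6 * ((c₀ + 3) * lg n) := by rw [← Nat.mul_assoc]; rfl
      rw [this, pow_mul]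
      refine (pow_le_pow_left₀ (by norm_num) (by norm_num : ((7 : ℝ) / 8) ^ 6 ≤ 1 / 2) _).trans ?_
      exact two_pow_lg_le (by omega) _
    · have : pot n (fun _ _ => 0) ≤ n * n := by
        unfold pot
        refine (Finset.sum_le_card_nsmul _ _ n fun s _ => ?_).trans (by simp)
        exact (Finset.card_filter_le _ _).trans (by simp)
      exact_mod_cast this
  have := sum_failure_le hn c₀
  linarith

end Accuracy

end MinCutOracle

namespace MinCutOracle

/-! ### Correctness of the programs -/

section Correct

variable {n w tp c₀ M : ℕ} {G : CapGraph n} {D : CutOracle n} {β : Var → ℕ} {ε : ℝ}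

/-- The memory contains a correct table of cheap cuts. -/
structure CutTable (G : CapGraph n) (D : CutOracle n) (ε : ℝ) (g : Var → ℕ) (tb : ℕ → ℕ → ℕ)
    (mem : ℕ → ℕ) : Prop where
  size : mem 0 = n
  seg : mem (n * n + 1) = g .H
  mem_tb : ∀ x < n, ∀ y < n, mem (g .H + x * n + y) = tb x y
  tb_le : ∀ x < n, ∀ y < n, tb x y ≤ g .K * n
  tb_symm : ∀ x < n, ∀ y < n, tb x y = tb y x
  bits : ∀ i < g .K * n * n, mem (2 * g .H + i) = 0 ∨ mem (2 * g .H + i) = 1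
  val_lt : ∀ x < n, ∀ y < n, mem (3 * g .H + tb x y) < g .INF
  ne_zero : ∀ x < n, ∀ y < n, x ≠ y → tb x y ≠ 0
  cut : ∀ x y : Fin n, x ≠ y → ∃ A : Finset (Fin n),
    (∀ z : Fin n, mem (2 * g .H + (tb x y - 1) * n + z) = (decide (z ∈ A)).toNat) ∧
    Separates A x y ∧ G.cutCap A ≤ mem (3 * g .H + tb x y) ∧
    G.maxFlow x y ≤ mem (3 * g .H + tb x y) ∧
    (mem (3 * g .H + tb x y) : ℝ) ≤ (1 + ε) * G.maxFlow x y

theorem tri_cuts_of_lucky (hε : 0 < ε) (hε1 : ε ≤ 1) (hD : D.IsApprox G (ε / 3)) (hM : 1 / ε ≤ M)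
    (h : Params (oracleEnv w D tp) β M (parms c₀ M n G.total)) {s : HState}
    (hs : s.mem = inputMem G) (hω : Lucky n w tp c₀ M G D s.tape) :
    Tri (oracleEnv w D tp) β (Prog.cuts c₀ M) s fun t => Glob (parms c₀ M n G.total) t ∧
      CutTable G D ε (parms c₀ M n G.total)
        (finalTable (oracleEnv w D tp) M (parms c₀ M n G.total) (inputCap G) s.tape) t.mem ∧
      ∀ x < n, t.mem (9 * parms c₀ M n G.total .H + x) = 0 := by
  set E := oracleEnv w D tp with hE
  have hn : parms c₀ M n G.total .n = n := rfl
  have hnn : parms c₀ M n G.total .nn = n * n := rfl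
  set g := parms c₀ M n G.total with hg
  refine (tri_cuts (cap := inputCap G) h (by rw [hs]; rfl) (fun i _ => by rw [hs]; rfl) rfl
    (fun a ha => by rw [hs]; exact inputMem_eq_zero G ha)
    (accurate_of_allGood hε hD h hω.1)).mono fun t ⟨ω', m₀, c, m1, m2, m3, m4⟩ _ => ?_
  have h2 := h.nn_le_H
  have h3 := h.n_le_nn
  have h4 := h.n_pos
  have hINF : 0 < g .INF := by rw [h.INF]; omega
  rw [hnn] at h2 h3
  rw [hn] at h3 h4
  have htb := c.mem_tb
  have htl := c.tb_le
  have hgood := c.tb_good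
  have hcl := c.cls
  have hbits := c.bits
  have hfr := c.frame
  rw [← hg] at htb htl hgood hcl hbits hfr m2 m3 m4
  rw [hn] at htb htl hcl hbits
  refine ⟨c.glob, ⟨(hfr _ (by omega)).trans m1, (hfr _ (by omega)).trans m2, htb, htl, hcl.symm,
    hbits, fun x hx y hy => ?_, fun x hx y hy hxy => hω.table_ne_zero hx hy hxy,
    fun x y hxy => ?_⟩, fun x hx => (hfr _ (by omega)).trans (m4 _ (by omega) (by omega))⟩
  · by_cases h0 : finalTable E M g (inputCap G) s.tape x y = 0
    -- Zero entries, such as those on the diagonal, refer to the cell `3 * H`, which is never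
    -- written and holds zero.
    · rw [h0, Nat.add_zero, hfr _ (by omega), m3]
      exact hINF
    · obtain ⟨a, b, -, -, -, h5, -⟩ := hgood x hx y hy h0
      rw [h5]
      exact tapeEst_lt h (inputCap G) s.tape a b
  · obtain ⟨a, b, hab, hb, h5, h6, h7, h8, h9⟩ := hgood x x.isLt y y.isLt
      (hω.table_ne_zero x.isLt y.isLt (fun h => hxy (Fin.ext h)))
    have hb : b < n := hb
    have ha := hab.trans hb
    have hans : ∀ z : Fin n, E.answer a b z = decide (z ∈ D ⟨a, ha⟩ ⟨b, hb⟩) :=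
      oracle_answer D ha hb
    refine ⟨D ⟨a, ha⟩ ⟨b, hb⟩, fun z => ?_, ?_, ?_, ?_, ?_⟩
    · rw [← hans]; exact h5 z z.isLt
    · rw [hans, hans] at h7
      unfold Separates
      simpa [decide_eq_decide] using h7
    · rw [h6]
      exact (tapeEst_bounds h (hω.1 a b hab hb) (pairCap_answer ha hb)).1
    · rw [G.flow_eq x.isLt y.isLt] at h8
      rw [h6]
      exact_mod_cast h8
    · rw [G.flow_eq x.isLt y.isLt] at h9
      rw [h6]
      exact h9.trans (mul_le_mul_of_nonneg_right (precision_sq_le hε hε1 hM) (Nat.cast_nonneg _))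

theorem tri_treeProg (hε : 0 < ε) (hε1 : ε ≤ 1) (hD : D.IsApprox G (ε / 3)) (hM : 1 / ε ≤ M)
    (hG : G.graph.Connected)
    (h : Params (oracleEnv w D tp) β M (parms c₀ M n G.total)) {s : HState}
    (hs : s.mem = inputMem G) (hω : Lucky n w tp c₀ M G D s.tape) :
    Tri (oracleEnv w D tp) β (Prog.treeProg c₀ M) s fun t => ∀ x : Config, Sim x t →
      ∃ T : CapGraph n, x.OutputsTree T ∧ G.IsApproxFlowEquivTree ε T := by
  simp only [Prog.treeProg, tri_seq]
  refine (tri_cuts_of_lucky hε hε1 hD hM h hs hω).mono fun t1 ⟨a1, a2, a3⟩ _ => ?_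
  have h2 := h.nn_le_H
  have h3 := h.n_le_nn
  have h4 := h.n_pos
  have h5 := h.H_le
  have hK := h.kn_le (Nat.sub_lt h.K_pos Nat.one_pos)
  have hKn : parms c₀ M n G.total .K * n < parms c₀ M n G.total .H := by
    have h6 := h.K_pos
    have h7 : (parms c₀ M n G.total .K - 1) * n + n = parms c₀ M n G.total .K * n := by
      rw [← Nat.succ_mul, Nat.succ_eq_add_one, Nat.sub_add_cancel h6]
    have h8 : parms c₀ M n G.total .n = n := rfl
    rw [h8] at hK h3 h4
    omega
  have hINF := h.INF_lt
  have hM0 := h.M_pos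
  have hINF' : parms c₀ M n G.total .INF + 1 < 2 ^ (oracleEnv w D tp).w := by
    have : 1 ≤ parms c₀ M n G.total .INF := by rw [h.INF]; omega
    have h6 : parms c₀ M n G.total .INF * 60 ≤ parms c₀ M n G.total .INF * (60 * M) :=
      Nat.mul_le_mul_left _ (by omega)
    omega
  refine (tri_prim h (tb := finalTable (oracleEnv w D tp) M (parms c₀ M n G.total) (inputCap G) s.tape)
    (val := fun x y => t1.mem (3 * parms c₀ M n G.total .H +
      finalTable (oracleEnv w D tp) M (parms c₀ M n G.total) (inputCap G) s.tape x y)) a1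
    a2.mem_tb (fun x hx y hy => (a2.tb_le x hx y hy).trans_lt hKn) (fun x _ y _ => rfl)
    (fun x hx y hy => lt_of_le_of_lt (Nat.succ_le_succ (a2.val_lt x hx y hy).le) hINF')
    a3).mono fun t2 ⟨b, y, c, hP, hout⟩ f2 => ?_
  have hH2 : t2.v .H = parms c₀ M n G.total .H := (f2.v .H rfl).trans (a1 .H rfl)
  rw [tri_asg]
  constructor
  · simp [hH2]; omega
  intro x hx
  have hP' : IsPrim n _ b y c := hP
  refine ⟨hP'.tree, ⟨hP'.endB, hP'.endY, fun i => c i, fun i => ?_, fun u v => rfl⟩,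
    hP'.tree_isApproxFlowEquivTree h4 G hG ε (fun u hu v hv => ?_) fun s' t' hst => ?_⟩
  · have e1 : x.reg 0 = 12 * parms c₀ M n G.total .H := by
      have := hx.v .out
      simp [hH2] at this
      exact this
    rw [e1, hx.mem]
    have hi : i.val + 1 < n := by omega
    exact hout i hi
  · rw [a2.tb_symm u hu v hv]
  · obtain ⟨A, -, -, -, h6, h7⟩ := a2.cut s' t' hst
    exact ⟨h6, h7⟩

theorem tri_dsProg (hε : 0 < ε) (hε1 : ε ≤ 1) (hD : D.IsApprox G (ε / 3)) (hM : 1 / ε ≤ M)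
    (h : Params (oracleEnv w D tp) β M (parms c₀ M n G.total)) {s : HState}
    (hs : s.mem = inputMem G) (hω : Lucky n w tp c₀ M G D s.tape) :
    Tri (oracleEnv w D tp) β (Prog.dsProg c₀ M) s fun t =>
      t.v .out = 0 ∧ t.v .size = 3 * parms c₀ M n G.total .H ∧
      CutTable G D ε (parms c₀ M n G.total)
        (finalTable (oracleEnv w D tp) M (parms c₀ M n G.total) (inputCap G) s.tape) t.mem := by
  simp only [Prog.dsProg, tri_seq]
  refine (tri_cuts_of_lucky hε hε1 hD hM h hs hω).mono fun t1 ⟨a1, a2, a3⟩ _ => ?_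
  have hH := a1 .H rfl
  have := h.H_le
  simp [hH]
  exact ⟨by omega, a2⟩

/-- The input size, the table and all cuts lie below `3 * H`, so this initial part of the memory
suffices. The pointers are the beginnings of all `K * n` rows. -/
theorem CutTable.isCutDataStructure {E : Env} {g : Var → ℕ} {tb : ℕ → ℕ → ℕ} {mem B : ℕ → ℕ}
    (h : Params E β M g) (hn : g .n = n) (ht : CutTable G D ε g tb mem)
    (hB : ∀ i < 3 * g .H, B i = mem i) {numCuts queryTime : ℝ} (hc : g .K * n ≤ numCuts)
    (hq : 100 ≤ queryTime) :
    IsCutDataStructure G ε E.w Prog.queryProg.comp B (3 * g .H) numCuts queryTime := by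
  have h2 := h.nn_le_H
  have h3 := h.n_le_nn
  have h4 := h.n_pos
  have h5 := h.H_le
  have hnn := h.nn
  rw [hn] at h3 h4 hnn
  have hK : g .K * n * n + 2 * g .nn ≤ g .H := by
    rw [h.H, Nat.mul_assoc, ← hnn]
    exact le_of_eq (by ring)
  have hslot : ∀ m < g .K * n, m * n + n ≤ g .K * n * n := fun m hm => by
    rw [← Nat.succ_mul]; exact Nat.mul_le_mul_right _ hm
  refine ⟨(Finset.range (g .K * n)).image fun m => 2 * g .H + m * n, ?_, fun a ha => ?_,
    fun s t hst => ?_⟩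
  · refine le_trans ?_ hc
    exact_mod_cast Finset.card_image_le.trans (Finset.card_range _).le
  · obtain ⟨m, hm, rfl⟩ := Finset.mem_image.1 ha
    have h6 := hslot m (Finset.mem_range.1 hm)
    refine ⟨by omega, fun v => ?_⟩
    have := v.isLt
    rw [hB _ (by omega), Nat.add_assoc]
    exact ht.bits _ (by omega)
  · have hs := s.isLt
    have ht' := t.isLt
    have hrow := h.row_le (v := s) (by rw [hn]; exact hs)
    rw [hn] at hrow
    have htb := ht.tb_le s hs t ht'
    have htb0 := ht.ne_zero s hs t ht' (fun h => hst (Fin.ext h))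
    have hm := hslot (tb s t - 1) (by omega)
    -- The query program has no loops and draws no words, so no loop bounds are needed and every
    -- tape succeeds.
    refine HCom.succeeds (β := fun _ => 0) (fun _ => True) (fun ω _ u hu => ?_) ⟨0, fun m _ => ?_⟩
    · have e1 : u.v .out = s := by rw [hu]; rfl
      have e2 : u.v .size = t := by rw [hu]; rfl
      have hT : Tri (plainEnv E.w) (fun _ => 0) Prog.queryProg u fun x =>
          x.v .out = 2 * g .H + (tb s t - 1) * n ∧ x.mem = B := by
        refine (tri_queryProg (n := n) (H := g .H) (m := tb s t) ?_ ?_ ?_ ?_ ?_ ?_ ?_).mono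
          fun x hx hf => ⟨hx, (hf.mem rfl).trans (by rw [hu])⟩
        · rw [hu]; exact (hB _ (by omega)).trans ht.size
        · rw [hu]; exact (hB _ (by omega)).trans ht.seg
        · rw [e1, e2, hu]; exact (hB _ (by omega)).trans (ht.mem_tb s hs t ht')
        · change _ < 2 ^ E.w; omega
        · rw [e1, e2]; change _ < 2 ^ E.w; omega
        · change _ < 2 ^ E.w; omega
        · change _ < 2 ^ E.w; omega
      refine ⟨hT.1, fun y hy _ hsim => ?_⟩
      obtain ⟨hx, hmem⟩ := hT.2
      have e3 : y.reg 0 = 2 * g .H + (tb s t - 1) * n := (hsim.v .out).trans hx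
      refine ⟨?_, ?_, ?_⟩
      · have : Prog.queryProg.cost (plainEnv E.w) (fun _ => 0) ≤ 100 := by
          exact Nat.le_of_ble_eq_true rfl
        refine le_trans ?_ hq
        exact_mod_cast hy.trans this
      · rw [e3, Finset.mem_image]
        exact ⟨tb s t - 1, Finset.mem_range.2 (by omega), rfl⟩
      · obtain ⟨A, h6, h7, h8, -, h9⟩ := ht.cut s t hst
        have hA : storedCut n B (y.reg 0) = A := by
          ext z
          have := z.isLt
          rw [storedCut, Finset.mem_filter, e3, hB _ (by omega), h6]
          by_cases hz : z ∈ A <;> simp [hz]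
        rw [hA]
        exact ⟨h7, le_trans (by exact_mod_cast h8) h9⟩
    · simp [avg_const (show 0 < 2 ^ (plainEnv E.w).w by positivity)]

end Correct

end MinCutOracle

namespace MinCutOracle

/-! ### Running times -/

section Cost

variable (a b : Ex) (x : Var) (k : ℕ) (o : Op)

@[simp] theorem Ex.cost_var : (Ex.var x).cost = 3 := rfl
@[simp] theorem Ex.cost_lit : (Ex.lit k).cost = 1 := rfl
@[simp] theorem Ex.cost_ofNat [k.AtLeastTwo] : (ofNat(k) : Ex).cost = 1 := rfl
@[simp] theorem Ex.cost_zero : (0 : Ex).cost = 1 := rfl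
@[simp] theorem Ex.cost_one : (1 : Ex).cost = 1 := rfl
@[simp] theorem Ex.cost_bin : (Ex.bin o a b).cost = a.cost + b.cost + 3 := rfl
@[simp] theorem Ex.cost_add : (a + b).cost = a.cost + b.cost + 3 := rfl
@[simp] theorem Ex.cost_sub : (a - b).cost = a.cost + b.cost + 3 := rfl
@[simp] theorem Ex.cost_mul : (a * b).cost = a.cost + b.cost + 3 := rfl
@[simp] theorem Ex.cost_div : (a / b).cost = a.cost + b.cost + 3 := rfl
@[simp] theorem Ex.cost_mod : (a % b).cost = a.cost + b.cost + 3 := rfl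
@[simp] theorem Ex.cost_ld : (Ex.ld a).cost = a.cost + 2 := rfl

end Cost

/-- The dominating term of the running time. -/
def work (g : Var → ℕ) : ℕ := g .K * g .Q * g .nn

section Work

variable {E : Env} {β : Var → ℕ} {M : ℕ} {g : Var → ℕ}

/-- The dominating part is the evaluation of the sketch in time of order Q·n for each of K·n cuts.
Building the sketch takes time of order Q·n², and all other loops are shorter. -/
theorem cost_cuts_le (h : Params E β M g) (hell : g .ell ≤ g .K) (c₀ M' : ℕ) :
    (Prog.cuts c₀ M').cost E g ≤ 2100 * work g + E.prepTime := by
  have hK := h.K_pos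
  have hn := h.n_pos
  have hB := h.B_pos
  have hL := h.L_pos
  have hQ : 0 < g .Q := by rw [h.Q]; exact Nat.mul_pos hB hL
  have hLQ : g .L ≤ g .Q := by rw [h.Q]; exact Nat.le_mul_of_pos_left _ hB
  have hT := h.T
  have hnn := h.nn
  have hEn := h.n_eq
  simp [Prog.cuts, Prog.setup, Prog.sketch, Prog.round, Prog.queries, Prog.classSize, Prog.pivot,
    Prog.query, Prog.sideSize, Prog.estimate, Prog.sketchBlock, Prog.argmins, Prog.subs, Prog.refine,
    Prog.tbAt, Prog.cutAt, Prog.estAt, HCom.cost, work, hT, hEn]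
  rw [hnn]
  generalize g .K = K at *
  generalize g .n = n at *
  generalize g .Q = Q at *
  generalize g .L = L at *
  generalize g .ell = l at *
  have one : ∀ {x y : ℕ}, 0 < x → y ≤ y * x := fun hx => Nat.le_mul_of_pos_right _ hx
  have q0 : K * n * n ≤ K * Q * (n * n) := by
    calc K * n * n = K * 1 * (n * n) := by ring
      _ ≤ _ := by gcongr; exact hQ
  have q1 : K * n ≤ K * n * n := one hn
  have q2 : K ≤ K * n := one hn
  have q3 : Q * (n * n) ≤ K * Q * (n * n) := by
    rw [Nat.mul_assoc]; exact Nat.le_mul_of_pos_left _ hK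
  have q4 : Q ≤ Q * (n * n) := one (Nat.mul_pos hn hn)
  have q5 : n * n ≤ Q * (n * n) := Nat.le_mul_of_pos_left _ hQ
  have q6 : K * n * Q ≤ K * Q * (n * n) := by
    calc K * n * Q = K * Q * (n * 1) := by ring
      _ ≤ _ := by gcongr; exact hn
  ring_nf at *
  linarith

theorem cost_prim_le (h : Params E β M g) : Prog.prim.cost E g ≤ 1000 * work g := by
  have hK := h.K_pos
  have hn := h.n_pos
  have hQ : 0 < g .Q := by rw [h.Q]; exact Nat.mul_pos h.B_pos h.L_pos
  have hpred : g .pred ≤ g .n := by rw [h.pred]; omega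
  have hnn := h.nn
  simp [Prog.prim, Prog.tbAt, HCom.cost, Prog.valAt, work]
  rw [hnn]
  generalize g .K = K at *
  generalize g .n = n at *
  generalize g .Q = Q at *
  generalize g .pred = p at *
  have q0 : n * n ≤ K * Q * (n * n) := Nat.le_mul_of_pos_left _ (Nat.mul_pos hK hQ)
  have q1 : n ≤ n * n := Nat.le_mul_of_pos_right _ hn
  have q2 : p * n ≤ n * n := Nat.mul_le_mul_right _ hpred
  ring_nf at *
  linarith

theorem work_pos (h : Params E β M g) : 0 < work g := by
  have hQ : 0 < g .Q := by rw [h.Q]; exact Nat.mul_pos h.B_pos h.L_pos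
  exact Nat.mul_pos (Nat.mul_pos h.K_pos hQ) (h.n_pos.trans_le h.n_le_nn)

theorem cost_treeProg_le (h : Params E β M g) (hell : g .ell ≤ g .K) (c₀ M' : ℕ) :
    (Prog.treeProg c₀ M').cost E g ≤ 4000 * work g + E.prepTime := by
  have h1 := cost_cuts_le h hell c₀ M'
  have h2 := cost_prim_le h
  have h3 := work_pos h
  simp [Prog.treeProg, HCom.cost]
  omega

theorem cost_dsProg_le (h : Params E β M g) (hell : g .ell ≤ g .K) (c₀ M' : ℕ) :
    (Prog.dsProg c₀ M').cost E g ≤ 4000 * work g + E.prepTime := by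
  have h1 := cost_cuts_le h hell c₀ M'
  have h3 := work_pos h
  simp [Prog.dsProg, HCom.cost]
  omega

end Work

theorem queries_cuts (β : Var → ℕ) (c₀ M : ℕ) : (Prog.cuts c₀ M).queries β = β .K * β .n := by
  simp [Prog.cuts, Prog.setup, Prog.sketch, Prog.round, Prog.queries, Prog.classSize, Prog.pivot,
    Prog.query, Prog.sideSize, Prog.estimate, Prog.sketchBlock, Prog.argmins, Prog.subs, Prog.refine,
    HCom.queries]

theorem queries_prim (β : Var → ℕ) : Prog.prim.queries β = 0 := by
  simp [Prog.prim, HCom.queries]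

theorem queries_treeProg (β : Var → ℕ) (c₀ M : ℕ) :
    (Prog.treeProg c₀ M).queries β = β .K * β .n := by
  simp [Prog.treeProg, HCom.queries, queries_cuts, queries_prim]

theorem queries_dsProg (β : Var → ℕ) (c₀ M : ℕ) :
    (Prog.dsProg c₀ M).queries β = β .K * β .n := by
  simp [Prog.dsProg, HCom.queries, queries_cuts]

/-! ### The size of the parameters -/

theorem mul_le_pow {W x y a b : ℕ} (hx : x ≤ W ^ a) (hy : y ≤ W ^ b) : x * y ≤ W ^ (a + b) := by
  rw [pow_add]; exact Nat.mul_le_mul hx hy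

theorem add_le_pow {W x y a : ℕ} (hW : 2 ≤ W) (hx : x ≤ W ^ a) (hy : y ≤ W ^ a) :
    x + y ≤ W ^ (a + 1) := by
  rw [pow_succ]
  have := Nat.mul_le_mul_left (W ^ a) hW
  omega

theorem le_pow_of_le {W x a b : ℕ} (hW : 2 ≤ W) (hx : x ≤ W ^ a) (hab : a ≤ b) : x ≤ W ^ b :=
  hx.trans (Nat.pow_le_pow_right (by omega) hab)

theorem le_pow_of_le_two_pow {W x a : ℕ} (hW : 2 ≤ W) (hx : x ≤ 2 ^ a) : x ≤ W ^ a :=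
  hx.trans (Nat.pow_le_pow_left hW a)

theorem two_pow_lg_le_two_mul {x : ℕ} (hx : 0 < x) : 2 ^ lg x ≤ 2 * x := by
  rw [lg, pow_succ, mul_comm]
  exact Nat.mul_le_mul_left _ (Nat.pow_log_le_self 2 hx.ne')

section Bounds

variable {n U M c tot : ℕ}

/-- With W = 2^lg(nUM), each parameter is bounded by a power of W, numerical constants included
since W ≥ 2. All exponents stay below c+60, which determines the constant in the word length. -/
theorem params_bounds (hn : 0 < n) (hU : 0 < U) (hM : 0 < M) (htot0 : 0 < tot)
    (htot : tot ≤ n * n * U) :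
    parms c M n tot .PW + parms c M n tot .L + 2 < 2 ^ ((c + 60) * lg (n * U * M)) ∧
    parms c M n tot .INF * (60 * M) < 2 ^ ((c + 60) * lg (n * U * M)) ∧
    parms c M n tot .B * (2 * (60 * M - 1)) < 2 ^ ((c + 60) * lg (n * U * M)) := by
  have hV : n * U * M < 2 ^ lg (n * U * M) := lt_two_pow_lg _
  have hW : 2 ≤ 2 ^ lg (n * U * M) := by
    calc 2 = 2 ^ 1 := rfl
      _ ≤ _ := Nat.pow_le_pow_right (by norm_num) (lg_pos _)
  rw [Nat.mul_comm, pow_mul]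
  generalize 2 ^ lg (n * U * M) = W at hV hW
  have hnW : n ≤ W ^ 1 := by
    rw [pow_one]
    exact (Nat.le_mul_of_pos_right n hU).trans ((Nat.le_mul_of_pos_right _ hM).trans hV.le)
  have hMW : M ≤ W ^ 1 := by
    rw [pow_one]
    exact (Nat.le_mul_of_pos_left M (Nat.mul_pos hn hU)).trans hV.le
  have hnU : n * U ≤ W ^ 1 := by
    rw [pow_one]
    exact (Nat.le_mul_of_pos_right _ hM).trans hV.le
  have htW : tot ≤ W ^ 2 := htot.trans (by rw [Nat.mul_assoc]; exact mul_le_pow hnW hnU)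
  have hlW : lg n ≤ W ^ 1 := (lg_le hn).trans hnW
  have hLW : lg tot ≤ W ^ 2 := (lg_le htot0).trans htW
  have h2L : 2 ^ lg tot ≤ W ^ 3 := (two_pow_lg_le_two_mul htot0).trans
    (by have := mul_le_pow (W := W) (x := 2) (a := 1) (by simpa using hW) htW; simpa using this)
  have hc : c + 4 ≤ W ^ (c + 4) := le_pow_of_le_two_pow hW Nat.lt_two_pow_self.le
  have hR : repConst c M ≤ W ^ (c + 28) := by
    have h1 : 1024 * 3600 ≤ W ^ 22 := le_pow_of_le_two_pow hW (by norm_num)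
    exact le_pow_of_le hW (mul_le_pow (mul_le_pow (mul_le_pow h1 hMW) hMW) hc) (by omega)
  have hB : parms c M n tot .B ≤ W ^ (c + 29) :=
    le_pow_of_le hW (mul_le_pow hR hlW) (by omega)
  have hQ : parms c M n tot .Q ≤ W ^ (c + 31) :=
    le_pow_of_le hW (mul_le_pow hB hLW) (by omega)
  have hH : parms c M n tot .H ≤ W ^ (c + 14) := by
    have h1 : 6 * (c + 3) ≤ W ^ (c + 7) := by
      have h6 : 6 ≤ W ^ 3 := le_pow_of_le_two_pow hW (by norm_num)
      refine le_pow_of_le hW (mul_le_pow h6 ((Nat.le_succ _).trans hc)) (by omega)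
    have h2 : 6 * (c + 3) * lg n + 2 ≤ W ^ (c + 8 + 1) :=
      add_le_pow hW (le_pow_of_le hW (mul_le_pow h1 hlW) (by omega))
        (le_pow_of_le (a := 1) hW (by simpa using hW) (by omega))
    exact le_pow_of_le hW (mul_le_pow (mul_le_pow hnW hnW) h2) (by omega)
  have hPW : parms c M n tot .PW ≤ W ^ (c + 40) := by
    have h16 : 16 ≤ W ^ 4 := le_pow_of_le_two_pow hW (by norm_num)
    have h1 : 16 * parms c M n tot .H ≤ W ^ (c + 33) :=
      le_pow_of_le hW (mul_le_pow h16 hH) (by omega)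
    have h2 : 2 * (parms c M n tot .Q * n) ≤ W ^ (c + 33) :=
      le_pow_of_le hW (mul_le_pow (W := W) (x := 2) (a := 1) (by simpa using hW)
        (mul_le_pow hQ hnW)) (by omega)
    exact le_pow_of_le hW (add_le_pow hW h1 h2) (by omega)
  have lt : ∀ {a}, a < c + 60 → W ^ a < W ^ (c + 60) := fun ha =>
    Nat.pow_lt_pow_right (by omega) ha
  have h60 : 60 ≤ W ^ 6 := le_pow_of_le_two_pow hW (by norm_num)
  refine ⟨?_, ?_, ?_⟩
  · have h1 : parms c M n tot .PW + parms c M n tot .L ≤ W ^ (c + 41) :=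
      add_le_pow hW hPW (le_pow_of_le hW hLW (by omega))
    have h2 : parms c M n tot .PW + parms c M n tot .L + 2 ≤ W ^ (c + 42) :=
      add_le_pow hW h1 (le_pow_of_le (a := 1) hW (by simpa using hW) (by omega))
    exact h2.trans_lt (lt (by omega))
  · have h3 : n * (n * n) ≤ W ^ 3 := mul_le_pow hnW (mul_le_pow hnW hnW)
    have h1 : parms c M n tot .INF ≤ W ^ (c + 41) :=
      add_le_pow hW (le_pow_of_le hW (mul_le_pow (mul_le_pow (mul_le_pow hQ h2L) h3) h3) (by omega))
        (Nat.one_le_pow _ _ (by omega))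
    exact (mul_le_pow h1 (mul_le_pow h60 hMW)).trans_lt (lt (by omega))
  · have h1 : 2 * (60 * M - 1) ≤ W ^ (1 + (6 + 1)) := mul_le_pow (by simpa using hW)
      ((Nat.sub_le _ _).trans (mul_le_pow h60 hMW))
    exact (mul_le_pow hB h1).trans_lt (lt (by omega))

theorem lg_mono {x y : ℕ} (h : x ≤ y) : lg x ≤ lg y :=
  Nat.succ_le_succ (Nat.log_mono_right h)

/-- The total capacity is at most (nU)². -/
theorem lg_le_two_mul (hU : 0 < U) (htot : tot ≤ n * n * U) :
    lg tot ≤ 2 * lg (n * U) := by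
  rcases Nat.eq_zero_or_pos tot with rfl | h0
  · have := lg_pos (n * U)
    simp [lg]; omega
  refine Nat.log_lt_of_lt_pow h0.ne' ?_
  have h1 := lt_two_pow_lg (n * U)
  rw [Nat.mul_comm, pow_mul, sq]
  have h2 : tot ≤ (n * U) * (n * U) := htot.trans <| by
    calc n * n * U = n * U * (n * 1) := by ring
      _ ≤ _ := by gcongr; exact hU
  exact h2.trans_lt (Nat.mul_lt_mul'' h1 h1)

/-- The constant in the bounds. -/
def boundConst (c : ℕ) : ℕ := 4000 * (48 * 1024 * 3600 * (c + 3) * (c + 4))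

theorem work_le {ε : ℝ} (hε : 0 < ε) (hε1 : ε ≤ 1) (hU : 0 < U)
    (hM : M = ⌈1 / ε⌉₊) (htot : tot ≤ n * n * U) :
    4000 * (work (parms c M n tot) : ℝ) ≤
      boundConst c * (n : ℝ) ^ 2 * ((lg (n * U) : ℝ) / ε) ^ 3 := by
  set l := lg (n * U) with hl
  have h1 : lg n ≤ l := lg_mono (Nat.le_mul_of_pos_right _ hU)
  have h2 : lg tot ≤ 2 * l := lg_le_two_mul hU htot
  have hM2 : (M : ℝ) ≤ 2 / ε := by
    have h3 := Nat.ceil_lt_add_one (a := 1 / ε) (by positivity)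
    have h4 : 1 ≤ 1 / ε := by rw [le_div_iff₀ hε]; linarith
    rw [hM]
    have : 2 / ε = 1 / ε + 1 / ε := by ring
    linarith
  have h5 : work (parms c M n tot) ≤
      6 * (c + 3) * l * (1024 * 3600 * M * M * (c + 4) * l * (2 * l)) * (n * n) := by
    change 6 * (c + 3) * lg n * (1024 * 3600 * M * M * (c + 4) * lg n * lg tot) * (n * n) ≤ _
    gcongr
  have h6 : (work (parms c M n tot) : ℝ) ≤
      6 * (c + 3) * l * (1024 * 3600 * M * M * (c + 4) * l * (2 * l)) * (n * n) := by
    exact_mod_cast h5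
  -- Two factors 1/ε would do; a third one, admissible as ε ≤ 1, matches the common exponent 3 of
  -- the bound.
  have h7 : (M : ℝ) * M ≤ 4 * (1 / ε) ^ 3 := by
    have h8 : (1 / ε) ^ 2 ≤ (1 / ε) ^ 3 := by
      refine pow_le_pow_right₀ ?_ (by norm_num)
      rw [le_div_iff₀ hε]; linarith
    calc (M : ℝ) * M ≤ 2 / ε * (2 / ε) := by gcongr
      _ = 4 * (1 / ε) ^ 2 := by ring
      _ ≤ _ := by gcongr
  calc 4000 * (work (parms c M n tot) : ℝ) ≤
      4000 * (6 * (c + 3) * 1024 * 3600 * (c + 4) * 2 * (l : ℝ) ^ 3 * n ^ 2 * (M * M)) := by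
        refine mul_le_mul_of_nonneg_left (h6.trans_eq ?_) (by norm_num)
        ring
    _ ≤ 4000 * (6 * (c + 3) * 1024 * 3600 * (c + 4) * 2 * (l : ℝ) ^ 3 * n ^ 2 *
      (4 * (1 / ε) ^ 3)) := by gcongr
    _ = _ := by
      unfold boundConst
      push_cast
      ring

theorem le_boundConst (c : ℕ) : 18 * (c + 3) + 100 ≤ boundConst c := by
  have h1 : (c + 3) * 4 ≤ (c + 3) * (c + 4) := Nat.mul_le_mul_left _ (by omega)
  have h2 : boundConst c = 707788800000 * ((c + 3) * (c + 4)) := by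
    unfold boundConst; ring
  omega

end Bounds

end MinCutOracle

namespace MinCutOracle

/-! ### The theorem -/

/-- Needed for n = 1, where the required probability is zero. -/
theorem succeeds_of_nonpos {E : Env} {x : Config} {p : ℝ} (hp : p ≤ 0) (good : Config → Prop) :
    Succeeds E x p good := ⟨0, by rw [ENNReal.ofReal_of_nonpos hp]; exact zero_le⟩

section Main

variable {n U : ℕ} {G : CapGraph n}

theorem inputCap_le (hU : ∀ u v, G.cap u v ≤ U) (i : ℕ) : inputCap G i ≤ U := by
  rw [inputCap, inputMem, if_neg (by omega)]
  split_ifs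
  · exact hU _ _
  · exact Nat.zero_le _

theorem total_le (hU : ∀ u v, G.cap u v ≤ U) : G.total ≤ n * n * U := by
  refine (Finset.sum_le_card_nsmul _ _ U fun i _ => inputCap_le hU i).trans ?_
  simp

theorem total_pos (hn : 2 ≤ n) (hG : G.graph.Connected) : 0 < G.total := by
  have hne : (⟨0, by omega⟩ : Fin n) ≠ ⟨1, by omega⟩ := by simp
  have h1 := maxFlow_pos G hG hne
  obtain ⟨S, hS, hc⟩ := exists_cut_eq_maxFlow G hne
  rw [← hc] at h1
  obtain ⟨u, -, h2⟩ := Finset.exists_ne_zero_of_sum_ne_zero h1.ne'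
  obtain ⟨v, -, h3⟩ := Finset.exists_ne_zero_of_sum_ne_zero h2
  rw [← inputCap_eq] at h3
  refine (Nat.pos_of_ne_zero h3).trans_le (Finset.single_le_sum (f := inputCap G)
    (fun _ _ => Nat.zero_le _) (Finset.mem_range.2 ?_))
  have h4 := Nat.mul_le_mul_right n (show u.val + 1 ≤ n from u.isLt)
  rw [Nat.succ_mul] at h4
  have := v.isLt
  omega

/-- The bounds on the loops are the values of the parameters themselves. -/
theorem params_oracleEnv {M c tp : ℕ} {ε : ℝ} (D : CutOracle n) (hn : 2 ≤ n) (hM : M = ⌈1 / ε⌉₊)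
    (hε : 0 < ε) (hG : G.graph.Connected) (hU : ∀ u v, G.cap u v ≤ U) :
    Params (oracleEnv (wordBits (c + 60) n U ε) D tp) (parms c M n G.total) M
      (parms c M n G.total) := by
  have h1 := total_pos hn hG
  have h2 := total_le hU
  have hU0 : 0 < U := by
    rcases Nat.eq_zero_or_pos U with rfl | h
    · simp at h2; omega
    · exact h
  have hM0 : 0 < M := by rw [hM, Nat.ceil_pos]; positivity
  have hw : wordBits (c + 60) n U ε = (c + 60) * lg (n * U * M) := by rw [wordBits, ← hM]
  obtain ⟨h3, h4, h5⟩ := params_bounds (c := c) (by omega) hU0 hM0 h1 h2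
  rw [hw]
  exact params_parms hM0 (by omega) rfl (fun t x => by simp [oracleEnv]) (fun z _ => le_rfl) h3 h4 h5

theorem one_sub_nonpos (c : ℕ) (h : n = 1) : 1 - 1 / (n : ℝ) ^ c ≤ 0 := by simp [h]

theorem queries_bound (hn : 0 < n) (c : ℕ) :
    ((6 * (c + 3) * lg n * n : ℕ) : ℝ) ≤ boundConst c * n * (lg n : ℝ) ^ 3 := by
  have h1 : (1 : ℝ) ≤ lg n := by exact_mod_cast lg_pos n
  have h2 : ((6 * (c + 3) : ℕ) : ℝ) ≤ boundConst c := by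
    have := le_boundConst c
    exact_mod_cast (show 6 * (c + 3) ≤ boundConst c by omega)
  calc ((6 * (c + 3) * lg n * n : ℕ) : ℝ) = ((6 * (c + 3) : ℕ) : ℝ) * n * (lg n : ℝ) ^ 1 := by
        push_cast; ring
    _ ≤ _ := by
      gcongr
      · norm_num

theorem size_bound (c : ℕ) :
    ((3 * (n * n * (6 * (c + 3) * lg n + 2)) : ℕ) : ℝ) ≤
      boundConst c * (n : ℝ) ^ 2 * (lg n : ℝ) ^ 3 := by
  have h1 : (1 : ℝ) ≤ lg n := by exact_mod_cast lg_pos n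
  have h2 : ((18 * (c + 3) + 6 : ℕ) : ℝ) ≤ boundConst c := by
    have := le_boundConst c
    exact_mod_cast (show 18 * (c + 3) + 6 ≤ boundConst c by omega)
  have h3 : 3 * (n * n * (6 * (c + 3) * lg n + 2)) ≤ (18 * (c + 3) + 6) * (n * n) * lg n := by
    have := lg_pos n
    calc 3 * (n * n * (6 * (c + 3) * lg n + 2)) ≤ 3 * (n * n * (6 * (c + 3) * lg n + 2 * lg n)) := by
          gcongr; omega
      _ = _ := by ring
  calc ((3 * (n * n * (6 * (c + 3) * lg n + 2)) : ℕ) : ℝ) ≤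
      (((18 * (c + 3) + 6) * (n * n) * lg n : ℕ) : ℝ) := by exact_mod_cast h3
    _ = ((18 * (c + 3) + 6 : ℕ) : ℝ) * (n : ℝ) ^ 2 * (lg n : ℝ) ^ 1 := by push_cast; ring
    _ ≤ _ := by
      gcongr
      · norm_num

theorem query_time_bound (c n : ℕ) : (100 : ℝ) ≤ boundConst c * (lg n : ℝ) ^ 3 := by
  have h4 : (1 : ℝ) ≤ (lg n : ℝ) ^ 3 := one_le_pow₀ (by exact_mod_cast lg_pos n)
  have h5 : (100 : ℝ) ≤ boundConst c := by
    have := le_boundConst c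
    exact_mod_cast (show 100 ≤ boundConst c by omega)
  generalize (boundConst c : ℝ) = b at h5
  nlinarith

theorem time_bound {c M tp τ : ℕ} {ε : ℝ} (hε : 0 < ε) (hε1 : ε ≤ 1) (hn : 2 ≤ n)
    (hM : M = ⌈1 / ε⌉₊) (hG : G.graph.Connected) (hU : ∀ u v, G.cap u v ≤ U)
    (hτ : τ ≤ 4000 * work (parms c M n G.total) + tp) :
    (τ : ℝ) ≤ boundConst c * tp + boundConst c * (n : ℝ) ^ 2 * ((lg (n * U) : ℝ) / ε) ^ 3 := by
  have h1 := total_pos hn hG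
  have h2 := total_le hU
  have hU0 : 0 < U := by
    rcases Nat.eq_zero_or_pos U with rfl | h
    · simp at h2; omega
    · exact h
  have h3 := work_le (c := c) hε hε1 hU0 hM h2
  have h4 : (τ : ℝ) ≤ 4000 * work (parms c M n G.total) + tp := by exact_mod_cast hτ
  have h5 : (1 : ℝ) ≤ boundConst c := by
    have := le_boundConst c
    exact_mod_cast (show 1 ≤ boundConst c by omega)
  have h6 := le_mul_of_one_le_left (Nat.cast_nonneg (α := ℝ) tp) h5
  linarith

end Main

end MinCutOracle

open MinCutOracle
theorem theorem2p1 (c : ℕ) :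
    ∃ κ C k : ℕ, 0 < κ ∧ ∀ ε : ℝ, 0 < ε → ε ≤ 1 →
      -- the flow-equivalent tree
      (∃ P : Com, ∀ (n U : ℕ) (G : CapGraph n) (D : CutOracle n) (tp : ℕ → ℕ),
        G.graph.Connected → (∀ u v, G.cap u v ≤ U) → D.IsApprox G (ε / 3) →
        Succeeds (oracleEnv (wordBits κ n U ε) D (tp n)) (inputConfig G P) (1 - 1 / (n : ℝ) ^ c)
          fun x =>
            (x.time : ℝ) ≤ C * tp n + C * (n : ℝ) ^ 2 * ((lg (n * U) : ℝ) / ε) ^ k ∧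
            (x.queries : ℝ) ≤ C * n * (lg n : ℝ) ^ k ∧
            ∃ T : CapGraph n, x.OutputsTree T ∧ G.IsApproxFlowEquivTree ε T) ∧
      -- the data structure, with its construction algorithm and its query algorithm
      (∃ P Q : Com, ∀ (n U : ℕ) (G : CapGraph n) (D : CutOracle n) (tp : ℕ → ℕ),
        G.graph.Connected → (∀ u v, G.cap u v ≤ U) → D.IsApprox G (ε / 3) →
        Succeeds (oracleEnv (wordBits κ n U ε) D (tp n)) (inputConfig G P) (1 - 1 / (n : ℝ) ^ c)
          fun x =>
            (x.time : ℝ) ≤ C * tp n + C * (n : ℝ) ^ 2 * ((lg (n * U) : ℝ) / ε) ^ k ∧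
            (x.queries : ℝ) ≤ C * n * (lg n : ℝ) ^ k ∧
            (x.reg 1 : ℝ) ≤ C * (n : ℝ) ^ 2 * (lg n : ℝ) ^ k ∧
            IsCutDataStructure G ε (wordBits κ n U ε) Q x.block (x.reg 1)
              (C * n * (lg n : ℝ) ^ k) (C * (lg n : ℝ) ^ k)) := by
  classical
  -- The time has three logarithmic factors: from the number of rounds, the repetitions of the
  -- sketch and the bit levels.
  refine ⟨c + 60, boundConst c, 3, by omega, fun ε hε hε1 => ?_⟩
  obtain ⟨M, hM⟩ : ∃ M, M = ⌈1 / ε⌉₊ := ⟨_, rfl⟩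
  have hMε : 1 / ε ≤ M := by rw [hM]; exact Nat.le_ceil _
  have hell : ∀ n tot, parms c M n tot .ell ≤ parms c M n tot .K := fun n tot =>
    Nat.le_mul_of_pos_left (lg n) (by omega)
  refine ⟨⟨(Prog.treeProg c M).comp, fun n U G D tp hG hU hD => ?_⟩,
    (Prog.dsProg c M).comp, Prog.queryProg.comp, fun n U G D tp hG hU hD => ?_⟩
  · have hn0 : 0 < n := by obtain ⟨v⟩ := hG.nonempty; exact v.pos
    rcases Nat.lt_or_ge n 2 with hn | hn
    · exact succeeds_of_nonpos (one_sub_nonpos c (by omega)) _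
    have h := params_oracleEnv (c := c) (tp := tp n) D hn hM hε hG hU
    refine HCom.succeeds (β := parms c M n G.total)
      (Lucky n (wordBits (c + 60) n U ε) (tp n) c M G D) (fun ω hω s hs => ?_)
      ⟨_, fun m hm => avg_lucky hG hD hn h hm⟩
    have hT := tri_treeProg (c₀ := c) (s := s) hε hε1 hD hMε hG h (by rw [hs]) (by rw [hs]; exact hω)
    refine ⟨hT.1, fun y h1 h2 h3 => ⟨?_, ?_, hT.2 y h3⟩⟩
    · exact time_bound hε hε1 hn hM hG hU (h1.trans (cost_treeProg_le h (hell _ _) c M))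
    · rw [queries_treeProg] at h2
      exact (Nat.cast_le.2 h2).trans (queries_bound hn0 c)
  · have hn0 : 0 < n := by obtain ⟨v⟩ := hG.nonempty; exact v.pos
    rcases Nat.lt_or_ge n 2 with hn | hn
    · exact succeeds_of_nonpos (one_sub_nonpos c (by omega)) _
    have h := params_oracleEnv (c := c) (tp := tp n) D hn hM hε hG hU
    refine HCom.succeeds (β := parms c M n G.total)
      (Lucky n (wordBits (c + 60) n U ε) (tp n) c M G D) (fun ω hω s hs => ?_)
      ⟨_, fun m hm => avg_lucky hG hD hn h hm⟩
    have hT := tri_dsProg (c₀ := c) (s := s) hε hε1 hD hMε h (by rw [hs]) (by rw [hs]; exact hω)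
    obtain ⟨e1, e2, e3⟩ := hT.2
    refine ⟨hT.1, fun y h1 h2 h3 => ?_⟩
    have r0 : y.reg 0 = 0 := (h3.v .out).trans e1
    have r1 : y.reg 1 = 3 * parms c M n G.total .H := (h3.v .size).trans e2
    refine ⟨?_, ?_, ?_, ?_⟩
    · exact time_bound hε hε1 hn hM hG hU (h1.trans (cost_dsProg_le h (hell _ _) c M))
    · rw [queries_dsProg] at h2
      exact (Nat.cast_le.2 h2).trans (queries_bound hn0 c)
    · rw [r1]
      exact size_bound c
    · rw [r1]
      refine e3.isCutDataStructure h rfl (fun i hi => ?_) ?_ ?_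
      · rw [Config.block, if_pos (by rw [r1]; exact hi), r0, Nat.zero_add, h3.mem]
      · rw [← Nat.cast_mul]
        exact queries_bound hn0 c
      · exact query_time_bound c n
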